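/- \textbf{Setting.} Work with chain complexes over a field $k$ (Koszul sign rule). A stable $\mathbb S$-module $\mathcal A$ is a family of chain complexes $\mathcal A((g,n))$, $g,n\ge 0$, with action of $S_n$, vanishing if $2g+n-2\le 0$; for a finite set $I$ with $n$ elements let $\mathcal A((g,I))=\bigl(\bigoplus_{f:\{1,\dots,n\}\cong I}\mathcal A((g,n))\bigr)_{S_n}$. A modular operad structure on $\mathcal A$ is an algebra structure over the triple of stable graphs: composition maps $\mu_G:\bigotimes_{v}\mathcal A((g(v),\mathrm{Leg}(v)))\to\mathcal A((g(G),\mathrm{Leg}(G)))$ for all stable graphs $G$, natural for isomorphisms, equal to the identity if $G$ has one vertex and no edge, and such that, for every morphism of stable graphs $G_0\to G_1$, $\mu_{G_0}$ is the composite of $\bigotimes_{w\in \mathrm{Vert}(G_1)}\mu_{f^{-1}(w)}$ and $\mu_{G_1}$. Write $\mathcal A(g;n)=\mathcal A((g,n+1))$, with labels $0,\dots,n$, let $\mathcal A(n)=\bigoplus_g\mathcal A(g;n)$, $n\ge0$, and let $a^*$ be the result of applying the cycle $\tau=(0\,1\cdots n)$ to $a\in\mathcal A(n)$. A stable graded cyclic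 operad structure on $\mathcal A$ consists of chain maps $\circ_i:\mathcal A(g;m)\otimes\mathcal A(h;n)\to\mathcal A(g+h;m+n-1)$, $1\le i\le m$, satisfying the usual (non-unital) operad axioms (equivariance for the permutations fixing the label $0$, and the two associativity axioms), together with $(a\circ_m b)^*=(-1)^{|a||b|}\,b^*\circ_1a^*$ for $m,n\ge1$ and $(a\circ_i b)^*=a^*\circ_{i+1}b$ for $1\le i<m$; and, since there are components $\mathcal A((g,0))$ without labels, of the gluing $\langle\ ,\ \rangle:\mathcal A((g,1))\otimes\mathcal A((h,1))\to\mathcal A((g+h,0))$ of the only labels of two elements of $\mathcal A(0)$, a chain map with $\langle a,b\rangle=(-1)^{|a||b|}\langle b,a\rangle$ and $\langle a\circ_1b,c\rangle=(-1)^{|b||c|}\langle a^*\circ_1c,b\rangle$ for $a\in\mathcal A(1)$, $b,c\in\mathcal A(0)$. (If $\mathcal A((g,0))=0$ for all $g$, then $\langle\ ,\ \rangle$ is zero and may be ignored, as may the relations with target $\mathcal A((g,0))$ below.) \textbf{Theorem.} Let $\mathcal A$ be a stable graded cyclic operad with chain maps (contractions) $$\xi_{ij}:\mathcal A((g,I))\to\mathcal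 A((g+1,I\setminus\{i,j\})),$$ one for each finite set $I$ and each unordered pair of distinct elements $i,j\in I$ (so $\xi_{ij}=\xi_{ji}$), equivariant in the sense that $\xi_{\sigma(i)\sigma(j)}\,\sigma=\sigma\,\xi_{ij}$ for every bijection $\sigma:I\to J$. There is a modular operad structure on $\mathcal A$ whose compositions along trees with one edge are the given operations $\circ_i$ and $\langle\ ,\ \rangle$, and whose compositions along graphs with one vertex and one loop are the given $\xi_{ij}$, if and only if the following relations hold: 1) $\xi_{ij}\circ\xi_{kl}=\xi_{kl}\circ\xi_{ij}$ for every finite set $I$ and distinct $i,j,k,l\in I$; and for $a\in\mathcal A(m)$, $b\in\mathcal A(n)$ (after a contraction, the remaining labels are renumbered in their order; on the right of 2), $\circ_m$ refers to the label of $\xi_{12}a$ that was $m$ before the renumbering): 2) $\xi_{12}(a\circ_m b)=(\xi_{12}a)\circ_m b$ if $m\ge3$; and, without remaining labels, $\xi_{01}(a\circ_2b)=\langle\xi_{01}a,b\rangle$ for $a\in\mathcal A(2)$, $b\in\mathcal A(0)$; 3) $\xi_{m,m+1}(a\circ_m b)=a\circ_m(\xi_{12}b)$ if $m\ge1$, $n\ge2$;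 4) $\xi_{m-1,m}(a\circ_m b)=\xi_{m+n-2,m+n-1}(a\circ_{m-1}\tau^{-1}b)$ if $m\ge2$, $n\ge1$; and, without remaining labels, $\xi_{01}(a\circ_1b)=\xi_{01}(a^*\circ_1b^*)$ for $a,b\in\mathcal A(1)$. Moreover, such a modular operad structure is unique if it exists. -/

import Mathlib

universe u v

noncomputable section

/-! ## Stable symmetric modules -/

/-- A stable `𝕊`-module: chain complexes `V((g,n))` over `k` with an action of the symmetric group
on `n` letters (here `Perm (Fin n)`), vanishing for `2g + n - 2 ≤ 0`.  A chain complex is given by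
its total space, an internal `ℤ`-grading `deg` and a differential of degree `-1`. -/
structure StableSModule (k : Type u) [Field k] where
  obj : ℕ → ℕ → Type v
  [addCommGroup : ∀ g n, AddCommGroup (obj g n)]
  [module : ∀ g n, Module k (obj g n)]
  deg : ∀ g n, ℤ → Submodule k (obj g n)
  isInternal : ∀ g n, DirectSum.IsInternal (deg g n)
  d : ∀ g n, obj g n →ₗ[k] obj g n
  d_mem : ∀ g n (p : ℤ) (x : obj g n), x ∈ deg g n p → d g n x ∈ deg g n (p - 1)
  d_d : ∀ g n (x : obj g n), d g n (d g n x) = 0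
  act : ∀ g n, Representation k (Equiv.Perm (Fin n)) (obj g n)
  act_mem : ∀ g n (σ : Equiv.Perm (Fin n)) (p : ℤ) (x : obj g n),
    x ∈ deg g n p → act g n σ x ∈ deg g n p
  act_d : ∀ g n (σ : Equiv.Perm (Fin n)) (x : obj g n),
    d g n (act g n σ x) = act g n σ (d g n x)
  stable : ∀ g n, 2 * g + n ≤ 2 → Subsingleton (obj g n)

attribute [instance] StableSModule.addCommGroup StableSModule.module

namespace StableSModule

variable {k : Type u} [Field k] (A : StableSModule.{u, v} k)

/-! ### Extension to all finite sets

`A((g,I))` is the space of coinvariants of the symmetric group acting on the direct sum of copies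
of `A((g,n))` over the bijections `f : Fin n ≃ I`.  Summing over all `n` is harmless, since such
bijections exist for one `n` only. -/

open Classical in
/-- The subspace spanned by the differences `(f ∘ σ⁻¹, σ x) - (f, x)`. -/
def relations (g : ℕ) (I : Type) :
    Submodule k (DirectSum (Σ n : ℕ, Fin n ≃ I) (fun f => A.obj g f.1)) :=
  Submodule.span k
    {z | ∃ (n : ℕ) (f : Fin n ≃ I) (σ : Equiv.Perm (Fin n)) (x : A.obj g n),
      z = DirectSum.lof k _ (fun f : Σ n : ℕ, Fin n ≃ I => A.obj g f.1) ⟨n, σ.symm.trans f⟩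
            (A.act g n σ x)
          - DirectSum.lof k _ (fun f : Σ n : ℕ, Fin n ≃ I => A.obj g f.1) ⟨n, f⟩ x}

/-- The space `A((g,I))`. -/
def onSet (g : ℕ) (I : Type) : Type v :=
  (DirectSum (Σ n : ℕ, Fin n ≃ I) (fun f => A.obj g f.1)) ⧸ A.relations g I

instance (g : ℕ) (I : Type) : AddCommGroup (A.onSet g I) :=
  inferInstanceAs (AddCommGroup (_ ⧸ A.relations g I))

instance (g : ℕ) (I : Type) : Module k (A.onSet g I) :=
  inferInstanceAs (Module k (_ ⧸ A.relations g I))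

open Classical in
/-- The class in `A((g,I))` of an element of `A((g,n))`, for a bijection `f : Fin n ≃ I`. -/
def cls {g n : ℕ} {I : Type} (f : Fin n ≃ I) : A.obj g n →ₗ[k] A.onSet g I :=
  (A.relations g I).mkQ ∘ₗ
    DirectSum.lof k _ (fun f : Σ n : ℕ, Fin n ≃ I => A.obj g f.1) ⟨n, f⟩

theorem cls_act {g n : ℕ} {I : Type} (f : Fin n ≃ I) (σ : Equiv.Perm (Fin n)) (x : A.obj g n) :
    A.cls (σ.symm.trans f) (A.act g n σ x) = A.cls f x := by
  refine (Submodule.Quotient.eq (A.relations g I)).2 ?_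
  exact Submodule.subset_span ⟨n, f, σ, x, rfl⟩

open Classical in
/-- Linear maps out of `A((g,I))`. -/
def lift {g : ℕ} {I : Type} {M : Type*} [AddCommGroup M] [Module k M]
    (F : ∀ n : ℕ, (Fin n ≃ I) → (A.obj g n →ₗ[k] M))
    (hF : ∀ (n : ℕ) (f : Fin n ≃ I) (σ : Equiv.Perm (Fin n)) (x : A.obj g n),
      F n (σ.symm.trans f) (A.act g n σ x) = F n f x) : A.onSet g I →ₗ[k] M :=
  (A.relations g I).liftQ (DirectSum.toModule k _ M (fun f => F f.1 f.2)) (by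
    refine Submodule.span_le.2 ?_
    rintro _ ⟨n, f, σ, x, rfl⟩
    simp only [SetLike.mem_coe, LinearMap.mem_ker, map_sub, DirectSum.toModule_lof]
    exact sub_eq_zero.2 (hF n f σ x))

@[simp]
theorem lift_cls {g : ℕ} {I : Type} {M : Type*} [AddCommGroup M] [Module k M]
    (F : ∀ n : ℕ, (Fin n ≃ I) → (A.obj g n →ₗ[k] M)) (hF) {n : ℕ} (f : Fin n ≃ I)
    (x : A.obj g n) : A.lift F hF (A.cls f x) = F n f x := by
  classical
  refine (Submodule.liftQ_apply _ _ _).trans ?_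
  simp [DirectSum.toModule_lof]

@[elab_as_elim]
theorem onSet_induction {g : ℕ} {I : Type} {P : A.onSet g I → Prop}
    (hzero : P 0) (hcls : ∀ (n : ℕ) (f : Fin n ≃ I) (x : A.obj g n), P (A.cls f x))
    (hadd : ∀ x y, P x → P y → P (x + y)) (x : A.onSet g I) : P x := by
  classical
  obtain ⟨y, rfl⟩ := Submodule.mkQ_surjective (A.relations g I) x
  induction y using DirectSum.induction_on with
  | zero => exact (map_zero (A.relations g I).mkQ) ▸ hzero
  | of f x => exact hcls f.1 f.2 x
  | add x y hx hy => exact (map_add (A.relations g I).mkQ x y) ▸ hadd _ _ hx hy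

/-- The homogeneous part of degree `p` of `A((g,I))`. -/
def onSetDeg (g : ℕ) (I : Type) (p : ℤ) : Submodule k (A.onSet g I) :=
  ⨆ f : Σ n : ℕ, Fin n ≃ I, (A.deg g f.1 p).map (A.cls f.2)

/-- The differential of `A((g,I))`. -/
def onSetD (g : ℕ) (I : Type) : A.onSet g I →ₗ[k] A.onSet g I :=
  A.lift (fun n f => A.cls f ∘ₗ A.d g n) (fun n f σ x => by
    simp only [LinearMap.comp_apply, A.act_d, A.cls_act])

/-- The isomorphism-functoriality of `A((g,I))`: relabelling along a bijection of finite sets. The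
equality of genera is carried along to avoid transports. -/
def relabel {g g' : ℕ} (hg : g = g') {I J : Type} (τ : I ≃ J) : A.onSet g I →ₗ[k] A.onSet g' J :=
  A.lift (fun n f => hg ▸ A.cls (f.trans τ)) (fun n f σ x => by
    subst hg
    exact A.cls_act (f.trans τ) σ x)

@[simp]
theorem relabel_cls {g : ℕ} {I J : Type} (τ : I ≃ J) {n : ℕ} (f : Fin n ≃ I) (x : A.obj g n) :
    A.relabel rfl τ (A.cls f x) = A.cls (f.trans τ) x :=
  A.lift_cls _ _ f x

/-- The change of numbering from `f'` to `f`, as a map `A((g,n')) → A((g,n))` (where necessarily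
`n' = n`). -/
def coord {g n n' : ℕ} {I : Type} (f : Fin n ≃ I) (f' : Fin n' ≃ I) :
    A.obj g n' →ₗ[k] A.obj g n := by
  have h : n' = n := by simpa using Fintype.card_congr (f'.trans f.symm)
  subst h
  exact A.act g n' (f'.trans f.symm)

theorem coord_eq {g n : ℕ} {I : Type} (f f' : Fin n ≃ I) (x : A.obj g n) :
    A.coord f f' x = A.act g n (f'.trans f.symm) x := rfl

/-- A numbering `f : Fin n ≃ I` identifies `A((g,n))` with `A((g,I))`. -/
def numbering (g : ℕ) {n : ℕ} {I : Type} (f : Fin n ≃ I) : A.obj g n ≃ₗ[k] A.onSet g I :=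
  LinearEquiv.ofLinearMap (A.cls f)
    (A.lift (fun n' f' => A.coord f f') (fun n' f' σ x => by
      have h : n' = n := by simpa using Fintype.card_congr (f'.trans f.symm)
      subst h
      simp only [coord_eq]
      rw [← Module.End.mul_apply, ← map_mul]
      congr 2
      ext j
      simp [Equiv.Perm.mul_def]))
    (by
      ext x
      refine A.onSet_induction (P := fun x => (A.cls f ∘ₗ A.lift _ _) x = LinearMap.id x) ?_ ?_ ?_ x
      · simp
      · intro n' f' x
        have h : n' = n := by simpa using Fintype.card_congr (f'.trans f.symm)
        subst h
        simp only [LinearMap.comp_apply, lift_cls, coord_eq, LinearMap.id_apply]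
        rw [← A.cls_act f' (f'.trans f.symm) x]
        congr 2
        ext j
        simp
      · intro x y hx hy
        rw [map_add, hx, hy, map_add])
    (by
      ext x
      simp only [LinearMap.comp_apply, lift_cls, coord_eq, LinearMap.id_apply, Equiv.self_trans_symm]
      exact congrArg (fun T => T x) (map_one (A.act g n)))

@[simp]
theorem numbering_apply (g : ℕ) {n : ℕ} {I : Type} (f : Fin n ≃ I) (x : A.obj g n) :
    A.numbering g f x = A.cls f x := rfl

/-- The operation `a ↦ a^*` on `A(n) = A((n+1))`: the action of the cycle `(0 1 … n)`. -/
def star {g n : ℕ} (a : A.obj g (n + 1)) : A.obj g (n + 1) :=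
  A.act g (n + 1) (finRotate (n + 1)) a

/-- The inverse operation of `a ↦ a^*`: the action of the inverse of the cycle `(0 1 … n)`. -/
def unstar {g n : ℕ} (a : A.obj g (n + 1)) : A.obj g (n + 1) :=
  A.act g (n + 1) (finRotate (n + 1))⁻¹ a

end StableSModule

/-! ## Stable graded cyclic operads -/

/-- Numbering of the labels of `a ∘_i b`, where `a` has labels `0, …, m` and `b` has labels
`0, …, n`, and the label `i` of `a` is glued to the label `0` of `b`: first the labels
`0, …, i-1` of `a`, then the labels `1, …, n` of `b`, then the labels `i+1, …, m` of `a`. -/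
def circNumbering {m n s : ℕ} (hs : m + n = s) (i : Fin (m + 1)) :
    {z : Fin (m + 1) ⊕ Fin (n + 1) // z ≠ Sum.inl i ∧ z ≠ Sum.inr 0} ≃ Fin s where
  toFun z :=
    match z with
    | ⟨Sum.inl j, h⟩ =>
      if hj : (j : ℕ) < i then ⟨j, by have := i.2; omega⟩
      else ⟨j + n - 1, by
        have h1 : (j : ℕ) ≠ i := fun e => h.1 (by rw [Fin.ext e])
        have := j.2; omega⟩
    | ⟨Sum.inr j, h⟩ => ⟨i + j - 1, by
        have h1 : (j : ℕ) ≠ 0 := fun e => h.2 (by rw [Fin.ext (a := j) (b := 0) e])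
        have := i.2; have := j.2; omega⟩
  invFun x :=
    if h1 : (x : ℕ) < i then
      ⟨Sum.inl ⟨x, by have := i.2; omega⟩, by simp [Fin.ext_iff]; omega⟩
    else if h2 : (x : ℕ) < i + n then
      ⟨Sum.inr ⟨x - i + 1, by omega⟩, by simp [Fin.ext_iff]⟩
    else
      ⟨Sum.inl ⟨x - n + 1, by have := x.2; omega⟩, by simp [Fin.ext_iff]; omega⟩
  left_inv := by
    rintro ⟨j | j, h⟩
    · have h1 : (j : ℕ) ≠ i := fun e => h.1 (by rw [Fin.ext e])
      by_cases hj : (j : ℕ) < i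
      · simp [hj]
      · have e1 : ¬ ((j : ℕ) + n - 1 < i) := by omega
        have e2 : ¬ ((j : ℕ) + n - 1 < i + n) := by omega
        simp only [hj, dite_false, e1, e2, Subtype.mk.injEq, Sum.inl.injEq, Fin.ext_iff]
        omega
    · have h1 : (j : ℕ) ≠ 0 := fun e => h.2 (by rw [Fin.ext (a := j) (b := 0) e])
      have := j.2
      have e1 : ¬ ((i : ℕ) + j - 1 < i) := by omega
      have e2 : (i : ℕ) + j - 1 < i + n := by omega
      simp only [dite_false, dite_true, e1, e2, Subtype.mk.injEq, Sum.inr.injEq, Fin.ext_iff]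
      omega
  right_inv := by
    intro x
    by_cases h1 : (x : ℕ) < i
    · simp [h1]
    · by_cases h2 : (x : ℕ) < i + n
      · simp only [h1, h2, dite_false, dite_true, Fin.ext_iff]
        omega
      · have e1 : ¬ ((x : ℕ) - n + 1 < i) := by omega
        simp only [h1, h2, e1, dite_false, Fin.ext_iff]
        omega

/-- The permutation `π ∘_i ρ` of the labels of `a ∘_i b` induced by a permutation `π` of the labels
of `a` with `π i = i'`, and a permutation `ρ` of the labels of `b` with `ρ 0 = 0`. -/
def circPerm {m n s : ℕ} (hs : m + n = s) (i i' : Fin (m + 1)) (π : Equiv.Perm (Fin (m + 1)))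
    (ρ : Equiv.Perm (Fin (n + 1))) (hi : π i = i') (hρ : ρ 0 = 0) : Equiv.Perm (Fin s) :=
  (circNumbering hs i).symm.trans
    (((Equiv.sumCongr π ρ).subtypeEquiv (by
        subst hi
        rintro (j | j)
        · simp
        · have : ρ j = 0 ↔ j = 0 := by
            rw [← ρ.injective.eq_iff (a := j) (b := 0), hρ]
          simp [this])).trans
      (circNumbering hs i'))

/-- A stable graded cyclic operad with underlying stable `𝕊`-module `A`.

In operadic notation `P(n) = ⨁_g A((g,n+1))`, with labels `0, …, n` (`0` being the output).  The
operations are the graded components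
`∘_i : A((g,m+1)) ⊗ A((h,n+1)) → A((g+h,m+n))`, `1 ≤ i ≤ m`,
of `∘_i : P(m) ⊗ P(n) → P(m+n-1)`; they are maps of chain complexes.  Indices of targets are
variables related by equations, in order to avoid transports.

Since `A` has components `A((g,0))` without labels, an operad contains in addition the composition
`A((g,1)) ⊗ A((h,1)) → A((g+h,0))`, here called `pair`, which glues the only label of an element of
`P(0)` to the only label of another one. -/
structure StableGradedCyclicOperad {k : Type u} [Field k] (A : StableSModule.{u, v} k) where
  circ : ∀ {g h γ m n s : ℕ} (_ : g + h = γ) (_ : m + n = s) (i : ℕ) (_ : 1 ≤ i ∧ i ≤ m),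
    A.obj g (m + 1) →ₗ[k] A.obj h (n + 1) →ₗ[k] A.obj γ s
  circ_mem : ∀ {g h γ m n s : ℕ} (hγ : g + h = γ) (hs : m + n = s) (i : ℕ) (hi : 1 ≤ i ∧ i ≤ m)
    (p q : ℤ) (a : A.obj g (m + 1)) (b : A.obj h (n + 1)),
    a ∈ A.deg g (m + 1) p → b ∈ A.deg h (n + 1) q →
      circ hγ hs i hi a b ∈ A.deg γ s (p + q)
  circ_d : ∀ {g h γ m n s : ℕ} (hγ : g + h = γ) (hs : m + n = s) (i : ℕ) (hi : 1 ≤ i ∧ i ≤ m)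
    (p : ℤ) (a : A.obj g (m + 1)) (b : A.obj h (n + 1)), a ∈ A.deg g (m + 1) p →
      A.d γ s (circ hγ hs i hi a b) =
        circ hγ hs i hi (A.d g (m + 1) a) b
          + p.negOnePow • circ hγ hs i hi a (A.d h (n + 1) b)
  /-- Equivariance under the permutations fixing the output:
  `(π a) ∘_{π(i)} (ρ b) = (π ∘_i ρ) (a ∘_i b)`. -/
  circ_equivariant : ∀ {g h γ m n s : ℕ} (hγ : g + h = γ) (hs : m + n = s)
    (i i' : ℕ) (hi : 1 ≤ i ∧ i ≤ m) (hi' : 1 ≤ i' ∧ i' ≤ m)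
    (π : Equiv.Perm (Fin (m + 1))) (ρ : Equiv.Perm (Fin (n + 1))) (_ : π 0 = 0) (hρ : ρ 0 = 0)
    (hπi : π ⟨i, by omega⟩ = ⟨i', by omega⟩) (a : A.obj g (m + 1)) (b : A.obj h (n + 1)),
      circ hγ hs i' hi' (A.act g (m + 1) π a) (A.act h (n + 1) ρ b) =
        A.act γ s (circPerm hs ⟨i, by omega⟩ ⟨i', by omega⟩ π ρ hπi hρ) (circ hγ hs i hi a b)
  /-- `(a ∘_i b) ∘_{j+l-1} c = (-1)^{|b||c|} (a ∘_j c) ∘_i b` for `1 ≤ i < j ≤ k`. -/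
  circ_parallel : ∀ {g g₁ g₂ γ γ₁ γ₂ k l m r₁ r₂ s : ℕ}
    (hγ₁ : g + g₁ = γ₁) (hγ₂ : g + g₂ = γ₂) (hγ₁' : γ₁ + g₂ = γ) (hγ₂' : γ₂ + g₁ = γ)
    (hr₁ : k + l = r₁ + 1) (hr₂ : k + m = r₂ + 1) (hs₁ : r₁ + m = s) (hs₂ : r₂ + l = s)
    (i j : ℕ) (hi : 1 ≤ i) (hij : i < j) (hj : j ≤ k) (p q : ℤ)
    (a : A.obj g (k + 1)) (b : A.obj g₁ (l + 1)) (c : A.obj g₂ (m + 1)),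
    b ∈ A.deg g₁ (l + 1) p → c ∈ A.deg g₂ (m + 1) q →
      circ hγ₁' hs₁ (j + l - 1) (by omega) (circ hγ₁ hr₁ i (by omega) a b) c =
        (p * q).negOnePow •
          circ hγ₂' hs₂ i (by omega) (circ hγ₂ hr₂ j (by omega) a c) b
  /-- `(a ∘_i b) ∘_{i+j-1} c = a ∘_i (b ∘_j c)` for `1 ≤ i ≤ k` and `1 ≤ j ≤ l`. -/
  circ_sequential : ∀ {g g₁ g₂ γ γ₁ γ₂ k l m r₁ r₂ s : ℕ}
    (hγ₁ : g + g₁ = γ₁) (hγ₂ : g₁ + g₂ = γ₂) (hγ₁' : γ₁ + g₂ = γ) (hγ₂' : g + γ₂ = γ)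
    (hr₁ : k + l = r₁ + 1) (hr₂ : l + m = r₂ + 1) (hs₁ : r₁ + m = s) (hs₂ : k + r₂ = s)
    (i j : ℕ) (hi : 1 ≤ i ∧ i ≤ k) (hj : 1 ≤ j ∧ j ≤ l)
    (a : A.obj g (k + 1)) (b : A.obj g₁ (l + 1)) (c : A.obj g₂ (m + 1)),
      circ hγ₁' hs₁ (i + j - 1) (by omega) (circ hγ₁ hr₁ i hi a b) c =
        circ hγ₂' hs₂ i hi a (circ hγ₂ hr₂ j hj b c)
  /-- `(a ∘_m b)^* = (-1)^{|a||b|} b^* ∘_1 a^*` for `a ∈ P(m)`, `b ∈ P(n)` with `m, n ≥ 1`. -/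
  circ_star_last : ∀ {g h γ m n r : ℕ} (hγ : g + h = γ) (hγ' : h + g = γ)
    (hs : m + n = r + 1) (hs' : n + m = r + 1) (hm : 1 ≤ m) (hn : 1 ≤ n) (p q : ℤ)
    (a : A.obj g (m + 1)) (b : A.obj h (n + 1)),
    a ∈ A.deg g (m + 1) p → b ∈ A.deg h (n + 1) q →
      A.star (circ hγ hs m ⟨hm, le_rfl⟩ a b) =
        (p * q).negOnePow • circ hγ' hs' 1 ⟨le_rfl, hn⟩ (A.star b) (A.star a)
  /-- `(a ∘_i b)^* = a^* ∘_{i+1} b` for `a ∈ P(m)` and `1 ≤ i < m`. -/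
  circ_star_of_lt : ∀ {g h γ m n r : ℕ} (hγ : g + h = γ) (hs : m + n = r + 1)
    (i : ℕ) (hi : 1 ≤ i) (him : i < m) (a : A.obj g (m + 1)) (b : A.obj h (n + 1)),
      A.star (circ hγ hs i (by omega) a b) =
        circ hγ hs (i + 1) (by omega) (A.star a) b
  pair : ∀ {g h γ : ℕ} (_ : g + h = γ), A.obj g 1 →ₗ[k] A.obj h 1 →ₗ[k] A.obj γ 0
  pair_mem : ∀ {g h γ : ℕ} (hγ : g + h = γ) (p q : ℤ) (a : A.obj g 1) (b : A.obj h 1),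
    a ∈ A.deg g 1 p → b ∈ A.deg h 1 q → pair hγ a b ∈ A.deg γ 0 (p + q)
  pair_d : ∀ {g h γ : ℕ} (hγ : g + h = γ) (p : ℤ) (a : A.obj g 1) (b : A.obj h 1),
    a ∈ A.deg g 1 p →
      A.d γ 0 (pair hγ a b) = pair hγ (A.d g 1 a) b + p.negOnePow • pair hγ a (A.d h 1 b)
  /-- `⟨a, b⟩ = (-1)^{|a||b|} ⟨b, a⟩`. -/
  pair_symm : ∀ {g h γ : ℕ} (hγ : g + h = γ) (hγ' : h + g = γ) (p q : ℤ)
    (a : A.obj g 1) (b : A.obj h 1), a ∈ A.deg g 1 p → b ∈ A.deg h 1 q →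
      pair hγ a b = (p * q).negOnePow • pair hγ' b a
  /-- `⟨a ∘_1 b, c⟩ = (-1)^{|b||c|} ⟨a^* ∘_1 c, b⟩` for `a ∈ P(1)` and `b, c ∈ P(0)`. -/
  pair_circ : ∀ {g g₁ g₂ γ γ₁ γ₂ : ℕ}
    (hγ₁ : g + g₁ = γ₁) (hγ₂ : g + g₂ = γ₂) (hγ₁' : γ₁ + g₂ = γ) (hγ₂' : γ₂ + g₁ = γ)
    (p q : ℤ) (a : A.obj g 2) (b : A.obj g₁ 1) (c : A.obj g₂ 1),
    b ∈ A.deg g₁ 1 p → c ∈ A.deg g₂ 1 q →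
      pair hγ₁' (circ (m := 1) (n := 0) (s := 1) hγ₁ rfl 1 ⟨le_rfl, le_rfl⟩ a b) c =
        (p * q).negOnePow •
          pair hγ₂' (circ (m := 1) (n := 0) (s := 1) hγ₂ rfl 1 ⟨le_rfl, le_rfl⟩
            (A.star (n := 1) a) c) b

/-! ## Contractions -/

/-- Equivariant contraction maps `ξ_{ij} : A((g,I)) → A((g+1, I ∖ {i,j}))`, which are maps of chain
complexes, defined for each finite set `I` and each unordered pair `{i,j}` of distinct elements. -/
structure Contractions {k : Type u} [Field k] (A : StableSModule.{u, v} k) where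
  xi : ∀ {g : ℕ} {I : Type} [Finite I] (i j : I) (_ : i ≠ j),
    A.onSet g I →ₗ[k] A.onSet (g + 1) {x : I // x ≠ i ∧ x ≠ j}
  xi_mem : ∀ {g : ℕ} {I : Type} [Finite I] (i j : I) (hij : i ≠ j) (p : ℤ) (a : A.onSet g I),
    a ∈ A.onSetDeg g I p → xi i j hij a ∈ A.onSetDeg (g + 1) {x : I // x ≠ i ∧ x ≠ j} p
  xi_d : ∀ {g : ℕ} {I : Type} [Finite I] (i j : I) (hij : i ≠ j) (a : A.onSet g I),
    A.onSetD (g + 1) {x : I // x ≠ i ∧ x ≠ j} (xi i j hij a) = xi i j hij (A.onSetD g I a)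
  /-- The pair `{i,j}` is unordered: `ξ_{ij} = ξ_{ji}`. -/
  xi_symm : ∀ {g : ℕ} {I : Type} [Finite I] (i j : I) (hij : i ≠ j) (a : A.onSet g I),
    xi j i hij.symm a =
      A.relabel rfl (Equiv.subtypeEquivRight (fun _ => and_comm)) (xi i j hij a)
  /-- `ξ_{σ(i)σ(j)} σ = σ ξ_{ij}` for each bijection `σ : I ≃ J`. -/
  xi_equivariant : ∀ {g : ℕ} {I J : Type} [Finite I] [Finite J] (σ : I ≃ J) (i j : I)
    (hij : i ≠ j) (a : A.onSet g I),
    xi (σ i) (σ j) (σ.injective.ne hij) (A.relabel rfl σ a) =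
      A.relabel rfl (σ.subtypeEquiv (fun x => by simp)) (xi i j hij a)

/-- The order-preserving numbering of the labels other than `i` and `j`. -/
def restNumbering {n : ℕ} (i j : Fin (n + 2)) (hij : i ≠ j) :
    Fin n ≃ {x : Fin (n + 2) // x ≠ i ∧ x ≠ j} :=
  (monoEquivOfFin {x : Fin (n + 2) // x ≠ i ∧ x ≠ j} (by
    rw [Fintype.card_subtype]
    have : (Finset.univ.filter fun x : Fin (n + 2) => x ≠ i ∧ x ≠ j) =
        (Finset.univ.erase i).erase j := by
      ext x; simp [and_comm]
    rw [this, Finset.card_erase_of_mem (by simp [hij.symm]), Finset.card_erase_of_mem (by simp)]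
    simp)).toEquiv

/-- The contraction `ξ_{ij}` in numbered form: after contracting the labels `i` and `j`, the other
labels are renumbered in their order. -/
def Contractions.xiFin {k : Type u} [Field k] {A : StableSModule.{u, v} k} (X : Contractions A)
    {g n : ℕ} (i j : Fin (n + 2)) (hij : i ≠ j) : A.obj g (n + 2) →ₗ[k] A.obj (g + 1) n :=
  ((A.numbering (g + 1) (restNumbering i j hij)).symm : _ →ₗ[k] _) ∘ₗ
    X.xi i j hij ∘ₗ A.cls (Equiv.refl (Fin (n + 2)))

/-! ## Stable graphs -/

/-- A graph: a finite set of flags with an involution, and a finite set of vertices, each flag being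
attached to a vertex, together with a genus for each vertex. -/
structure FlagGraph where
  Flag : Type
  Vert : Type
  [finite_flag : Finite Flag]
  [finite_vert : Finite Vert]
  vert : Flag → Vert
  inv : Flag → Flag
  inv_inv : Function.Involutive inv
  genus : Vert → ℕ

namespace FlagGraph

attribute [instance] FlagGraph.finite_flag FlagGraph.finite_vert

instance (G : FlagGraph) : Fintype G.Vert := Fintype.ofFinite _

/-- The flags at a vertex. -/
abbrev Leg (G : FlagGraph) (v : G.Vert) : Type := {x : G.Flag // G.vert x = v}

/-- The legs of a graph: the fixed points of the involution. -/
abbrev Legs (G : FlagGraph) : Type := {x : G.Flag // G.inv x = x}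

/-- The edges of a graph: the two-cycles of the involution. -/
abbrev Edge (G : FlagGraph) : Type := {e : Sym2 G.Flag // ∃ x, G.inv x ≠ x ∧ e = s(x, G.inv x)}

/-- A graph is connected if it has a vertex and any two vertices are joined by a chain of edges. -/
def Connected (G : FlagGraph) : Prop :=
  Nonempty G.Vert ∧ ∀ u v : G.Vert,
    Relation.ReflTransGen (fun u v => ∃ x, G.vert x = u ∧ G.vert (G.inv x) = v) u v

/-- The genus of a connected graph is `γ`: that is, `γ = ∑_v (g(v) - 1) + |Edge(G)| + 1`. -/
def HasGenus (G : FlagGraph) (γ : ℕ) : Prop :=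
  γ + Nat.card G.Vert = ∑ v, G.genus v + Nat.card G.Edge + 1

end FlagGraph

/-- An object of the groupoid of stable graphs of genus `γ` with legs labelled by `I`: a connected
graph of genus `γ` with `2(g(v) - 1) + n(v) > 0` for each vertex `v`, and a bijection from the set
of its legs to `I`. -/
structure StableGraph (γ : ℕ) (I : Type) extends FlagGraph where
  leg : toFlagGraph.Legs ≃ I
  connected : toFlagGraph.Connected
  hasGenus : toFlagGraph.HasGenus γ
  stable : ∀ v, 2 < 2 * genus v + Nat.card (toFlagGraph.Leg v)

/-- An isomorphism of stable graphs over a bijection `τ` of the sets labelling the legs. -/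
structure StableGraph.Iso {γ : ℕ} {I J : Type} (G : StableGraph γ I) (G' : StableGraph γ J)
    (τ : I ≃ J) where
  flag : G.Flag ≃ G'.Flag
  vert : G.Vert ≃ G'.Vert
  vert_flag : ∀ x, G'.vert (flag x) = vert (G.vert x)
  inv_flag : ∀ x, G'.inv (flag x) = flag (G.inv x)
  genus_vert : ∀ v, G.genus v = G'.genus (vert v)
  leg_flag : ∀ x : G.toFlagGraph.Legs,
    G'.leg ⟨flag x.1, by rw [inv_flag, x.2]⟩ = τ (G.leg x)

/-- The bijection of the sets of flags at `v` and at its image induced by an isomorphism. -/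
def StableGraph.Iso.legEquiv {γ : ℕ} {I J : Type} {G : StableGraph γ I} {G' : StableGraph γ J}
    {τ : I ≃ J} (φ : G.Iso G' τ) (v : G.Vert) :
    G.toFlagGraph.Leg v ≃ G'.toFlagGraph.Leg (φ.vert v) :=
  φ.flag.subtypeEquiv (fun x => by rw [φ.vert_flag, φ.vert.injective.eq_iff])

/-- The data and the incidence conditions of a morphism of graphs `G₀ → G₁`: an injection of the
flags of `G₁` into those of `G₀` commuting with the involutions, such that the remaining flags of
`G₀` form edges (the contracted edges), and the induced map on vertices, under which both ends of
a contracted edge have the same image. -/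
structure FlagGraph.PreHom (G₀ G₁ : FlagGraph) where
  flag : G₁.Flag → G₀.Flag
  flag_injective : Function.Injective flag
  vert : G₀.Vert → G₁.Vert
  inv_flag : ∀ x, G₀.inv (flag x) = flag (G₁.inv x)
  vert_flag : ∀ x, vert (G₀.vert (flag x)) = G₁.vert x
  inv_ne : ∀ x, x ∉ Set.range flag → G₀.inv x ≠ x
  vert_inv : ∀ x, x ∉ Set.range flag → vert (G₀.vert (G₀.inv x)) = vert (G₀.vert x)

open Classical in
/-- The preimage of a vertex `w` of `G₁`: its vertices and flags are those of `G₀` lying over `w`,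
its edges are the contracted edges over `w`, and the flags which are not contracted are legs. -/
def FlagGraph.PreHom.preimage {G₀ G₁ : FlagGraph} (f : G₀.PreHom G₁) (w : G₁.Vert) : FlagGraph where
  Flag := {x : G₀.Flag // f.vert (G₀.vert x) = w}
  Vert := {u : G₀.Vert // f.vert u = w}
  vert x := ⟨G₀.vert x.1, x.2⟩
  inv x := if h : x.1 ∈ Set.range f.flag then x
    else ⟨G₀.inv x.1, (f.vert_inv x.1 h).trans x.2⟩
  inv_inv := by
    rintro ⟨x, hx⟩
    by_cases h : x ∈ Set.range f.flag
    · simp only [h, dite_true]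
    · have h' : G₀.inv x ∉ Set.range f.flag := by
        rintro ⟨y, hy⟩
        refine h ⟨G₁.inv y, ?_⟩
        rw [← f.inv_flag, hy, G₀.inv_inv]
      simp only [h, h', dite_false, Subtype.mk.injEq]
      exact G₀.inv_inv x
  genus u := G₀.genus u.1

/-- A morphism of stable graphs with legs labelled by `I`: the preimage of each vertex is connected
and has the genus of that vertex, and the labels of the legs are preserved. -/
structure StableGraph.Hom {γ : ℕ} {I : Type} (G₀ G₁ : StableGraph γ I) extends
    FlagGraph.PreHom G₀.toFlagGraph G₁.toFlagGraph where
  connected : ∀ w, (toPreHom.preimage w).Connected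
  hasGenus : ∀ w, (toPreHom.preimage w).HasGenus (G₁.genus w)
  leg_flag : ∀ x : G₁.toFlagGraph.Legs,
    G₀.leg ⟨flag x.1, by rw [inv_flag, x.2]⟩ = G₁.leg x

/-- The flags of the preimage of `w` at a vertex `u` are the flags of `G₀` at `u`. -/
def FlagGraph.PreHom.preimageLegEquiv {G₀ G₁ : FlagGraph} (f : G₀.PreHom G₁) (w : G₁.Vert)
    (u : (f.preimage w).Vert) : G₀.Leg u.1 ≃ (f.preimage w).Leg u where
  toFun x := ⟨⟨x.1, by rw [x.2]; exact u.2⟩, Subtype.ext x.2⟩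
  invFun x := ⟨x.1.1, congrArg Subtype.val x.2⟩
  left_inv _ := rfl
  right_inv _ := rfl

open Classical in
/-- The legs of the preimage of `w` are the flags of `G₁` at `w`. -/
def FlagGraph.PreHom.preimageLegs {G₀ G₁ : FlagGraph} (f : G₀.PreHom G₁) (w : G₁.Vert) :
    (f.preimage w).Legs ≃ G₁.Leg w :=
  (Equiv.ofBijective
    (fun y : G₁.Leg w =>
      (⟨⟨f.flag y.1, (f.vert_flag y.1).trans y.2⟩, by
        simp [FlagGraph.PreHom.preimage]⟩ : (f.preimage w).Legs))
    ⟨fun y y' h => by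
      exact Subtype.ext (f.flag_injective
        (congrArg (fun z : (f.preimage w).Legs => z.1.1) h)), by
      rintro ⟨⟨x, hx⟩, h⟩
      by_cases hr : x ∈ Set.range f.flag
      · obtain ⟨y, rfl⟩ := hr
        exact ⟨⟨y, (f.vert_flag y).symm.trans hx⟩, rfl⟩
      · refine absurd ?_ (f.inv_ne x hr)
        simpa [FlagGraph.PreHom.preimage, hr] using h⟩).symm

/-- The preimage `f⁻¹(w)`, a stable graph of genus `g(w)` with legs labelled by `Leg(w)`. -/
def StableGraph.Hom.fiber {γ : ℕ} {I : Type} {G₀ G₁ : StableGraph γ I} (f : G₀.Hom G₁)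
    (w : G₁.Vert) : StableGraph (G₁.genus w) (G₁.toFlagGraph.Leg w) where
  toFlagGraph := f.toPreHom.preimage w
  leg := f.toPreHom.preimageLegs w
  connected := f.connected w
  hasGenus := f.hasGenus w
  stable u := by
    rw [← Nat.card_congr (f.toPreHom.preimageLegEquiv w u)]
    exact G₀.stable u.1

/-- The graph with one vertex, of genus `γ`, and no edges, with set of legs `I`. -/
def StableGraph.corolla (γ : ℕ) (I : Type) [Finite I] (h : 2 < 2 * γ + Nat.card I) :
    StableGraph γ I where
  Flag := I
  Vert := Unit
  vert _ := ()
  inv x := x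
  inv_inv _ := rfl
  genus _ := γ
  leg := Equiv.subtypeUnivEquiv (fun _ => rfl)
  connected := ⟨⟨()⟩, fun _ _ => Relation.ReflTransGen.refl⟩
  hasGenus := by
    have : IsEmpty {e : Sym2 I // ∃ x : I, x ≠ x ∧ e = s(x, x)} :=
      ⟨fun ⟨_, _, h, _⟩ => h rfl⟩
    simp [FlagGraph.HasGenus, FlagGraph.Edge]
  stable _ := by
    rw [Nat.card_congr (Equiv.subtypeUnivEquiv (fun _ => rfl))]
    exact h

theorem swap_apply_eq_self_iff' {X : Type} [DecidableEq X] {p q : X} (hpq : p ≠ q) (z : X) :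
    Equiv.swap p q z = z ↔ z ≠ p ∧ z ≠ q := by
  constructor
  · intro h
    refine ⟨?_, ?_⟩
    · rintro rfl
      rw [Equiv.swap_apply_left] at h
      exact hpq h.symm
    · rintro rfl
      rw [Equiv.swap_apply_right] at h
      exact hpq h
  · rintro ⟨h1, h2⟩
    exact Equiv.swap_apply_of_ne_of_ne h1 h2

theorem card_edge_swap {X : Type} [DecidableEq X] {p q : X} (hpq : p ≠ q) :
    Nat.card {e : Sym2 X // ∃ x, Equiv.swap p q x ≠ x ∧ e = s(x, Equiv.swap p q x)} = 1 := by
  rw [Nat.card_eq_one_iff_unique]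
  refine ⟨⟨?_⟩, ⟨⟨s(p, q), p, ?_, ?_⟩⟩⟩
  · have key : ∀ x, Equiv.swap p q x ≠ x → s(x, Equiv.swap p q x) = s(p, q) := by
      intro x hx
      by_cases h1 : x = p
      · subst h1; rw [Equiv.swap_apply_left]
      · by_cases h2 : x = q
        · subst h2; rw [Equiv.swap_apply_right]; exact Sym2.eq_swap
        · exact absurd (Equiv.swap_apply_of_ne_of_ne h1 h2) hx
    rintro ⟨e, x, hx, rfl⟩ ⟨e', x', hx', rfl⟩
    exact Subtype.ext ((key x hx).trans (key x' hx').symm)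
  · rw [Equiv.swap_apply_left]; exact hpq.symm
  · rw [Equiv.swap_apply_left]

open Classical in
/-- The graph with set of flags `I`, one vertex, of genus `g`, and one edge, a loop joining the
flags `i` and `j`. -/
def StableGraph.loop (g : ℕ) {I : Type} [Finite I] (i j : I) (hij : i ≠ j)
    (h : 2 < 2 * g + Nat.card I) : StableGraph (g + 1) {x : I // x ≠ i ∧ x ≠ j} where
  Flag := I
  Vert := Unit
  vert _ := ()
  inv := Equiv.swap i j
  inv_inv x := Equiv.congr_fun (Equiv.swap_swap i j) x
  genus _ := g
  leg := Equiv.subtypeEquivRight (swap_apply_eq_self_iff' hij)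
  connected := ⟨⟨()⟩, fun _ _ => Relation.ReflTransGen.refl⟩
  hasGenus := by
    simp only [FlagGraph.HasGenus, FlagGraph.Edge]
    rw [card_edge_swap hij]
    simp
  stable _ := by
    rw [Nat.card_congr (Equiv.subtypeUnivEquiv (fun _ => rfl))]
    exact h

/-- The flags of the tree at its first vertex. -/
def treeFlagsFst (X Y : Type) :
    X ≃ {z : X ⊕ Y // Sum.elim (fun _ => false) (fun _ => true) z = false} where
  toFun x := ⟨Sum.inl x, rfl⟩
  invFun z := match z with
    | ⟨Sum.inl x, _⟩ => x
    | ⟨Sum.inr _, h⟩ => absurd h (by simp)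
  left_inv _ := rfl
  right_inv := by rintro ⟨z | z, h⟩ <;> simp at h ⊢

/-- The flags of the tree at its second vertex. -/
def treeFlagsSnd (X Y : Type) :
    Y ≃ {z : X ⊕ Y // Sum.elim (fun _ => false) (fun _ => true) z = true} where
  toFun y := ⟨Sum.inr y, rfl⟩
  invFun z := match z with
    | ⟨Sum.inr y, _⟩ => y
    | ⟨Sum.inl _, h⟩ => absurd h (by simp)
  left_inv _ := rfl
  right_inv := by rintro ⟨z | z, h⟩ <;> simp at h ⊢

open Classical in
/-- The tree with two vertices `false` and `true`, of genera `g` and `h` and with flags `X` and `Y`,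
and with one edge joining the flag `x ∈ X` to the flag `y ∈ Y`. -/
def StableGraph.tree {X Y I : Type} [Finite X] [Finite Y] (g h γ : ℕ) (hγ : g + h = γ)
    (x : X) (y : Y) (hX : 2 < 2 * g + Nat.card X) (hY : 2 < 2 * h + Nat.card Y)
    (e : {z : X ⊕ Y // z ≠ Sum.inl x ∧ z ≠ Sum.inr y} ≃ I) : StableGraph γ I where
  Flag := X ⊕ Y
  Vert := Bool
  vert := Sum.elim (fun _ => false) (fun _ => true)
  inv := Equiv.swap (Sum.inl x) (Sum.inr y)
  inv_inv z := Equiv.congr_fun (Equiv.swap_swap _ _) z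
  genus v := Bool.rec g h v
  leg := (Equiv.subtypeEquivRight (swap_apply_eq_self_iff' Sum.inl_ne_inr)).trans e
  connected := by
    refine ⟨⟨true⟩, ?_⟩
    rintro (_ | _) (_ | _)
    · exact Relation.ReflTransGen.refl
    · exact Relation.ReflTransGen.single ⟨Sum.inl x, rfl, by simp⟩
    · exact Relation.ReflTransGen.single ⟨Sum.inr y, rfl, by simp⟩
    · exact Relation.ReflTransGen.refl
  hasGenus := by
    simp only [FlagGraph.HasGenus, FlagGraph.Edge]
    rw [card_edge_swap Sum.inl_ne_inr]
    have e : ∀ (F : Fintype Bool) (f : Bool → ℕ), @Finset.sum Bool ℕ _ (@Finset.univ Bool F) f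
        = f true + f false := by
      intro F f
      rw [Subsingleton.elim F Bool.fintype]
      exact Fintype.sum_bool f
    rw [e]
    simp
    omega
  stable := by
    rintro (_ | _)
    · rw [Nat.card_congr (treeFlagsFst X Y)] at hX; exact hX
    · rw [Nat.card_congr (treeFlagsSnd X Y)] at hY; exact hY

/-! ## Modular operads -/

open Classical in
/-- The Koszul sign of the reordering of homogeneous elements of degrees `p v`, ordered by `o`,
when their order is changed to the one that `o'` induces through `φ`. -/
def koszulSign {V V' : Type} [Fintype V] (o : LinearOrder V) (o' : LinearOrder V') (φ : V ≃ V')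
    (p : V → ℤ) : ℤˣ :=
  ∏ u, ∏ v, if o.lt u v ∧ o'.lt (φ v) (φ u) then (p u * p v).negOnePow else 1

/-- A modular operad with underlying stable `𝕊`-module `A`: an algebra structure on `A` over the
triple `𝕄` of stable graphs, where `𝕄A((γ,I))` is the colimit of the tensor products
`A((G)) = ⨂_v A((g(v),Leg(v)))` over the groupoid of stable graphs `G` of genus `γ` with legs `I`.

A map out of the colimit is a family of maps `A((G)) → A((γ,I))` (composition along `G`) which is
natural for isomorphisms.  The tensor product over the unordered set of vertices is the one of
chain complexes, with the Koszul sign rule; a map out of it is a multilinear map for each linear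
order of the vertices, such that the maps for different orders agree up to the Koszul sign.  -/
structure ModularOperad {k : Type u} [Field k] (A : StableSModule.{u, v} k) where
  /-- Composition along a stable graph. -/
  comp : ∀ {γ : ℕ} {I : Type} (G : StableGraph γ I) (_ : LinearOrder G.Vert),
    MultilinearMap k (fun v : G.Vert => A.onSet (G.genus v) (G.toFlagGraph.Leg v)) (A.onSet γ I)
  /-- Composition has degree zero. -/
  comp_mem : ∀ {γ : ℕ} {I : Type} (G : StableGraph γ I) (o : LinearOrder G.Vert) (p : G.Vert → ℤ)
    (a : ∀ v : G.Vert, A.onSet (G.genus v) (G.toFlagGraph.Leg v)),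
    (∀ v, a v ∈ A.onSetDeg (G.genus v) (G.toFlagGraph.Leg v) (p v)) →
      comp G o a ∈ A.onSetDeg γ I (∑ v, p v)
  /-- Composition commutes with the differentials. -/
  comp_d : ∀ {γ : ℕ} {I : Type} (G : StableGraph γ I) (o : LinearOrder G.Vert) (p : G.Vert → ℤ)
    (a : ∀ v : G.Vert, A.onSet (G.genus v) (G.toFlagGraph.Leg v)),
    (∀ v, a v ∈ A.onSetDeg (G.genus v) (G.toFlagGraph.Leg v) (p v)) →
      A.onSetD γ I (comp G o a) =
        open Classical in
        ∑ v, (∏ u, if o.lt u v then (p u).negOnePow else 1) •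
          comp G o (Function.update a v (A.onSetD (G.genus v) (G.toFlagGraph.Leg v) (a v)))
  /-- Naturality for isomorphisms of stable graphs, covering bijections of the sets of legs and
  arbitrary changes of the order of the vertices. -/
  comp_iso : ∀ {γ : ℕ} {I J : Type} {G : StableGraph γ I} {G' : StableGraph γ J} {τ : I ≃ J}
    (φ : G.Iso G' τ) (o : LinearOrder G.Vert) (o' : LinearOrder G'.Vert) (p : G.Vert → ℤ)
    (a : ∀ v : G.Vert, A.onSet (G.genus v) (G.toFlagGraph.Leg v))
    (a' : ∀ v : G'.Vert, A.onSet (G'.genus v) (G'.toFlagGraph.Leg v)),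
    (∀ v, a v ∈ A.onSetDeg (G.genus v) (G.toFlagGraph.Leg v) (p v)) →
    (∀ v, a' (φ.vert v) = A.relabel (φ.genus_vert v) (φ.legEquiv v) (a v)) →
      comp G' o' a' = koszulSign o o' φ.vert p • A.relabel rfl τ (comp G o a)
  /-- The unit axiom: composition along a graph with one vertex and no edges is the identity. -/
  comp_unit : ∀ (γ : ℕ) (I : Type) [Finite I] (h : 2 < 2 * γ + Nat.card I) (o : LinearOrder Unit)
    (a : A.onSet γ I),
    comp (StableGraph.corolla γ I h) o
      (fun _ => A.relabel rfl (Equiv.subtypeUnivEquiv (fun _ => rfl)).symm a) = a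
  /-- The associativity axiom: for a morphism `f : G₀ → G₁`, composition along `G₀` is composition
  along all preimages `f⁻¹(w)` followed by composition along `G₁`.  (There is no sign if the orders
  of the vertices are compatible.) -/
  comp_assoc : ∀ {γ : ℕ} {I : Type} {G₀ G₁ : StableGraph γ I} (f : G₀.Hom G₁)
    (o₀ : LinearOrder G₀.Vert) (o₁ : LinearOrder G₁.Vert)
    (_ : ∀ u u', o₀.le u u' → o₁.le (f.vert u) (f.vert u'))
    (a : ∀ v : G₀.Vert, A.onSet (G₀.genus v) (G₀.toFlagGraph.Leg v)),
      comp G₁ o₁ (fun w =>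
        comp (f.fiber w)
          (LinearOrder.lift' (fun u : {u : G₀.Vert // f.vert u = w} => u.1) Subtype.val_injective)
          (fun u : {u : G₀.Vert // f.vert u = w} =>
            A.relabel rfl (f.toPreHom.preimageLegEquiv w u) (a u.1))) =
        comp G₀ o₀ a

/-- The element `a ⊗ b` of `A((G))` for `G` the tree with one edge and two vertices, with
`a ∈ A((g,X))` at the first and `b ∈ A((h,Y))` at the second vertex. -/
def treeDecoration {k : Type u} [Field k] (A : StableSModule.{u, v} k) {X Y I : Type} [Finite X]
    [Finite Y] {g h γ : ℕ} {hγ : g + h = γ} {x : X} {y : Y} {hX : 2 < 2 * g + Nat.card X}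
    {hY : 2 < 2 * h + Nat.card Y} {e : {z : X ⊕ Y // z ≠ Sum.inl x ∧ z ≠ Sum.inr y} ≃ I}
    (a : A.onSet g X) (b : A.onSet h Y) (v : (StableGraph.tree g h γ hγ x y hX hY e).Vert) :
    A.onSet ((StableGraph.tree g h γ hγ x y hX hY e).genus v)
      ((StableGraph.tree g h γ hγ x y hX hY e).toFlagGraph.Leg v) :=
  match v with
  | false => A.relabel (J := (StableGraph.tree g h γ hγ x y hX hY e).toFlagGraph.Leg false) rfl
      (treeFlagsFst X Y) a
  | true => A.relabel (J := (StableGraph.tree g h γ hγ x y hX hY e).toFlagGraph.Leg true) rfl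
      (treeFlagsSnd X Y) b

/-- The modular operad `M` induces the cyclic operad `C` and the contractions `X`: composition along
trees with one edge is given by `C`, and composition along graphs with one vertex and one loop is
given by `X`. -/
structure ModularOperad.Induces {k : Type u} [Field k] {A : StableSModule.{u, v} k}
    (M : ModularOperad A) (C : StableGradedCyclicOperad A) (X : Contractions A) : Prop where
  circ : ∀ {g h γ m n s : ℕ} (hγ : g + h = γ) (hs : m + n = s) (i : ℕ) (hi : 1 ≤ i ∧ i ≤ m)
    (hm : 2 < 2 * g + Nat.card (Fin (m + 1))) (hn : 2 < 2 * h + Nat.card (Fin (n + 1)))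
    (a : A.obj g (m + 1)) (b : A.obj h (n + 1)),
      M.comp (StableGraph.tree g h γ hγ (⟨i, by omega⟩ : Fin (m + 1)) (0 : Fin (n + 1)) hm hn
          (circNumbering hs ⟨i, by omega⟩)) (inferInstance : LinearOrder Bool)
        (treeDecoration A (A.cls (Equiv.refl _) a) (A.cls (Equiv.refl _) b)) =
        A.cls (Equiv.refl (Fin s)) (C.circ hγ hs i hi a b)
  pair : ∀ {g h γ : ℕ} (hγ : g + h = γ)
    (hm : 2 < 2 * g + Nat.card (Fin 1)) (hn : 2 < 2 * h + Nat.card (Fin 1))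
    (a : A.obj g 1) (b : A.obj h 1),
      M.comp (StableGraph.tree g h γ hγ (0 : Fin 1) (0 : Fin 1) hm hn
          (circNumbering (m := 0) (n := 0) rfl 0)) (inferInstance : LinearOrder Bool)
        (treeDecoration A (A.cls (Equiv.refl _) a) (A.cls (Equiv.refl _) b)) =
        A.cls (Equiv.refl (Fin 0)) (C.pair hγ a b)
  xi : ∀ {g : ℕ} {I : Type} [Finite I] (i j : I) (hij : i ≠ j) (h : 2 < 2 * g + Nat.card I)
    (a : A.onSet g I),
      M.comp (StableGraph.loop g i j hij h) (inferInstance : LinearOrder Unit)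
        (fun _ => A.relabel rfl (Equiv.subtypeUnivEquiv (fun _ => rfl)).symm a) =
        X.xi i j hij a

/-! ## The coherence relations -/

section Coherence

variable {k : Type u} [Field k] {A : StableSModule.{u, v} k}

/-- Removing `k, l` and then `i, j` leaves the same set as removing `i, j` and then `k, l`. -/
def removeSwap {I : Type} {i j k l : I} (hik : i ≠ k) (hil : i ≠ l) (hjk : j ≠ k) (hjl : j ≠ l) :
    {x : {x : I // x ≠ k ∧ x ≠ l} // x ≠ ⟨i, hik, hil⟩ ∧ x ≠ ⟨j, hjk, hjl⟩} ≃
      {x : {x : I // x ≠ i ∧ x ≠ j} //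
        x ≠ ⟨k, hik.symm, hjk.symm⟩ ∧ x ≠ ⟨l, hil.symm, hjl.symm⟩} where
  toFun x := ⟨⟨x.1.1, fun h => x.2.1 (Subtype.ext h), fun h => x.2.2 (Subtype.ext h)⟩,
    fun h => x.1.2.1 (congrArg Subtype.val h), fun h => x.1.2.2 (congrArg Subtype.val h)⟩
  invFun x := ⟨⟨x.1.1, fun h => x.2.1 (Subtype.ext h), fun h => x.2.2 (Subtype.ext h)⟩,
    fun h => x.1.2.1 (congrArg Subtype.val h), fun h => x.1.2.2 (congrArg Subtype.val h)⟩
  left_inv _ := rfl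
  right_inv _ := rfl

/-- Contractions commute: `ξ_{ij} ∘ ξ_{kl} = ξ_{kl} ∘ ξ_{ij}` for distinct `i, j, k, l`. -/
def Contractions.Commute (X : Contractions A) : Prop :=
  ∀ (g : ℕ) (I : Type) [Finite I] (i j k l : I) (hij : i ≠ j) (hkl : k ≠ l)
    (hik : i ≠ k) (hil : i ≠ l) (hjk : j ≠ k) (hjl : j ≠ l) (a : A.onSet g I),
    A.relabel rfl (removeSwap hik hil hjk hjl)
      (X.xi (⟨i, hik, hil⟩ : {x : I // x ≠ k ∧ x ≠ l}) ⟨j, hjk, hjl⟩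
        (fun h => hij (congrArg Subtype.val h)) (X.xi k l hkl a)) =
      X.xi (⟨k, hik.symm, hjk.symm⟩ : {x : I // x ≠ i ∧ x ≠ j}) ⟨l, hil.symm, hjl.symm⟩
        (fun h => hkl (congrArg Subtype.val h)) (X.xi i j hij a)

/-- `ξ_{12}(a ∘_m b) = (ξ_{12} a) ∘_m b` for `a ∈ A(m)` with `m ≥ 3` and `b ∈ A(n)`; here `m` is
`m' + 2`, and the label `m` of `a` has the number `m'` in `ξ_{12} a`.  The second part is the
instance without remaining labels: `ξ_{01}(a ∘_2 b) = ⟨ξ_{01} a, b⟩` for `a ∈ A(2)`, `b ∈ A(0)`. -/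
def ContractLeft (C : StableGradedCyclicOperad A) (X : Contractions A) : Prop :=
  (∀ (g h γ m' n r : ℕ) (hγ : g + h = γ) (hγ' : g + 1 + h = γ + 1) (hr : m' + n = r + 1)
    (hr' : m' + 2 + n = r + 1 + 2) (hm : 1 ≤ m')
    (a : A.obj g (m' + 2 + 1)) (b : A.obj h (n + 1)),
      X.xiFin (n := r + 1) ⟨1, by omega⟩ ⟨2, by omega⟩ (by simp)
          (C.circ hγ hr' (m' + 2) (by omega) a b) =
        C.circ hγ' hr m' (by omega)
          (X.xiFin (n := m' + 1) ⟨1, by omega⟩ ⟨2, by omega⟩ (by simp) a) b) ∧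
  (∀ (g h γ : ℕ) (hγ : g + h = γ) (hγ' : g + 1 + h = γ + 1) (a : A.obj g 3) (b : A.obj h 1),
      X.xiFin (n := 0) 0 1 (by simp) (C.circ (m := 2) (n := 0) hγ rfl 2 (by omega) a b) =
        C.pair hγ' (X.xiFin (n := 1) 0 1 (by simp) a) b)

/-- `ξ_{m,m+1}(a ∘_m b) = a ∘_m (ξ_{12} b)` for `a ∈ A(m)` with `m ≥ 1` and `b ∈ A(n)` with
`n ≥ 2`; here `n` is `n' + 2`. -/
def ContractRight (C : StableGradedCyclicOperad A) (X : Contractions A) : Prop :=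
  ∀ (g h γ m n' r : ℕ) (hγ : g + h = γ) (hγ' : g + (h + 1) = γ + 1) (hr : m + n' = r + 1)
    (hr' : m + (n' + 2) = r + 1 + 2) (hm : 1 ≤ m)
    (a : A.obj g (m + 1)) (b : A.obj h (n' + 2 + 1)),
      X.xiFin (n := r + 1) ⟨m, by omega⟩ ⟨m + 1, by omega⟩ (by simp)
          (C.circ hγ hr' m (by omega) a b) =
        C.circ hγ' hr m (by omega) a
          (X.xiFin (n := n' + 1) ⟨1, by omega⟩ ⟨2, by omega⟩ (by simp) b)

/-- `ξ_{m-1,m}(a ∘_m b) = ξ_{m+n-2,m+n-1}(a ∘_{m-1} τ⁻¹b)` for `a ∈ A(m)` with `m ≥ 2` and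
`b ∈ A(n)` with `n ≥ 1`, where `τ = (0 1 … n)`; here `m` is `m' + 2` and `n` is `n' + 1`.  The
second part is the instance without remaining labels: `ξ_{01}(a ∘_1 b) = ξ_{01}(a^* ∘_1 b^*)` for
`a, b ∈ A(1)`. -/
def ContractBoth (C : StableGradedCyclicOperad A) (X : Contractions A) : Prop :=
  (∀ (g h γ m' n' : ℕ) (hγ : g + h = γ) (hs : m' + 2 + (n' + 1) = m' + n' + 1 + 2)
    (a : A.obj g (m' + 2 + 1)) (b : A.obj h (n' + 1 + 1)),
      X.xiFin (n := m' + n' + 1) ⟨m' + 1, by omega⟩ ⟨m' + 2, by omega⟩ (by simp)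
          (C.circ hγ hs (m' + 2) (by omega) a b) =
        X.xiFin (n := m' + n' + 1) ⟨m' + n' + 1, by omega⟩ ⟨m' + n' + 2, by omega⟩ (by simp)
          (C.circ hγ hs (m' + 1) (by omega) a (A.unstar b))) ∧
  (∀ (g h γ : ℕ) (hγ : g + h = γ) (a : A.obj g 2) (b : A.obj h 2),
      X.xiFin (n := 0) 0 1 (by simp) (C.circ (m := 1) (n := 1) hγ rfl 1 (by omega) a b) =
        X.xiFin (n := 0) 0 1 (by simp)
          (C.circ (m := 1) (n := 1) hγ rfl 1 (by omega) (A.star (n := 1) a)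
            (A.star (n := 1) b)))

end Coherence

end

noncomputable section

/-! ### Signs and internally graded vector spaces -/

section Signs

variable {R : Type*} [Semiring R] {M N : Type*} [AddCommGroup M] [AddCommGroup N] [Module R M]
  [Module R N]

/-! Composing along a graph one edge at a time needs only two moves: gluing two parts along an edge
that joins them, and contracting an edge that has both ends at the same part. The predicate `IsVal`
records the results of all such stepwise compositions, for a set `c` of vertices, a set `s` of
remaining flags and a genus. The theorem comes down to the independence of these results from the
order of the edges.

To avoid numberings, all labels live in an ambient set of flags. The operad axioms imply that `a ∘_i
b` depends only on the classes of `a` and `b` and on the two labels that are glued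
(`ofEnum_circ_eq`). So there is a gluing `glue` of any `x ∈ s₁` to any `y ∈ s₂`, made of the `∘_i`
and, when both factors have a single label, of the pairing. It is symmetric up to the Koszul sign
(`glue_symm`) and associative (`glue_assoc`). By equivariance, the relations given for particular
numbers are equivalent to relations for arbitrary labels: two contractions commute (`loop_loop`), a
contraction at one factor passes through a gluing (`loop_glue`), and of two edges joining the same
two vertices either one may be the glued one (`loop_glue_cross`).

Sufficiency. Two successive steps can be exchanged by one of `glue_assoc`, `loop_glue`,
`loop_glue_cross` and `loop_loop`, so every edge already used can be made the last one
(`IsVal.lastStep`). Given a part and one of its contracted edges, connectedness without that edge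
decides whether the last step along it is a gluing or a contraction, and what its factors are.
Induction then gives uniqueness of values (`IsVal.unique`). Values exist for connected graphs
(`exists_isVal_univ`) and are linear in each decoration, hence they define compositions. The sign
`crossSign` in each gluing step sorts the two blocks of vertices; it makes the steps symmetric and
produces the Koszul signs of the axioms. The Leibniz rule and naturality hold step by step. For
associativity, putting the stepwise compositions of the fibres of a morphism in place of the
vertices of its target gives a stepwise composition of its source (`IsVal.of_hom`).

Necessity and uniqueness. In a modular operad inducing the given operations, every stepwise value is
the composition along the part of the graph that it describes (`IsVal.comp_eq`): contracting all
edges but the last one is a morphism to a graph with one edge, to which the associativity axiom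
applies. As every stable graph has a value, the modular operad is determined. As two stepwise
compositions along the same graph have the same value, graphs with two edges yield all the
relations. -/

theorem LinearMap.map_intUnits_smul (f : M →ₗ[R] N) (ε : ℤˣ) (x : M) : f (ε • x) = ε • f x := by
  rcases Int.units_eq_one_or ε with rfl | rfl <;> simp [Units.smul_def]

theorem Submodule.intUnits_smul_mem {R M : Type*} [Ring R] [AddCommGroup M] [Module R M]
    (S : Submodule R M) (ε : ℤˣ) {x : M} (hx : x ∈ S) : ε • x ∈ S := by
  rcases Int.units_eq_one_or ε with rfl | rfl
  · simpa using hx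
  · simpa [Units.smul_def] using hx

theorem intUnits_smul_smul_self (ε : ℤˣ) (x : M) : ε • ε • x = x := by
  rw [smul_smul, Int.units_mul_self, one_smul]

end Signs

/-- A linear map that is prescribed on the homogeneous parts of an internal grading. -/
theorem DirectSum.IsInternal.exists_linearMap {k M N : Type*} [Field k] [AddCommGroup M]
    [Module k M] [AddCommGroup N] [Module k N] {D : ℤ → Submodule k M}
    (hD : DirectSum.IsInternal D) (L : ℤ → M →ₗ[k] N) :
    ∃ f : M →ₗ[k] N, ∀ p, ∀ x ∈ D p, f x = L p x := by
  classical
  have hb : Function.Bijective (DirectSum.coeLinearMap D) := hD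
  let e := LinearEquiv.ofBijective (DirectSum.coeLinearMap D) hb
  refine ⟨DirectSum.toModule k ℤ N (fun p => L p ∘ₗ (D p).subtype) ∘ₗ e.symm.toLinearMap,
    fun p x hx => ?_⟩
  have : e.symm x = DirectSum.lof k ℤ (fun p => D p) p ⟨x, hx⟩ := by
    rw [LinearEquiv.symm_apply_eq]
    exact (DirectSum.coeLinearMap_lof D p ⟨x, hx⟩).symm
  simp [this]

/-- Bilinear maps with a Koszul sign for the exchange of the arguments. -/
theorem exists_bilinear_swap {k M M' N : Type*} [Field k] [AddCommGroup M] [Module k M]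
    [AddCommGroup M'] [Module k M'] [AddCommGroup N] [Module k N] {D : ℤ → Submodule k M}
    {D' : ℤ → Submodule k M'} (hD : DirectSum.IsInternal D) (hD' : DirectSum.IsInternal D')
    (B : M' →ₗ[k] M →ₗ[k] N) :
    ∃ B' : M →ₗ[k] M' →ₗ[k] N, ∀ p q, ∀ x ∈ D p, ∀ y ∈ D' q,
      B' x y = (p * q).negOnePow • B y x := by
  -- The sign is built one variable at a time: for a fixed degree `q` of the second argument, `σ q`
  -- multiplies the part of degree `p` by `(-1)^{pq}`; the resulting maps are then assembled over
  -- `q`.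
  have h1 : ∀ q : ℤ, ∃ σ : M →ₗ[k] M, ∀ p, ∀ x ∈ D p, σ x = (p * q).negOnePow • x := by
    intro q
    obtain ⟨f, hf⟩ := hD.exists_linearMap
      (fun p => ((((p * q).negOnePow : ℤˣ) : ℤ) : k) • (LinearMap.id : M →ₗ[k] M))
    refine ⟨f, fun p x hx => ?_⟩
    rw [hf p x hx]
    rw [LinearMap.smul_apply, LinearMap.id_apply, Int.cast_smul_eq_zsmul, Units.smul_def]
  choose σ hσ using h1
  obtain ⟨f, hf⟩ := hD'.exists_linearMap (fun q => B.compl₂ (σ q))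
  refine ⟨f.flip, fun p q x hx y hy => ?_⟩
  rw [LinearMap.flip_apply, hf q y hy, LinearMap.compl₂_apply, hσ q p x hx,
    LinearMap.map_intUnits_smul]

theorem DirectSum.IsInternal.induction_on {k M : Type*} [Field k] [AddCommGroup M] [Module k M]
    {D : ℤ → Submodule k M} (hD : DirectSum.IsInternal D) {P : M → Prop}
    (hom : ∀ p, ∀ x ∈ D p, P x) (add : ∀ x y, P x → P y → P (x + y)) (x : M) : P x := by
  have hx : x ∈ ⨆ p, D p := by rw [hD.submodule_iSup_eq_top]; trivial
  exact Submodule.iSup_induction D (motive := P) hx hom (hom 0 0 (zero_mem _)) add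

namespace StableSModule

variable {k : Type u} [Field k] (A : StableSModule.{u, v} k)

/-! ### Relabelling -/

@[simp]
theorem relabel_refl {g : ℕ} {I : Type} (x : A.onSet g I) :
    A.relabel rfl (Equiv.refl I) x = x := by
  refine A.onSet_induction ?_ ?_ ?_ x
  · exact map_zero _
  · intro n f x
    rw [relabel_cls]
    rfl
  · intro x y hx hy
    rw [map_add, hx, hy]

theorem relabel_relabel {g g' g'' : ℕ} (hg : g = g') (hg' : g' = g'') {I J K : Type} (τ : I ≃ J)
    (σ : J ≃ K) (x : A.onSet g I) :
    A.relabel hg' σ (A.relabel hg τ x) = A.relabel (hg.trans hg') (τ.trans σ) x := by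
  subst hg hg'
  refine A.onSet_induction (P := fun x => A.relabel rfl σ (A.relabel rfl τ x) = A.relabel _ _ x)
    ?_ ?_ ?_ x
  · simp
  · intro n f x
    simp only [relabel_cls]
    rfl
  · intro x y hx hy
    simp only [map_add, hx, hy]

theorem relabel_injective {g g' : ℕ} (hg : g = g') {I J : Type} (τ : I ≃ J) :
    Function.Injective (A.relabel hg τ) := by
  subst hg
  intro x y h
  have := congrArg (A.relabel rfl τ.symm) h
  simpa [relabel_relabel] using this

theorem relabel_mem {g g' : ℕ} (hg : g = g') {I J : Type} (τ : I ≃ J) {p : ℤ} {x : A.onSet g I}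
    (hx : x ∈ A.onSetDeg g I p) : A.relabel hg τ x ∈ A.onSetDeg g' J p := by
  subst hg
  have : A.onSetDeg g I p ≤ (A.onSetDeg g J p).comap (A.relabel rfl τ) := by
    refine iSup_le fun f => ?_
    rintro _ ⟨y, hy, rfl⟩
    rw [Submodule.mem_comap, relabel_cls]
    exact Submodule.mem_iSup_of_mem (⟨f.1, f.2.trans τ⟩ : Σ n : ℕ, Fin n ≃ J) ⟨y, hy, rfl⟩
  exact this hx

theorem onSetD_cls {g n : ℕ} {I : Type} (f : Fin n ≃ I) (x : A.obj g n) :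
    A.onSetD g I (A.cls f x) = A.cls f (A.d g n x) := by
  simp [onSetD]

theorem onSetD_relabel {g g' : ℕ} (hg : g = g') {I J : Type} (τ : I ≃ J) (x : A.onSet g I) :
    A.onSetD g' J (A.relabel hg τ x) = A.relabel hg τ (A.onSetD g I x) := by
  subst hg
  refine A.onSet_induction
    (P := fun x => A.onSetD g J (A.relabel rfl τ x) = A.relabel rfl τ (A.onSetD g I x)) ?_ ?_ ?_ x
  · simp
  · intro n f x
    simp only [relabel_cls, onSetD_cls]
  · intro x y hx hy
    simp only [map_add, hx, hy]

theorem exists_cls_eq {g n : ℕ} {I : Type} (f : Fin n ≃ I) (x : A.onSet g I) :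
    ∃ y, A.cls f y = x :=
  (A.numbering g f).surjective x

theorem cls_injective {g n : ℕ} {I : Type} (f : Fin n ≃ I) :
    Function.Injective (A.cls (g := g) f) :=
  (A.numbering g f).injective

theorem cls_perm {g n : ℕ} {I : Type} (f : Fin n ≃ I) (σ : Equiv.Perm (Fin n)) (x : A.obj g n) :
    A.cls f (A.act g n σ x) = A.cls (σ.trans f) x := by
  rw [← A.cls_act (σ.trans f) σ x]
  congr 1
  congr 1
  ext i
  simp

/-- Two numberings differ by a permutation, and permutations preserve degrees, so one term of the
supremum is already all of it. -/
theorem onSetDeg_eq_map {g n : ℕ} {I : Type} (f : Fin n ≃ I) (p : ℤ) :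
    A.onSetDeg g I p = (A.deg g n p).map (A.cls f) := by
  refine le_antisymm (iSup_le ?_)
    (le_iSup (fun f : Σ n : ℕ, Fin n ≃ I => (A.deg g f.1 p).map (A.cls f.2)) ⟨n, f⟩)
  rintro ⟨n', f'⟩
  have h : n' = n := by simpa using Fintype.card_congr (f'.trans f.symm)
  subst h
  rintro _ ⟨y, hy, rfl⟩
  refine ⟨A.act g n' (f'.trans f.symm) y, A.act_mem _ _ _ _ _ hy, ?_⟩
  rw [cls_perm]
  congr 1
  congr 1
  ext i
  simp

theorem cls_mem_iff {g n : ℕ} {I : Type} (f : Fin n ≃ I) {p : ℤ} {x : A.obj g n} :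
    A.cls f x ∈ A.onSetDeg g I p ↔ x ∈ A.deg g n p := by
  rw [A.onSetDeg_eq_map f]
  constructor
  · rintro ⟨y, hy, h⟩
    rwa [← A.cls_injective f h]
  · exact fun h => ⟨x, h, rfl⟩

/-- Transported along one numbering. This allows linear statements about `A((g,I))` to be tested on
homogeneous elements, where Koszul signs make sense. -/
theorem isInternal_onSetDeg (g : ℕ) (I : Type) [Finite I] :
    DirectSum.IsInternal (A.onSetDeg g I) := by
  classical
  obtain ⟨n, ⟨f⟩⟩ := Finite.exists_equiv_fin I
  have hf := f.symm
  have h1 := A.isInternal g n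
  rw [DirectSum.isInternal_submodule_iff_iSupIndep_and_iSup_eq_top] at h1 ⊢
  have e : A.onSetDeg g I = fun p => (A.deg g n p).map (A.numbering g f.symm).toLinearMap := by
    funext p
    rw [A.onSetDeg_eq_map f.symm]
    rfl
  rw [e]
  refine ⟨?_, ?_⟩
  · exact h1.1.map_orderIso (Submodule.orderIsoMapComap (A.numbering g f.symm))
  · rw [← Submodule.map_iSup, h1.2, Submodule.map_top]
    exact LinearMap.range_eq_top.2 (A.numbering g f.symm).surjective

theorem onSetD_mem {g : ℕ} {I : Type} {p : ℤ} {x : A.onSet g I} (hx : x ∈ A.onSetDeg g I p) :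
    A.onSetD g I x ∈ A.onSetDeg g I (p - 1) := by
  have : A.onSetDeg g I p ≤ (A.onSetDeg g I (p - 1)).comap (A.onSetD g I) := by
    refine iSup_le fun f => ?_
    rintro _ ⟨y, hy, rfl⟩
    rw [Submodule.mem_comap, onSetD_cls]
    exact Submodule.mem_iSup_of_mem f ⟨_, A.d_mem _ _ _ _ hy, rfl⟩
  exact this hx

/-- Disposes of the unstable components, to which no vertex of a stable graph corresponds: linear
identities are trivial there. -/
theorem onSet_subsingleton (g : ℕ) (I : Type) [Finite I] (h : 2 * g + Nat.card I ≤ 2) :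
    Subsingleton (A.onSet g I) := by
  obtain ⟨n, ⟨f⟩⟩ := Finite.exists_equiv_fin I
  have hn : Nat.card I = n := by rw [Nat.card_congr f, Nat.card_fin]
  have := A.stable g n (hn ▸ h)
  exact (A.numbering g f.symm).toEquiv.symm.subsingleton

/-! ### Subsets of an ambient set of flags -/

section Sets

variable {F F' F'' : Type}

/-- The map `A((g,s)) → A((g,t))` induced by a map of ambient sets that restricts to a bijection
`s → t`. -/
def push {g g' : ℕ} (hg : g = g') (f : F → F') {s : Set F} {t : Set F'} (h : Set.BijOn f s t) :
    A.onSet g s →ₗ[k] A.onSet g' t :=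
  A.relabel hg (h.equiv f)

theorem push_id {g : ℕ} {s : Set F} {f : F → F} (h : Set.BijOn f s s) (e : ∀ x ∈ s, f x = x)
    (x : A.onSet g s) : A.push rfl f h x = x := by
  have : h.equiv f = Equiv.refl s := by
    ext z
    exact e z z.2
  rw [push, this, relabel_refl]

theorem push_mem {g g' : ℕ} (hg : g = g') {f : F → F'} {s : Set F} {t : Set F'}
    (h : Set.BijOn f s t) {p : ℤ} {x : A.onSet g s} (hx : x ∈ A.onSetDeg g s p) :
    A.push hg f h x ∈ A.onSetDeg g' t p :=
  A.relabel_mem _ _ hx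

theorem onSetD_push {g g' : ℕ} (hg : g = g') {f : F → F'} {s : Set F} {t : Set F'}
    (h : Set.BijOn f s t) (x : A.onSet g s) :
    A.onSetD g' t (A.push hg f h x) = A.push hg f h (A.onSetD g s x) :=
  A.onSetD_relabel _ _ x

/-- The class in `A((g,s))` of an element of `A((g,n))`, for an enumeration `φ` of `s`. -/
def ofEnum {g n : ℕ} (φ : Fin n → F) {s : Set F} (h : Set.BijOn φ Set.univ s) :
    A.obj g n →ₗ[k] A.onSet g s :=
  A.cls ((Equiv.Set.univ (Fin n)).symm.trans (h.equiv φ))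

theorem ofEnum_congr {g n : ℕ} {φ φ' : Fin n → F} {s : Set F} (h : Set.BijOn φ Set.univ s)
    (h' : Set.BijOn φ' Set.univ s) (e : ∀ i, φ i = φ' i) (x : A.obj g n) :
    A.ofEnum φ h x = A.ofEnum φ' h' x := by
  obtain rfl : φ = φ' := funext e
  rfl

theorem push_ofEnum {g n : ℕ} {φ : Fin n → F} {s : Set F} (h : Set.BijOn φ Set.univ s) {f : F → F'}
    {t : Set F'} (h' : Set.BijOn f s t) (x : A.obj g n) :
    A.push rfl f h' (A.ofEnum φ h x) = A.ofEnum (f ∘ φ) (h'.comp h) x := by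
  simp only [push, ofEnum, relabel_cls]
  congr 2
  ext z
  rfl

theorem ofEnum_act {g n : ℕ} {φ : Fin n → F} {s : Set F} (h : Set.BijOn φ Set.univ s)
    (σ : Equiv.Perm (Fin n)) (x : A.obj g n) :
    A.ofEnum φ h (A.act g n σ x) = A.ofEnum (φ ∘ σ) (h.comp (σ.bijective.bijOn_univ)) x := by
  simp only [ofEnum, cls_perm]
  congr 2
  ext z
  rfl

theorem exists_ofEnum_eq {g n : ℕ} {φ : Fin n → F} {s : Set F} (h : Set.BijOn φ Set.univ s)
    (x : A.onSet g s) : ∃ y, A.ofEnum φ h y = x :=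
  A.exists_cls_eq _ x

theorem ofEnum_injective {g n : ℕ} {φ : Fin n → F} {s : Set F} (h : Set.BijOn φ Set.univ s) :
    Function.Injective (A.ofEnum (g := g) φ h) :=
  A.cls_injective _

theorem ofEnum_mem_iff {g n : ℕ} {φ : Fin n → F} {s : Set F} (h : Set.BijOn φ Set.univ s) {p : ℤ}
    {x : A.obj g n} : A.ofEnum φ h x ∈ A.onSetDeg g s p ↔ x ∈ A.deg g n p :=
  A.cls_mem_iff _

theorem onSetD_ofEnum {g n : ℕ} {φ : Fin n → F} {s : Set F} (h : Set.BijOn φ Set.univ s)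
    (x : A.obj g n) : A.onSetD g s (A.ofEnum φ h x) = A.ofEnum φ h (A.d g n x) :=
  A.onSetD_cls _ x

end Sets

end StableSModule

/-! ### Enumerations -/

section Enumerations

variable {F : Type}

theorem exists_enum [Finite F] (s : Set F) {n : ℕ} (hn : s.ncard = n) :
    ∃ φ : Fin n → F, Set.BijOn φ Set.univ s := by
  have e : s ≃ Fin n := Finite.equivFinOfCardEq (by rwa [Nat.card_coe_set_eq])
  refine ⟨fun i => (e.symm i).1, fun i _ => (e.symm i).2, fun i _ j _ h => ?_, fun x hx => ?_⟩
  · exact e.symm.injective (Subtype.ext h)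
  · exact ⟨e ⟨x, hx⟩, trivial, by simp⟩

theorem Set.BijOn.ncard_enum {n : ℕ} {φ : Fin n → F} {s : Set F} (h : Set.BijOn φ Set.univ s) :
    s.ncard = n := by
  rw [← h.image_eq, h.injOn.ncard_image, Set.ncard_univ, Nat.card_fin]

theorem Set.BijOn.apply_eq_iff {n : ℕ} {φ : Fin n → F} {s : Set F} (h : Set.BijOn φ Set.univ s)
    (i j : Fin n) : φ i = φ j ↔ i = j :=
  ⟨fun e => h.injOn trivial trivial e, fun e => e ▸ rfl⟩

/-- An enumeration can be changed so as to take a prescribed value at a given place, without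
changing other values but the one exchanged. -/
theorem Set.BijOn.exists_enum_apply_eq {n : ℕ} {φ : Fin n → F} {s : Set F}
    (h : Set.BijOn φ Set.univ s) (i : Fin n) {x : F} (hx : x ∈ s) :
    ∃ φ' : Fin n → F, Set.BijOn φ' Set.univ s ∧ φ' i = x ∧
      ∀ j, j ≠ i → φ j ≠ x → φ' j = φ j := by
  obtain ⟨l, -, rfl⟩ := h.surjOn hx
  refine ⟨φ ∘ Equiv.swap i l, h.comp (Equiv.swap i l).bijective.bijOn_univ, by simp, ?_⟩
  intro j hj hjl
  rw [Function.comp_apply, Equiv.swap_apply_of_ne_of_ne hj (fun e => hjl (e ▸ rfl))]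

theorem exists_enum₁ [Finite F] {s : Set F} {n : ℕ} (hn : s.ncard = n) (i : Fin n) {x : F}
    (hx : x ∈ s) : ∃ φ : Fin n → F, Set.BijOn φ Set.univ s ∧ φ i = x := by
  obtain ⟨φ, h⟩ := exists_enum s hn
  obtain ⟨φ, h, h1, -⟩ := h.exists_enum_apply_eq i hx
  exact ⟨φ, h, h1⟩

theorem exists_enum₂ [Finite F] {s : Set F} {n : ℕ} (hn : s.ncard = n) {i j : Fin n} (hij : i ≠ j)
    {x y : F} (hx : x ∈ s) (hy : y ∈ s) (hxy : x ≠ y) :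
    ∃ φ : Fin n → F, Set.BijOn φ Set.univ s ∧ φ i = x ∧ φ j = y := by
  obtain ⟨φ, h, h1⟩ := exists_enum₁ hn i hx
  obtain ⟨φ', h', h2, h3⟩ := h.exists_enum_apply_eq j hy
  exact ⟨φ', h', by rw [h3 i hij (h1 ▸ hxy), h1], h2⟩

theorem exists_enum₃ [Finite F] {s : Set F} {n : ℕ} (hn : s.ncard = n) {i j l : Fin n}
    (hij : i ≠ j) (hil : i ≠ l) (hjl : j ≠ l) {x y z : F} (hx : x ∈ s) (hy : y ∈ s) (hz : z ∈ s)
    (hxy : x ≠ y) (hxz : x ≠ z) (hyz : y ≠ z) :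
    ∃ φ : Fin n → F, Set.BijOn φ Set.univ s ∧ φ i = x ∧ φ j = y ∧ φ l = z := by
  obtain ⟨φ, h, h1, h2⟩ := exists_enum₂ hn hij hx hy hxy
  obtain ⟨φ', h', h3, h4⟩ := h.exists_enum_apply_eq l hz
  exact ⟨φ', h', by rw [h4 i hil (h1 ▸ hxz), h1], by rw [h4 j hjl (h2 ▸ hyz), h2], h3⟩

end Enumerations

theorem coe_finRotate_succ {n : ℕ} (x : Fin (n + 1)) :
    ((finRotate (n + 1) x : Fin (n + 1)) : ℕ) = if (x : ℕ) = n then 0 else (x : ℕ) + 1 := by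
  rw [finRotate_apply]
  split_ifs with h
  · have : x = Fin.last n := Fin.ext h
    simp [this]
  · exact Fin.val_add_one_of_lt (Fin.lt_last_iff_ne_last.2 (fun e => h (by simp [e])))

/-! ### Enumerating the labels of a composite -/

section Cat

variable {F : Type}

/-- The enumeration of the labels of `a ∘_i b` for enumerations of the labels of `a` and of `b`. -/
def cat {m n s : ℕ} (hs : m + n = s) (i : ℕ) (hi : i ≤ m) (φ : Fin (m + 1) → F)
    (ψ : Fin (n + 1) → F) (x : Fin s) : F :=
  if h1 : (x : ℕ) < i then φ ⟨x, by omega⟩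
  else if h2 : (x : ℕ) < i + n then ψ ⟨x - i + 1, by omega⟩
  else φ ⟨x - n + 1, by omega⟩

theorem cat_of_lt {m n s : ℕ} (hs : m + n = s) (i : ℕ) (hi : i ≤ m) (φ : Fin (m + 1) → F)
    (ψ : Fin (n + 1) → F) (x : Fin s) (h1 : (x : ℕ) < i) (z : Fin (m + 1))
    (hz : (z : ℕ) = x) : cat hs i hi φ ψ x = φ z := by
  rw [cat, dif_pos h1]
  exact congrArg φ (Fin.ext hz.symm)

/-- The label `0` of the second factor is glued and takes no place, so that its label `z ≥ 1` comes
at place `i + z - 1`. -/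
theorem cat_of_mid {m n s : ℕ} (hs : m + n = s) (i : ℕ) (hi : i ≤ m) (φ : Fin (m + 1) → F)
    (ψ : Fin (n + 1) → F) (x : Fin s) (h1 : i ≤ (x : ℕ)) (h2 : (x : ℕ) < i + n) (z : Fin (n + 1))
    (hz : (z : ℕ) + i = x + 1) : cat hs i hi φ ψ x = ψ z := by
  rw [cat, dif_neg (by omega), dif_pos h2]
  exact congrArg ψ (Fin.ext (by simp; omega))

theorem cat_of_ge {m n s : ℕ} (hs : m + n = s) (i : ℕ) (hi : i ≤ m) (φ : Fin (m + 1) → F)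
    (ψ : Fin (n + 1) → F) (x : Fin s) (h1 : i + n ≤ (x : ℕ)) (z : Fin (m + 1))
    (hz : (z : ℕ) + n = x + 1) : cat hs i hi φ ψ x = φ z := by
  rw [cat, dif_neg (by omega), dif_neg (by omega)]
  exact congrArg φ (Fin.ext (by simp; omega))

/-- Identifies the explicit case distinction with the numbering used in the equivariance axiom;
bijectivity of `circNumbering` then does the work in `bijOn_cat`. -/
theorem cat_eq_elim {m n s : ℕ} (hs : m + n = s) (i : ℕ) (hi : i ≤ m) (φ : Fin (m + 1) → F)
    (ψ : Fin (n + 1) → F) (x : Fin s) :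
    cat hs i hi φ ψ x =
      Sum.elim φ ψ ((circNumbering hs (⟨i, by omega⟩ : Fin (m + 1))).symm x).1 := by
  unfold cat
  simp only [circNumbering, Equiv.coe_fn_symm_mk]
  split_ifs <;> rfl

theorem cat_circNumbering {m n s : ℕ} (hs : m + n = s) (i : ℕ) (hi : i ≤ m)
    (φ : Fin (m + 1) → F) (ψ : Fin (n + 1) → F)
    (z : {z : Fin (m + 1) ⊕ Fin (n + 1) // z ≠ Sum.inl ⟨i, by omega⟩ ∧ z ≠ Sum.inr 0}) :
    cat hs i hi φ ψ (circNumbering hs ⟨i, by omega⟩ z) = Sum.elim φ ψ z.1 := by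
  rw [cat_eq_elim, Equiv.symm_apply_apply]

/-- The set `s` arises from the disjoint sets `s₁` and `s₂` by removing `x ∈ s₁` and `y ∈ s₂`. -/
structure GlueData (s₁ s₂ s : Set F) (x y : F) : Prop where
  left : x ∈ s₁
  right : y ∈ s₂
  disj : Disjoint s₁ s₂
  eq : s = (s₁ \ {x}) ∪ (s₂ \ {y})

theorem GlueData.symm {s₁ s₂ s : Set F} {x y : F} (H : GlueData s₁ s₂ s x y) :
    GlueData s₂ s₁ s y x :=
  ⟨H.right, H.left, H.disj.symm, by rw [H.eq, Set.union_comm]⟩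

theorem GlueData.mem_iff {s₁ s₂ s : Set F} {x y : F} (H : GlueData s₁ s₂ s x y) (z : F) :
    z ∈ s ↔ (z ∈ s₁ ∧ z ≠ x) ∨ (z ∈ s₂ ∧ z ≠ y) := by
  rw [H.eq]; rfl

theorem GlueData.ne_of_mem {s₁ s₂ s : Set F} {x y : F} (H : GlueData s₁ s₂ s x y) {z w : F}
    (hz : z ∈ s₁) (hw : w ∈ s₂) : z ≠ w :=
  fun e => Set.disjoint_left.1 H.disj hz (e ▸ hw)

theorem bijOn_cat {m n s : ℕ} (hs : m + n = s) (i : ℕ) (hi : i ≤ m) {φ : Fin (m + 1) → F}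
    {ψ : Fin (n + 1) → F} {s₁ s₂ t : Set F} {x y : F} (H : GlueData s₁ s₂ t x y)
    (hφ : Set.BijOn φ Set.univ s₁) (hψ : Set.BijOn ψ Set.univ s₂)
    (hx : φ ⟨i, by omega⟩ = x) (hy : ψ 0 = y) : Set.BijOn (cat hs i hi φ ψ) Set.univ t := by
  have key : ∀ z : {z : Fin (m + 1) ⊕ Fin (n + 1) // z ≠ Sum.inl ⟨i, by omega⟩ ∧ z ≠ Sum.inr 0},
      Sum.elim φ ψ z.1 ∈ t := by
    rintro ⟨z | z, h1, h2⟩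
    · exact (H.mem_iff _).2 (Or.inl ⟨hφ.mapsTo trivial, fun e => h1 (by
        rw [(hφ.apply_eq_iff _ _).1 (e.trans hx.symm)])⟩)
    · exact (H.mem_iff _).2 (Or.inr ⟨hψ.mapsTo trivial, fun e => h2 (by
        rw [(hψ.apply_eq_iff _ _).1 (e.trans hy.symm)])⟩)
  refine ⟨fun j _ => ?_, fun j _ j' _ e => ?_, fun z hz => ?_⟩
  · rw [cat_eq_elim]
    exact key _
  · rw [cat_eq_elim, cat_eq_elim] at e
    refine (circNumbering hs (⟨i, by omega⟩ : Fin (m + 1))).symm.injective (Subtype.ext ?_)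
    generalize ((circNumbering hs (⟨i, by omega⟩ : Fin (m + 1))).symm j).1 = w at e
    generalize ((circNumbering hs (⟨i, by omega⟩ : Fin (m + 1))).symm j').1 = w' at e
    rcases w with w | w <;> rcases w' with w' | w'
    · exact congrArg _ ((hφ.apply_eq_iff _ _).1 e)
    · exact absurd e (H.ne_of_mem (hφ.mapsTo trivial) (hψ.mapsTo trivial))
    · exact absurd e.symm (H.ne_of_mem (hφ.mapsTo trivial) (hψ.mapsTo trivial))
    · exact congrArg _ ((hψ.apply_eq_iff _ _).1 e)
  · rcases (H.mem_iff z).1 hz with ⟨h1, h2⟩ | ⟨h1, h2⟩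
    · obtain ⟨j, -, rfl⟩ := hφ.surjOn h1
      refine ⟨circNumbering hs ⟨i, by omega⟩ ⟨Sum.inl j, ?_, by simp⟩, trivial, ?_⟩
      · rintro e
        exact h2 (by rw [Sum.inl_injective e, hx])
      · rw [cat_circNumbering]; rfl
    · obtain ⟨j, -, rfl⟩ := hψ.surjOn h1
      refine ⟨circNumbering hs ⟨i, by omega⟩ ⟨Sum.inr j, by simp, ?_⟩, trivial, ?_⟩
      · rintro e
        exact h2 (by rw [Sum.inr_injective e, hy])
      · rw [cat_circNumbering]; rfl

theorem exists_perm_comp_eq {n : ℕ} {φ φ' : Fin n → F} {s : Set F} (h : Set.BijOn φ Set.univ s)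
    (h' : Set.BijOn φ' Set.univ s) : ∃ π : Equiv.Perm (Fin n), ∀ j, φ' (π j) = φ j := by
  have h1 : ∀ j, ∃ l, φ' l = φ j := fun j => by
    obtain ⟨l, -, hl⟩ := h'.surjOn (h.mapsTo (Set.mem_univ j))
    exact ⟨l, hl⟩
  choose π hπ using h1
  refine ⟨Equiv.ofBijective π (Finite.injective_iff_bijective.1 fun i j e => ?_), hπ⟩
  exact h.injOn trivial trivial ((hπ i).symm.trans ((congrArg φ' e).trans (hπ j)))

end Cat

/-! ### Full equivariance of the operations of a cyclic operad -/

namespace StableGradedCyclicOperad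

variable {k : Type u} [Field k] {A : StableSModule.{u, v} k} (C : StableGradedCyclicOperad A)

section Circ

variable {F : Type} {g h γ m n s : ℕ} (hγ : g + h = γ) (hs : m + n = s)

/-- Equivariance of the operations of an operad under permutations fixing the output, in terms of
enumerations. -/
theorem ofEnum_circ_of_fix {s₁ s₂ t : Set F} {x y : F} (H : GlueData s₁ s₂ t x y) {i i' : ℕ}
    (hi : 1 ≤ i ∧ i ≤ m) (hi' : 1 ≤ i' ∧ i' ≤ m) {φ : Fin (m + 1) → F} {ψ : Fin (n + 1) → F}
    (hφ : Set.BijOn φ Set.univ s₁) (hψ : Set.BijOn ψ Set.univ s₂)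
    (π : Equiv.Perm (Fin (m + 1))) (ρ : Equiv.Perm (Fin (n + 1))) (hπ : π 0 = 0) (hρ : ρ 0 = 0)
    (hπi : π ⟨i, by omega⟩ = ⟨i', by omega⟩) (hx : φ ⟨i', by omega⟩ = x) (hy : ψ 0 = y)
    (hx' : (φ ∘ π) ⟨i, by omega⟩ = x) (hy' : (ψ ∘ ρ) 0 = y)
    (a : A.obj g (m + 1)) (b : A.obj h (n + 1)) :
    A.ofEnum (cat hs i' hi'.2 φ ψ) (bijOn_cat hs i' hi'.2 H hφ hψ hx hy)
        (C.circ hγ hs i' hi' (A.act g (m + 1) π a) (A.act h (n + 1) ρ b)) =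
      A.ofEnum (cat hs i hi.2 (φ ∘ π) (ψ ∘ ρ))
        (bijOn_cat hs i hi.2 H (hφ.comp π.bijective.bijOn_univ) (hψ.comp ρ.bijective.bijOn_univ)
          hx' hy')
        (C.circ hγ hs i hi a b) := by
  rw [C.circ_equivariant hγ hs i i' hi hi' π ρ hπ hρ hπi, A.ofEnum_act]
  refine A.ofEnum_congr _ _ (fun j => ?_) _
  obtain ⟨z, rfl⟩ := (circNumbering hs (⟨i, by omega⟩ : Fin (m + 1))).surjective j
  rw [cat_circNumbering]
  simp only [Function.comp_apply, circPerm, Equiv.trans_apply, Equiv.symm_apply_apply]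
  rw [cat_circNumbering]
  rcases z with ⟨z | z, hz⟩ <;> rfl

/-- Rotating the first factor moves the glued label from `i` to `i + 1` and rotates the composite.
Among the axioms for `∘_i` this is the one that changes the output of the first factor while keeping
the roles of the two factors. -/
theorem ofEnum_circ_of_star {s₁ s₂ t : Set F} {x y : F} (H : GlueData s₁ s₂ t x y) {i : ℕ}
    (hi : 1 ≤ i) (him : i < m) {φ : Fin (m + 1) → F} {ψ : Fin (n + 1) → F}
    (hφ : Set.BijOn φ Set.univ s₁) (hψ : Set.BijOn ψ Set.univ s₂)
    (hx : φ ⟨i + 1, by omega⟩ = x) (hy : ψ 0 = y)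
    (hx' : (φ ∘ finRotate (m + 1)) ⟨i, by omega⟩ = x)
    (a : A.obj g (m + 1)) (b : A.obj h (n + 1)) :
    A.ofEnum (cat hs (i + 1) him φ ψ) (bijOn_cat hs (i + 1) him H hφ hψ hx hy)
        (C.circ hγ hs (i + 1) (by omega) (A.act g (m + 1) (finRotate (m + 1)) a) b) =
      A.ofEnum (cat hs i him.le (φ ∘ finRotate (m + 1)) ψ)
        (bijOn_cat hs i him.le H (hφ.comp (finRotate (m + 1)).bijective.bijOn_univ) hψ hx' hy)
        (C.circ hγ hs i (by omega) a b) := by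
  obtain ⟨r, rfl⟩ : ∃ r, s = r + 1 := ⟨s - 1, by omega⟩
  have := C.circ_star_of_lt hγ hs i hi him a b
  unfold StableSModule.star at this
  rw [← this, A.ofEnum_act]
  refine A.ofEnum_congr _ _ (fun j => ?_) _
  have h0 := coe_finRotate_succ j
  rw [Function.comp_apply]
  generalize finRotate (r + 1) j = w at h0 ⊢
  -- As `i < m`, the last label of the composite is the last label of the first factor; the rotation
  -- makes it the output.
  by_cases hjr : (j : ℕ) = r
  · rw [if_pos hjr] at h0
    rw [cat_of_lt hs (i + 1) him φ ψ _ (by omega) 0 (by simp [h0])]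
    rw [cat_of_ge hs i him.le (φ ∘ _) ψ _ (by omega) (Fin.last m) (by simp; omega)]
    simp
  · rw [if_neg hjr] at h0
    by_cases h1 : (j : ℕ) < i
    · rw [cat_of_lt hs (i + 1) him φ ψ _ (by omega) ⟨j + 1, by omega⟩ (by simp [h0])]
      rw [cat_of_lt hs i him.le (φ ∘ _) ψ _ (by omega) ⟨j, by omega⟩ (by simp)]
      refine congrArg φ (Fin.ext ?_)
      rw [coe_finRotate_succ, if_neg (by simp; omega)]
    · by_cases h2 : (j : ℕ) < i + n
      · rw [cat_of_mid hs (i + 1) him φ ψ _ (by omega) (by omega) ⟨j - i + 1, by omega⟩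
          (by simp; omega)]
        rw [cat_of_mid hs i him.le (φ ∘ _) ψ _ (by omega) (by omega) ⟨j - i + 1, by omega⟩
          (by simp; omega)]
      · rw [cat_of_ge hs (i + 1) him φ ψ _ (by omega) ⟨j - n + 2, by omega⟩ (by simp; omega)]
        rw [cat_of_ge hs i him.le (φ ∘ _) ψ _ (by omega) ⟨j - n + 1, by omega⟩ (by simp; omega)]
        refine congrArg φ (Fin.ext ?_)
        rw [coe_finRotate_succ, if_neg (by simp; omega)]

/-- Full equivariance: the permutation of the labels of `a` need not fix the output. -/
theorem ofEnum_circ_perm {s₁ s₂ t : Set F} {x y : F} (H : GlueData s₁ s₂ t x y) {i i' : ℕ}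
    (hi : 1 ≤ i ∧ i ≤ m) (hi' : 1 ≤ i' ∧ i' ≤ m) {φ : Fin (m + 1) → F} {ψ : Fin (n + 1) → F}
    (hφ : Set.BijOn φ Set.univ s₁) (hψ : Set.BijOn ψ Set.univ s₂)
    (π : Equiv.Perm (Fin (m + 1))) (ρ : Equiv.Perm (Fin (n + 1))) (hρ : ρ 0 = 0)
    (hx : φ ⟨i', by omega⟩ = x) (hy : ψ 0 = y)
    (hx' : (φ ∘ π) ⟨i, by omega⟩ = x) (hy' : (ψ ∘ ρ) 0 = y)
    (a : A.obj g (m + 1)) (b : A.obj h (n + 1)) :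
    A.ofEnum (cat hs i' hi'.2 φ ψ) (bijOn_cat hs i' hi'.2 H hφ hψ hx hy)
        (C.circ hγ hs i' hi' (A.act g (m + 1) π a) (A.act h (n + 1) ρ b)) =
      A.ofEnum (cat hs i hi.2 (φ ∘ π) (ψ ∘ ρ))
        (bijOn_cat hs i hi.2 H (hφ.comp π.bijective.bijOn_univ) (hψ.comp ρ.bijective.bijOn_univ)
          hx' hy')
        (C.circ hγ hs i hi a b) := by
  have hπi : π ⟨i, by omega⟩ = ⟨i', by omega⟩ := (hφ.apply_eq_iff _ _).1 (hx'.trans hx.symm)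
  by_cases hπ : π 0 = 0
  · exact C.ofEnum_circ_of_fix hγ hs H hi hi' hφ hψ π ρ hπ hρ hπi hx hy hx' hy' a b
  -- A permutation that moves the output is factored as `β τ α`, with `τ` the rotation and with `α`,
  -- `β` fixing `0`. Since `0`, `i` and `l = π⁻¹(0)` are three distinct labels, `α` can be chosen to
  -- send `i` to `1` and `l` to `m`; then `τ` sends these to `2` and `0`, and what is left to `β` is
  -- `0 ↦ 0` and `2 ↦ i'`.
  · obtain ⟨l, hl⟩ := π.surjective 0
    have hl0 : l ≠ 0 := fun e => hπ (e ▸ hl)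
    have hli : l ≠ ⟨i, by omega⟩ := by
      intro e
      rw [e, hπi] at hl
      have := congrArg Fin.val hl
      simp at this
      omega
    have hi0 : (⟨i, by omega⟩ : Fin (m + 1)) ≠ 0 := by
      intro e
      have := congrArg Fin.val e
      simp at this
      omega
    have hm : 2 ≤ m := by
      by_contra hm
      have h1 : (l : ℕ) ≠ 0 := fun e => hl0 (Fin.ext e)
      have h2 : (l : ℕ) ≠ i := fun e => hli (Fin.ext e)
      omega
    obtain ⟨f, hf, hf0, hfi, hfl⟩ := exists_enum₃ (F := Fin (m + 1)) (s := Set.univ)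
      (n := m + 1) (by simp [Set.ncard_univ]) hi0.symm hl0.symm (Ne.symm hli)
      (x := 0) (y := ⟨1, by omega⟩) (z := Fin.last m) trivial trivial trivial
      (by simp [Fin.ext_iff]) (by simp [Fin.ext_iff]; omega) (by simp [Fin.ext_iff]; omega)
    let α : Equiv.Perm (Fin (m + 1)) := Equiv.ofBijective f (Set.bijOn_univ.1 hf)
    have hα0 : α 0 = 0 := hf0
    have hαi : α ⟨i, by omega⟩ = ⟨1, by omega⟩ := hfi
    have hαl : α l = Fin.last m := hfl
    let τ : Equiv.Perm (Fin (m + 1)) := finRotate (m + 1)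
    have hτ1 : τ ⟨1, by omega⟩ = ⟨2, by omega⟩ := by
      refine Fin.ext ?_
      rw [coe_finRotate_succ, if_neg (by simp; omega)]
    have hτl : τ (Fin.last m) = 0 := finRotate_last
    obtain ⟨β, hβ⟩ : ∃ β : Equiv.Perm (Fin (m + 1)), π = β * (τ * α) :=
      ⟨π * (τ * α)⁻¹, by group⟩
    have hβ0 : β 0 = 0 := by
      have : (β * (τ * α)) l = 0 := by rw [← hβ, hl]
      simpa [hαl, hτl] using this
    have hβi : β ⟨2, by omega⟩ = ⟨i', by omega⟩ := by
      have : (β * (τ * α)) ⟨i, by omega⟩ = ⟨i', by omega⟩ := by rw [← hβ, hπi]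
      simpa [hαi, hτ1] using this
    have hact : A.act g (m + 1) π a =
        A.act g (m + 1) β (A.act g (m + 1) τ (A.act g (m + 1) α a)) := by
      rw [hβ, map_mul, map_mul]
      rfl
    have hx2 : (φ ∘ β) ⟨2, by omega⟩ = x := by rw [Function.comp_apply, hβi, hx]
    have hx3 : ((φ ∘ β) ∘ τ) ⟨1, by omega⟩ = x := by rw [Function.comp_apply, hτ1, hx2]
    have hx4 : (((φ ∘ β) ∘ τ) ∘ α) ⟨i, by omega⟩ = x := by rw [Function.comp_apply, hαi, hx3]
    have hφβ : Set.BijOn (φ ∘ β) Set.univ s₁ := hφ.comp β.bijective.bijOn_univ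
    have hφτ : Set.BijOn ((φ ∘ β) ∘ τ) Set.univ s₁ := hφβ.comp τ.bijective.bijOn_univ
    have h1 : A.act h (n + 1) ρ b = A.act h (n + 1) ρ b := rfl
    rw [hact, C.ofEnum_circ_of_fix hγ hs H (i := 2) ⟨by omega, hm⟩ hi' hφ hψ β ρ hβ0 hρ hβi hx hy
      hx2 hy']
    have hψρ : Set.BijOn (ψ ∘ ρ) Set.univ s₂ := hψ.comp ρ.bijective.bijOn_univ
    rw [C.ofEnum_circ_of_star hγ hs H (i := 1) le_rfl (by omega) hφβ hψρ hx2 hy' hx3]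
    have hid : A.act h (n + 1) 1 b = b := by rw [map_one]; rfl
    have := C.ofEnum_circ_of_fix hγ hs H hi (i' := 1) ⟨le_rfl, by omega⟩ hφτ hψρ α 1 hα0 rfl hαi
      hx3 hy' hx4 hy' a b
    rw [hid] at this
    rw [this]
    refine A.ofEnum_congr _ _ (fun j => ?_) _
    rw [hβ]
    rfl

/-- The element `a ∘_i b`, considered as an element of `A((g,t))`, depends only on the elements
`a` and `b` of `A((g,s₁))` and `A((g,s₂))` and on the labels that are glued. -/
theorem ofEnum_circ_eq {s₁ s₂ t : Set F} {x y : F} (H : GlueData s₁ s₂ t x y) {i i' : ℕ}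
    (hi : 1 ≤ i ∧ i ≤ m) (hi' : 1 ≤ i' ∧ i' ≤ m) {φ φ' : Fin (m + 1) → F} {ψ ψ' : Fin (n + 1) → F}
    (hφ : Set.BijOn φ Set.univ s₁) (hψ : Set.BijOn ψ Set.univ s₂)
    (hφ' : Set.BijOn φ' Set.univ s₁) (hψ' : Set.BijOn ψ' Set.univ s₂)
    (hx : φ ⟨i, by omega⟩ = x) (hy : ψ 0 = y) (hx' : φ' ⟨i', by omega⟩ = x) (hy' : ψ' 0 = y)
    {a a' : A.obj g (m + 1)} {b b' : A.obj h (n + 1)}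
    (ha : A.ofEnum φ hφ a = A.ofEnum φ' hφ' a') (hb : A.ofEnum ψ hψ b = A.ofEnum ψ' hψ' b') :
    A.ofEnum (cat hs i hi.2 φ ψ) (bijOn_cat hs i hi.2 H hφ hψ hx hy) (C.circ hγ hs i hi a b) =
      A.ofEnum (cat hs i' hi'.2 φ' ψ') (bijOn_cat hs i' hi'.2 H hφ' hψ' hx' hy')
        (C.circ hγ hs i' hi' a' b') := by
  obtain ⟨π, hπ⟩ := exists_perm_comp_eq hφ hφ'
  obtain ⟨ρ, hρ⟩ := exists_perm_comp_eq hψ hψ'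
  obtain rfl : φ' ∘ π = φ := funext hπ
  obtain rfl : ψ' ∘ ρ = ψ := funext hρ
  have ha' : a' = A.act g (m + 1) π a := by
    refine A.ofEnum_injective hφ' ?_
    rw [← ha, A.ofEnum_act]
  have hb' : b' = A.act h (n + 1) ρ b := by
    refine A.ofEnum_injective hψ' ?_
    rw [← hb, A.ofEnum_act]
  rw [ha', hb']
  refine (C.ofEnum_circ_perm hγ hs H hi hi' hφ' hψ' π ρ ?_ hx' hy' hx hy a b).symm
  exact (hψ'.apply_eq_iff _ _).1 (hy.trans hy'.symm)

end Circ

end StableGradedCyclicOperad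

theorem negOnePow_congr {a b : ℤ} (h : Even (a - b)) : a.negOnePow = b.negOnePow :=
  (Int.negOnePow_eq_iff a b).2 h

section Cat

variable {F : Type}

/-- The labels of `a ∘_m b` are `0, …, m-1` of `a` followed by `1, …, n` of `b`. One rotation of
this list puts the last label of `b` in front, and this is the output of `b^* ∘_1 a^*`. -/
theorem cat_finRotate {m n r : ℕ} (hs : m + n = r + 1) (hs' : n + m = r + 1)
    (hn : 1 ≤ n) (φ : Fin (m + 1) → F) (ψ : Fin (n + 1) → F) (j : Fin (r + 1)) :
    cat hs' 1 hn ψ φ (finRotate (r + 1) j) =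
      cat hs m le_rfl (φ ∘ finRotate (m + 1)) (ψ ∘ finRotate (n + 1)) j := by
  have h0 := coe_finRotate_succ j
  generalize finRotate (r + 1) j = w at h0 ⊢
  by_cases h1 : (j : ℕ) < m
  · rw [if_neg (by omega)] at h0
    rw [cat_of_lt hs m le_rfl _ _ _ h1 ⟨j, by omega⟩ rfl]
    rw [cat_of_mid hs' 1 hn ψ φ _ (by omega) (by omega) ⟨j + 1, by omega⟩ (by simp; omega)]
    refine congrArg φ (Fin.ext ?_)
    rw [coe_finRotate_succ, if_neg (by simp; omega)]
  · rw [cat_of_mid hs m le_rfl _ _ _ (by omega) (by omega) ⟨j - m + 1, by omega⟩ (by simp; omega)]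
    by_cases h2 : (j : ℕ) = r
    · rw [if_pos h2] at h0
      rw [cat_of_lt hs' 1 hn ψ φ _ (by omega) 0 (by simp [h0])]
      refine congrArg ψ (Fin.ext ?_)
      rw [coe_finRotate_succ, if_pos (by simp; omega)]
      rfl
    · rw [if_neg h2] at h0
      rw [cat_of_ge hs' 1 hn ψ φ _ (by omega) ⟨j - m + 2, by omega⟩ (by simp; omega)]
      refine congrArg ψ (Fin.ext ?_)
      rw [coe_finRotate_succ, if_neg (by simp; omega)]

theorem cat_assoc {l m n r₁ r₂ s : ℕ} (hr₁ : l + m = r₁ + 1) (hr₂ : m + n = r₂ + 1)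
    (hs₁ : r₁ + n = s) (hs₂ : l + r₂ = s) (i j : ℕ) (hi : 1 ≤ i ∧ i ≤ l) (hj : 1 ≤ j ∧ j ≤ m)
    (φ : Fin (l + 1) → F) (ψ : Fin (m + 1) → F) (χ : Fin (n + 1) → F) (x : Fin s) :
    cat hs₁ (i + j - 1) (by omega) (cat hr₁ i hi.2 φ ψ) χ x =
      cat hs₂ i hi.2 φ (cat hr₂ j hj.2 ψ χ) x := by
  unfold cat
  dsimp only
  split_ifs <;> first
    | (exfalso; omega)
    | (refine congrArg _ (Fin.ext ?_); first | rfl | (dsimp only; omega))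

theorem cat_parallel {l m n r₁ r₂ s : ℕ} (hr₁ : l + m = r₁ + 1) (hr₂ : l + n = r₂ + 1)
    (hs₁ : r₁ + n = s) (hs₂ : r₂ + m = s) (i j : ℕ) (hi : 1 ≤ i) (hij : i < j) (hj : j ≤ l)
    (φ : Fin (l + 1) → F) (ψ : Fin (m + 1) → F) (χ : Fin (n + 1) → F) (x : Fin s) :
    cat hs₁ (j + m - 1) (by omega) (cat hr₁ i (by omega) φ ψ) χ x =
      cat hs₂ i (by omega) (cat hr₂ j hj φ χ) ψ x := by
  unfold cat
  dsimp only
  split_ifs <;> first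
    | (exfalso; omega)
    | (refine congrArg _ (Fin.ext ?_); first | rfl | (dsimp only; omega))

end Cat

/-! ### Gluing along arbitrary labels -/

namespace StableGradedCyclicOperad

variable {k : Type u} [Field k] {A : StableSModule.{u, v} k} (C : StableGradedCyclicOperad A)

/-- If both factors have at least two labels, then the two ways to compose them agree up to the
Koszul sign. -/
theorem ofEnum_circ_swap {F : Type} [Finite F] {g h γ m n s : ℕ} (hγ : g + h = γ) (hγ' : h + g = γ)
    (hs : m + n = s) (hs' : n + m = s) {s₁ s₂ t : Set F} {x y : F} (H : GlueData s₁ s₂ t x y)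
    {i j : ℕ} (hi : 1 ≤ i ∧ i ≤ m) (hj : 1 ≤ j ∧ j ≤ n) {φ φ' : Fin (m + 1) → F}
    {ψ ψ' : Fin (n + 1) → F} (hφ : Set.BijOn φ Set.univ s₁) (hψ : Set.BijOn ψ Set.univ s₂)
    (hφ' : Set.BijOn φ' Set.univ s₁) (hψ' : Set.BijOn ψ' Set.univ s₂)
    (hx : φ ⟨i, by omega⟩ = x) (hy : ψ 0 = y) (hx' : φ' 0 = x) (hy' : ψ' ⟨j, by omega⟩ = y)
    {a a' : A.obj g (m + 1)} {b b' : A.obj h (n + 1)}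
    (ha : A.ofEnum φ hφ a = A.ofEnum φ' hφ' a') (hb : A.ofEnum ψ hψ b = A.ofEnum ψ' hψ' b')
    {p q : ℤ} (hp : a ∈ A.deg g (m + 1) p) (hq : b ∈ A.deg h (n + 1) q) :
    A.ofEnum (cat hs i hi.2 φ ψ) (bijOn_cat hs i hi.2 H hφ hψ hx hy) (C.circ hγ hs i hi a b) =
      (p * q).negOnePow • A.ofEnum (cat hs' j hj.2 ψ' φ')
        (bijOn_cat hs' j hj.2 H.symm hψ' hφ' hy' hx') (C.circ hγ' hs' j hj b' a') := by
  -- These enumerations suit `b^* ∘_1 a^*`: `x` is at place `0` and `y` at place `1`. Precomposed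
  -- with the rotations they put `x` at place `m` and `y` at place `0`, as `a ∘_m b` requires, so
  -- that `circ_star_last` applies.
  obtain ⟨φ₁, hφ₁, hx₁⟩ := exists_enum₁ hφ.ncard_enum 0 H.left
  obtain ⟨ψ₁, hψ₁, hy₁⟩ := exists_enum₁ hψ.ncard_enum ⟨1, by omega⟩ H.right
  have hφ₀ := hφ₁.comp (finRotate (m + 1)).bijective.bijOn_univ
  have hψ₀ := hψ₁.comp (finRotate (n + 1)).bijective.bijOn_univ
  obtain ⟨a₀, ha₀⟩ := A.exists_ofEnum_eq hφ₀ (A.ofEnum φ hφ a)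
  obtain ⟨b₀, hb₀⟩ := A.exists_ofEnum_eq hψ₀ (A.ofEnum ψ hψ b)
  have hp₀ : a₀ ∈ A.deg g (m + 1) p := by
    rw [← A.ofEnum_mem_iff hφ₀, ha₀, A.ofEnum_mem_iff]
    exact hp
  have hq₀ : b₀ ∈ A.deg h (n + 1) q := by
    rw [← A.ofEnum_mem_iff hψ₀, hb₀, A.ofEnum_mem_iff]
    exact hq
  have hx₀ : (φ₁ ∘ finRotate (m + 1)) ⟨m, by omega⟩ = x := by
    rw [Function.comp_apply, ← hx₁]
    refine congrArg φ₁ (Fin.ext ?_)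
    rw [coe_finRotate_succ, if_pos rfl]
    rfl
  have hy₀ : (ψ₁ ∘ finRotate (n + 1)) 0 = y := by
    rw [Function.comp_apply, ← hy₁]
    refine congrArg ψ₁ (Fin.ext ?_)
    rw [coe_finRotate_succ, if_neg (by simp; omega)]
    rfl
  rw [C.ofEnum_circ_eq hγ hs H hi (i' := m) ⟨by omega, le_rfl⟩ hφ hψ hφ₀ hψ₀ hx hy hx₀ hy₀
    ha₀.symm hb₀.symm]
  rw [C.ofEnum_circ_eq hγ' hs' H.symm hj (i' := 1) ⟨le_rfl, by omega⟩ hψ' hφ' hψ₁ hφ₁ hy' hx' hy₁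
    hx₁ (b := a') (a := b') (a' := A.star b₀) (b' := A.star a₀)
    (by rw [StableSModule.star, A.ofEnum_act, hb₀, hb])
    (by rw [StableSModule.star, A.ofEnum_act, ha₀, ha])]
  obtain ⟨r, rfl⟩ : ∃ r, s = r + 1 := ⟨s - 1, by omega⟩
  rw [← LinearMap.map_intUnits_smul, ← C.circ_star_last hγ hγ' hs hs' (by omega) (by omega) p q
    a₀ b₀ hp₀ hq₀, StableSModule.star, A.ofEnum_act]
  exact A.ofEnum_congr _ _
    (fun l => (cat_finRotate hs hs' (by omega) φ₁ ψ₁ l).symm) _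

section Glue

variable {F : Type}

/-- The properties that characterize the gluing operation `A((g,s₁)) ⊗ A((h,s₂)) → A((γ,t))` of a
cyclic operad for the labels `x ∈ s₁` and `y ∈ s₂`. -/
structure IsGlue {g h γ : ℕ} (hγ : g + h = γ) {s₁ s₂ t : Set F} {x y : F}
    (H : GlueData s₁ s₂ t x y) (B : A.onSet g s₁ →ₗ[k] A.onSet h s₂ →ₗ[k] A.onSet γ t) :
    Prop where
  fst : ∀ {m n s : ℕ} (hs : m + n = s) (i : ℕ) (hi : 1 ≤ i ∧ i ≤ m) (φ : Fin (m + 1) → F)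
    (ψ : Fin (n + 1) → F) (hφ : Set.BijOn φ Set.univ s₁) (hψ : Set.BijOn ψ Set.univ s₂)
    (hx : φ ⟨i, by omega⟩ = x) (hy : ψ 0 = y) (a : A.obj g (m + 1)) (b : A.obj h (n + 1)),
    B (A.ofEnum φ hφ a) (A.ofEnum ψ hψ b) =
      A.ofEnum (cat hs i hi.2 φ ψ) (bijOn_cat hs i hi.2 H hφ hψ hx hy) (C.circ hγ hs i hi a b)
  snd : ∀ {m n s : ℕ} (hγ' : h + g = γ) (hs : m + n = s) (i : ℕ) (hi : 1 ≤ i ∧ i ≤ m)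
    (φ : Fin (m + 1) → F) (ψ : Fin (n + 1) → F) (hφ : Set.BijOn φ Set.univ s₂)
    (hψ : Set.BijOn ψ Set.univ s₁) (hy : φ ⟨i, by omega⟩ = y) (hx : ψ 0 = x)
    (p q : ℤ) (b : A.obj h (m + 1)) (a : A.obj g (n + 1)),
    a ∈ A.deg g (n + 1) p → b ∈ A.deg h (m + 1) q →
    B (A.ofEnum ψ hψ a) (A.ofEnum φ hφ b) =
      (p * q).negOnePow • A.ofEnum (cat hs i hi.2 φ ψ)
        (bijOn_cat hs i hi.2 H.symm hφ hψ hy hx) (C.circ hγ' hs i hi b a)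
  pair : ∀ (φ ψ : Fin 1 → F) (θ : Fin 0 → F) (hφ : Set.BijOn φ Set.univ s₁)
    (hψ : Set.BijOn ψ Set.univ s₂) (hθ : Set.BijOn θ Set.univ t) (a : A.obj g 1) (b : A.obj h 1),
    B (A.ofEnum φ hφ a) (A.ofEnum ψ hψ b) = A.ofEnum θ hθ (C.pair hγ a b)

variable [Finite F] {g h γ : ℕ} (hγ : g + h = γ) {s₁ s₂ t : Set F} {x y : F}

/-- One choice of numberings, with `x` at place `1` and `y` at place `0`, defines the map, and by
`ofEnum_circ_eq` any other choice gives the same one. The second label of `s₁` serves as the output,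
which must not be `x`. -/
theorem exists_glue_of_two_le (H : GlueData s₁ s₂ t x y) (h2 : 2 ≤ s₁.ncard) :
    ∃ B : A.onSet g s₁ →ₗ[k] A.onSet h s₂ →ₗ[k] A.onSet γ t,
    ∀ {m n s : ℕ} (hs : m + n = s) (i : ℕ) (hi : 1 ≤ i ∧ i ≤ m) (φ : Fin (m + 1) → F)
    (ψ : Fin (n + 1) → F) (hφ : Set.BijOn φ Set.univ s₁) (hψ : Set.BijOn ψ Set.univ s₂)
    (hx : φ ⟨i, by omega⟩ = x) (hy : ψ 0 = y) (a : A.obj g (m + 1)) (b : A.obj h (n + 1)),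
    B (A.ofEnum φ hφ a) (A.ofEnum ψ hψ b) =
      A.ofEnum (cat hs i hi.2 φ ψ) (bijOn_cat hs i hi.2 H hφ hψ hx hy)
        (C.circ hγ hs i hi a b) := by
  obtain ⟨m, hm⟩ : ∃ m, s₁.ncard = m + 1 := ⟨s₁.ncard - 1, by omega⟩
  obtain ⟨n, hn⟩ : ∃ n, s₂.ncard = n + 1 := by
    have : s₂.ncard ≠ 0 := Set.ncard_ne_zero_of_mem H.right
    exact ⟨s₂.ncard - 1, by omega⟩
  obtain ⟨φ, hφ, hx⟩ := exists_enum₁ hm ⟨1, by omega⟩ H.left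
  obtain ⟨ψ, hψ, hy⟩ := exists_enum₁ hn 0 H.right
  let e₁ : A.obj g (m + 1) ≃ₗ[k] A.onSet g s₁ :=
    A.numbering g ((Equiv.Set.univ _).symm.trans (hφ.equiv φ))
  let e₂ : A.obj h (n + 1) ≃ₗ[k] A.onSet h s₂ :=
    A.numbering h ((Equiv.Set.univ _).symm.trans (hψ.equiv ψ))
  refine ⟨((C.circ hγ rfl 1 ⟨le_rfl, by omega⟩).compl₁₂ e₁.symm.toLinearMap
    e₂.symm.toLinearMap).compr₂ (A.ofEnum (cat rfl 1 (by omega) φ ψ)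
      (bijOn_cat rfl 1 (by omega) H hφ hψ hx hy)), ?_⟩
  intro m' n' s hs i hi φ' ψ' hφ' hψ' hx' hy' a b
  obtain rfl : m' = m := by have := hφ'.ncard_enum; omega
  obtain rfl : n' = n := by have := hψ'.ncard_enum; omega
  subst hs
  rw [LinearMap.compr₂_apply, LinearMap.compl₁₂_apply]
  refine C.ofEnum_circ_eq hγ rfl H _ hi hφ hψ hφ' hψ' hx hy hx' hy' ?_ ?_
  · exact e₁.apply_symm_apply _
  · exact e₂.apply_symm_apply _

/-- If `s₁` has a label besides `x`, some `∘_i` is available. If only `s₂` has a second label, the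
factors are exchanged at the cost of the Koszul sign. If neither has one, the pairing takes over. -/
theorem exists_isGlue (H : GlueData s₁ s₂ t x y) :
    ∃ B : A.onSet g s₁ →ₗ[k] A.onSet h s₂ →ₗ[k] A.onSet γ t, C.IsGlue hγ H B := by
  have h1 : s₁.ncard ≠ 0 := Set.ncard_ne_zero_of_mem H.left
  have h2 : s₂.ncard ≠ 0 := Set.ncard_ne_zero_of_mem H.right
  by_cases h1' : 2 ≤ s₁.ncard
  · obtain ⟨B, hB⟩ := C.exists_glue_of_two_le hγ H h1'
    refine ⟨B, hB, ?_, ?_⟩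
    · intro m n s hγ' hs i hi φ ψ hφ hψ hy hx p q b a ha hb
      have hn : 1 ≤ n := by have := hψ.ncard_enum; omega
      obtain ⟨φ', hφ', hx'⟩ := exists_enum₁ hψ.ncard_enum ⟨1, by omega⟩ H.left
      obtain ⟨ψ', hψ', hy'⟩ := exists_enum₁ hφ.ncard_enum 0 H.right
      obtain ⟨a', ha'⟩ := A.exists_ofEnum_eq hφ' (A.ofEnum ψ hψ a)
      obtain ⟨b', hb'⟩ := A.exists_ofEnum_eq hψ' (A.ofEnum φ hφ b)
      rw [← ha', ← hb', hB (by omega : n + m = s) 1 ⟨le_rfl, hn⟩ φ' ψ' hφ' hψ' hx' hy']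
      refine C.ofEnum_circ_swap hγ hγ' _ hs H _ hi hφ' hψ' hψ hφ hx' hy' hx hy ha' hb' ?_ ?_
      · rw [← A.ofEnum_mem_iff hφ', ha', A.ofEnum_mem_iff]
        exact ha
      · rw [← A.ofEnum_mem_iff hψ', hb', A.ofEnum_mem_iff]
        exact hb
    · intro φ ψ θ hφ
      have := hφ.ncard_enum
      omega
  · by_cases h2' : 2 ≤ s₂.ncard
    · obtain ⟨B', hB'⟩ := C.exists_glue_of_two_le (by omega : h + g = γ) H.symm h2'
      obtain ⟨B, hB⟩ := exists_bilinear_swap (A.isInternal_onSetDeg g s₁)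
        (A.isInternal_onSetDeg h s₂) B'
      refine ⟨B, ?_, ?_, ?_⟩
      · intro m n s hs i hi φ ψ hφ
        have := hφ.ncard_enum
        omega
      · intro m n s hγ' hs i hi φ ψ hφ hψ hy hx p q b a ha hb
        rw [hB p q _ ((A.ofEnum_mem_iff hψ).2 ha) _ ((A.ofEnum_mem_iff hφ).2 hb),
          hB' hs i hi φ ψ hφ hψ hy hx]
      · intro φ ψ θ hφ hψ
        have := hψ.ncard_enum
        omega
    · obtain ⟨φ, hφ⟩ := exists_enum s₁ (n := 1) (by omega)
      obtain ⟨ψ, hψ⟩ := exists_enum s₂ (n := 1) (by omega)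
      have ht : t.ncard = 0 := by
        obtain ⟨x', hx'⟩ := Set.ncard_eq_one.1 (by omega : s₁.ncard = 1)
        obtain ⟨y', hy'⟩ := Set.ncard_eq_one.1 (by omega : s₂.ncard = 1)
        have hx := H.left
        have hy := H.right
        have ht := H.eq
        rw [hx'] at hx ht
        rw [hy'] at hy ht
        rw [ht, Set.mem_singleton_iff.1 hx, Set.mem_singleton_iff.1 hy]
        simp
      obtain ⟨θ, hθ⟩ := exists_enum t ht
      let e₁ : A.obj g 1 ≃ₗ[k] A.onSet g s₁ :=
        A.numbering g ((Equiv.Set.univ _).symm.trans (hφ.equiv φ))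
      let e₂ : A.obj h 1 ≃ₗ[k] A.onSet h s₂ :=
        A.numbering h ((Equiv.Set.univ _).symm.trans (hψ.equiv ψ))
      refine ⟨((C.pair hγ).compl₁₂ e₁.symm.toLinearMap e₂.symm.toLinearMap).compr₂
        (A.ofEnum θ hθ), ?_, ?_, ?_⟩
      · intro m n s hs i hi φ ψ hφ
        have := hφ.ncard_enum
        omega
      · intro m n s hγ' hs i hi φ ψ hφ
        have := hφ.ncard_enum
        omega
      · intro φ' ψ' θ' hφ' hψ' hθ' a b
        obtain rfl : φ' = φ := by
          funext j
          have h3 := hφ'.mapsTo (Set.mem_univ j)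
          obtain ⟨l, -, hl⟩ := hφ.surjOn h3
          rw [← hl, Subsingleton.elim l j]
        obtain rfl : ψ' = ψ := by
          funext j
          have h3 := hψ'.mapsTo (Set.mem_univ j)
          obtain ⟨l, -, hl⟩ := hψ.surjOn h3
          rw [← hl, Subsingleton.elim l j]
        obtain rfl : θ' = θ := Subsingleton.elim _ _
        rw [LinearMap.compr₂_apply, LinearMap.compl₁₂_apply]
        have h3 : e₁.symm (A.ofEnum φ' hφ' a) = a := e₁.symm_apply_apply a
        have h4 : e₂.symm (A.ofEnum ψ' hψ' b) = b := e₂.symm_apply_apply b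
        rw [LinearEquiv.coe_coe, LinearEquiv.coe_coe, h3, h4]

/-- The gluing operation `A((g,s₁)) ⊗ A((h,s₂)) → A((γ,t))` for the labels `x ∈ s₁`, `y ∈ s₂`. -/
def glue (H : GlueData s₁ s₂ t x y) : A.onSet g s₁ →ₗ[k] A.onSet h s₂ →ₗ[k] A.onSet γ t :=
  (C.exists_isGlue hγ H).choose

theorem isGlue_glue (H : GlueData s₁ s₂ t x y) : C.IsGlue hγ H (C.glue hγ H) :=
  (C.exists_isGlue hγ H).choose_spec

end Glue

end StableGradedCyclicOperad

theorem GlueData.push {F F' : Type} {s₁ s₂ t : Set F} {x y : F} (H : GlueData s₁ s₂ t x y)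
    {f : F → F'} {s₁' s₂' : Set F'} (h₁ : Set.BijOn f s₁ s₁') (h₂ : Set.BijOn f s₂ s₂')
    (hf : Set.InjOn f (s₁ ∪ s₂)) : GlueData s₁' s₂' (f '' t) (f x) (f y) := by
  refine ⟨h₁.mapsTo H.left, h₂.mapsTo H.right, ?_, ?_⟩
  · rw [← h₁.image_eq, ← h₂.image_eq]
    rw [Set.disjoint_left]
    rintro _ ⟨u, hu, rfl⟩ ⟨v, hv, e⟩
    exact H.ne_of_mem hu hv (hf (Or.inl hu) (Or.inr hv) e.symm)
  · ext z
    simp only [Set.mem_image, Set.mem_union, Set.mem_sdiff, Set.mem_singleton_iff, H.mem_iff,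
      ← h₁.image_eq, ← h₂.image_eq]
    constructor
    · rintro ⟨w, ⟨h1, h2⟩ | ⟨h1, h2⟩, rfl⟩
      · exact Or.inl ⟨⟨w, h1, rfl⟩, fun e => h2 (hf (Or.inl h1) (Or.inl H.left) e)⟩
      · exact Or.inr ⟨⟨w, h1, rfl⟩, fun e => h2 (hf (Or.inr h1) (Or.inr H.right) e)⟩
    · rintro (⟨⟨w, h1, rfl⟩, h2⟩ | ⟨⟨w, h1, rfl⟩, h2⟩)
      · exact ⟨w, Or.inl ⟨h1, fun e => h2 (e ▸ rfl)⟩, rfl⟩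
      · exact ⟨w, Or.inr ⟨h1, fun e => h2 (e ▸ rfl)⟩, rfl⟩

theorem GlueData.ncard_add_two {F : Type} [Finite F] {s₁ s₂ t : Set F} {x y : F}
    (H : GlueData s₁ s₂ t x y) : t.ncard + 2 = s₁.ncard + s₂.ncard := by
  rw [H.eq, Set.ncard_union_eq (H.disj.mono Set.sdiff_subset Set.sdiff_subset)]
  have h1 := Set.ncard_sdiff_singleton_add_one H.left
  have h2 := Set.ncard_sdiff_singleton_add_one H.right
  omega

namespace StableGradedCyclicOperad

variable {k : Type u} [Field k] {A : StableSModule.{u, v} k} (C : StableGradedCyclicOperad A)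

section Glue

variable {F : Type} [Finite F] {g h γ : ℕ} {s₁ s₂ t : Set F} {x y : F}

/-- Gluing is symmetric up to the Koszul sign. -/
theorem glue_symm (hγ : g + h = γ) (hγ' : h + g = γ) (H : GlueData s₁ s₂ t x y) {p q : ℤ}
    {a : A.onSet g s₁} {b : A.onSet h s₂} (ha : a ∈ A.onSetDeg g s₁ p)
    (hb : b ∈ A.onSetDeg h s₂ q) :
    C.glue hγ H a b = (p * q).negOnePow • C.glue hγ' H.symm b a := by
  have h1 : s₁.ncard ≠ 0 := Set.ncard_ne_zero_of_mem H.left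
  have h2 : s₂.ncard ≠ 0 := Set.ncard_ne_zero_of_mem H.right
  obtain ⟨m, hm⟩ : ∃ m, s₁.ncard = m + 1 := ⟨s₁.ncard - 1, by omega⟩
  obtain ⟨n, hn⟩ : ∃ n, s₂.ncard = n + 1 := ⟨s₂.ncard - 1, by omega⟩
  by_cases hm1 : 1 ≤ m
  · obtain ⟨φ, hφ, hx⟩ := exists_enum₁ hm ⟨1, by omega⟩ H.left
    obtain ⟨ψ, hψ, hy⟩ := exists_enum₁ hn 0 H.right
    obtain ⟨a, rfl⟩ := A.exists_ofEnum_eq hφ a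
    obtain ⟨b, rfl⟩ := A.exists_ofEnum_eq hψ b
    rw [A.ofEnum_mem_iff] at ha hb
    rw [(C.isGlue_glue hγ H).fst rfl 1 ⟨le_rfl, hm1⟩ φ ψ hφ hψ hx hy,
      (C.isGlue_glue hγ' H.symm).snd hγ rfl 1 ⟨le_rfl, hm1⟩ φ ψ hφ hψ hx hy q p a b hb ha,
      mul_comm q p, intUnits_smul_smul_self]
  · by_cases hn1 : 1 ≤ n
    · obtain ⟨φ, hφ, hx⟩ := exists_enum₁ hm 0 H.left
      obtain ⟨ψ, hψ, hy⟩ := exists_enum₁ hn ⟨1, by omega⟩ H.right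
      obtain ⟨a, rfl⟩ := A.exists_ofEnum_eq hφ a
      obtain ⟨b, rfl⟩ := A.exists_ofEnum_eq hψ b
      rw [A.ofEnum_mem_iff] at ha hb
      rw [(C.isGlue_glue hγ H).snd hγ' rfl 1 ⟨le_rfl, hn1⟩ ψ φ hψ hφ hy hx p q b a ha hb,
        (C.isGlue_glue hγ' H.symm).fst rfl 1 ⟨le_rfl, hn1⟩ ψ φ hψ hφ hy hx]
    · obtain rfl : m = 0 := by omega
      obtain rfl : n = 0 := by omega
      obtain ⟨φ, hφ⟩ := exists_enum s₁ hm
      obtain ⟨ψ, hψ⟩ := exists_enum s₂ hn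
      obtain ⟨θ, hθ⟩ := exists_enum t (n := 0) (by have := H.ncard_add_two; omega)
      obtain ⟨a, rfl⟩ := A.exists_ofEnum_eq hφ a
      obtain ⟨b, rfl⟩ := A.exists_ofEnum_eq hψ b
      rw [A.ofEnum_mem_iff] at ha hb
      rw [(C.isGlue_glue hγ H).pair φ ψ θ hφ hψ hθ,
        (C.isGlue_glue hγ' H.symm).pair ψ φ θ hψ hφ hθ, C.pair_symm hγ hγ' p q a b ha hb,
        LinearMap.map_intUnits_smul]

/-- A statement about gluing holds if it is invariant under the exchange of the factors and holds
for the operations of the operad. -/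
theorem glue_cases {P : Set F → Set F → F → F → Prop}
    (hsymm : ∀ s₁ s₂ x y, P s₂ s₁ y x → P s₁ s₂ x y)
    (hcirc : ∀ s₁ s₂ x y m n, x ∈ s₁ → y ∈ s₂ → s₁.ncard = m + 1 → s₂.ncard = n + 1 → 1 ≤ m →
      P s₁ s₂ x y)
    (hpair : ∀ s₁ s₂ x y, x ∈ s₁ → y ∈ s₂ → s₁.ncard = 1 → s₂.ncard = 1 → P s₁ s₂ x y)
    (s₁ s₂ : Set F) (x y : F) (hx : x ∈ s₁) (hy : y ∈ s₂) : P s₁ s₂ x y := by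
  have h1 : s₁.ncard ≠ 0 := Set.ncard_ne_zero_of_mem hx
  have h2 : s₂.ncard ≠ 0 := Set.ncard_ne_zero_of_mem hy
  obtain ⟨m, hm⟩ : ∃ m, s₁.ncard = m + 1 := ⟨s₁.ncard - 1, by omega⟩
  obtain ⟨n, hn⟩ : ∃ n, s₂.ncard = n + 1 := ⟨s₂.ncard - 1, by omega⟩
  by_cases hm1 : 1 ≤ m
  · exact hcirc _ _ _ _ m n hx hy hm hn hm1
  · by_cases hn1 : 1 ≤ n
    · exact hsymm _ _ _ _ (hcirc _ _ _ _ n m hy hx hn hm hn1)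
    · exact hpair _ _ _ _ hx hy (by omega) (by omega)

theorem glue_mem (hγ : g + h = γ) (H : GlueData s₁ s₂ t x y) {p q : ℤ}
    {a : A.onSet g s₁} {b : A.onSet h s₂} (ha : a ∈ A.onSetDeg g s₁ p)
    (hb : b ∈ A.onSetDeg h s₂ q) : C.glue hγ H a b ∈ A.onSetDeg γ t (p + q) := by
  refine glue_cases (P := fun s₁ s₂ x y => ∀ (g h : ℕ) (hγ : g + h = γ)
    (H : GlueData s₁ s₂ t x y) (p q : ℤ) (a : A.onSet g s₁) (b : A.onSet h s₂)
    (_ : a ∈ A.onSetDeg g s₁ p) (_ : b ∈ A.onSetDeg h s₂ q),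
      C.glue hγ H a b ∈ A.onSetDeg γ t (p + q)) ?_ ?_ ?_ s₁ s₂ x y H.left H.right g h hγ H p q a b
      ha hb
  · intro s₁ s₂ x y hP g h hγ H p q a b ha hb
    rw [C.glue_symm hγ (by omega) H ha hb, add_comm p q]
    exact Submodule.intUnits_smul_mem _ _ (hP _ _ _ _ _ _ _ _ hb ha)
  · intro s₁ s₂ x y m n hx hy hm hn h1 g h hγ H p q a b ha hb
    obtain ⟨φ, hφ, hx⟩ := exists_enum₁ hm ⟨1, by omega⟩ H.left
    obtain ⟨ψ, hψ, hy⟩ := exists_enum₁ hn 0 H.right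
    obtain ⟨a, rfl⟩ := A.exists_ofEnum_eq hφ a
    obtain ⟨b, rfl⟩ := A.exists_ofEnum_eq hψ b
    rw [A.ofEnum_mem_iff] at ha hb
    rw [(C.isGlue_glue hγ H).fst rfl 1 ⟨le_rfl, h1⟩ φ ψ hφ hψ hx hy, A.ofEnum_mem_iff]
    exact C.circ_mem _ _ _ _ _ _ _ _ ha hb
  · intro s₁ s₂ x y hx hy hm hn g h hγ H p q a b ha hb
    obtain ⟨φ, hφ⟩ := exists_enum s₁ hm
    obtain ⟨ψ, hψ⟩ := exists_enum s₂ hn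
    obtain ⟨θ, hθ⟩ := exists_enum t (n := 0) (by have := H.ncard_add_two; omega)
    obtain ⟨a, rfl⟩ := A.exists_ofEnum_eq hφ a
    obtain ⟨b, rfl⟩ := A.exists_ofEnum_eq hψ b
    rw [A.ofEnum_mem_iff] at ha hb
    rw [(C.isGlue_glue hγ H).pair φ ψ θ hφ hψ hθ, A.ofEnum_mem_iff]
    exact C.pair_mem _ _ _ _ _ ha hb

theorem glue_d (hγ : g + h = γ) (H : GlueData s₁ s₂ t x y) {p q : ℤ}
    {a : A.onSet g s₁} {b : A.onSet h s₂} (ha : a ∈ A.onSetDeg g s₁ p)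
    (hb : b ∈ A.onSetDeg h s₂ q) :
    A.onSetD γ t (C.glue hγ H a b) =
      C.glue hγ H (A.onSetD g s₁ a) b + p.negOnePow • C.glue hγ H a (A.onSetD h s₂ b) := by
  refine glue_cases (P := fun s₁ s₂ x y => ∀ (g h : ℕ) (hγ : g + h = γ)
    (H : GlueData s₁ s₂ t x y) (p q : ℤ) (a : A.onSet g s₁) (b : A.onSet h s₂)
    (_ : a ∈ A.onSetDeg g s₁ p) (_ : b ∈ A.onSetDeg h s₂ q),
      A.onSetD γ t (C.glue hγ H a b) =
      C.glue hγ H (A.onSetD g s₁ a) b + p.negOnePow • C.glue hγ H a (A.onSetD h s₂ b))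
      ?_ ?_ ?_ s₁ s₂ x y H.left H.right g h hγ H p q a b ha hb
  · intro s₁ s₂ x y hP g h hγ H p q a b ha hb
    have hγ' : h + g = γ := by omega
    rw [C.glue_symm hγ hγ' H ha hb, LinearMap.map_intUnits_smul, hP h g hγ' H.symm q p b a hb ha,
      C.glue_symm hγ hγ' H (A.onSetD_mem ha) hb, C.glue_symm hγ hγ' H ha (A.onSetD_mem hb),
      smul_add, smul_smul, smul_smul, add_comm, ← Int.negOnePow_add, ← Int.negOnePow_add]
    congr 2
    -- In the exchanged order `d` has moved past `b`, which costs `(-1)^q`; this is the difference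
    -- between the signs of degrees `p q` and `(p - 1) q`.
    · exact negOnePow_congr ⟨q, by ring⟩
    · exact negOnePow_congr ⟨0, by ring⟩
  · intro s₁ s₂ x y m n hx hy hm hn h1 g h hγ H p q a b ha hb
    obtain ⟨φ, hφ, hx⟩ := exists_enum₁ hm ⟨1, by omega⟩ H.left
    obtain ⟨ψ, hψ, hy⟩ := exists_enum₁ hn 0 H.right
    obtain ⟨a, rfl⟩ := A.exists_ofEnum_eq hφ a
    obtain ⟨b, rfl⟩ := A.exists_ofEnum_eq hψ b
    rw [A.ofEnum_mem_iff] at ha hb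
    simp only [A.onSetD_ofEnum, (C.isGlue_glue hγ H).fst rfl 1 ⟨le_rfl, h1⟩ φ ψ hφ hψ hx hy]
    rw [C.circ_d _ _ _ _ _ _ _ ha, map_add, LinearMap.map_intUnits_smul]
  · intro s₁ s₂ x y hx hy hm hn g h hγ H p q a b ha hb
    obtain ⟨φ, hφ⟩ := exists_enum s₁ hm
    obtain ⟨ψ, hψ⟩ := exists_enum s₂ hn
    obtain ⟨θ, hθ⟩ := exists_enum t (n := 0) (by have := H.ncard_add_two; omega)
    obtain ⟨a, rfl⟩ := A.exists_ofEnum_eq hφ a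
    obtain ⟨b, rfl⟩ := A.exists_ofEnum_eq hψ b
    rw [A.ofEnum_mem_iff] at ha hb
    simp only [A.onSetD_ofEnum, (C.isGlue_glue hγ H).pair φ ψ θ hφ hψ hθ]
    rw [C.pair_d _ _ _ _ ha, map_add, LinearMap.map_intUnits_smul]

/-- Gluing is natural for bijections. -/
theorem glue_push {F' : Type} [Finite F'] {f : F → F'} {s₁' s₂' t' : Set F'} {x' y' : F'}
    (hγ : g + h = γ) (H : GlueData s₁ s₂ t x y) (H' : GlueData s₁' s₂' t' x' y')
    (h₁ : Set.BijOn f s₁ s₁') (h₂ : Set.BijOn f s₂ s₂') (ht : Set.BijOn f t t') (hx : f x = x')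
    (hy : f y = y') {p q : ℤ} {a : A.onSet g s₁} {b : A.onSet h s₂}
    (ha : a ∈ A.onSetDeg g s₁ p) (hb : b ∈ A.onSetDeg h s₂ q) :
    C.glue hγ H' (A.push rfl f h₁ a) (A.push rfl f h₂ b) = A.push rfl f ht (C.glue hγ H a b) := by
  subst hx hy
  refine glue_cases (P := fun s₁ s₂ x y => ∀ (s₁' s₂' : Set F') (g h : ℕ) (hγ : g + h = γ)
    (H : GlueData s₁ s₂ t x y) (H' : GlueData s₁' s₂' t' (f x) (f y))
    (h₁ : Set.BijOn f s₁ s₁') (h₂ : Set.BijOn f s₂ s₂')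
    (p q : ℤ) (a : A.onSet g s₁) (b : A.onSet h s₂)
    (_ : a ∈ A.onSetDeg g s₁ p) (_ : b ∈ A.onSetDeg h s₂ q),
      C.glue hγ H' (A.push rfl f h₁ a) (A.push rfl f h₂ b) = A.push rfl f ht (C.glue hγ H a b))
      ?_ ?_ ?_ s₁ s₂ x y H.left H.right s₁' s₂' g h hγ H H' h₁ h₂ p q a b ha hb
  · intro s₁ s₂ x y hP s₁' s₂' g h hγ H H' h₁ h₂ p q a b ha hb
    have hγ' : h + g = γ := by omega
    rw [C.glue_symm hγ hγ' H ha hb, C.glue_symm hγ hγ' H' (A.push_mem _ _ ha) (A.push_mem _ _ hb),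
      LinearMap.map_intUnits_smul, hP _ _ h g hγ' H.symm H'.symm h₂ h₁ q p b a hb ha]
  · intro s₁ s₂ x y m n hx hy hm hn h1 s₁' s₂' g h hγ H H' h₁ h₂ p q a b ha hb
    obtain ⟨φ, hφ, hx⟩ := exists_enum₁ hm ⟨1, by omega⟩ H.left
    obtain ⟨ψ, hψ, hy⟩ := exists_enum₁ hn 0 H.right
    obtain ⟨a, rfl⟩ := A.exists_ofEnum_eq hφ a
    obtain ⟨b, rfl⟩ := A.exists_ofEnum_eq hψ b
    rw [A.push_ofEnum, A.push_ofEnum, (C.isGlue_glue hγ H).fst rfl 1 ⟨le_rfl, h1⟩ φ ψ hφ hψ hx hy,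
      (C.isGlue_glue hγ H').fst rfl 1 ⟨le_rfl, h1⟩ (f ∘ φ) (f ∘ ψ) (h₁.comp hφ) (h₂.comp hψ)
        (congrArg f hx) (congrArg f hy), A.push_ofEnum]
    refine A.ofEnum_congr _ _ (fun j => ?_) _
    unfold cat
    dsimp only [Function.comp_apply]
    split_ifs <;> rfl
  · intro s₁ s₂ x y hx hy hm hn s₁' s₂' g h hγ H H' h₁ h₂ p q a b ha hb
    obtain ⟨φ, hφ⟩ := exists_enum s₁ hm
    obtain ⟨ψ, hψ⟩ := exists_enum s₂ hn
    obtain ⟨θ, hθ⟩ := exists_enum t (n := 0) (by have := H.ncard_add_two; omega)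
    obtain ⟨a, rfl⟩ := A.exists_ofEnum_eq hφ a
    obtain ⟨b, rfl⟩ := A.exists_ofEnum_eq hψ b
    rw [A.push_ofEnum, A.push_ofEnum, (C.isGlue_glue hγ H).pair φ ψ θ hφ hψ hθ,
      (C.isGlue_glue hγ H').pair (f ∘ φ) (f ∘ ψ) (f ∘ θ) (h₁.comp hφ) (h₂.comp hψ) (ht.comp hθ),
      A.push_ofEnum]

end Glue

/-! ### Associativity of gluing -/

section Assoc

variable {F : Type} [Finite F] {g₁ g₂ g₃ g₁₂ g₂₃ γ : ℕ} {s₁ s₂ s₃ s₁₂ s₂₃ t : Set F} {x y z w : F}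

/-- With `x` an input of `a`, with `y` the output and `z` the first input of `b`, and with `w` the
output of `c`, the identity is `circ_sequential` for `i = j = 1`. The extra label of `s₁` is needed
for `x` not to be the output. -/
theorem glue_assoc_of_two_le (h₁₂ : g₁ + g₂ = g₁₂) (h₁₂' : g₁₂ + g₃ = γ) (h₂₃ : g₂ + g₃ = g₂₃)
    (h₂₃' : g₁ + g₂₃ = γ) (H₁₂ : GlueData s₁ s₂ s₁₂ x y) (H₁₂' : GlueData s₁₂ s₃ t z w)
    (H₂₃ : GlueData s₂ s₃ s₂₃ z w) (H₂₃' : GlueData s₁ s₂₃ t x y) (hs₁ : 2 ≤ s₁.ncard)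
    (a : A.onSet g₁ s₁) (b : A.onSet g₂ s₂) (c : A.onSet g₃ s₃) :
    C.glue h₁₂' H₁₂' (C.glue h₁₂ H₁₂ a b) c = C.glue h₂₃' H₂₃' a (C.glue h₂₃ H₂₃ b c) := by
  -- The label `z` still exists after `y` has been glued.
  have hyz : y ≠ z := by
    rintro rfl
    rcases (H₁₂.mem_iff y).1 H₁₂'.left with h | h
    · exact H₁₂.ne_of_mem h.1 H₁₂.right rfl
    · exact h.2 rfl
  have hs₂ : 1 < s₂.ncard := (Set.one_lt_ncard).2 ⟨y, H₁₂.right, z, H₂₃.left, hyz⟩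
  have hs₃ : s₃.ncard ≠ 0 := Set.ncard_ne_zero_of_mem H₂₃.right
  obtain ⟨l, hl⟩ : ∃ l, s₁.ncard = l + 1 := ⟨s₁.ncard - 1, by omega⟩
  obtain ⟨m, hm⟩ : ∃ m, s₂.ncard = m + 1 := ⟨s₂.ncard - 1, by omega⟩
  obtain ⟨n, hn⟩ : ∃ n, s₃.ncard = n + 1 := ⟨s₃.ncard - 1, by omega⟩
  obtain ⟨φ, hφ, hx⟩ := exists_enum₁ hl ⟨1, by omega⟩ H₁₂.left
  obtain ⟨ψ, hψ, hy, hz⟩ := exists_enum₂ hm (i := 0) (j := ⟨1, by omega⟩) (by simp [Fin.ext_iff])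
    H₁₂.right H₂₃.left hyz
  obtain ⟨χ, hχ, hw⟩ := exists_enum₁ hn 0 H₂₃.right
  obtain ⟨a, rfl⟩ := A.exists_ofEnum_eq hφ a
  obtain ⟨b, rfl⟩ := A.exists_ofEnum_eq hψ b
  obtain ⟨c, rfl⟩ := A.exists_ofEnum_eq hχ c
  obtain ⟨r₁, hr₁⟩ : ∃ r₁, l + m = r₁ + 1 := ⟨l + m - 1, by omega⟩
  obtain ⟨r₂, hr₂⟩ : ∃ r₂, m + n = r₂ + 1 := ⟨m + n - 1, by omega⟩
  rw [(C.isGlue_glue h₁₂ H₁₂).fst hr₁ 1 ⟨le_rfl, by omega⟩ φ ψ hφ hψ hx hy,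
    (C.isGlue_glue h₂₃ H₂₃).fst hr₂ 1 ⟨le_rfl, by omega⟩ ψ χ hψ hχ hz hw]
  rw [(C.isGlue_glue h₁₂' H₁₂').fst (s := r₁ + n) rfl (1 + 1 - 1) ⟨le_rfl, by omega⟩ _ χ _ hχ
    ?_ hw, (C.isGlue_glue h₂₃' H₂₃').fst (s := r₁ + n) (by omega) 1 ⟨le_rfl, by omega⟩ φ _ hφ _ hx
    ?_]
  · rw [C.circ_sequential h₁₂ h₂₃ h₁₂' h₂₃' hr₁ hr₂ rfl (by omega) 1 1]
    exact A.ofEnum_congr _ _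
      (cat_assoc hr₁ hr₂ rfl (by omega) 1 1 ⟨le_rfl, by omega⟩ ⟨le_rfl, by omega⟩ φ ψ χ) _
  · rw [cat_of_lt hr₂ 1 (by omega) ψ χ _ (by simp) 0 (by simp), hy]
  · rw [cat_of_mid hr₁ 1 (by omega) φ ψ _ (by simp) (by simp; omega) ⟨1, by omega⟩ (by simp), hz]

/-- Gluing along the two edges of a tree with three vertices does not depend on the order. -/
theorem glue_assoc (h₁₂ : g₁ + g₂ = g₁₂) (h₁₂' : g₁₂ + g₃ = γ) (h₂₃ : g₂ + g₃ = g₂₃)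
    (h₂₃' : g₁ + g₂₃ = γ) (H₁₂ : GlueData s₁ s₂ s₁₂ x y) (H₁₂' : GlueData s₁₂ s₃ t z w)
    (H₂₃ : GlueData s₂ s₃ s₂₃ z w) (H₂₃' : GlueData s₁ s₂₃ t x y) {p q r : ℤ}
    {a : A.onSet g₁ s₁} {b : A.onSet g₂ s₂} {c : A.onSet g₃ s₃} (ha : a ∈ A.onSetDeg g₁ s₁ p)
    (hb : b ∈ A.onSetDeg g₂ s₂ q) (hc : c ∈ A.onSetDeg g₃ s₃ r) :
    C.glue h₁₂' H₁₂' (C.glue h₁₂ H₁₂ a b) c = C.glue h₂₃' H₂₃' a (C.glue h₂₃ H₂₃ b c) := by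
  by_cases hs₁ : 2 ≤ s₁.ncard
  · exact C.glue_assoc_of_two_le h₁₂ h₁₂' h₂₃ h₂₃' H₁₂ H₁₂' H₂₃ H₂₃' hs₁ a b c
  -- Read from the other end, the tree satisfies the assumption of the previous lemma; both sides
  -- then carry the sign `(-1)^{pq+pr+qr}`.
  by_cases hs₃ : 2 ≤ s₃.ncard
  · have e := C.glue_assoc_of_two_le (by omega : g₃ + g₂ = g₂₃) (by omega : g₂₃ + g₁ = γ)
      (by omega : g₂ + g₁ = g₁₂) (by omega : g₃ + g₁₂ = γ) H₂₃.symm H₂₃'.symm H₁₂.symm H₁₂'.symm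
      hs₃ c b a
    rw [C.glue_symm h₁₂' (by omega) H₁₂' (C.glue_mem h₁₂ H₁₂ ha hb) hc,
      C.glue_symm h₁₂ (by omega) H₁₂ ha hb, C.glue_symm h₂₃' (by omega) H₂₃' ha
        (C.glue_mem h₂₃ H₂₃ hb hc), C.glue_symm h₂₃ (by omega) H₂₃ hb hc]
    simp only [LinearMap.map_intUnits_smul, LinearMap.smul_apply, smul_smul, ← Int.negOnePow_add]
    have e1 : ∀ (ε : ℤˣ), C.glue (by omega : g₂₃ + g₁ = γ) H₂₃'.symm
        (ε • C.glue (by omega : g₃ + g₂ = g₂₃) H₂₃.symm c b) a =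
        ε • C.glue (by omega : g₂₃ + g₁ = γ) H₂₃'.symm
        (C.glue (by omega : g₃ + g₂ = g₂₃) H₂₃.symm c b) a := by
      intro ε
      rw [LinearMap.map_intUnits_smul]
      rfl
    have e2 : ∀ ε ε' : ℤˣ, ε = ε' → ε • C.glue (by omega : g₂₃ + g₁ = γ) H₂₃'.symm
        (C.glue (by omega : g₃ + g₂ = g₂₃) H₂₃.symm c b) a =
        ε' • C.glue (by omega : g₂₃ + g₁ = γ) H₂₃'.symm
        (C.glue (by omega : g₃ + g₂ = g₂₃) H₂₃.symm c b) a := fun ε ε' h => by rw [h]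
    rw [← e]
    exact e2 _ _ (negOnePow_congr ⟨0, by ring⟩)
  have hyz : y ≠ z := by
    rintro rfl
    rcases (H₁₂.mem_iff y).1 H₁₂'.left with h | h
    · exact H₁₂.ne_of_mem h.1 H₁₂.right rfl
    · exact h.2 rfl
  have hs₂ : 1 < s₂.ncard := (Set.one_lt_ncard).2 ⟨y, H₁₂.right, z, H₂₃.left, hyz⟩
  have hs₁0 : s₁.ncard ≠ 0 := Set.ncard_ne_zero_of_mem H₁₂.left
  have hs₃0 : s₃.ncard ≠ 0 := Set.ncard_ne_zero_of_mem H₂₃.right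
  obtain ⟨m, hm⟩ : ∃ m, s₂.ncard = m + 1 := ⟨s₂.ncard - 1, by omega⟩
  obtain ⟨φ, hφ, hx⟩ := exists_enum₁ (n := 1) (by omega) 0 H₁₂.left
  obtain ⟨χ, hχ, hw⟩ := exists_enum₁ (n := 1) (by omega) 0 H₂₃.right
  obtain ⟨a, rfl⟩ := A.exists_ofEnum_eq hφ a
  obtain ⟨c, rfl⟩ := A.exists_ofEnum_eq hχ c
  rw [A.ofEnum_mem_iff] at ha hc
  -- Now `a` and `c` have one label each, and `b` has to be the first factor in both gluings. A
  -- third label of `b` can serve as its output, which makes `y` and `z` inputs, and the identity is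
  -- `circ_parallel`.
  by_cases hm2 : 2 ≤ m
  · obtain ⟨ψ, hψ, hy, hz⟩ := exists_enum₂ hm (i := ⟨1, by omega⟩) (j := ⟨2, by omega⟩)
      (by simp) H₁₂.right H₂₃.left hyz
    obtain ⟨b, rfl⟩ := A.exists_ofEnum_eq hψ b
    rw [A.ofEnum_mem_iff] at hb
    obtain ⟨r, rfl⟩ : ∃ r, m = r + 1 := ⟨m - 1, by omega⟩
    rw [(C.isGlue_glue h₁₂ H₁₂).snd (by omega : g₂ + g₁ = g₁₂) (s := r + 1) (n := 0) rfl 1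
      ⟨le_rfl, by omega⟩ ψ φ hψ hφ hy hx p q b a ha hb,
      (C.isGlue_glue h₂₃ H₂₃).fst (s := r + 1) (n := 0) rfl 2 ⟨by omega, by omega⟩ ψ χ hψ hχ hz hw,
      LinearMap.map_intUnits_smul, LinearMap.smul_apply]
    rw [(C.isGlue_glue h₁₂' H₁₂').fst (s := r) (n := 0) rfl (2 + 0 - 1) ⟨by omega, by omega⟩ _ χ _
      hχ ?_ hw, (C.isGlue_glue h₂₃' H₂₃').snd (by omega : g₂₃ + g₁ = γ) (s := r) (n := 0) rfl 1
      ⟨by omega, by omega⟩ _ φ _ hφ ?_ hx p _ _ a ha (C.circ_mem _ _ _ _ _ _ _ _ hb hc)]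
    · rw [C.circ_parallel (γ := γ) (γ₁ := g₁₂) (γ₂ := g₂₃) (s := r) (by omega) h₂₃ h₁₂' (by omega)
        (l := 0) (m := 0) rfl rfl rfl rfl 1 2 (by omega) (by omega) (by omega) p _ b a c ha hc,
        LinearMap.map_intUnits_smul, smul_smul, ← Int.negOnePow_add]
      refine congrArg₂ _ (negOnePow_congr ⟨0, by ring⟩) ?_
      refine A.ofEnum_congr _ _ (fun j => ?_) _
      exact cat_parallel (l := r + 1) (m := 0) (n := 0) rfl rfl rfl rfl 1 2 (by omega) (by omega)
        (by omega) ψ φ χ j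
    · rw [cat_of_lt (m := r + 1) (n := 0) rfl 2 (by omega) ψ χ _ (by simp) ⟨1, by omega⟩ (by simp),
        hy]
    · rw [cat_of_ge (m := r + 1) (n := 0) rfl 1 (by omega) ψ φ _ (by simp) ⟨2, by omega⟩ (by simp),
        hz]
  -- The only labels of `b` are `y` and `z`, so one of them has to be the output: `y` is the input
  -- of `b` and `z` the input of `b^*`. The identity is `pair_circ`, together with the symmetry of
  -- the pairing.
  · obtain rfl : m = 1 := by omega
    obtain ⟨ψ, hψ, hz, hy⟩ := exists_enum₂ hm (i := 0) (j := 1) (by simp) H₂₃.left H₁₂.right hyz.symm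
    obtain ⟨b, rfl⟩ := A.exists_ofEnum_eq hψ b
    rw [A.ofEnum_mem_iff] at hb
    have hψ' := hψ.comp ((finRotate 2)⁻¹).bijective.bijOn_univ
    have e : A.ofEnum ψ hψ b = A.ofEnum _ hψ' (A.star (n := 1) b) := by
      rw [StableSModule.star, A.ofEnum_act]
      refine A.ofEnum_congr _ _ (fun j => ?_) _
      simp
    have hstar : A.star (n := 1) b ∈ A.deg g₂ (1 + 1) q := A.act_mem _ _ _ _ _ hb
    have hz' : (ψ ∘ ⇑(finRotate 2)⁻¹) ⟨1, by omega⟩ = z := hz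
    have hw' : (ψ ∘ ⇑(finRotate 2)⁻¹) 0 = y := hy
    obtain ⟨θ, hθ⟩ := exists_enum t (n := 0) (by
      have := H₁₂.ncard_add_two
      have := H₁₂'.ncard_add_two
      omega)
    rw [(C.isGlue_glue h₁₂ H₁₂).snd (by omega : g₂ + g₁ = g₁₂) (s := 1) (n := 0) rfl 1
      ⟨le_rfl, by omega⟩ ψ φ hψ hφ hy hx p q b a ha hb, e,
      (C.isGlue_glue h₂₃ H₂₃).fst (s := 1) (n := 0) rfl 1 ⟨by omega, by omega⟩ _ χ hψ' hχ hz' hw,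
      LinearMap.map_intUnits_smul, LinearMap.smul_apply,
      (C.isGlue_glue h₁₂' H₁₂').pair _ χ θ _ hχ hθ, (C.isGlue_glue h₂₃' H₂₃').pair φ _ θ hφ _ hθ,
      C.pair_circ (by omega) h₂₃ h₁₂' (by omega) p r b a c ha hc,
      C.pair_symm h₂₃' (by omega) p (q + r) a _ ha
        (C.circ_mem _ _ _ _ _ _ _ _ hstar hc),
      LinearMap.map_intUnits_smul, LinearMap.map_intUnits_smul, smul_smul, ← Int.negOnePow_add]
    exact congrArg₂ _ (negOnePow_congr ⟨0, by ring⟩) rfl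

end Assoc

end StableGradedCyclicOperad

/-! ### Contractions of subsets of an ambient set -/

section LoopData

variable {F : Type}

/-- The set `t` arises from `s` by removing two distinct elements `x` and `y`. -/
structure LoopData (s t : Set F) (x y : F) : Prop where
  left : x ∈ s
  right : y ∈ s
  ne : x ≠ y
  mem_iff : ∀ z, z ∈ t ↔ z ∈ s ∧ z ≠ x ∧ z ≠ y

theorem LoopData.symm {s t : Set F} {x y : F} (H : LoopData s t x y) : LoopData s t y x :=
  ⟨H.right, H.left, H.ne.symm, fun z => by rw [H.mem_iff, and_comm (a := z ≠ x)]⟩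

theorem LoopData.ncard_add_two [Finite F] {s t : Set F} {x y : F} (H : LoopData s t x y) :
    t.ncard + 2 = s.ncard := by
  have e : t = (s \ {x}) \ {y} := by
    ext z
    simp [H.mem_iff, and_assoc]
  have h1 := Set.ncard_sdiff_singleton_add_one H.left
  have h2 := Set.ncard_sdiff_singleton_add_one (s := s \ {x}) (a := y) ⟨H.right, H.ne.symm⟩
  rw [e]
  omega

/-- The bijection between the two forms of the set of labels that remain after a contraction. -/
def LoopData.equiv {s t : Set F} {x y : F} (H : LoopData s t x y) :
    {z : s // z ≠ ⟨x, H.left⟩ ∧ z ≠ ⟨y, H.right⟩} ≃ t where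
  toFun z := ⟨z.1.1, (H.mem_iff _).2 ⟨z.1.2, fun e => z.2.1 (Subtype.ext e),
    fun e => z.2.2 (Subtype.ext e)⟩⟩
  invFun z := ⟨⟨z.1, ((H.mem_iff _).1 z.2).1⟩,
    fun e => ((H.mem_iff _).1 z.2).2.1 (congrArg Subtype.val e),
    fun e => ((H.mem_iff _).1 z.2).2.2 (congrArg Subtype.val e)⟩
  left_inv _ := rfl
  right_inv _ := rfl

theorem LoopData.push {F' : Type} {s t : Set F} {x y : F} (H : LoopData s t x y) {f : F → F'}
    {s' : Set F'} (h : Set.BijOn f s s') : LoopData s' (f '' t) (f x) (f y) := by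
  refine ⟨h.mapsTo H.left, h.mapsTo H.right, fun e => H.ne (h.injOn H.left H.right e), ?_⟩
  intro z
  rw [← h.image_eq]
  constructor
  · rintro ⟨w, hw, rfl⟩
    obtain ⟨h1, h2, h3⟩ := (H.mem_iff w).1 hw
    exact ⟨⟨w, h1, rfl⟩, fun e => h2 (h.injOn h1 H.left e), fun e => h3 (h.injOn h1 H.right e)⟩
  · rintro ⟨⟨w, hw, rfl⟩, h1, h2⟩
    exact ⟨w, (H.mem_iff w).2 ⟨hw, fun e => h1 (e ▸ rfl), fun e => h2 (e ▸ rfl)⟩, rfl⟩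

end LoopData

namespace Contractions

variable {k : Type u} [Field k] {A : StableSModule.{u, v} k} (X : Contractions A)

section Loop

variable {F : Type} [Finite F] {g g' : ℕ} {s t : Set F} {x y : F}

/-- The contraction `A((g,s)) → A((g+1,t))` of the labels `x, y ∈ s`. -/
def loop (hg : g + 1 = g') (H : LoopData s t x y) : A.onSet g s →ₗ[k] A.onSet g' t :=
  A.relabel hg H.equiv ∘ₗ X.xi ⟨x, H.left⟩ ⟨y, H.right⟩ (fun e => H.ne (congrArg Subtype.val e))

theorem loop_mem (hg : g + 1 = g') (H : LoopData s t x y) {p : ℤ} {a : A.onSet g s}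
    (ha : a ∈ A.onSetDeg g s p) : X.loop hg H a ∈ A.onSetDeg g' t p :=
  A.relabel_mem _ _ (X.xi_mem _ _ _ _ _ ha)

theorem loop_d (hg : g + 1 = g') (H : LoopData s t x y) (a : A.onSet g s) :
    A.onSetD g' t (X.loop hg H a) = X.loop hg H (A.onSetD g s a) := by
  rw [loop, LinearMap.comp_apply, A.onSetD_relabel, X.xi_d]
  rfl

theorem loop_symm (hg : g + 1 = g') (H : LoopData s t x y) (a : A.onSet g s) :
    X.loop hg H.symm a = X.loop hg H a := by
  rw [loop, LinearMap.comp_apply, X.xi_symm ⟨x, H.left⟩ ⟨y, H.right⟩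
    (fun e => H.ne (congrArg Subtype.val e)), A.relabel_relabel]
  rfl

/-- The equivariance of `ξ` for a label set outside the ambient set. The bijection `e` of the
remaining labels is forced by `τ` but kept as a variable, so that it can be supplied in whatever
form it occurs. -/
theorem loop_relabel (hg : g + 1 = g') (H : LoopData s t x y) {I : Type} [Finite I] (τ : I ≃ s)
    (i j : I) (hij : i ≠ j) (hi : (τ i : F) = x) (hj : (τ j : F) = y)
    (e : {z : I // z ≠ i ∧ z ≠ j} ≃ t) (he : ∀ z, (e z : F) = τ z.1) (a : A.onSet g I) :
    X.loop hg H (A.relabel rfl τ a) = A.relabel hg e (X.xi i j hij a) := by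
  subst hi hj
  have := X.xi_equivariant τ i j hij a
  rw [loop, LinearMap.comp_apply]
  refine (congrArg _ this).trans ?_
  rw [A.relabel_relabel]
  congr 2
  ext z
  exact (he z).symm

theorem loop_push {F' : Type} [Finite F'] (hg : g + 1 = g') {s' t' : Set F'} {x' y' : F'}
    (H : LoopData s t x y) (H' : LoopData s' t' x' y') {f : F → F'} (h : Set.BijOn f s s')
    (ht : Set.BijOn f t t') (hx : f x = x') (hy : f y = y') (a : A.onSet g s) :
    X.loop hg H' (A.push rfl f h a) = A.push rfl f ht (X.loop hg H a) := by
  rw [StableSModule.push, X.loop_relabel hg H' (h.equiv f) ⟨x, H.left⟩ ⟨y, H.right⟩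
    (fun e => H.ne (congrArg Subtype.val e)) hx hy (H.equiv.trans (ht.equiv f)) (fun _ => rfl),
    loop, LinearMap.comp_apply, StableSModule.push, A.relabel_relabel]

/-- `Commute` speaks of iterated subtypes. Both sides are carried to such subtypes by
`loop_relabel`, and the bijections match because none of them changes the underlying flag. -/
theorem loop_loop (hX : X.Commute) {g'' : ℕ} (hg : g + 1 = g') (hg' : g' + 1 = g'')
    {s₁ s₂ : Set F} {z w : F} (H₁ : LoopData s s₁ x y) (H₁' : LoopData s₁ t z w)
    (H₂ : LoopData s s₂ z w) (H₂' : LoopData s₂ t x y) (a : A.onSet g s) :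
    X.loop hg' H₁' (X.loop hg H₁ a) = X.loop hg' H₂' (X.loop hg H₂ a) := by
  subst hg hg'
  have hz := (H₁.mem_iff z).1 H₁'.left
  have hw := (H₁.mem_iff w).1 H₁'.right
  have key := hX g s ⟨z, hz.1⟩ ⟨w, hw.1⟩ ⟨x, H₁.left⟩ ⟨y, H₁.right⟩
    (fun e => H₁'.ne (congrArg Subtype.val e)) (fun e => H₁.ne (congrArg Subtype.val e))
    (fun e => hz.2.1 (congrArg Subtype.val e)) (fun e => hz.2.2 (congrArg Subtype.val e))
    (fun e => hw.2.1 (congrArg Subtype.val e)) (fun e => hw.2.2 (congrArg Subtype.val e)) a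
  have hp : ∀ z' : {z' : s // z' ≠ ⟨x, H₁.left⟩ ∧ z' ≠ ⟨y, H₁.right⟩},
      (z' ≠ ⟨⟨z, hz.1⟩, fun e => hz.2.1 (congrArg Subtype.val e),
        fun e => hz.2.2 (congrArg Subtype.val e)⟩ ∧ z' ≠ ⟨⟨w, hw.1⟩,
        fun e => hw.2.1 (congrArg Subtype.val e), fun e => hw.2.2 (congrArg Subtype.val e)⟩) ↔
      (H₁.equiv z' ≠ ⟨z, H₁'.left⟩ ∧ H₁.equiv z' ≠ ⟨w, H₁'.right⟩) := by
    intro z'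
    simp only [LoopData.equiv, Equiv.coe_fn_mk, ne_eq, Subtype.ext_iff]
  have l₁ := X.loop_relabel rfl H₁' H₁.equiv
    ⟨⟨z, hz.1⟩, fun e => hz.2.1 (congrArg Subtype.val e), fun e => hz.2.2 (congrArg Subtype.val e)⟩
    ⟨⟨w, hw.1⟩, fun e => hw.2.1 (congrArg Subtype.val e), fun e => hw.2.2 (congrArg Subtype.val e)⟩
    (fun e => H₁'.ne (congrArg (fun u => (u.1.1 : F)) e)) rfl rfl
    ((H₁.equiv.subtypeEquiv hp).trans H₁'.equiv) (fun _ => rfl)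
    (X.xi ⟨x, H₁.left⟩ ⟨y, H₁.right⟩ (fun e => H₁.ne (congrArg Subtype.val e)) a)
  have hz' := (H₂.mem_iff x).1 H₂'.left
  have hw' := (H₂.mem_iff y).1 H₂'.right
  have l₂ := X.loop_relabel rfl H₂' H₂.equiv
    ⟨⟨x, H₁.left⟩, fun e => hz'.2.1 (congrArg Subtype.val e),
      fun e => hz'.2.2 (congrArg Subtype.val e)⟩
    ⟨⟨y, H₁.right⟩, fun e => hw'.2.1 (congrArg Subtype.val e),
      fun e => hw'.2.2 (congrArg Subtype.val e)⟩
    (fun e => H₂'.ne (congrArg (fun u => (u.1.1 : F)) e)) rfl rfl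
    ((removeSwap (fun e => hz.2.1 (congrArg Subtype.val e))
      (fun e => hz.2.2 (congrArg Subtype.val e)) (fun e => hw.2.1 (congrArg Subtype.val e))
      (fun e => hw.2.2 (congrArg Subtype.val e))).symm.trans
      ((H₁.equiv.subtypeEquiv hp).trans H₁'.equiv)) (fun _ => rfl)
    (X.xi ⟨z, hz.1⟩ ⟨w, hw.1⟩ (fun e => H₁'.ne (congrArg Subtype.val e)) a)
  refine l₁.trans (Eq.trans ?_ l₂.symm)
  rw [← key, A.relabel_relabel]
  congr 2

end Loop

/-! ### Contractions in terms of enumerations -/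

/-- An order-preserving numbering is unique, so it suffices that skipping `i` and `i + 1` is
strictly monotone and hits every remaining label. -/
theorem restNumbering_succ {n i : ℕ} (hi : i ≤ n)
    (h : (⟨i, by omega⟩ : Fin (n + 2)) ≠ ⟨i + 1, by omega⟩) (x : Fin n) :
    ((restNumbering ⟨i, by omega⟩ ⟨i + 1, by omega⟩ h x).1 : ℕ) =
      if (x : ℕ) < i then (x : ℕ) else x + 2 := by
  let f : Fin n → {x : Fin (n + 2) // x ≠ ⟨i, by omega⟩ ∧ x ≠ ⟨i + 1, by omega⟩} := fun x =>
    ⟨⟨if (x : ℕ) < i then (x : ℕ) else x + 2, by split_ifs <;> omega⟩, by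
      simp only [ne_eq, Fin.mk.injEq]; split_ifs <;> omega⟩
  have hf : StrictMono f := by
    intro a b hab
    simp only [f, Subtype.mk_lt_mk, Fin.mk_lt_mk]
    have : (a : ℕ) < b := hab
    split_ifs <;> omega
  have hs : Function.Surjective f := by
    rintro ⟨z, h1, h2⟩
    simp only [ne_eq, Fin.ext_iff] at h1 h2
    by_cases hz : (z : ℕ) < i
    · exact ⟨⟨z, by omega⟩, by simp [f, hz]⟩
    · refine ⟨⟨z - 2, by omega⟩, ?_⟩
      simp only [f, Subtype.mk.injEq, Fin.ext_iff]
      split_ifs <;> omega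
  have : restNumbering ⟨i, by omega⟩ ⟨i + 1, by omega⟩ h =
      (hf.orderIsoOfSurjective f hs).toEquiv := by
    unfold restNumbering
    exact congrArg _ (Subsingleton.elim _ _)
  rw [this]
  rfl

section Del

variable {F : Type}

/-- Removal of the values of an enumeration at `i` and `i + 1`. -/
def _root_.del {n : ℕ} (i : ℕ) (φ : Fin (n + 2) → F) (x : Fin n) : F :=
  if (x : ℕ) < i then φ ⟨x, by omega⟩ else φ ⟨x + 2, by omega⟩

theorem _root_.bijOn_del {n i : ℕ} (hi : i ≤ n) {φ : Fin (n + 2) → F} {s t : Set F} {x y : F}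
    (H : LoopData s t x y) (hφ : Set.BijOn φ Set.univ s) (hx : φ ⟨i, by omega⟩ = x)
    (hy : φ ⟨i + 1, by omega⟩ = y) : Set.BijOn (del i φ) Set.univ t := by
  subst hx hy
  refine ⟨fun z _ => ?_, fun z _ w _ e => ?_, fun z hz => ?_⟩
  · rw [H.mem_iff]
    unfold del
    split_ifs with h
    · refine ⟨hφ.mapsTo trivial, ?_, ?_⟩ <;>
      · rw [ne_eq, hφ.apply_eq_iff, Fin.ext_iff]
        dsimp only
        omega
    · refine ⟨hφ.mapsTo trivial, ?_, ?_⟩ <;>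
      · rw [ne_eq, hφ.apply_eq_iff, Fin.ext_iff]
        dsimp only
        omega
  · unfold del at e
    apply Fin.ext
    split_ifs at e <;>
    · rw [hφ.apply_eq_iff, Fin.ext_iff] at e
      dsimp only at e
      omega
  · obtain ⟨h1, h2, h3⟩ := (H.mem_iff z).1 hz
    obtain ⟨w, -, rfl⟩ := hφ.surjOn h1
    rw [ne_eq, hφ.apply_eq_iff, Fin.ext_iff] at h2 h3
    dsimp only at h2 h3
    by_cases hw : (w : ℕ) < i
    · exact ⟨⟨w, by omega⟩, trivial, by simp [del, hw]⟩
    · refine ⟨⟨w - 2, by omega⟩, trivial, ?_⟩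
      unfold del
      rw [if_neg (by dsimp only; omega)]
      exact congrArg φ (Fin.ext (by dsimp only; omega))

/-- Passes between `loop` and numbered contractions of two neighbouring labels, which are the only
ones occurring in the numbered relations. -/
theorem loop_ofEnum [Finite F] {g n i : ℕ} (hi : i ≤ n) {φ : Fin (n + 2) → F} {s t : Set F}
    {x y : F} (H : LoopData s t x y) (hφ : Set.BijOn φ Set.univ s) (hx : φ ⟨i, by omega⟩ = x)
    (hy : φ ⟨i + 1, by omega⟩ = y) (h : (⟨i, by omega⟩ : Fin (n + 2)) ≠ ⟨i + 1, by omega⟩)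
    (a : A.obj g (n + 2)) :
    X.loop rfl H (A.ofEnum φ hφ a) =
      A.ofEnum (del i φ) (bijOn_del hi H hφ hx hy)
        (X.xiFin ⟨i, by omega⟩ ⟨i + 1, by omega⟩ h a) := by
  have h1 : A.ofEnum φ hφ a = A.relabel rfl ((Equiv.Set.univ _).symm.trans (hφ.equiv φ))
      (A.cls (Equiv.refl _) a) := by
    rw [A.relabel_cls]
    rfl
  have hd := bijOn_del hi H hφ hx hy
  let e : {z : Fin (n + 2) // z ≠ ⟨i, by omega⟩ ∧ z ≠ ⟨i + 1, by omega⟩} ≃ t :=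
    (restNumbering _ _ h).symm.trans ((Equiv.Set.univ _).symm.trans (hd.equiv _))
  have he : ∀ z, (e z : F) = ((Equiv.Set.univ _).symm.trans (hφ.equiv φ)) z.1 := by
    intro z
    obtain ⟨w, rfl⟩ := (restNumbering _ _ h).surjective z
    have h2 := restNumbering_succ hi h w
    have h3 : (e (restNumbering _ _ h w) : F) = del i φ w := by
      simp only [e, Equiv.trans_apply, Equiv.symm_apply_apply]
      rfl
    rw [h3]
    change _ = φ _
    unfold del
    split_ifs with hw
    · rw [if_pos hw] at h2
      exact congrArg φ (Fin.ext h2.symm)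
    · rw [if_neg hw] at h2
      exact congrArg φ (Fin.ext h2.symm)
  rw [h1, X.loop_relabel rfl H _ ⟨i, by omega⟩ ⟨i + 1, by omega⟩ h hx hy e he]
  have h4 : X.xi _ _ h (A.cls (Equiv.refl _) a) = A.cls (restNumbering _ _ h)
      (X.xiFin _ _ h a) := by
    exact ((A.numbering (g + 1) (restNumbering _ _ h)).apply_symm_apply _).symm
  rw [h4, A.relabel_cls]
  unfold StableSModule.ofEnum
  congr 2
  ext w
  simp [e]

end Del

end Contractions

/-! ### The numbered relations as relations between gluing and contraction -/

section Relations

variable {k : Type u} [Field k] {A : StableSModule.{u, v} k} (C : StableGradedCyclicOperad A)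
  (X : Contractions A) {F : Type} [Finite F] {g h γ : ℕ} {s₁ s₂ s₁' s s' t : Set F} {x y z w : F}

/-- With `x` at the last place and `z`, `w` at places `1`, `2`, the remaining labels come in the
same order on both sides, and `ofEnum` is injective. One direction of the equivalence serves the
sufficiency of the relations, the other one their necessity. -/
theorem loop_glue_left_iff (hγ : g + h = γ) (hγ' : g + 1 + h = γ + 1) (H : GlueData s₁ s₂ s x y)
    (H' : LoopData s t z w) (H₁ : LoopData s₁ s₁' z w) (H₁' : GlueData s₁' s₂ t x y) {m n r : ℕ}
    (hr : m + n = r + 1) (hr' : m + 2 + n = r + 1 + 2) (hm : 1 ≤ m) {φ : Fin (m + 2 + 1) → F}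
    {ψ : Fin (n + 1) → F} (hφ : Set.BijOn φ Set.univ s₁) (hψ : Set.BijOn ψ Set.univ s₂)
    (hx : φ ⟨m + 2, by omega⟩ = x) (hz : φ ⟨1, by omega⟩ = z) (hw : φ ⟨2, by omega⟩ = w)
    (hy : ψ 0 = y) (a : A.obj g (m + 2 + 1)) (b : A.obj h (n + 1)) :
    X.loop rfl H' (C.glue hγ H (A.ofEnum φ hφ a) (A.ofEnum ψ hψ b)) =
        C.glue hγ' H₁' (X.loop rfl H₁ (A.ofEnum φ hφ a)) (A.ofEnum ψ hψ b) ↔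
      X.xiFin (n := r + 1) ⟨1, by omega⟩ ⟨2, by omega⟩ (by simp)
          (C.circ hγ hr' (m + 2) (by omega) a b) =
        C.circ hγ' hr m (by omega)
          (X.xiFin (n := m + 1) ⟨1, by omega⟩ ⟨2, by omega⟩ (by simp) a) b := by
  rw [(C.isGlue_glue hγ H).fst hr' (m + 2) ⟨by omega, le_rfl⟩ φ ψ hφ hψ hx hy,
    X.loop_ofEnum (i := 1) (n := r + 1) (by omega) H' _ ?_ ?_ (by simp),
    X.loop_ofEnum (i := 1) (n := m + 1) (by omega) H₁ hφ hz hw (by simp),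
    (C.isGlue_glue hγ' H₁').fst hr m ⟨hm, le_rfl⟩ _ ψ _ hψ ?_ hy]
  · rw [A.ofEnum_congr (φ' := cat hr m le_rfl (del 1 φ) ψ) _ _ (fun j => ?_)]
    · exact (A.ofEnum_injective _).eq_iff
    · unfold cat del
      dsimp only
      split_ifs <;> first
        | (exfalso; omega)
        | (refine congrArg _ (Fin.ext ?_); first | rfl | (dsimp only; omega))
  · unfold del
    rw [if_neg (by dsimp only; omega)]
    exact hx
  · rw [cat_of_lt hr' (m + 2) le_rfl φ ψ _ (by dsimp only; omega) ⟨1, by omega⟩ rfl, hz]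
  · rw [cat_of_lt hr' (m + 2) le_rfl φ ψ _ (by dsimp only; omega) ⟨2, by omega⟩ rfl, hw]

/-- The case in which the contraction leaves the first factor with the label `x` alone and the
second factor has no label but `y`, so that the outer gluing is the pairing. -/
theorem loop_glue_pair_iff (hγ : g + h = γ) (hγ' : g + 1 + h = γ + 1) (H : GlueData s₁ s₂ s x y)
    (H' : LoopData s t z w) (H₁ : LoopData s₁ s₁' z w) (H₁' : GlueData s₁' s₂ t x y)
    {φ : Fin 3 → F} {ψ : Fin 1 → F} (hφ : Set.BijOn φ Set.univ s₁) (hψ : Set.BijOn ψ Set.univ s₂)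
    (hx : φ 2 = x) (hz : φ 0 = z) (hw : φ 1 = w) (hy : ψ 0 = y) (a : A.obj g 3) (b : A.obj h 1) :
    X.loop rfl H' (C.glue hγ H (A.ofEnum φ hφ a) (A.ofEnum ψ hψ b)) =
        C.glue hγ' H₁' (X.loop rfl H₁ (A.ofEnum φ hφ a)) (A.ofEnum ψ hψ b) ↔
      X.xiFin (n := 0) 0 1 (by simp) (C.circ (m := 2) (n := 0) hγ rfl 2 (by omega) a b) =
        C.pair hγ' (X.xiFin (n := 1) 0 1 (by simp) a) b := by
  have hd : Set.BijOn (del (n := 0) 0 (cat (m := 2) (n := 0) rfl 2 le_rfl φ ψ)) Set.univ t :=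
    bijOn_del (n := 0) le_rfl H' (bijOn_cat (m := 2) (n := 0) rfl 2 le_rfl H hφ hψ hx hy) hz hw
  rw [(C.isGlue_glue hγ H).fst (m := 2) (n := 0) rfl 2 ⟨by omega, le_rfl⟩ φ ψ hφ hψ hx hy,
    X.loop_ofEnum (i := 0) (n := 0) (by omega) H' _ ?_ ?_ (by simp),
    X.loop_ofEnum (i := 0) (n := 1) (by omega) H₁ hφ hz hw (by simp),
    (C.isGlue_glue hγ' H₁').pair _ ψ _ _ hψ hd]
  · exact (A.ofEnum_injective _).eq_iff
  · exact hz
  · exact hw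

theorem loop_glue_right_iff (hγ : g + h = γ) (hγ' : g + (h + 1) = γ + 1)
    {s₂' : Set F} (H : GlueData s₁ s₂ s x y)
    (H' : LoopData s t z w) (H₂ : LoopData s₂ s₂' z w) (H₂' : GlueData s₁ s₂' t x y) {m n r : ℕ}
    (hr : m + n = r + 1) (hr' : m + (n + 2) = r + 1 + 2) (hm : 1 ≤ m) {φ : Fin (m + 1) → F}
    {ψ : Fin (n + 2 + 1) → F} (hφ : Set.BijOn φ Set.univ s₁) (hψ : Set.BijOn ψ Set.univ s₂)
    (hx : φ ⟨m, by omega⟩ = x) (hy : ψ 0 = y) (hz : ψ ⟨1, by omega⟩ = z)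
    (hw : ψ ⟨2, by omega⟩ = w) (a : A.obj g (m + 1)) (b : A.obj h (n + 2 + 1)) :
    X.loop rfl H' (C.glue hγ H (A.ofEnum φ hφ a) (A.ofEnum ψ hψ b)) =
        C.glue hγ' H₂' (A.ofEnum φ hφ a) (X.loop rfl H₂ (A.ofEnum ψ hψ b)) ↔
      X.xiFin (n := r + 1) ⟨m, by omega⟩ ⟨m + 1, by omega⟩ (by simp)
          (C.circ hγ hr' m (by omega) a b) =
        C.circ hγ' hr m (by omega) a
          (X.xiFin (n := n + 1) ⟨1, by omega⟩ ⟨2, by omega⟩ (by simp) b) := by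
  rw [(C.isGlue_glue hγ H).fst hr' m ⟨hm, le_rfl⟩ φ ψ hφ hψ hx hy,
    X.loop_ofEnum (i := m) (n := r + 1) (by omega) H' _ ?_ ?_ (by simp),
    X.loop_ofEnum (i := 1) (n := n + 1) (by omega) H₂ hψ hz hw (by simp),
    (C.isGlue_glue hγ' H₂').fst hr m ⟨hm, le_rfl⟩ φ _ hφ _ hx ?_]
  · rw [A.ofEnum_congr (φ' := cat hr m le_rfl φ (del 1 ψ)) _ _ (fun j => ?_)]
    · exact (A.ofEnum_injective _).eq_iff
    · unfold cat del
      dsimp only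
      split_ifs <;> first
        | (exfalso; omega)
        | (refine congrArg _ (Fin.ext ?_); first | rfl | (dsimp only; omega))
  · exact hy
  · rw [cat_of_mid hr' m le_rfl φ ψ _ (by dsimp only; omega) (by dsimp only; omega) ⟨1, by omega⟩
      (by dsimp only; omega), hz]
  · rw [cat_of_mid hr' m le_rfl φ ψ _ (by dsimp only; omega) (by dsimp only; omega) ⟨2, by omega⟩
      (by dsimp only; omega), hw]

/-- To glue `w` instead of `y`, the second factor must have `w` as its output; since `w` is at place
`1`, this is achieved by the inverse rotation, which sends `y` to the last place. -/
theorem loop_glue_cross_iff (hγ : g + h = γ) (H : GlueData s₁ s₂ s x y) (H' : LoopData s t z w)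
    (K : GlueData s₁ s₂ s' z w) (K' : LoopData s' t x y) {m n : ℕ}
    (hs : m + 2 + (n + 1) = m + n + 1 + 2) {φ : Fin (m + 2 + 1) → F} {ψ : Fin (n + 1 + 1) → F}
    (hφ : Set.BijOn φ Set.univ s₁) (hψ : Set.BijOn ψ Set.univ s₂)
    (hx : φ ⟨m + 2, by omega⟩ = x) (hz : φ ⟨m + 1, by omega⟩ = z) (hy : ψ 0 = y)
    (hw : ψ ⟨1, by omega⟩ = w) (a : A.obj g (m + 2 + 1)) (b : A.obj h (n + 1 + 1)) :
    X.loop rfl H' (C.glue hγ H (A.ofEnum φ hφ a) (A.ofEnum ψ hψ b)) =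
        X.loop rfl K' (C.glue hγ K (A.ofEnum φ hφ a) (A.ofEnum ψ hψ b)) ↔
      X.xiFin (n := m + n + 1) ⟨m + 1, by omega⟩ ⟨m + 2, by omega⟩ (by simp)
          (C.circ hγ hs (m + 2) (by omega) a b) =
        X.xiFin (n := m + n + 1) ⟨m + n + 1, by omega⟩ ⟨m + n + 2, by omega⟩ (by simp)
          (C.circ hγ hs (m + 1) (by omega) a (A.unstar b)) := by
  have hψ' := hψ.comp (finRotate (n + 1 + 1)).bijective.bijOn_univ
  have hb : A.ofEnum ψ hψ b = A.ofEnum _ hψ' (A.unstar b) := by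
    rw [StableSModule.unstar, A.ofEnum_act]
    refine A.ofEnum_congr _ _ (fun j => ?_) _
    simp
  have hw' : (ψ ∘ finRotate (n + 1 + 1)) 0 = w := by
    rw [← hw]
    exact congrArg ψ (Fin.ext (by rw [coe_finRotate_succ, if_neg (by simp)]; rfl))
  have hy' : (ψ ∘ finRotate (n + 1 + 1)) ⟨n + 1, by omega⟩ = y := by
    rw [← hy]
    exact congrArg ψ (Fin.ext (by rw [coe_finRotate_succ, if_pos rfl]; rfl))
  -- In the second composite `y` is at place `m + n + 1` and `x` at the next one, so the contraction
  -- is taken in the order `y`, `x`.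
  rw [← X.loop_symm rfl K', (C.isGlue_glue hγ H).fst hs (m + 2) ⟨by omega, le_rfl⟩ φ ψ hφ hψ hx hy,
    hb, (C.isGlue_glue hγ K).fst hs (m + 1) ⟨by omega, by omega⟩ φ _ hφ hψ' hz hw',
    X.loop_ofEnum (i := m + 1) (n := m + n + 1) (by omega) H' _ ?_ ?_ (by simp),
    X.loop_ofEnum (i := m + n + 1) (n := m + n + 1) (by omega) K'.symm _ ?_ ?_ (by simp)]
  · rw [A.ofEnum_congr (φ := del (m + n + 1) _) (φ' := del (m + 1) (cat hs (m + 2) le_rfl φ ψ)) _ _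
      (fun j => ?_)]
    · exact (A.ofEnum_injective _).eq_iff
    · unfold cat del
      dsimp only [Function.comp_apply]
      split_ifs <;> first
        | (exfalso; omega)
        | (refine congrArg _ (Fin.ext ?_); first
            | rfl
            | (rw [coe_finRotate_succ, if_neg (by dsimp only; omega)]; dsimp only; omega))
  · rw [cat_of_mid hs (m + 1) (by omega) φ _ _ (by dsimp only; omega) (by dsimp only; omega)
      ⟨n + 1, by omega⟩ (by dsimp only; omega), hy']
  · rw [cat_of_ge hs (m + 1) (by omega) φ _ _ (by dsimp only; omega)
      ⟨m + 2, by omega⟩ (by dsimp only; omega), hx]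
  · rw [cat_of_lt hs (m + 2) (by omega) φ _ _ (by dsimp only; omega) ⟨m + 1, by omega⟩ rfl, hz]
  · rw [cat_of_mid hs (m + 2) (by omega) φ _ _ (by dsimp only; omega) (by dsimp only; omega)
      ⟨1, by omega⟩ (by dsimp only; omega), hw]

/-- With two labels at each vertex there is no spare output. Gluing `z` to `w` needs `z` as the
input of the first factor and `w` as the output of the second, so both factors are rotated. -/
theorem loop_glue_cross_two_iff (hγ : g + h = γ) (H : GlueData s₁ s₂ s x y) (H' : LoopData s t z w)
    (K : GlueData s₁ s₂ s' z w) (K' : LoopData s' t x y) {φ ψ : Fin 2 → F}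
    (hφ : Set.BijOn φ Set.univ s₁) (hψ : Set.BijOn ψ Set.univ s₂)
    (hz : φ 0 = z) (hx : φ 1 = x) (hy : ψ 0 = y) (hw : ψ 1 = w) (a : A.obj g 2) (b : A.obj h 2) :
    X.loop rfl H' (C.glue hγ H (A.ofEnum φ hφ a) (A.ofEnum ψ hψ b)) =
        X.loop rfl K' (C.glue hγ K (A.ofEnum φ hφ a) (A.ofEnum ψ hψ b)) ↔
      X.xiFin (n := 0) 0 1 (by simp) (C.circ (m := 1) (n := 1) hγ rfl 1 (by omega) a b) =
        X.xiFin (n := 0) 0 1 (by simp)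
          (C.circ (m := 1) (n := 1) hγ rfl 1 (by omega) (A.star (n := 1) a)
            (A.star (n := 1) b)) := by
  have hφ' := hφ.comp ((finRotate 2)⁻¹).bijective.bijOn_univ
  have hψ' := hψ.comp ((finRotate 2)⁻¹).bijective.bijOn_univ
  have ha : A.ofEnum φ hφ a = A.ofEnum _ hφ' (A.star (n := 1) a) := by
    rw [StableSModule.star, A.ofEnum_act]
    exact A.ofEnum_congr _ _ (fun j => by simp) _
  have hb : A.ofEnum ψ hψ b = A.ofEnum _ hψ' (A.star (n := 1) b) := by
    rw [StableSModule.star, A.ofEnum_act]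
    exact A.ofEnum_congr _ _ (fun j => by simp) _
  have hx₁ : (φ ∘ ⇑(finRotate 2)⁻¹) 0 = x := hx
  have hz₁ : (φ ∘ ⇑(finRotate 2)⁻¹) 1 = z := hz
  have hw₁ : (ψ ∘ ⇑(finRotate 2)⁻¹) 0 = w := hw
  have hy₁ : (ψ ∘ ⇑(finRotate 2)⁻¹) 1 = y := hy
  rw [(C.isGlue_glue hγ H).fst (m := 1) (n := 1) rfl 1 ⟨le_rfl, le_rfl⟩ φ ψ hφ hψ hx hy, ha, hb,
    (C.isGlue_glue hγ K).fst (m := 1) (n := 1) rfl 1 ⟨le_rfl, le_rfl⟩ _ _ hφ' hψ' hz₁ hw₁,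
    X.loop_ofEnum (i := 0) (n := 0) (by omega) H' _ ?_ ?_ (by simp),
    X.loop_ofEnum (i := 0) (n := 0) (by omega) K' _ ?_ ?_ (by simp)]
  · rw [A.ofEnum_congr (φ := del 0 (cat _ _ _ (φ ∘ _) _))
      (φ' := del 0 (cat (m := 1) (n := 1) rfl 1 le_rfl φ ψ)) _ _ (fun j => j.elim0)]
    exact (A.ofEnum_injective _).eq_iff
  · exact hx₁
  · exact hy₁
  · exact hz
  · exact hw

variable {C X}

/-- A contraction of two labels of the same factor commutes with gluing. -/
theorem loop_glue (hL : ContractLeft C X) (hR : ContractRight C X) {g' γ' : ℕ} (hγ : g + h = γ)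
    (hg : g + 1 = g') (hγ₁ : γ + 1 = γ') (hγ' : g' + h = γ') (H : GlueData s₁ s₂ s x y)
    (H' : LoopData s t z w) (H₁ : LoopData s₁ s₁' z w) (H₁' : GlueData s₁' s₂ t x y) {p q : ℤ}
    {a : A.onSet g s₁} {b : A.onSet h s₂} (ha : a ∈ A.onSetDeg g s₁ p)
    (hb : b ∈ A.onSetDeg h s₂ q) :
    X.loop hγ₁ H' (C.glue hγ H a b) = C.glue hγ' H₁' (X.loop hg H₁ a) b := by
  subst hg hγ₁
  have hc₁ := H₁.ncard_add_two
  have h1 : s₁'.ncard ≠ 0 := Set.ncard_ne_zero_of_mem H₁'.left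
  have h2 : s₂.ncard ≠ 0 := Set.ncard_ne_zero_of_mem H.right
  obtain ⟨m, hm⟩ : ∃ m, s₁.ncard = m + 2 + 1 := ⟨s₁.ncard - 3, by omega⟩
  obtain ⟨n, hn⟩ : ∃ n, s₂.ncard = n + 1 := ⟨s₂.ncard - 1, by omega⟩
  obtain ⟨-, hxz, hxw⟩ := (H₁.mem_iff x).1 H₁'.left
  -- Here `m` counts the labels of the first factor besides `x`, `z`, `w`. If there is one, it can
  -- be the output and `ContractLeft` applies. If not, `x` becomes the output after the contraction,
  -- so the factors are exchanged and `ContractRight` applies, unless the second factor has no label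
  -- but `y`; then the relation with the pairing is the one needed.
  by_cases hm1 : 1 ≤ m
  · obtain ⟨φ, hφ, hx, hz, hw⟩ := exists_enum₃ hm (i := ⟨m + 2, by omega⟩) (j := ⟨1, by omega⟩)
      (l := ⟨2, by omega⟩) (by simp) (by simp; omega) (by simp) H.left H₁.left H₁.right hxz hxw
      H₁.ne
    obtain ⟨ψ, hψ, hy⟩ := exists_enum₁ hn 0 H.right
    obtain ⟨a, rfl⟩ := A.exists_ofEnum_eq hφ a
    obtain ⟨b, rfl⟩ := A.exists_ofEnum_eq hψ b
    obtain ⟨r, hr⟩ : ∃ r, m + n = r + 1 := ⟨m + n - 1, by omega⟩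
    exact (loop_glue_left_iff C X hγ hγ' H H' H₁ H₁' hr (by omega) hm1 hφ hψ hx hz hw hy a b).2
      (hL.1 g h γ m n r hγ hγ' hr (by omega) hm1 a b)
  obtain rfl : m = 0 := by omega
  by_cases hn1 : 1 ≤ n
  · obtain ⟨φ, hφ, hx, hz, hw⟩ := exists_enum₃ hm (i := 0) (j := ⟨1, by omega⟩)
      (l := ⟨2, by omega⟩) (by simp) (by simp [Fin.ext_iff]) (by simp)
      H.left H₁.left H₁.right hxz hxw H₁.ne
    obtain ⟨ψ, hψ, hy⟩ := exists_enum₁ hn ⟨n, by omega⟩ H.right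
    rw [C.glue_symm hγ (by omega) H ha hb,
      C.glue_symm hγ' (by omega) H₁' (X.loop_mem rfl H₁ ha) hb, LinearMap.map_intUnits_smul]
    refine congrArg _ ?_
    obtain ⟨a, rfl⟩ := A.exists_ofEnum_eq hφ a
    obtain ⟨b, rfl⟩ := A.exists_ofEnum_eq hψ b
    obtain ⟨r, hr⟩ : ∃ r, n + 0 = r + 1 := ⟨n - 1, by omega⟩
    exact (loop_glue_right_iff C X (by omega) (by omega) H.symm H' H₁ H₁'.symm hr (by omega) hn1 hψ
      hφ hy hx hz hw b a).2 (hR h g γ n 0 r (by omega) (by omega) hr (by omega) hn1 b a)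
  · obtain rfl : n = 0 := by omega
    obtain ⟨φ, hφ, hx, hz, hw⟩ := exists_enum₃ hm (i := 2) (j := 0) (l := 1) (by simp)
      (by simp) (by simp) H.left H₁.left H₁.right hxz hxw H₁.ne
    obtain ⟨ψ, hψ, hy⟩ := exists_enum₁ hn 0 H.right
    obtain ⟨a, rfl⟩ := A.exists_ofEnum_eq hφ a
    obtain ⟨b, rfl⟩ := A.exists_ofEnum_eq hψ b
    exact (loop_glue_pair_iff C X hγ hγ' H H' H₁ H₁' hφ hψ hx hz hw hy a b).2
      (hL.2 _ _ _ _ _ _ _)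

/-- The compositions along two edges that join the same two vertices can be exchanged. -/
theorem loop_glue_cross (hB : ContractBoth C X) {γ' : ℕ} (hγ : g + h = γ) (hγ₁ : γ + 1 = γ')
    (H : GlueData s₁ s₂ s x y) (H' : LoopData s t z w) (K : GlueData s₁ s₂ s' z w)
    (K' : LoopData s' t x y) {p q : ℤ} {a : A.onSet g s₁} {b : A.onSet h s₂}
    (ha : a ∈ A.onSetDeg g s₁ p) (hb : b ∈ A.onSetDeg h s₂ q) :
    X.loop hγ₁ H' (C.glue hγ H a b) = X.loop hγ₁ K' (C.glue hγ K a b) := by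
  subst hγ₁
  have hxz : x ≠ z := by
    rintro rfl
    rcases (H.mem_iff x).1 H'.left with h | h
    · exact h.2 rfl
    · exact H.ne_of_mem K.left h.1 rfl
  have hyw : y ≠ w := by
    rintro rfl
    rcases (H.mem_iff y).1 H'.right with h | h
    · exact H.ne_of_mem h.1 K.right rfl
    · exact h.2 rfl
  -- A third label in `s₁` can be the output, so that `x` and `z` are both inputs, as in the first
  -- part of `ContractBoth`. A third label in `s₂` is handled by symmetry; otherwise both factors
  -- have exactly two labels and the second part applies.
  have key : ∀ {g h : ℕ} (hγ : g + h = γ) {s₁ s₂ : Set F} {x y z w : F}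
      (H : GlueData s₁ s₂ s x y) (H' : LoopData s t z w) (K : GlueData s₁ s₂ s' z w)
      (K' : LoopData s' t x y) {a : A.onSet g s₁} {b : A.onSet h s₂} (_ : x ≠ z) (_ : y ≠ w),
      3 ≤ s₁.ncard →
      X.loop rfl H' (C.glue hγ H a b) = X.loop rfl K' (C.glue hγ K a b) := by
    intro g h hγ s₁ s₂ x y z w H H' K K' a b hxz hyw hs₁
    have hs₂ : 1 < s₂.ncard := (Set.one_lt_ncard).2 ⟨y, H.right, w, K.right, hyw⟩
    obtain ⟨m, hm⟩ : ∃ m, s₁.ncard = m + 2 + 1 := ⟨s₁.ncard - 3, by omega⟩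
    obtain ⟨n, hn⟩ : ∃ n, s₂.ncard = n + 1 + 1 := ⟨s₂.ncard - 2, by omega⟩
    obtain ⟨φ, hφ, hx, hz⟩ := exists_enum₂ hm (i := ⟨m + 2, by omega⟩) (j := ⟨m + 1, by omega⟩)
      (by simp) H.left K.left hxz
    obtain ⟨ψ, hψ, hy, hw⟩ := exists_enum₂ hn (i := 0) (j := ⟨1, by omega⟩)
      (by simp) H.right K.right hyw
    obtain ⟨a, rfl⟩ := A.exists_ofEnum_eq hφ a
    obtain ⟨b, rfl⟩ := A.exists_ofEnum_eq hψ b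
    exact (loop_glue_cross_iff C X hγ H H' K K' (by omega) hφ hψ hx hz hy hw a b).2
      (hB.1 _ _ _ _ _ _ _ _ _)
  by_cases h3 : 3 ≤ s₁.ncard
  · exact key hγ H H' K K' hxz hyw h3
  by_cases h3' : 3 ≤ s₂.ncard
  · rw [C.glue_symm hγ (by omega) H ha hb, C.glue_symm hγ (by omega) K ha hb,
      LinearMap.map_intUnits_smul, LinearMap.map_intUnits_smul, ← X.loop_symm rfl H',
      ← X.loop_symm rfl K']
    exact congrArg _ (key (by omega) H.symm H'.symm K.symm K'.symm hyw hxz h3')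
  · have hs₁ : 1 < s₁.ncard := (Set.one_lt_ncard).2 ⟨x, H.left, z, K.left, hxz⟩
    have hs₂ : 1 < s₂.ncard := (Set.one_lt_ncard).2 ⟨y, H.right, w, K.right, hyw⟩
    obtain ⟨φ, hφ, hz, hx⟩ := exists_enum₂ (s := s₁) (n := 2) (by omega) (i := 0) (j := 1)
      (by simp) K.left H.left hxz.symm
    obtain ⟨ψ, hψ, hy, hw⟩ := exists_enum₂ (s := s₂) (n := 2) (by omega) (i := 0) (j := 1)
      (by simp) H.right K.right hyw
    obtain ⟨a, rfl⟩ := A.exists_ofEnum_eq hφ a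
    obtain ⟨b, rfl⟩ := A.exists_ofEnum_eq hψ b
    exact (loop_glue_cross_two_iff C X hγ H H' K K' hφ hψ hz hx hy hw a b).2
      (hB.2 _ _ _ _ _ _)

end Relations

/-! ### Signs for the exchange of blocks of vertices -/

section Sign

variable {V : Type} (o : LinearOrder V) (p : V → ℤ)

open Classical in
/-- The Koszul sign for sorting the vertices in `c₁` followed by the vertices in `c₂`, if those in
`c₁` and those in `c₂` are sorted. -/
def crossSign (c₁ c₂ : Finset V) : ℤˣ :=
  ∏ u ∈ c₁, ∏ v ∈ c₂, if o.lt v u then (p u * p v).negOnePow else 1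

theorem crossSign_disjUnion_left (c₁ c₂ c₃ : Finset V) (h : Disjoint c₁ c₂) :
    crossSign o p (c₁.disjUnion c₂ h) c₃ = crossSign o p c₁ c₃ * crossSign o p c₂ c₃ := by
  simp only [crossSign, Finset.prod_disjUnion]

theorem crossSign_disjUnion_right (c₁ c₂ c₃ : Finset V) (h : Disjoint c₂ c₃) :
    crossSign o p c₁ (c₂.disjUnion c₃ h) = crossSign o p c₁ c₂ * crossSign o p c₁ c₃ := by
  simp only [crossSign, Finset.prod_disjUnion, Finset.prod_mul_distrib]

theorem negOnePow_sum {ι : Type*} (s : Finset ι) (f : ι → ℤ) :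
    (∑ i ∈ s, f i).negOnePow = ∏ i ∈ s, (f i).negOnePow := by
  classical
  induction s using Finset.induction_on with
  | empty => simp
  | insert i s hi ih => rw [Finset.sum_insert hi, Finset.prod_insert hi, Int.negOnePow_add, ih]

/-- For `u ∈ c₁` and `v ∈ c₂` exactly one of `u < v` and `v < u` holds, so every pair contributes
its sign once. -/
theorem crossSign_mul_crossSign (c₁ c₂ : Finset V) (h : Disjoint c₁ c₂) :
    crossSign o p c₁ c₂ * crossSign o p c₂ c₁ =
      ((∑ u ∈ c₁, p u) * ∑ v ∈ c₂, p v).negOnePow := by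
  rw [crossSign, crossSign, Finset.prod_comm (s := c₂), ← Finset.prod_mul_distrib,
    Finset.sum_mul_sum, negOnePow_sum]
  refine Finset.prod_congr rfl fun u hu => ?_
  rw [negOnePow_sum, ← Finset.prod_mul_distrib]
  refine Finset.prod_congr rfl fun v hv => ?_
  have huv : u ≠ v := fun e => Finset.disjoint_left.1 h hu (e ▸ hv)
  rcases lt_or_gt_of_ne huv with h' | h'
  · rw [if_neg (not_lt_of_gt h'), if_pos h', one_mul, mul_comm]
  · rw [if_pos h', if_neg (not_lt_of_gt h'), mul_one]

/-- Multiplying by the Koszul sign of an exchange of factors amounts to exchanging `c₁` and `c₂`. -/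
theorem crossSign_swap (c₁ c₂ : Finset V) (h : Disjoint c₁ c₂) :
    crossSign o p c₁ c₂ * ((∑ u ∈ c₁, p u) * ∑ v ∈ c₂, p v).negOnePow = crossSign o p c₂ c₁ := by
  rw [← crossSign_mul_crossSign o p c₁ c₂ h, ← mul_assoc, Int.units_mul_self, one_mul]

end Sign

/-! ### Stepwise composition along the edges of a graph -/

section Values

variable {k : Type u} [Field k] {A : StableSModule.{u, v} k} (C : StableGradedCyclicOperad A)
  (X : Contractions A) (G : FlagGraph) (o : LinearOrder G.Vert) (p : G.Vert → ℤ)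
  (a : ∀ v : G.Vert, A.onSet (G.genus v) (G.Leg v))

/-- `IsVal C X G o p a c s g r`: by gluing and contracting along edges, the decorations `a v` of the
vertices `v ∈ c` of a connected part of the graph `G` compose to `r ∈ A((g,s))`, where `s` is the set
of the remaining flags at the vertices in `c`. -/
inductive IsVal : Finset G.Vert → ∀ (s : Set G.Flag) (g : ℕ), A.onSet g s → Prop
  -- All indices are tied by equations and are not computed, so that case analysis never has to
  -- unify sets of flags or genera.
  | vertex {c s g r} (v : G.Vert) (hc : c = {v}) (hg : G.genus v = g)
      (hs : Set.BijOn id {x | G.vert x = v} s) (hr : r = A.push hg id hs (a v)) : IsVal c s g r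
  | glue {c c₁ c₂ s s₁ s₂ g g₁ g₂ r r₁ r₂} (x y : G.Flag) (hxy : G.inv x = y)
      (d₁ : IsVal c₁ s₁ g₁ r₁) (d₂ : IsVal c₂ s₂ g₂ r₂) (hd : Disjoint c₁ c₂)
      (hc : c = c₁.disjUnion c₂ hd) (hg : g₁ + g₂ = g) (H : GlueData s₁ s₂ s x y)
      (hr : r = crossSign o p c₁ c₂ • C.glue hg H r₁ r₂) : IsVal c s g r
  | loop {c s s₁ g g₁ r r₁} (x y : G.Flag) (hxy : G.inv x = y) (d₁ : IsVal c s₁ g₁ r₁)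
      (hg : g₁ + 1 = g) (H : LoopData s₁ s x y) (hr : r = X.loop hg H r₁) : IsVal c s g r

/-- Values that are obtained by a composition whose last step is along the edge `{x, y}`. -/
inductive LastStep (x y : G.Flag) (c : Finset G.Vert) (s : Set G.Flag) (g : ℕ)
    (r : A.onSet g s) : Prop
  | glue {c₁ c₂ s₁ s₂ g₁ g₂ r₁ r₂} (d₁ : IsVal C X G o p a c₁ s₁ g₁ r₁)
      (d₂ : IsVal C X G o p a c₂ s₂ g₂ r₂) (hd : Disjoint c₁ c₂)
      (hc : c = c₁.disjUnion c₂ hd) (hg : g₁ + g₂ = g) (H : GlueData s₁ s₂ s x y)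
      (hr : r = crossSign o p c₁ c₂ • C.glue hg H r₁ r₂) : LastStep x y c s g r
  | loop {s₁ g₁ r₁} (d₁ : IsVal C X G o p a c s₁ g₁ r₁)
      (hg : g₁ + 1 = g) (H : LoopData s₁ s x y) (hr : r = X.loop hg H r₁) : LastStep x y c s g r

variable {C X G o p a}

namespace IsVal

theorem vert_mem {c s g r} (d : IsVal C X G o p a c s g r) : ∀ x ∈ s, G.vert x ∈ c := by
  induction d with
  | vertex v hc hg hs hr =>
    intro x hx
    obtain ⟨y, hy, rfl⟩ := hs.surjOn hx
    simpa [hc] using hy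
  | glue x y hxy d₁ d₂ hd hc hg H hr ih₁ ih₂ =>
    intro z hz
    rw [hc, Finset.mem_disjUnion]
    exact ((H.mem_iff z).1 hz).imp (fun h => ih₁ z h.1) (fun h => ih₂ z h.1)
  | loop x y hxy d₁ hg H hr ih =>
    intro z hz
    exact ih z ((H.mem_iff z).1 hz).1

theorem nonempty {c s g r} (d : IsVal C X G o p a c s g r) : c.Nonempty := by
  induction d with
  | vertex v hc hg hs hr => simp [hc]
  | glue x y hxy d₁ d₂ hd hc hg H hr ih₁ ih₂ =>
    obtain ⟨v, hv⟩ := ih₁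
    exact ⟨v, by simp [hc, hv]⟩
  | loop x y hxy d₁ hg H hr ih => exact ih

/-- The flags that do not remain form edges. -/
theorem inv_mem {c s g r} (d : IsVal C X G o p a c s g r) :
    ∀ z, G.vert z ∈ c → z ∉ s → G.vert (G.inv z) ∈ c ∧ G.inv z ∉ s ∧ G.inv z ≠ z := by
  induction d with
  | vertex v hc hg hs hr =>
    intro z hz hzs
    exact absurd (hs.mapsTo (by simpa [hc] using hz)) hzs
  | @glue c c₁ c₂ s s₁ s₂ g g₁ g₂ r r₁ r₂ x y hxy d₁ d₂ hd hc hg H hr ih₁ ih₂ =>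
    have hd' := Finset.disjoint_left.1 hd
    have hv₁ := d₁.vert_mem
    have hv₂ := d₂.vert_mem
    have hyx : G.inv y = x := by rw [← hxy, G.inv_inv]
    have hx := H.left
    have hy := H.right
    have hne := H.ne_of_mem hx hy
    subst hc
    intro z hz hzs
    simp only [Finset.mem_disjUnion, H.mem_iff, not_or, not_and, not_not] at hz hzs ⊢
    rcases hz with hz | hz
    · by_cases hz₁ : z ∈ s₁
      · obtain rfl := hzs.1 hz₁
        rw [hxy]
        exact ⟨Or.inr (hv₂ _ hy), ⟨fun h => absurd rfl (H.ne_of_mem h hy), fun _ => rfl⟩, hne.symm⟩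
      · obtain ⟨h1, h2, h3⟩ := ih₁ z hz hz₁
        exact ⟨Or.inl h1, ⟨fun h => absurd h h2, fun h => absurd (hv₂ _ h) (hd' h1)⟩, h3⟩
    · by_cases hz₂ : z ∈ s₂
      · obtain rfl := hzs.2 hz₂
        rw [hyx]
        exact ⟨Or.inl (hv₁ _ hx), ⟨fun _ => rfl, fun h => absurd rfl (H.ne_of_mem hx h)⟩, hne⟩
      · obtain ⟨h1, h2, h3⟩ := ih₂ z hz hz₂
        exact ⟨Or.inr h1, ⟨fun h => absurd h1 (hd' (hv₁ _ h)), fun h => absurd h h2⟩, h3⟩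
  | @loop c s s₁ g g₁ r r₁ x y hxy d₁ hg H hr ih =>
    have hyx : G.inv y = x := by rw [← hxy, G.inv_inv]
    have hv₁ := d₁.vert_mem
    intro z hz hzs
    by_cases hz₁ : z ∈ s₁
    · by_cases hzx : z = x
      · subst hzx
        rw [hxy]
        exact ⟨hv₁ _ H.right, fun h => ((H.mem_iff _).1 h).2.2 rfl, H.ne.symm⟩
      · have hzy : z = y := by
          by_contra hzy
          exact hzs ((H.mem_iff z).2 ⟨hz₁, hzx, hzy⟩)
        subst hzy
        rw [hyx]
        exact ⟨hv₁ _ H.left, fun h => ((H.mem_iff _).1 h).2.1 rfl, H.ne⟩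
    · obtain ⟨h1, h2, h3⟩ := ih z hz hz₁
      exact ⟨h1, fun h => h2 ((H.mem_iff _).1 h).1, h3⟩

theorem mem_deg {c s g r} (d : IsVal C X G o p a c s g r)
    (ha : ∀ v, a v ∈ A.onSetDeg (G.genus v) (G.Leg v) (p v)) :
    r ∈ A.onSetDeg g s (∑ v ∈ c, p v) := by
  induction d with
  | vertex v hc hg hs hr =>
    subst hc hr
    rw [Finset.sum_singleton]
    exact A.push_mem hg hs (ha v)
  | glue x y hxy d₁ d₂ hd hc hg H hr ih₁ ih₂ =>
    subst hc hr
    rw [Finset.sum_disjUnion]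
    exact Submodule.intUnits_smul_mem _ _ (C.glue_mem hg H ih₁ ih₂)
  | loop x y hxy d₁ hg H hr ih =>
    subst hr
    exact X.loop_mem hg H ih

/-- The genus of a composition is determined by its vertices and its remaining flags. -/
theorem genus_eq {c s g r} (d : IsVal C X G o p a c s g r) :
    2 * g + 2 * c.card + s.ncard =
      2 * ∑ v ∈ c, G.genus v + Set.ncard {x | G.vert x ∈ c} + 2 := by
  -- A gluing removes two flags and merges two constants `2` into one; a contraction trades two
  -- flags for one genus.
  induction d with
  | @vertex c s g r v hc hg hs hr =>
    have : {x | G.vert x = v} = s := by simpa using hs.image_eq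
    subst hc hg this
    simp
    omega
  | @glue c c₁ c₂ s s₁ s₂ g g₁ g₂ r r₁ r₂ x y hxy d₁ d₂ hd hc hg H hr ih₁ ih₂ =>
    have e : {x | G.vert x ∈ c₁.disjUnion c₂ hd} = {x | G.vert x ∈ c₁} ∪ {x | G.vert x ∈ c₂} := by
      ext x
      simp
    have h1 := H.ncard_add_two
    have h2 := Set.ncard_union_eq (s := {x | G.vert x ∈ c₁}) (t := {x | G.vert x ∈ c₂})
      (Set.disjoint_left.2 fun x hx hx' => Finset.disjoint_left.1 hd hx hx')
    subst hc hg
    rw [Finset.sum_disjUnion, Finset.card_disjUnion, e]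
    omega
  | loop x y hxy d₁ hg H hr ih =>
    subst hg
    have h1 := H.ncard_add_two
    omega

/-- The number `2g - 2 + n` is additive under gluing and invariant under contraction, so it stays
positive. -/
theorem two_lt {c s g r} (d : IsVal C X G o p a c s g r)
    (hG : ∀ v, 2 < 2 * G.genus v + Nat.card (G.Leg v)) : 2 < 2 * g + s.ncard := by
  induction d with
  | @vertex c s g r v hc hg hs hr =>
    have : {x | G.vert x = v} = s := by simpa using hs.image_eq
    subst hc hg this
    have := hG v
    rwa [← Nat.card_coe_set_eq]
  | glue x y hxy d₁ d₂ hd hc hg H hr ih₁ ih₂ =>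
    have h1 := H.ncard_add_two
    omega
  | loop x y hxy d₁ hg H hr ih =>
    have h1 := H.ncard_add_two
    omega

/-- A part of a graph along which one can compose is connected. -/
theorem exists_crossing {c s g r} (d : IsVal C X G o p a c s g r) (P : G.Vert → Prop) :
    ∀ u ∈ c, P u → ∀ v ∈ c, ¬ P v →
      ∃ z, G.vert z ∈ c ∧ z ∉ s ∧ P (G.vert z) ∧ ¬ P (G.vert (G.inv z)) := by
  induction d with
  | vertex v hc hg hs hr =>
    subst hc
    intro u hu hPu w hw hPw
    rw [Finset.mem_singleton] at hu hw
    exact absurd (hw ▸ hu ▸ hPu) hPw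
  | @glue c c₁ c₂ s s₁ s₂ g g₁ g₂ r r₁ r₂ x y hxy d₁ d₂ hd hc hg H hr ih₁ ih₂ =>
    have hd' := Finset.disjoint_left.1 hd
    have hv₁ := d₁.vert_mem
    have hv₂ := d₂.vert_mem
    have hx := hv₁ _ H.left
    have hy := hv₂ _ H.right
    have hyx : G.inv y = x := by rw [← hxy, G.inv_inv]
    subst hc
    have lift₁ : (∃ z, G.vert z ∈ c₁ ∧ z ∉ s₁ ∧ P (G.vert z) ∧ ¬ P (G.vert (G.inv z))) →
        ∃ z, G.vert z ∈ c₁.disjUnion c₂ hd ∧ z ∉ s ∧ P (G.vert z) ∧ ¬ P (G.vert (G.inv z)) := by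
      rintro ⟨z, h1, h2, h3⟩
      refine ⟨z, by simp [h1], fun h => ?_, h3⟩
      rcases (H.mem_iff z).1 h with h | h
      · exact h2 h.1
      · exact hd' h1 (hv₂ _ h.1)
    have lift₂ : (∃ z, G.vert z ∈ c₂ ∧ z ∉ s₂ ∧ P (G.vert z) ∧ ¬ P (G.vert (G.inv z))) →
        ∃ z, G.vert z ∈ c₁.disjUnion c₂ hd ∧ z ∉ s ∧ P (G.vert z) ∧ ¬ P (G.vert (G.inv z)) := by
      rintro ⟨z, h1, h2, h3⟩
      refine ⟨z, by simp [h1], fun h => ?_, h3⟩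
      rcases (H.mem_iff z).1 h with h | h
      · exact hd' (hv₁ _ h.1) h1
      · exact h2 h.1
    have hxs : x ∉ s := fun h => by
      rcases (H.mem_iff x).1 h with h | h
      · exact h.2 rfl
      · exact H.ne_of_mem H.left h.1 rfl
    have hys : y ∉ s := fun h => by
      rcases (H.mem_iff y).1 h with h | h
      · exact H.ne_of_mem h.1 H.right rfl
      · exact h.2 rfl
    intro u hu hPu w hw hPw
    -- Either the glued edge itself crosses between the vertices with and without `P`, or its ends
    -- are on the same side, and then one of the two parts contains a crossing.
    by_cases hPx : P (G.vert x)
    · by_cases hPy : P (G.vert y)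
      · rcases Finset.mem_disjUnion.1 hw with hw | hw
        · exact lift₁ (ih₁ _ hx hPx w hw hPw)
        · exact lift₂ (ih₂ _ hy hPy w hw hPw)
      · exact ⟨x, by simp [hx], hxs, hPx, by rwa [hxy]⟩
    · by_cases hPy : P (G.vert y)
      · exact ⟨y, by simp [hy], hys, hPy, by rwa [hyx]⟩
      · rcases Finset.mem_disjUnion.1 hu with hu | hu
        · exact lift₁ (ih₁ u hu hPu _ hx hPx)
        · exact lift₂ (ih₂ u hu hPu _ hy hPy)
  | @loop c s s₁ g g₁ r r₁ x y hxy d₁ hg H hr ih =>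
    intro u hu hPu w hw hPw
    obtain ⟨z, h1, h2, h3⟩ := ih u hu hPu w hw hPw
    exact ⟨z, h1, fun h => h2 ((H.mem_iff z).1 h).1, h3⟩

end IsVal

/-! ### Independence of the order of the composition -/

/-- The relations between the compositions of a cyclic operad and contractions. -/
structure Coherent (C : StableGradedCyclicOperad A) (X : Contractions A) : Prop where
  commute : X.Commute
  left : ContractLeft C X
  right : ContractRight C X
  both : ContractBoth C X

/-- The sign absorbs the Koszul sign of `glue_symm`, so it does not matter which part of a gluing
step is called the first one. -/
theorem crossSign_smul_glue_symm {c₁ c₂ : Finset G.Vert} (hd : Disjoint c₁ c₂) {g g₁ g₂ : ℕ}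
    (hg : g₁ + g₂ = g) (hg' : g₂ + g₁ = g) {s₁ s₂ s : Set G.Flag} {x y : G.Flag}
    (H : GlueData s₁ s₂ s x y) {r₁ : A.onSet g₁ s₁} {r₂ : A.onSet g₂ s₂}
    (h₁ : r₁ ∈ A.onSetDeg g₁ s₁ (∑ v ∈ c₁, p v)) (h₂ : r₂ ∈ A.onSetDeg g₂ s₂ (∑ v ∈ c₂, p v)) :
    crossSign o p c₁ c₂ • C.glue hg H r₁ r₂ = crossSign o p c₂ c₁ • C.glue hg' H.symm r₂ r₁ := by
  rw [C.glue_symm hg hg' H h₁ h₂, smul_smul, crossSign_swap o p c₁ c₂ hd]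

theorem LastStep.symm {x y c s g r} (ha : ∀ v, a v ∈ A.onSetDeg (G.genus v) (G.Leg v) (p v))
    (L : LastStep C X G o p a x y c s g r) : LastStep C X G o p a y x c s g r := by
  cases L with
  | glue d₁ d₂ hd hc hg H hr =>
    refine LastStep.glue d₂ d₁ hd.symm ?_ (by omega) H.symm ?_
    · rw [hc, Finset.disjUnion_comm]
    · rw [hr, crossSign_smul_glue_symm hd hg (by omega) H (d₁.mem_deg ha) (d₂.mem_deg ha)]
  | loop d₁ hg H hr =>
    exact LastStep.loop d₁ hg H.symm (by rw [hr, X.loop_symm])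

/-- The edge `zw` attaches the third part at the second one. By `glue_assoc` these two can be glued
before the first part is attached along `xy`. The signs agree because `crossSign` is multiplicative
in disjoint unions. -/
theorem lastStep_glue_glue (ha : ∀ v, a v ∈ A.onSetDeg (G.genus v) (G.Leg v) (p v))
    {c₁ c₂ c₃ c₁₂ c : Finset G.Vert} {s₁ s₂ s₃ s₁₂ s : Set G.Flag} {g₁ g₂ g₃ g₁₂ g : ℕ}
    {r₁ r₂ r₃ r₁₂} {x y z w : G.Flag} (hzw : G.inv z = w)
    (d₁ : IsVal C X G o p a c₁ s₁ g₁ r₁)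
    (d₂ : IsVal C X G o p a c₂ s₂ g₂ r₂) (d₃ : IsVal C X G o p a c₃ s₃ g₃ r₃)
    (hd : Disjoint c₁ c₂) (hc : c₁₂ = c₁.disjUnion c₂ hd) (hg : g₁ + g₂ = g₁₂)
    (H : GlueData s₁ s₂ s₁₂ x y) (hr : r₁₂ = crossSign o p c₁ c₂ • C.glue hg H r₁ r₂)
    (hd' : Disjoint c₁₂ c₃) (hc' : c = c₁₂.disjUnion c₃ hd') (hg' : g₁₂ + g₃ = g)
    (H' : GlueData s₁₂ s₃ s z w) (hz : z ∈ s₂) :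
    LastStep C X G o p a x y c s g (crossSign o p c₁₂ c₃ • C.glue hg' H' r₁₂ r₃) := by
  subst hc hr hc'
  have hd₁₃ : Disjoint c₁ c₃ := Finset.disjoint_left.2 fun u hu hu' =>
    Finset.disjoint_left.1 hd' (Finset.mem_disjUnion.2 (Or.inl hu)) hu'
  have hd₂₃ : Disjoint c₂ c₃ := Finset.disjoint_left.2 fun u hu hu' =>
    Finset.disjoint_left.1 hd' (Finset.mem_disjUnion.2 (Or.inr hu)) hu'
  have hd₁ : Disjoint c₁ (c₂.disjUnion c₃ hd₂₃) := Finset.disjoint_left.2 fun u hu hu' =>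
    (Finset.mem_disjUnion.1 hu').elim (Finset.disjoint_left.1 hd hu)
      (Finset.disjoint_left.1 hd₁₃ hu)
  have hs : Disjoint s₂ s₃ := Set.disjoint_left.2 fun u hu hu' =>
    Finset.disjoint_left.1 hd₂₃ (d₂.vert_mem u hu) (d₃.vert_mem u hu')
  have hs' : Disjoint s₁ s₃ := Set.disjoint_left.2 fun u hu hu' =>
    Finset.disjoint_left.1 hd₁₃ (d₁.vert_mem u hu) (d₃.vert_mem u hu')
  have H₂₃ : GlueData s₂ s₃ ((s₂ \ {z}) ∪ (s₃ \ {w})) z w := ⟨hz, H'.right, hs, rfl⟩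
  have hyz : y ≠ z := by
    rintro rfl
    rcases (H.mem_iff y).1 H'.left with h | h
    · exact H.ne_of_mem h.1 H.right rfl
    · exact h.2 rfl
  have H₁ : GlueData s₁ ((s₂ \ {z}) ∪ (s₃ \ {w})) s x y := by
    refine ⟨H.left, Or.inl ⟨H.right, hyz⟩, ?_, ?_⟩
    · rw [Set.disjoint_left]
      rintro u hu (hu' | hu')
      · exact Set.disjoint_left.1 H.disj hu hu'.1
      · exact Set.disjoint_left.1 hs' hu hu'.1
    · ext u
      have h1 : u ∈ s₁ → u ≠ z := fun h => H.ne_of_mem h hz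
      have h2 : u ∈ s₃ → u ≠ y := fun h e => Set.disjoint_left.1 hs H.right (e ▸ h)
      simp only [H'.mem_iff, H.mem_iff, Set.mem_union, Set.mem_sdiff, Set.mem_singleton_iff]
      grind
  refine LastStep.glue d₁ (IsVal.glue (g := g₂ + g₃) z w hzw d₂ d₃ hd₂₃ rfl rfl H₂₃ rfl) hd₁
    (by ext u; simp) (by omega) H₁ ?_
  rw [crossSign_disjUnion_left, crossSign_disjUnion_right, LinearMap.map_intUnits_smul,
    LinearMap.map_intUnits_smul, LinearMap.smul_apply, smul_smul, smul_smul,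
    C.glue_assoc hg hg' rfl (by omega) H H' H₂₃ H₁ (d₁.mem_deg ha) (d₂.mem_deg ha)
      (d₃.mem_deg ha)]
  congr 1
  ac_rfl

/-- The gluing along `zw` is moved in front of the step along `xy`. If that step is itself a gluing,
`z` lies on one of its two sides and associativity applies; if it is a contraction, `loop_glue`
applies. -/
theorem LastStep.glue_right (hCX : Coherent C X)
    (ha : ∀ v, a v ∈ A.onSetDeg (G.genus v) (G.Leg v) (p v)) {c₁ c₂ c : Finset G.Vert}
    {s₁ s₂ s : Set G.Flag} {g₁ g₂ g : ℕ} {r₁ r₂} {x y z w : G.Flag}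
    (hzw : G.inv z = w) (L : LastStep C X G o p a x y c₁ s₁ g₁ r₁)
    (d₂ : IsVal C X G o p a c₂ s₂ g₂ r₂) (hd : Disjoint c₁ c₂) (hc : c = c₁.disjUnion c₂ hd)
    (hg : g₁ + g₂ = g) (H : GlueData s₁ s₂ s z w) :
    LastStep C X G o p a x y c s g (crossSign o p c₁ c₂ • C.glue hg H r₁ r₂) := by
  cases L with
  | glue d₁₁ d₁₂ hd₁ hc₁ hg₁ H₁ hr₁ =>
    rcases (H₁.mem_iff z).1 H.left with hz | hz
    · refine LastStep.symm ha ?_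
      rw [crossSign_smul_glue_symm hd₁ hg₁ (by omega) H₁ (d₁₁.mem_deg ha) (d₁₂.mem_deg ha)] at hr₁
      exact lastStep_glue_glue ha hzw d₁₂ d₁₁ d₂ hd₁.symm (by rw [hc₁, Finset.disjUnion_comm])
        (by omega) H₁.symm hr₁ hd hc hg H hz.1
    · exact lastStep_glue_glue ha hzw d₁₁ d₁₂ d₂ hd₁ hc₁ hg₁ H₁ hr₁ hd hc hg H hz.1
  | @loop s₁₁ g₁₁ r₁₁ d₁₁ hg₁ H₁ hr₁ =>
    subst hr₁
    obtain ⟨hz, hzx, hzy⟩ := (H₁.mem_iff z).1 H.left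
    have hs : Disjoint s₁₁ s₂ := Set.disjoint_left.2 fun u hu hu' =>
      Finset.disjoint_left.1 hd (d₁₁.vert_mem u hu) (d₂.vert_mem u hu')
    have H₂ : GlueData s₁₁ s₂ ((s₁₁ \ {z}) ∪ (s₂ \ {w})) z w := ⟨hz, H.right, hs, rfl⟩
    have H₃ : LoopData ((s₁₁ \ {z}) ∪ (s₂ \ {w})) s x y := by
      refine ⟨Or.inl ⟨H₁.left, hzx.symm⟩, Or.inl ⟨H₁.right, hzy.symm⟩, H₁.ne, fun u => ?_⟩
      have h1 : u ∈ s₂ → u ≠ x := fun h e => Set.disjoint_left.1 hs H₁.left (e ▸ h)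
      have h2 : u ∈ s₂ → u ≠ y := fun h e => Set.disjoint_left.1 hs H₁.right (e ▸ h)
      simp only [H.mem_iff, H₁.mem_iff, Set.mem_union, Set.mem_sdiff, Set.mem_singleton_iff]
      tauto
    refine LastStep.loop (IsVal.glue (g := g₁₁ + g₂) z w hzw d₁₁ d₂ hd hc rfl H₂ rfl) (by omega)
      H₃ ?_
    rw [LinearMap.map_intUnits_smul, loop_glue hCX.left hCX.right rfl hg₁ (by omega) hg H₂ H₃ H₁ H
      (d₁₁.mem_deg ha) (d₂.mem_deg ha)]

/-- If `w` lies at the same part as `z`, the contraction can be done before the gluing. If it lies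
at the other part, then `xy` and `zw` are parallel edges and `loop_glue_cross` exchanges their
roles. -/
theorem lastStep_loop_glue (hCX : Coherent C X)
    (ha : ∀ v, a v ∈ A.onSetDeg (G.genus v) (G.Leg v) (p v)) {c₁ c₂ c : Finset G.Vert}
    {s₁ s₂ s t : Set G.Flag} {g₁ g₂ g g' : ℕ} {r₁ r₂ r} {x y z w : G.Flag}
    (hzw : G.inv z = w) (d₁ : IsVal C X G o p a c₁ s₁ g₁ r₁) (d₂ : IsVal C X G o p a c₂ s₂ g₂ r₂)
    (hd : Disjoint c₁ c₂) (hc : c = c₁.disjUnion c₂ hd) (hg : g₁ + g₂ = g)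
    (H : GlueData s₁ s₂ s x y) (hr : r = crossSign o p c₁ c₂ • C.glue hg H r₁ r₂)
    (hg' : g + 1 = g') (H' : LoopData s t z w) (hz : z ∈ s₁) :
    LastStep C X G o p a x y c t g' (X.loop hg' H' r) := by
  subst hr
  have hzx : z ≠ x := by
    rintro rfl
    rcases (H.mem_iff z).1 H'.left with h | h
    · exact h.2 rfl
    · exact H.ne_of_mem hz h.1 rfl
  rcases (H.mem_iff w).1 H'.right with hw | hw
  · have H₁ : LoopData s₁ {u | u ∈ s₁ ∧ u ≠ z ∧ u ≠ w} z w := ⟨hz, hw.1, H'.ne, fun _ => Iff.rfl⟩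
    have H₂ : GlueData {u | u ∈ s₁ ∧ u ≠ z ∧ u ≠ w} s₂ t x y := by
      refine ⟨⟨H.left, hzx.symm, hw.2.symm⟩, H.right, ?_, ?_⟩
      · exact H.disj.mono_left fun u hu => hu.1
      · ext u
        have h1 : u ∈ s₂ → u ≠ z := fun h e => H.ne_of_mem hz h e.symm
        have h2 : u ∈ s₂ → u ≠ w := fun h e => H.ne_of_mem hw.1 h e.symm
        simp only [H'.mem_iff, H.mem_iff, Set.mem_union, Set.mem_sdiff, Set.mem_singleton_iff,
          Set.mem_ofPred_eq]
        tauto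
    refine LastStep.glue (IsVal.loop (g := g₁ + 1) z w hzw d₁ rfl H₁ rfl) d₂ hd hc (by omega) H₂ ?_
    rw [LinearMap.map_intUnits_smul, loop_glue hCX.left hCX.right hg rfl hg' (by omega) H H' H₁ H₂
      (d₁.mem_deg ha) (d₂.mem_deg ha)]
  · have K : GlueData s₁ s₂ ((s₁ \ {z}) ∪ (s₂ \ {w})) z w := ⟨hz, hw.1, H.disj, rfl⟩
    have K' : LoopData ((s₁ \ {z}) ∪ (s₂ \ {w})) t x y := by
      refine ⟨Or.inl ⟨H.left, hzx.symm⟩, Or.inr ⟨H.right, hw.2.symm⟩, H.ne_of_mem H.left H.right,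
        fun u => ?_⟩
      have h1 : u ∈ s₂ → u ≠ z := fun h e => H.ne_of_mem hz h e.symm
      have h2 : u ∈ s₁ → u ≠ w := fun h e => H.ne_of_mem h hw.1 e
      have h3 : u ∈ s₂ → u ≠ x := fun h e => H.ne_of_mem H.left h e.symm
      have h4 : u ∈ s₁ → u ≠ y := fun h e => H.ne_of_mem h H.right e
      simp only [H'.mem_iff, H.mem_iff, Set.mem_union, Set.mem_sdiff, Set.mem_singleton_iff]
      grind
    refine LastStep.loop (IsVal.glue (g := g) z w hzw d₁ d₂ hd hc hg K rfl) hg' K' ?_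
    rw [LinearMap.map_intUnits_smul, LinearMap.map_intUnits_smul,
      loop_glue_cross hCX.both hg hg' H H' K K' (d₁.mem_deg ha) (d₂.mem_deg ha)]

/-- If the step along `xy` is a gluing, one may assume that `z` lies at its first part; if it is a
contraction, two contractions commute. -/
theorem LastStep.loop_right (hCX : Coherent C X)
    (ha : ∀ v, a v ∈ A.onSetDeg (G.genus v) (G.Leg v) (p v)) {c : Finset G.Vert}
    {s t : Set G.Flag} {g g' : ℕ} {r} {x y z w : G.Flag}
    (hzw : G.inv z = w) (L : LastStep C X G o p a x y c s g r)
    (hg : g + 1 = g') (H : LoopData s t z w) :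
    LastStep C X G o p a x y c t g' (X.loop hg H r) := by
  cases L with
  | glue d₁ d₂ hd hc hg₁ H₁ hr =>
    rcases (H₁.mem_iff z).1 H.left with hz | hz
    · exact lastStep_loop_glue hCX ha hzw d₁ d₂ hd hc hg₁ H₁ hr hg H hz.1
    · refine LastStep.symm ha ?_
      rw [crossSign_smul_glue_symm hd hg₁ (by omega) H₁ (d₁.mem_deg ha) (d₂.mem_deg ha)] at hr
      exact lastStep_loop_glue hCX ha hzw d₂ d₁ hd.symm
        (by rw [hc, Finset.disjUnion_comm]) (by omega) H₁.symm hr hg H hz.1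
  | @loop s₁ g₁ r₁ d₁ hg₁ H₁ hr =>
    subst hr
    obtain ⟨hz, hzx, hzy⟩ := (H₁.mem_iff z).1 H.left
    obtain ⟨hw, hwx, hwy⟩ := (H₁.mem_iff w).1 H.right
    have H₂ : LoopData s₁ {u | u ∈ s₁ ∧ u ≠ z ∧ u ≠ w} z w := ⟨hz, hw, H.ne, fun _ => Iff.rfl⟩
    have H₃ : LoopData {u | u ∈ s₁ ∧ u ≠ z ∧ u ≠ w} t x y := by
      refine ⟨⟨H₁.left, hzx.symm, hwx.symm⟩, ⟨H₁.right, hzy.symm, hwy.symm⟩, H₁.ne, fun u => ?_⟩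
      simp only [H.mem_iff, H₁.mem_iff, Set.mem_ofPred_eq]
      tauto
    exact LastStep.loop (IsVal.loop (g := g) z w hzw d₁ hg₁ H₂ rfl) hg H₃
      (X.loop_loop hCX.commute hg₁ hg H₁ H H₂ H₃ r₁)

/-- Every edge along which a composition has been taken can be made the last one. -/
theorem IsVal.lastStep (hCX : Coherent C X)
    (ha : ∀ v, a v ∈ A.onSetDeg (G.genus v) (G.Leg v) (p v)) {c s g r}
    (d : IsVal C X G o p a c s g r) :
    ∀ x y, G.inv x = y → G.vert x ∈ c → x ∉ s → LastStep C X G o p a x y c s g r := by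
  induction d with
  | vertex v hc hg hs hr =>
    intro x y hxy hx hxs
    exact absurd (hs.mapsTo (by simpa [hc] using hx)) hxs
  | @glue c c₁ c₂ s s₁ s₂ g g₁ g₂ r r₁ r₂ z w hzw d₁ d₂ hd hc hg H hr ih₁ ih₂ =>
    intro x y hxy hx hxs
    have hx' := hx
    rw [hc, Finset.mem_disjUnion] at hx
    rcases hx with hx | hx
    · by_cases hx₁ : x ∈ s₁
      · obtain rfl : x = z := by
          by_contra hne
          exact hxs ((H.mem_iff x).2 (Or.inl ⟨hx₁, hne⟩))
        obtain rfl : y = w := hxy.symm.trans hzw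
        exact LastStep.glue d₁ d₂ hd hc hg H hr
      · rw [hr]
        exact (ih₁ x y hxy hx hx₁).glue_right hCX ha hzw d₂ hd hc hg H
    · by_cases hx₂ : x ∈ s₂
      · obtain rfl : x = w := by
          by_contra hne
          exact hxs ((H.mem_iff x).2 (Or.inr ⟨hx₂, hne⟩))
        obtain rfl : z = y := by rw [← hxy, ← hzw, G.inv_inv]
        exact (LastStep.glue d₁ d₂ hd hc hg H hr).symm ha
      · rw [hr, crossSign_smul_glue_symm hd hg (by omega) H (d₁.mem_deg ha) (d₂.mem_deg ha)]
        exact (ih₂ x y hxy hx hx₂).glue_right hCX ha (by rw [← hzw, G.inv_inv]) d₁ hd.symm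
          (by rw [hc, Finset.disjUnion_comm]) (by omega) H.symm
  | @loop c s s₁ g g₁ r r₁ z w hzw d₁ hg H hr ih =>
    intro x y hxy hx hxs
    by_cases hx₁ : x ∈ s₁
    · by_cases hxz : x = z
      · subst hxz
        obtain rfl : y = w := hxy.symm.trans hzw
        exact LastStep.loop d₁ hg H hr
      · obtain rfl : x = w := by
          by_contra hne
          exact hxs ((H.mem_iff x).2 ⟨hx₁, hxz, hne⟩)
        obtain rfl : z = y := by rw [← hxy, ← hzw, G.inv_inv]
        exact (LastStep.loop d₁ hg H hr).symm ha
    · rw [hr]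
      exact (ih x y hxy hx hx₁).loop_right hCX ha hzw hg H

end Values

section Unique

variable {k : Type u} [Field k] {A : StableSModule.{u, v} k} {C : StableGradedCyclicOperad A}
  {X : Contractions A} {G : FlagGraph} {o : LinearOrder G.Vert} {p : G.Vert → ℤ}
  {a : ∀ v : G.Vert, A.onSet (G.genus v) (G.Leg v)}

/-! ### Uniqueness of values -/

/-- Both sets are `t ∪ {x, y}`. -/
theorem LoopData.eq {F : Type} {s s' t : Set F} {x y : F} (H : LoopData s t x y)
    (H' : LoopData s' t x y) : s = s' := by
  ext u
  have h1 := H.mem_iff u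
  have h2 := H'.mem_iff u
  have h3 := H.left
  have h4 := H.right
  have h5 := H'.left
  have h6 := H'.right
  grind

namespace IsVal

/-- The part of the vertices on one side of the last edge of a composition is determined. -/
theorem subset_of_glueData {c₁ c₁' c₂ : Finset G.Vert} {s₁ s₂ s s₁' s₂' : Set G.Flag}
    {x y : G.Flag} {g₁ g₂ g₁' r₁ r₂ r₁'} (d₁ : IsVal C X G o p a c₁ s₁ g₁ r₁)
    (d₂ : IsVal C X G o p a c₂ s₂ g₂ r₂) (hd : Disjoint c₁ c₂) (H : GlueData s₁ s₂ s x y)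
    (d₁' : IsVal C X G o p a c₁' s₁' g₁' r₁') (H' : GlueData s₁' s₂' s x y) : c₁ ⊆ c₁' := by
  intro v hv
  by_contra hv'
  -- If `c₁` were not inside `c₁'`, an edge contracted within `c₁` would lead out of `c₁'`. Its flag
  -- `z` is not in `s₁'`: otherwise it would be in `s`, hence in `s₁` or at a vertex of `c₂`. So
  -- this edge is contracted within `c₁'` as well and cannot leave it.
  obtain ⟨z, hz, hzs, hz', hzi⟩ := d₁.exists_crossing (· ∈ c₁') _ (d₁.vert_mem x H.left)
    (d₁'.vert_mem x H'.left) v hv hv'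
  have hzs' : z ∉ s₁' := by
    intro h
    have hzx : z ≠ x := fun e => hzs (e ▸ H.left)
    rcases (H.mem_iff z).1 ((H'.mem_iff z).2 (Or.inl ⟨h, hzx⟩)) with h | h
    · exact hzs h.1
    · exact Finset.disjoint_left.1 hd hz (d₂.vert_mem z h.1)
  exact hzi (d₁'.inv_mem z hz' hzs').1

/-- In a composition ending with the gluing along `xy`, no other contracted edge leaves `c₁`; in one
ending with the contraction of `xy`, the vertices are already connected without this edge. -/
theorem not_glue_and_loop {c₁ c₂ c : Finset G.Vert} {s₁ s₂ s s' : Set G.Flag}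
    {x y : G.Flag} {g₁ g₂ g r₁ r₂ r} (d₁ : IsVal C X G o p a c₁ s₁ g₁ r₁)
    (d₂ : IsVal C X G o p a c₂ s₂ g₂ r₂) (hd : Disjoint c₁ c₂) (hc : c = c₁.disjUnion c₂ hd)
    (H : GlueData s₁ s₂ s x y) (d : IsVal C X G o p a c s' g r) (H' : LoopData s' s x y) :
    False := by
  subst hc
  have hx := d₁.vert_mem x H.left
  have hy := d₂.vert_mem y H.right
  obtain ⟨z, hz, hzs, hz', hzi⟩ := d.exists_crossing (· ∈ c₁) _
    (Finset.mem_disjUnion.2 (Or.inl hx)) hx _ (Finset.mem_disjUnion.2 (Or.inr hy))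
    (fun h => Finset.disjoint_left.1 hd h hy)
  have hzs₁ : z ∉ s₁ := by
    intro h
    have hzx : z ≠ x := fun e => hzs (e ▸ H'.left)
    exact hzs ((H'.mem_iff z).1 ((H.mem_iff z).2 (Or.inl ⟨h, hzx⟩))).1
  exact hzi (d₁.inv_mem z hz' hzs₁).1

/-- The remaining flags of a part are recovered from its vertices, so equal vertex sets have equal
flag sets. -/
theorem flags_left_iff {c₁ c₂ : Finset G.Vert} {s₁ s₂ s : Set G.Flag} {x y : G.Flag}
    {g₁ g₂ r₁ r₂} (d₁ : IsVal C X G o p a c₁ s₁ g₁ r₁) (d₂ : IsVal C X G o p a c₂ s₂ g₂ r₂)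
    (hd : Disjoint c₁ c₂) (H : GlueData s₁ s₂ s x y) :
    s₁ = {u | (u ∈ s ∨ u = x) ∧ G.vert u ∈ c₁} := by
  ext u
  have h1 := H.mem_iff u
  have h2 := d₁.vert_mem u
  have h3 := d₂.vert_mem u
  have h4 := H.left
  have h5 : G.vert u ∈ c₁ → G.vert u ∉ c₂ := fun h => Finset.disjoint_left.1 hd h
  constructor
  · intro h
    refine ⟨?_, h2 h⟩
    by_cases e : u = x
    · exact Or.inr e
    · exact Or.inl (h1.2 (Or.inl ⟨h, e⟩))
  · rintro ⟨h | rfl, h'⟩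
    · rcases h1.1 h with h | h
      · exact h.1
      · exact absurd (h3 h.1) (h5 h')
    · exact h4

/-- The value of a composition does not depend on the order in which it is performed. -/
theorem unique (hCX : Coherent C X) (ha : ∀ v, a v ∈ A.onSetDeg (G.genus v) (G.Leg v) (p v))
    {c s g r} (d : IsVal C X G o p a c s g r) :
    ∀ r', IsVal C X G o p a c s g r' → r = r' := by
  induction d with
  | @vertex c s g r v hc hg hs hr =>
    have no : ∀ x, G.vert x ∈ c → x ∈ s := fun x hx => hs.mapsTo (by simpa [hc] using hx)
    intro r' d'
    cases d' with
    | vertex v' hc' hg' hs' hr' =>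
      obtain rfl : v = v' := by simpa [hc] using hc'
      rw [hr, hr']
    | glue x y hxy d₁ d₂ hd hc' hg H hr' =>
      refine absurd (no x ?_) fun h => ?_
      · rw [hc', Finset.mem_disjUnion]
        exact Or.inl (d₁.vert_mem x H.left)
      · rcases (H.mem_iff x).1 h with h | h
        · exact h.2 rfl
        · exact H.ne_of_mem H.left h.1 rfl
    | loop x y hxy d₁ hg H hr' =>
      exact absurd (no x (d₁.vert_mem x H.left)) fun h => ((H.mem_iff x).1 h).2.1 rfl
  | @glue c c₁ c₂ s s₁ s₂ g g₁ g₂ r r₁ r₂ x y hxy d₁ d₂ hd hc hg H hr ih₁ ih₂ =>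
    intro r' d'
    have hxs : x ∉ s := fun h => by
      rcases (H.mem_iff x).1 h with h | h
      · exact h.2 rfl
      · exact H.ne_of_mem H.left h.1 rfl
    -- The second composition is rearranged so as to end with the same edge; then its parts, their
    -- flags and their genera coincide with those of the first one.
    have L := d'.lastStep hCX ha x y hxy
      (by rw [hc, Finset.mem_disjUnion]; exact Or.inl (d₁.vert_mem x H.left)) hxs
    cases L with
    | @glue c₁' c₂' s₁' s₂' g₁' g₂' r₁' r₂' d₁' d₂' hd' hc' hg' H' hr' =>
      obtain rfl : c₁ = c₁' := (subset_of_glueData d₁ d₂ hd H d₁' H').antisymm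
        (subset_of_glueData d₁' d₂' hd' H' d₁ H)
      obtain rfl : c₂ = c₂' := (subset_of_glueData d₂ d₁ hd.symm H.symm d₂' H'.symm).antisymm
        (subset_of_glueData d₂' d₁' hd'.symm H'.symm d₂ H.symm)
      obtain rfl : s₁ = s₁' := by
        rw [flags_left_iff d₁ d₂ hd H, flags_left_iff d₁' d₂' hd H']
      obtain rfl : s₂ = s₂' := by
        rw [flags_left_iff d₂ d₁ hd.symm H.symm, flags_left_iff d₂' d₁' hd.symm H'.symm]
      obtain rfl : g₁ = g₁' := by
        have h1 := d₁.genus_eq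
        have h2 := d₁'.genus_eq
        omega
      obtain rfl : g₂ = g₂' := by omega
      rw [hr, hr', ih₁ _ d₁', ih₂ _ d₂']
    | loop d₁' hg' H' hr' => exact (not_glue_and_loop d₁ d₂ hd hc H d₁' H').elim
  | @loop c s s₁ g g₁ r r₁ x y hxy d₁ hg H hr ih =>
    intro r' d'
    have L := d'.lastStep hCX ha x y hxy (d₁.vert_mem x H.left)
      (fun h => ((H.mem_iff x).1 h).2.1 rfl)
    cases L with
    | glue d₁' d₂' hd' hc' hg' H' hr' => exact (not_glue_and_loop d₁' d₂' hd' hc' H' d₁ H).elim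
    | @loop s₁' g₁' r₁' d₁' hg' H' hr' =>
      obtain rfl : g₁ = g₁' := by omega
      obtain rfl : s₁ = s₁' := H.eq H'
      rw [hr, hr', ih _ d₁']

end IsVal

/-! ### Existence of values -/

theorem FlagGraph.two_mul_card_edge (G : FlagGraph) :
    2 * Nat.card G.Edge + Set.ncard {x | G.inv x = x} = Nat.card G.Flag := by
  classical
  have : Fintype G.Flag := Fintype.ofFinite _
  set S : Finset G.Flag := Finset.univ.filter fun x => G.inv x ≠ x with hS
  let f : G.Flag → Sym2 G.Flag := fun x => s(x, G.inv x)
  have h1 : Nat.card G.Edge = (S.image f).card := by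
    have : {e : Sym2 G.Flag | ∃ x, G.inv x ≠ x ∧ e = s(x, G.inv x)} = (S.image f : Set _) := by
      ext e
      simp [hS, f, eq_comm]
    rw [← Set.ncard_coe_finset, ← this]
    rfl
  have h2 : S.card = ∑ e ∈ S.image f, (S.filter fun x => f x = e).card :=
    Finset.card_eq_sum_card_image f S
  have h3 : ∀ e ∈ S.image f, (S.filter fun x => f x = e).card = 2 := by
    intro e he
    obtain ⟨x, hx, rfl⟩ := Finset.mem_image.1 he
    have hx' : G.inv x ≠ x := by simpa [hS] using hx
    have : (S.filter fun y => f y = f x) = {x, G.inv x} := by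
      ext y
      simp only [hS, f, Finset.mem_filter, Finset.mem_univ, true_and, Finset.mem_insert,
        Finset.mem_singleton, Sym2.eq_iff]
      constructor
      · rintro ⟨-, h | h⟩
        · exact Or.inl h.1
        · exact Or.inr h.1
      · rintro (rfl | rfl)
        · exact ⟨hx', by simp⟩
        · rw [G.inv_inv]
          exact ⟨hx'.symm, by simp⟩
    rw [this, Finset.card_pair hx'.symm]
  rw [Finset.sum_congr rfl h3, Finset.sum_const, smul_eq_mul] at h2
  have h4 : Set.ncard {x | G.inv x = x} = (Finset.univ.filter fun x => G.inv x = x).card := by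
    rw [← Set.ncard_coe_finset]
    congr 1
    ext x
    simp
  have h5 := Finset.card_filter_add_card_filter_not (s := (Finset.univ : Finset G.Flag))
    (fun x => G.inv x = x)
  rw [h1, h4, Nat.card_eq_fintype_card, ← Finset.card_univ]
  have : S.card = ((Finset.univ : Finset G.Flag).filter fun x => ¬ G.inv x = x).card := rfl
  omega

variable (C X o p a) in
-- A part is grown from one vertex: an edge with both ends among the remaining flags is contracted
-- if there is one; otherwise connectedness provides an edge to a new vertex, which is glued. The
-- measure gives each missing vertex the weight `|Flag| + 1`, more than the number of flags it can
-- bring.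
theorem exists_isVal_univ (hG : G.Connected) :
    ∃ g r, IsVal C X G o p a Finset.univ {x | G.inv x = x} g r := by
  classical
  obtain ⟨⟨v₀⟩, hG⟩ := hG
  have key : ∀ (n : ℕ) (c : Finset G.Vert) (s : Set G.Flag) (g : ℕ) (r : A.onSet g s),
      IsVal C X G o p a c s g r → (Finset.univ \ c).card * (Nat.card G.Flag + 1) + s.ncard ≤ n →
        ∃ g r, IsVal C X G o p a Finset.univ {x | G.inv x = x} g r := by
    intro n
    induction n with
    | zero =>
      intro c s g r d hn
      have h1 : s = ∅ := by
        rw [← Set.ncard_eq_zero]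
        omega
      have h2 : c = Finset.univ := by
        have : (Finset.univ \ c).card = 0 := by
          by_contra h
          have := Nat.mul_pos (Nat.pos_of_ne_zero h) (Nat.succ_pos (Nat.card G.Flag))
          simp only [Nat.succ_eq_add_one] at this
          omega
        rw [Finset.card_eq_zero, Finset.sdiff_eq_empty_iff_subset] at this
        exact Finset.univ_subset_iff.1 this
      subst h1 h2
      have : {x | G.inv x = x} = (∅ : Set G.Flag) := by
        ext x
        simpa using (d.inv_mem x (Finset.mem_univ _) (fun h => h)).2.2
      rw [this]
      exact ⟨g, r, d⟩
    | succ n ih =>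
      intro c s g r d hn
      by_cases h : ∃ x ∈ s, G.inv x ∈ s ∧ G.inv x ≠ x
      · obtain ⟨x, hx, hxi, hne⟩ := h
        have H : LoopData s {u | u ∈ s ∧ u ≠ x ∧ u ≠ G.inv x} x (G.inv x) :=
          ⟨hx, hxi, hne.symm, fun _ => Iff.rfl⟩
        refine ih _ _ _ _ (IsVal.loop (g := g + 1) x _ rfl d rfl H rfl) ?_
        have := H.ncard_add_two
        omega
      · by_cases hc : c = Finset.univ
        · have : {x | G.inv x = x} = s := by
            ext x
            constructor
            · intro hx
              by_contra hxs
              exact (d.inv_mem x (by simp [hc]) hxs).2.2 hx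
            · intro hx
              by_contra hne
              refine h ⟨x, hx, ?_, hne⟩
              by_contra hxs
              refine (d.inv_mem _ (by simp [hc]) hxs).2.1 ?_
              rwa [G.inv_inv]
          rw [this]
          exact ⟨g, r, hc ▸ d⟩
        · obtain ⟨v, hv⟩ := d.nonempty
          obtain ⟨w, hw⟩ : ∃ w, w ∉ c := by
            by_contra hc'
            push Not at hc'
            exact hc (Finset.eq_univ_iff_forall.2 hc')
          obtain ⟨x, hx, hxi⟩ : ∃ x, G.vert x ∈ c ∧ G.vert (G.inv x) ∉ c := by
            have := hG v w
            induction this with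
            | refl => exact absurd hv hw
            | @tail b d' _ hbd ih =>
              by_cases hb : b ∈ c
              · obtain ⟨x, rfl, rfl⟩ := hbd
                exact ⟨x, hb, hw⟩
              · exact ih hb
          have hxs : x ∈ s := by
            by_contra hxs
            exact hxi (d.inv_mem x hx hxs).1
          have hd : Disjoint c {G.vert (G.inv x)} := Finset.disjoint_singleton_right.2 hxi
          have H : GlueData s {u | G.vert u = G.vert (G.inv x)}
              ((s \ {x}) ∪ ({u | G.vert u = G.vert (G.inv x)} \ {G.inv x})) x (G.inv x) := by
            refine ⟨hxs, rfl, Set.disjoint_left.2 fun u hu hu' => hxi ?_, rfl⟩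
            exact hu' ▸ d.vert_mem u hu
          refine ih _ _ _ _ (IsVal.glue x _ rfl d (IsVal.vertex _ rfl rfl (Set.bijOn_id _) rfl)
            hd rfl rfl H rfl) ?_
          have h1 := H.ncard_add_two
          have h2 : (Finset.univ \ c).card =
              (Finset.univ \ c.disjUnion {G.vert (G.inv x)} hd).card + 1 := by
            have : Finset.univ \ c =
                insert (G.vert (G.inv x)) (Finset.univ \ c.disjUnion {G.vert (G.inv x)} hd) := by
              ext u
              simp only [Finset.mem_sdiff, Finset.mem_univ, true_and, Finset.mem_insert,
                Finset.mem_disjUnion, Finset.mem_singleton]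
              by_cases hu : u = G.vert (G.inv x)
              · simp [hu, hxi]
              · simp [hu]
            rw [this, Finset.card_insert_of_notMem (by simp)]
          have h3 : Set.ncard {u | G.vert u = G.vert (G.inv x)} ≤ Nat.card G.Flag :=
            Set.ncard_le_card _
          rw [h2, add_mul] at hn
          omega
  exact key _ _ _ _ _ (IsVal.vertex v₀ rfl rfl (Set.bijOn_id _) rfl) le_rfl

/-- `IsVal.genus_eq` for all vertices is the Euler characteristic formula defining the genus of a
graph, once edges are counted by flags. -/
theorem IsVal.genus_eq_of_hasGenus {γ g r} (d : IsVal C X G o p a Finset.univ {x | G.inv x = x} g r)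
    (hG : G.HasGenus γ) : g = γ := by
  have h1 := d.genus_eq
  have h2 := G.two_mul_card_edge
  unfold FlagGraph.HasGenus at hG
  simp only [Finset.mem_univ, Set.ofPred_true, Set.ncard_univ, Finset.card_univ] at h1
  rw [Nat.card_eq_fintype_card] at hG
  omega

end Unique

/-! ### Dependence of values on the decorations -/

theorem crossSign_congr {V : Type} (o : LinearOrder V) {p p' : V → ℤ} {c₁ c₂ : Finset V}
    (h₁ : ∀ v ∈ c₁, p v = p' v) (h₂ : ∀ v ∈ c₂, p v = p' v) :
    crossSign o p c₁ c₂ = crossSign o p' c₁ c₂ := by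
  refine Finset.prod_congr rfl fun u hu => Finset.prod_congr rfl fun v hv => ?_
  rw [h₁ u hu, h₂ v hv]

section Decorations

variable {k : Type u} [Field k] {A : StableSModule.{u, v} k} {C : StableGradedCyclicOperad A}
  {X : Contractions A} {G : FlagGraph} {o : LinearOrder G.Vert} {p p' : G.Vert → ℤ}
  {a a' : ∀ v : G.Vert, A.onSet (G.genus v) (G.Leg v)}

namespace IsVal

/-- Only what is attached to the vertices in `c` enters. This allows the decoration to be changed at
a vertex of the other part of a gluing. -/
theorem congr {c s g r} (d : IsVal C X G o p a c s g r) (hp : ∀ v ∈ c, p v = p' v)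
    (ha : ∀ v ∈ c, a v = a' v) : IsVal C X G o p' a' c s g r := by
  induction d with
  | vertex v hc hg hs hr =>
    exact IsVal.vertex v hc hg hs (by rw [hr, ha v (by simp [hc])])
  | @glue c c₁ c₂ s s₁ s₂ g g₁ g₂ r r₁ r₂ x y hxy d₁ d₂ hd hc hg H hr ih₁ ih₂ =>
    subst hc
    have h1 : ∀ v ∈ c₁, v ∈ c₁.disjUnion c₂ hd := fun v hv => Finset.mem_disjUnion.2 (Or.inl hv)
    have h2 : ∀ v ∈ c₂, v ∈ c₁.disjUnion c₂ hd := fun v hv => Finset.mem_disjUnion.2 (Or.inr hv)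
    refine IsVal.glue x y hxy (ih₁ (fun v hv => hp v (h1 v hv)) (fun v hv => ha v (h1 v hv)))
      (ih₂ (fun v hv => hp v (h2 v hv)) (fun v hv => ha v (h2 v hv))) hd rfl hg H ?_
    rw [hr, crossSign_congr o (fun v hv => hp v (h1 v hv)) (fun v hv => hp v (h2 v hv))]
  | loop x y hxy d₁ hg H hr ih => exact IsVal.loop x y hxy (ih hp ha) hg H hr

/-- Values are linear in each decoration. -/
theorem linear {v : G.Vert} {a₀ a₁ a₂ : ∀ v : G.Vert, A.onSet (G.genus v) (G.Leg v)} {l m : k}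
    (h₁ : ∀ w, w ≠ v → a₀ w = a₁ w) (h₂ : ∀ w, w ≠ v → a₀ w = a₂ w)
    (hv : a₀ v = l • a₁ v + m • a₂ v) {c s g r} (d : IsVal C X G o p a₀ c s g r) (hvc : v ∈ c) :
    ∃ r₁ r₂, IsVal C X G o p a₁ c s g r₁ ∧ IsVal C X G o p a₂ c s g r₂ ∧
      r = l • r₁ + m • r₂ := by
  induction d with
  | vertex w hc hg hs hr =>
    obtain rfl : v = w := by simpa [hc] using hvc
    exact ⟨_, _, IsVal.vertex v hc hg hs rfl, IsVal.vertex v hc hg hs rfl, by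
      rw [hr, hv, map_add, map_smul, map_smul]⟩
  | glue x y hxy d₁ d₂ hd hc hg H hr ih₁ ih₂ =>
    subst hc
    rcases Finset.mem_disjUnion.1 hvc with h | h
    · have hne : ∀ w ∈ _, w ≠ v := fun w hw e => Finset.disjoint_left.1 hd h (e ▸ hw)
      obtain ⟨r₁, r₂, e₁, e₂, e⟩ := ih₁ h
      refine ⟨_, _, IsVal.glue x y hxy e₁ (d₂.congr (fun _ _ => rfl)
        fun w hw => h₁ w (hne w hw)) hd rfl hg H rfl, IsVal.glue x y hxy e₂
        (d₂.congr (fun _ _ => rfl) fun w hw => h₂ w (hne w hw)) hd rfl hg H rfl, ?_⟩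
      rw [hr, e, map_add, map_smul, map_smul, LinearMap.add_apply, LinearMap.smul_apply,
        LinearMap.smul_apply, smul_add, smul_comm l, smul_comm m]
    · have hne : ∀ w ∈ _, w ≠ v := fun w hw e => Finset.disjoint_left.1 hd hw (e ▸ h)
      obtain ⟨r₁, r₂, e₁, e₂, e⟩ := ih₂ h
      refine ⟨_, _, IsVal.glue x y hxy (d₁.congr (fun _ _ => rfl)
        fun w hw => h₁ w (hne w hw)) e₁ hd rfl hg H rfl, IsVal.glue x y hxy
        (d₁.congr (fun _ _ => rfl) fun w hw => h₂ w (hne w hw)) e₂ hd rfl hg H rfl, ?_⟩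
      rw [hr, e, map_add, map_smul, map_smul, smul_add, smul_comm l, smul_comm m]
  | loop x y hxy d₁ hg H hr ih =>
    obtain ⟨r₁, r₂, e₁, e₂, e⟩ := ih hvc
    exact ⟨_, _, IsVal.loop x y hxy e₁ hg H rfl, IsVal.loop x y hxy e₂ hg H rfl, by
      rw [hr, e, map_add, map_smul, map_smul]⟩

end IsVal

open Classical in
/-- The sign for moving an operator of degree `-1` past the vertices in `c` before `v`. -/
def passSign {V : Type} (o : LinearOrder V) (p : V → ℤ) (c : Finset V) (v : V) : ℤˣ :=
  ∏ u ∈ c, if o.lt u v then (p u).negOnePow else 1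

theorem passSign_disjUnion {V : Type} (o : LinearOrder V) (p : V → ℤ) (c₁ c₂ : Finset V)
    (hd : Disjoint c₁ c₂) (v : V) :
    passSign o p (c₁.disjUnion c₂ hd) v = passSign o p c₁ v * passSign o p c₂ v := by
  simp only [passSign, Finset.prod_disjUnion]

open Classical in
-- Only pairs that involve `v` change, and `(p v - 1) p w` differs from `p v * p w` by `p w`: this
-- is the sign for moving `d` past the vertices of `c₂` before `v`.
theorem crossSign_update_left {V : Type} (o : LinearOrder V) (p : V → ℤ) {c₁ c₂ : Finset V}
    (hd : Disjoint c₁ c₂) {v : V} (hv : v ∈ c₁) :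
    crossSign o (Function.update p v (p v - 1)) c₁ c₂ = crossSign o p c₁ c₂ * passSign o p c₂ v := by
  have h2 : ∀ w ∈ c₂, w ≠ v := fun w hw e => Finset.disjoint_left.1 hd hv (e ▸ hw)
  unfold crossSign
  rw [← Finset.mul_prod_erase _ _ hv, ← Finset.mul_prod_erase c₁ _ hv]
  have e1 : ∀ u ∈ c₁.erase v, (∏ w ∈ c₂, if o.lt w u then
      (Function.update p v (p v - 1) u * Function.update p v (p v - 1) w).negOnePow else 1) =
      ∏ w ∈ c₂, if o.lt w u then (p u * p w).negOnePow else 1 := fun u hu =>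
    Finset.prod_congr rfl fun w hw => by
      rw [Function.update_of_ne (Finset.ne_of_mem_erase hu), Function.update_of_ne (h2 w hw)]
  have e2 : (∏ w ∈ c₂, if o.lt w v then
      (Function.update p v (p v - 1) v * Function.update p v (p v - 1) w).negOnePow else 1) =
      (∏ w ∈ c₂, if o.lt w v then (p v * p w).negOnePow else 1) * passSign o p c₂ v := by
    rw [passSign, ← Finset.prod_mul_distrib]
    refine Finset.prod_congr rfl fun w hw => ?_
    rw [Function.update_self, Function.update_of_ne (h2 w hw)]
    split_ifs
    · rw [← Int.negOnePow_add]
      exact negOnePow_congr ⟨-p w, by ring⟩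
    · simp
  rw [Finset.prod_congr rfl e1, e2]
  ac_rfl

open Classical in
-- A vertex `u ∈ c₁` before `v` contributes through `passSign`, one after `v` through the lowered
-- degree. Together all of `c₁` contributes, which is the sign for moving `d` past the whole first
-- factor.
theorem crossSign_update_right {V : Type} (o : LinearOrder V) (p : V → ℤ) {c₁ c₂ : Finset V}
    (hd : Disjoint c₁ c₂) {v : V} (hv : v ∈ c₂) :
    crossSign o (Function.update p v (p v - 1)) c₁ c₂ * passSign o p c₁ v =
      crossSign o p c₁ c₂ * (∑ u ∈ c₁, p u).negOnePow := by
  have h1 : ∀ w ∈ c₁, w ≠ v := fun w hw e => Finset.disjoint_left.1 hd hw (e ▸ hv)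
  unfold crossSign passSign
  rw [negOnePow_sum, ← Finset.prod_mul_distrib, ← Finset.prod_mul_distrib]
  refine Finset.prod_congr rfl fun u hu => ?_
  rw [← Finset.mul_prod_erase _ _ hv, ← Finset.mul_prod_erase c₂ _ hv]
  have e1 : (∏ w ∈ c₂.erase v, if o.lt w u then
      (Function.update p v (p v - 1) u * Function.update p v (p v - 1) w).negOnePow else 1) =
      ∏ w ∈ c₂.erase v, if o.lt w u then (p u * p w).negOnePow else 1 :=
    Finset.prod_congr rfl fun w hw => by
      rw [Function.update_of_ne (Finset.ne_of_mem_erase hw), Function.update_of_ne (h1 u hu)]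
  rw [e1, Function.update_self, Function.update_of_ne (h1 u hu)]
  rcases lt_or_gt_of_ne (h1 u hu) with h | h
  · rw [if_neg (not_lt_of_gt h), if_neg (not_lt_of_gt h), if_pos h]
  · rw [if_pos h, if_pos h, if_neg (not_lt_of_gt h), mul_one, mul_right_comm, ← Int.negOnePow_add]
    congr 1
    exact negOnePow_congr ⟨-p u, by ring⟩

open Classical in
/-- The Leibniz rule. -/
theorem IsVal.leibniz (ha : ∀ v, a v ∈ A.onSetDeg (G.genus v) (G.Leg v) (p v)) {c s g r}
    (d : IsVal C X G o p a c s g r) :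
    ∃ ρ : G.Vert → A.onSet g s,
      (∀ v ∈ c, IsVal C X G o (Function.update p v (p v - 1))
        (Function.update a v (A.onSetD _ _ (a v))) c s g (ρ v)) ∧
      A.onSetD g s r = ∑ v ∈ c, passSign o p c v • ρ v := by
  induction d with
  | @vertex c s g r w hc hg hs hr =>
    subst hc
    refine ⟨fun _ => A.push hg id hs (A.onSetD _ _ (a w)), fun v hv => ?_, ?_⟩
    · obtain rfl := Finset.mem_singleton.1 hv
      exact IsVal.vertex v rfl hg hs (by rw [Function.update_self]; rfl)
    · rw [hr, A.onSetD_push, Finset.sum_singleton, passSign, Finset.prod_singleton,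
        if_neg (lt_irrefl _), one_smul]
  | @glue c c₁ c₂ s s₁ s₂ g g₁ g₂ r r₁ r₂ x y hxy d₁ d₂ hd hc hg H hr ih₁ ih₂ =>
    subst hc
    obtain ⟨ρ₁, hρ₁, e₁⟩ := ih₁
    obtain ⟨ρ₂, hρ₂, e₂⟩ := ih₂
    have hne₁ : ∀ v ∈ c₁, ∀ w ∈ c₂, w ≠ v := fun v hv w hw e =>
      Finset.disjoint_left.1 hd hv (e ▸ hw)
    have hne₂ : ∀ v ∈ c₂, ∀ w ∈ c₁, w ≠ v := fun v hv w hw e => hne₁ w hw v hv e.symm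
    -- The sign is that of the lowered degrees, as required of a value for the changed decoration.
    refine ⟨fun v => crossSign o (Function.update p v (p v - 1)) c₁ c₂ •
      (if v ∈ c₁ then C.glue hg H (ρ₁ v) r₂ else C.glue hg H r₁ (ρ₂ v)), fun v hv => ?_, ?_⟩
    · beta_reduce
      rcases Finset.mem_disjUnion.1 hv with h | h
      · rw [if_pos h]
        refine IsVal.glue x y hxy (hρ₁ v h) (d₂.congr (fun w hw => ?_) (fun w hw => ?_)) hd rfl hg
          H rfl
        · rw [Function.update_of_ne (hne₁ v h w hw)]
        · rw [Function.update_of_ne (hne₁ v h w hw)]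
      · rw [if_neg fun h' => hne₁ v h' v h rfl]
        refine IsVal.glue x y hxy (d₁.congr (fun w hw => ?_) (fun w hw => ?_)) (hρ₂ v h) hd rfl hg
          H rfl
        · rw [Function.update_of_ne (hne₂ v h w hw)]
        · rw [Function.update_of_ne (hne₂ v h w hw)]
    · rw [hr, LinearMap.map_intUnits_smul, C.glue_d hg H (d₁.mem_deg ha) (d₂.mem_deg ha), e₁, e₂,
        Finset.sum_disjUnion, smul_add]
      congr 1
      · rw [map_sum, LinearMap.sum_apply, Finset.smul_sum]
        refine Finset.sum_congr rfl fun v hv => ?_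
        beta_reduce
        rw [if_pos hv, LinearMap.map_intUnits_smul, passSign_disjUnion, smul_smul,
          crossSign_update_left o p hd hv]
        rw [Units.smul_def, Units.smul_def, Units.smul_def, LinearMap.smul_apply, ← Units.smul_def,
          ← Units.smul_def, ← Units.smul_def, smul_smul]
        congr 1
        calc _ = crossSign o p c₁ c₂ * passSign o p c₁ v *
              (passSign o p c₂ v * passSign o p c₂ v) := by
              rw [Int.units_mul_self, mul_one]
          _ = _ := by ac_rfl
      · rw [map_sum, Finset.smul_sum, Finset.smul_sum]
        refine Finset.sum_congr rfl fun v hv => ?_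
        beta_reduce
        rw [if_neg fun h' => hne₁ v h' v hv rfl, LinearMap.map_intUnits_smul, passSign_disjUnion,
          smul_smul, smul_smul, smul_smul]
        congr 1
        rw [← crossSign_update_right o p hd hv]
        ac_rfl
  | loop x y hxy d₁ hg H hr ih =>
    obtain ⟨ρ, hρ, e⟩ := ih
    refine ⟨fun v => X.loop hg H (ρ v), fun v hv => IsVal.loop x y hxy (hρ v hv) hg H rfl, ?_⟩
    rw [hr, X.loop_d, e, map_sum]
    exact Finset.sum_congr rfl fun v hv => LinearMap.map_intUnits_smul _ _ _

end Decorations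

/-! ### Functoriality of values -/

section Map

variable {k : Type u} [Field k] {A : StableSModule.{u, v} k} {C : StableGradedCyclicOperad A}
  {X : Contractions A} {G G' : FlagGraph} {o : LinearOrder G.Vert} {o' : LinearOrder G'.Vert}
  {p : G.Vert → ℤ} {p' : G'.Vert → ℤ} {a : ∀ v : G.Vert, A.onSet (G.genus v) (G.Leg v)}
  {a' : ∀ v : G'.Vert, A.onSet (G'.genus v) (G'.Leg v)}

/-- Values are transported along injective maps of flags, under which vertices may correspond to
parts of the target graph. -/
theorem IsVal.map (ha : ∀ v, a v ∈ A.onSetDeg (G.genus v) (G.Leg v) (p v)) (f : G.Flag → G'.Flag)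
    (hf : Function.Injective f) (Φ : Finset G.Vert → Finset G'.Vert) (K : Finset G.Vert → ℤˣ)
    (hΦ : ∀ c₁ c₂ (hd : Disjoint c₁ c₂), ∃ hd' : Disjoint (Φ c₁) (Φ c₂),
      Φ (c₁.disjUnion c₂ hd) = (Φ c₁).disjUnion (Φ c₂) hd')
    (hK : ∀ c₁ c₂ (hd : Disjoint c₁ c₂), K (c₁.disjUnion c₂ hd) * crossSign o p c₁ c₂ =
      K c₁ * K c₂ * crossSign o' p' (Φ c₁) (Φ c₂))
    (hinv : ∀ x, G.inv x ≠ x → G'.inv (f x) = f (G.inv x))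
    (hvert : ∀ v s g (hg : G.genus v = g) (t : Set G'.Flag)
      (hs : Set.BijOn id {x | G.vert x = v} s) (h : Set.BijOn f s t), ∃ r,
      IsVal C X G' o' p' a' (Φ {v}) t g r ∧
        r = K {v} • A.push rfl f h (A.push hg id hs (a v)))
    {c s g r} (d : IsVal C X G o p a c s g r) :
    ∀ (t : Set G'.Flag) (h : Set.BijOn f s t),
      IsVal C X G' o' p' a' (Φ c) t g (K c • A.push rfl f h r) := by
  induction d with
  | vertex v hc hg hs hr =>
    subst hc hr
    intro t h
    obtain ⟨r, d, rfl⟩ := hvert v _ _ hg t hs h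
    exact d
  | @glue c c₁ c₂ s s₁ s₂ g g₁ g₂ r r₁ r₂ x y hxy d₁ d₂ hd hc hg H hr ih₁ ih₂ =>
    subst hc hr
    intro t h
    obtain ⟨hd', e⟩ := hΦ c₁ c₂ hd
    have h₁ : Set.BijOn f s₁ (f '' s₁) := hf.injOn.bijOn_image
    have h₂ : Set.BijOn f s₂ (f '' s₂) := hf.injOn.bijOn_image
    have H' : GlueData (f '' s₁) (f '' s₂) t (f x) (f y) := by
      have := H.push h₁ h₂ hf.injOn
      rwa [h.image_eq] at this
    have hne : G.inv x ≠ x := hxy ▸ (H.ne_of_mem H.left H.right).symm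
    refine IsVal.glue (f x) (f y) (by rw [hinv x hne, hxy]) (ih₁ _ h₁) (ih₂ _ h₂) hd' e hg H' ?_
    rw [LinearMap.map_intUnits_smul, LinearMap.map_intUnits_smul, LinearMap.map_intUnits_smul]
    rw [Units.smul_def (K c₁), LinearMap.smul_apply, ← Units.smul_def,
      C.glue_push hg H H' h₁ h₂ h rfl rfl (d₁.mem_deg ha) (d₂.mem_deg ha), smul_smul, smul_smul,
      smul_smul, hK c₁ c₂ hd]
    congr 1
    ac_rfl
  | @loop c s s₁ g g₁ r r₁ x y hxy d₁ hg H hr ih =>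
    subst hr
    intro t h
    have h₁ : Set.BijOn f s₁ (f '' s₁) := hf.injOn.bijOn_image
    have H' : LoopData (f '' s₁) t (f x) (f y) := by
      have := H.push h₁
      rwa [h.image_eq] at this
    have hne : G.inv x ≠ x := hxy ▸ H.ne.symm
    refine IsVal.loop (f x) (f y) (by rw [hinv x hne, hxy]) (ih _ h₁) hg H' ?_
    rw [LinearMap.map_intUnits_smul, X.loop_push hg H H' h₁ h rfl rfl]

end Map

/-! ### Multilinear maps and gradings -/

section Multilinear

variable {k : Type*} [Field k] {ι : Type*} [Fintype ι] [DecidableEq ι] {M : ι → Type*}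
  [∀ i, AddCommGroup (M i)] [∀ i, Module k (M i)]
  {D : ∀ i, ℤ → Submodule k (M i)}

/-- A multilinear map can be prescribed on the homogeneous elements of each family of degrees. -/
theorem exists_multilinearMap {N : Type*} [AddCommGroup N] [Module k N]
    (hD : ∀ i, DirectSum.IsInternal (D i))
    (F : ∀ p : ι → ℤ, MultilinearMap k (fun i => D i (p i)) N) :
    ∃ φ : MultilinearMap k M N, ∀ (p : ι → ℤ) (x : ∀ i, D i (p i)), φ (fun i => x i) = F p x := by
  classical
  have hb : ∀ i, Function.Bijective (DirectSum.coeLinearMap (D i)) := hD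
  let e := fun i => LinearEquiv.ofBijective (DirectSum.coeLinearMap (D i)) (hb i)
  let φ := MultilinearMap.fromDFinsuppEquiv (fun _ : ι => ℤ) k (M := fun i j => D i j) F
  refine ⟨MultilinearMap.compLinearMap (M₁' := fun i => Π₀ j, D i j) φ
    (fun i => (e i).symm.toLinearMap), fun p x => ?_⟩
  rw [MultilinearMap.compLinearMap_apply]
  have : ∀ i, (e i).symm.toLinearMap (x i : M i) = DFinsupp.single (p i) (x i) := by
    intro i
    refine (LinearEquiv.symm_apply_eq _).2 ?_
    exact (DirectSum.coeLinearMap_lof (D i) (p i) (x i)).symm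
  rw [funext this]
  exact MultilinearMap.fromDFinsuppEquiv_single (κ := fun _ : ι => ℤ) (R := k)
    (M := fun i j => D i j) F p x

/-- Functions that are additive in each variable are equal if they agree on homogeneous elements. -/
theorem eq_of_eq_on_homogeneous {N : Type*} [AddCommGroup N]
    (hD : ∀ i, DirectSum.IsInternal (D i)) {f f' : (∀ i, M i) → N}
    (hf : ∀ a i x y, f (Function.update a i (x + y)) =
      f (Function.update a i x) + f (Function.update a i y))
    (hf' : ∀ a i x y, f' (Function.update a i (x + y)) =
      f' (Function.update a i x) + f' (Function.update a i y))
    (h : ∀ (p : ι → ℤ) a, (∀ i, a i ∈ D i (p i)) → f a = f' a) (a : ∀ i, M i) : f a = f' a := by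
  -- Induction on a set `s` of places outside of which the argument is homogeneous; additivity in
  -- one variable removes one place at a time.
  have key : ∀ (s : Finset ι) (a : ∀ i, M i), (∀ i ∉ s, ∃ q, a i ∈ D i q) → f a = f' a := by
    intro s
    induction s using Finset.induction_on with
    | empty =>
      intro a ha
      choose p hp using fun i => ha i (Finset.notMem_empty i)
      exact h p a hp
    | insert i s hi ih =>
      intro a ha
      have : ∀ x, f (Function.update a i x) = f' (Function.update a i x) := by
        intro x
        refine (hD i).induction_on
          (P := fun x => f (Function.update a i x) = f' (Function.update a i x)) ?_ ?_ x
        · intro q x hx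
          refine ih _ fun j hj => ?_
          by_cases hji : j = i
          · subst hji
            exact ⟨q, by rwa [Function.update_self]⟩
          · rw [Function.update_of_ne hji]
            exact ha j (by simp [hji, hj])
        · intro x y hx hy
          rw [hf, hf', hx, hy]
      simpa using this (a i)
  exact key Finset.univ a fun i hi => absurd (Finset.mem_univ i) hi

end Multilinear

/-! ### The modular operad of a cyclic operad with coherent contractions -/

section Construction

variable {k : Type u} [Field k] {A : StableSModule.{u, v} k} {C : StableGradedCyclicOperad A}
  {X : Contractions A}

theorem StableGraph.exists_isVal (C : StableGradedCyclicOperad A) (X : Contractions A) {γ : ℕ}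
    {I : Type} (G : StableGraph γ I) (o : LinearOrder G.Vert) (p : G.Vert → ℤ)
    (a : ∀ v : G.Vert, A.onSet (G.genus v) (G.toFlagGraph.Leg v)) :
    ∃ r, IsVal C X G.toFlagGraph o p a Finset.univ {x | G.inv x = x} γ r := by
  obtain ⟨g, r, d⟩ := exists_isVal_univ C X o p a G.connected
  obtain rfl := d.genus_eq_of_hasGenus G.hasGenus
  exact ⟨r, d⟩

/-- Relabelling from the set of flags that are legs to the set of labels. -/
def StableGraph.label (A : StableSModule.{u, v} k) {γ : ℕ} {I : Type} (G : StableGraph γ I) :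
    A.onSet γ ({x | G.inv x = x} : Set G.Flag) →ₗ[k] A.onSet γ I :=
  A.relabel (I := G.toFlagGraph.Legs) rfl G.leg

/-- For fixed degrees the value exists and is unique, hence it is multilinear by `IsVal.linear`. The
maps for all families of degrees are then assembled into one. -/
theorem exists_comp (hCX : Coherent C X) {γ : ℕ} {I : Type} (G : StableGraph γ I)
    (o : LinearOrder G.Vert) :
    ∃ φ : MultilinearMap k (fun v : G.Vert => A.onSet (G.genus v) (G.toFlagGraph.Leg v))
      (A.onSet γ I),
    ∀ p a, (∀ v, a v ∈ A.onSetDeg (G.genus v) (G.toFlagGraph.Leg v) (p v)) →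
      ∀ r, IsVal C X G.toFlagGraph o p a Finset.univ {x | G.inv x = x} γ r →
        φ a = G.label A r := by
  classical
  choose V hV using G.exists_isVal C X o
  let F : ∀ p : G.Vert → ℤ,
      MultilinearMap k (fun v => A.onSetDeg (G.genus v) (G.toFlagGraph.Leg v) (p v)) (A.onSet γ I) :=
    fun p => MultilinearMap.mk' (fun x => G.label A (V p fun v => x v))
      (fun x v y z => by
        rw [← map_add]
        congr 1
        obtain ⟨r₁, r₂, d₁, d₂, e⟩ := (hV p fun w => (Function.update x v (y + z) w : A.onSet _ _)
          ).linear (v := v) (a₁ := fun w => (Function.update x v y w : A.onSet _ _))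
          (a₂ := fun w => (Function.update x v z w : A.onSet _ _)) (l := 1) (m := 1)
          (fun w hw => by simp [hw]) (fun w hw => by simp [hw]) (by simp) (Finset.mem_univ v)
        rw [e, one_smul, one_smul, d₁.unique hCX (fun w => Subtype.property _) _ (hV _ _),
          d₂.unique hCX (fun w => Subtype.property _) _ (hV _ _)])
      (fun x v l y => by
        rw [← map_smul]
        congr 1
        -- Compatibility with scalars is the case of a linear combination whose second coefficient
        -- is zero.
        obtain ⟨r₁, r₂, d₁, d₂, e⟩ := (hV p fun w => (Function.update x v (l • y) w : A.onSet _ _)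
          ).linear (v := v) (a₁ := fun w => (Function.update x v y w : A.onSet _ _))
          (a₂ := fun w => (Function.update x v y w : A.onSet _ _)) (l := l) (m := 0)
          (fun w hw => by simp [hw]) (fun w hw => by simp [hw]) (by simp) (Finset.mem_univ v)
        rw [e, zero_smul, add_zero, d₁.unique hCX (fun w => Subtype.property _) _ (hV _ _)])
  obtain ⟨φ, hφ⟩ := exists_multilinearMap
    (fun v : G.Vert => A.isInternal_onSetDeg (G.genus v) (G.toFlagGraph.Leg v)) F
  refine ⟨φ, fun p a ha r d => ?_⟩
  rw [hφ p fun v => ⟨a v, ha v⟩, d.unique hCX ha _ (hV p a)]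
  rfl

/-- Composition along a stable graph. -/
def composite (hCX : Coherent C X) {γ : ℕ} {I : Type} (G : StableGraph γ I)
    (o : LinearOrder G.Vert) :
    MultilinearMap k (fun v : G.Vert => A.onSet (G.genus v) (G.toFlagGraph.Leg v))
      (A.onSet γ I) :=
  (exists_comp hCX G o).choose

theorem IsVal.composite_eq (hCX : Coherent C X) {γ : ℕ} {I : Type} {G : StableGraph γ I}
    {o : LinearOrder G.Vert} {p : G.Vert → ℤ}
    {a : ∀ v : G.Vert, A.onSet (G.genus v) (G.toFlagGraph.Leg v)}
    (ha : ∀ v, a v ∈ A.onSetDeg (G.genus v) (G.toFlagGraph.Leg v) (p v)) {r}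
    (d : IsVal C X G.toFlagGraph o p a Finset.univ {x | G.inv x = x} γ r) :
    composite hCX G o a = G.label A r :=
  (exists_comp hCX G o).choose_spec p a ha r d

theorem composite_mem (hCX : Coherent C X) {γ : ℕ} {I : Type} (G : StableGraph γ I)
    (o : LinearOrder G.Vert) (p : G.Vert → ℤ)
    (a : ∀ v : G.Vert, A.onSet (G.genus v) (G.toFlagGraph.Leg v))
    (ha : ∀ v, a v ∈ A.onSetDeg (G.genus v) (G.toFlagGraph.Leg v) (p v)) :
    composite hCX G o a ∈ A.onSetDeg γ I (∑ v, p v) := by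
  obtain ⟨r, d⟩ := G.exists_isVal C X o p a
  rw [d.composite_eq hCX ha]
  exact A.relabel_mem rfl _ (d.mem_deg ha)

theorem composite_d (hCX : Coherent C X) {γ : ℕ} {I : Type} (G : StableGraph γ I)
    (o : LinearOrder G.Vert) (p : G.Vert → ℤ)
    (a : ∀ v : G.Vert, A.onSet (G.genus v) (G.toFlagGraph.Leg v))
    (ha : ∀ v, a v ∈ A.onSetDeg (G.genus v) (G.toFlagGraph.Leg v) (p v)) :
    A.onSetD γ I (composite hCX G o a) =
      open Classical in
      ∑ v, (∏ u, if o.lt u v then (p u).negOnePow else 1) •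
        composite hCX G o
          (Function.update a v (A.onSetD (G.genus v) (G.toFlagGraph.Leg v) (a v))) := by
  classical
  obtain ⟨r, d⟩ := G.exists_isVal C X o p a
  obtain ⟨ρ, hρ, e⟩ := d.leibniz ha
  have h : A.onSetD γ I (G.label A r) = G.label A (A.onSetD γ _ r) := A.onSetD_relabel rfl _ r
  rw [d.composite_eq hCX ha, h, e, map_sum]
  refine Finset.sum_congr rfl fun v _ => ?_
  rw [LinearMap.map_intUnits_smul, (hρ v (Finset.mem_univ v)).composite_eq hCX fun w => ?_]
  · rfl
  · by_cases hw : w = v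
    · subst hw
      rw [Function.update_self, Function.update_self]
      exact A.onSetD_mem (ha w)
    · rw [Function.update_of_ne hw, Function.update_of_ne hw]
      exact ha w

open Classical in
/-- The Koszul sign of the reordering of the vertices in `c`. -/
def partSign {V V' : Type} (o : LinearOrder V) (o' : LinearOrder V') (φ : V ≃ V') (p : V → ℤ)
    (c : Finset V) : ℤˣ :=
  ∏ u ∈ c, ∏ v ∈ c, if o.lt u v ∧ o'.lt (φ v) (φ u) then (p u * p v).negOnePow else 1

/-- For `u ∈ c₁` and `v ∈ c₂`, the sign for sorting the pair in the source, times the sign if the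
two orders disagree on it, is the sign for sorting it in the target. -/
theorem partSign_mul_crossSign {V V' : Type} (o : LinearOrder V) (o' : LinearOrder V') (φ : V ≃ V')
    (p : V → ℤ) (c₁ c₂ : Finset V) (hd : Disjoint c₁ c₂) :
    partSign o o' φ p (c₁.disjUnion c₂ hd) * crossSign o p c₁ c₂ =
      partSign o o' φ p c₁ * partSign o o' φ p c₂ *
        crossSign o' (p ∘ φ.symm) (c₁.map φ.toEmbedding) (c₂.map φ.toEmbedding) := by
  classical
  set F : V → V → ℤˣ := fun u v =>
    if o.lt u v ∧ o'.lt (φ v) (φ u) then (p u * p v).negOnePow else 1 with hF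
  have h1 : partSign o o' φ p (c₁.disjUnion c₂ hd) = partSign o o' φ p c₁ *
      partSign o o' φ p c₂ * ∏ u ∈ c₁, ∏ v ∈ c₂, F u v * F v u := by
    have e : ∀ c, partSign o o' φ p c = ∏ u ∈ c, ∏ v ∈ c, F u v := fun c =>
      Finset.prod_congr rfl fun u _ => Finset.prod_congr rfl fun v _ => if_congr Iff.rfl rfl rfl
    simp only [e, Finset.prod_disjUnion, Finset.prod_mul_distrib]
    rw [Finset.prod_comm (s := c₂) (t := c₁)]
    ac_rfl
  rw [h1, mul_assoc]
  congr 1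
  simp only [crossSign, Finset.prod_map]
  rw [← Finset.prod_mul_distrib]
  refine Finset.prod_congr rfl fun u hu => ?_
  rw [← Finset.prod_mul_distrib]
  refine Finset.prod_congr rfl fun v hv => ?_
  have hne : u ≠ v := fun e => Finset.disjoint_left.1 hd hu (e ▸ hv)
  have hne' : φ u ≠ φ v := φ.injective.ne hne
  simp only [hF, Equiv.coe_toEmbedding, Function.comp_apply, Equiv.symm_apply_apply]
  rcases lt_or_gt_of_ne hne with h | h <;> rcases lt_or_gt_of_ne hne' with h' | h'
  · have a1 : ¬ o.lt v u := not_lt_of_gt h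
    have a2 : ¬ o'.lt (φ v) (φ u) := not_lt_of_gt h'
    simp [a1, a2]
  · have a1 : ¬ o.lt v u := not_lt_of_gt h
    have a2 : o'.lt (φ v) (φ u) := h'
    have a3 : o.lt u v := h
    simp [a1, a2, a3]
  · have a1 : o.lt v u := h
    have a2 : o'.lt (φ u) (φ v) := h'
    have a3 : ¬ o.lt u v := not_lt_of_gt h
    have a4 : ¬ o'.lt (φ v) (φ u) := not_lt_of_gt h'
    simp [a1, a2, a3, a4, mul_comm (p v) (p u)]
  · have a1 : o.lt v u := h
    have a2 : o'.lt (φ v) (φ u) := h'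
    have a3 : ¬ o.lt u v := not_lt_of_gt h
    have a4 : ¬ o'.lt (φ u) (φ v) := not_lt_of_gt h'
    simp [a1, a2, a3, a4]

/-- An isomorphism carries stepwise compositions to stepwise compositions by `IsVal.map`, with the
accumulated sign `partSign`; for the set of all vertices this is `koszulSign`. -/
theorem composite_iso (hCX : Coherent C X) {γ : ℕ} {I J : Type} {G : StableGraph γ I}
    {G' : StableGraph γ J} {τ : I ≃ J}
    (φ : G.Iso G' τ) (o : LinearOrder G.Vert) (o' : LinearOrder G'.Vert) (p : G.Vert → ℤ)
    (a : ∀ v : G.Vert, A.onSet (G.genus v) (G.toFlagGraph.Leg v))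
    (a' : ∀ v : G'.Vert, A.onSet (G'.genus v) (G'.toFlagGraph.Leg v))
    (ha : ∀ v, a v ∈ A.onSetDeg (G.genus v) (G.toFlagGraph.Leg v) (p v))
    (ha' : ∀ v, a' (φ.vert v) = A.relabel (φ.genus_vert v) (φ.legEquiv v) (a v)) :
    composite hCX G' o' a' =
      koszulSign o o' φ.vert p • A.relabel rfl τ (composite hCX G o a) := by
  obtain ⟨r, d⟩ := G.exists_isVal C X o p a
  have hlegs : Set.BijOn φ.flag {x | G.inv x = x} {x | G'.inv x = x} := by
    refine ⟨fun x hx => ?_, φ.flag.injective.injOn, fun y hy => ⟨φ.flag.symm y, ?_, by simp⟩⟩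
    · change G'.inv (φ.flag x) = φ.flag x
      rw [φ.inv_flag, show G.inv x = x from hx]
    · change G.inv _ = _
      rw [Equiv.eq_symm_apply, ← φ.inv_flag, Equiv.apply_symm_apply]
      exact hy
  have d' := d.map (G' := G'.toFlagGraph) (o' := o') (p' := p ∘ φ.vert.symm) (a' := a') ha φ.flag
    φ.flag.injective (fun c => c.map φ.vert.toEmbedding) (partSign o o' φ.vert p)
    (fun c₁ c₂ hd => ⟨(Finset.disjoint_map _).2 hd, by rw [Finset.map_disjUnion]⟩)
    (fun c₁ c₂ hd => partSign_mul_crossSign o o' φ.vert p c₁ c₂ hd)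
    (fun x _ => φ.inv_flag x)
    (fun v s g hg t hs h => by
      have hs' : {x | G.vert x = v} = s := by simpa using hs.image_eq
      have ht : Set.BijOn id {x | G'.vert x = φ.vert v} t := by
        have : {x | G'.vert x = φ.vert v} = t := by
          rw [← h.image_eq, ← hs']
          ext y
          constructor
          · intro hy
            refine ⟨φ.flag.symm y, ?_, by simp⟩
            apply φ.vert.injective
            rw [← φ.vert_flag, Equiv.apply_symm_apply]
            exact hy
          · rintro ⟨x, hx, rfl⟩
            exact (φ.vert_flag x).trans (congrArg _ hx)
        rw [← this]
        exact Set.bijOn_id _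
      refine ⟨_, IsVal.vertex (φ.vert v) (by simp) ((φ.genus_vert v).symm.trans hg) ht rfl, ?_⟩
      have h1 : partSign o o' φ.vert p {v} = 1 := by
        simp only [partSign, Finset.prod_singleton]
        exact if_neg fun h => lt_irrefl v h.1
      rw [h1, one_smul, ha']
      simp only [StableSModule.push]
      rw [A.relabel_relabel, A.relabel_relabel]
      congr 2
      ext x
      rfl)
    _ hlegs
  rw [Finset.map_univ_equiv] at d'
  rw [d'.composite_eq hCX fun v => ?_, d.composite_eq hCX ha]
  · rw [LinearMap.map_intUnits_smul]
    congr 1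
    simp only [StableGraph.label, StableSModule.push]
    refine (A.relabel_relabel _ _ _ _ _).trans (Eq.trans ?_ (A.relabel_relabel _ _ _ _ _).symm)
    congr 2
    ext x
    exact φ.leg_flag x
  · obtain ⟨w, rfl⟩ := φ.vert.surjective v
    rw [ha', Function.comp_apply, Equiv.symm_apply_apply]
    exact A.relabel_mem _ _ (ha w)

end Construction

/-! ### The unit and associativity axioms -/

section Construction

variable {k : Type u} [Field k] {A : StableSModule.{u, v} k} {C : StableGradedCyclicOperad A}
  {X : Contractions A}

/-- The decoration of the vertex of a corolla. -/
def corollaDecoration (A : StableSModule.{u, v} k) {γ : ℕ} {I : Type} [Finite I]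
    (h : 2 < 2 * γ + Nat.card I) (a : A.onSet γ I) (v : (StableGraph.corolla γ I h).Vert) :
    A.onSet ((StableGraph.corolla γ I h).genus v) ((StableGraph.corolla γ I h).toFlagGraph.Leg v) :=
  A.relabel (J := (StableGraph.corolla γ I h).toFlagGraph.Leg v) rfl
    (Equiv.subtypeUnivEquiv (fun _ => rfl)).symm a

theorem composite_corolla (hCX : Coherent C X) (γ : ℕ) (I : Type) [Finite I]
    (h : 2 < 2 * γ + Nat.card I) (o : LinearOrder (StableGraph.corolla γ I h).Vert)
    (a : A.onSet γ I) :
    composite hCX (StableGraph.corolla γ I h) o (corollaDecoration A h a) = a := by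
  classical
  let v₀ : (StableGraph.corolla γ I h).Vert := ()
  refine (A.isInternal_onSetDeg γ I).induction_on (P := fun a =>
    composite hCX (StableGraph.corolla γ I h) o (corollaDecoration A h a) = a) ?_ ?_ a
  · intro q x hx
    have hs : Set.BijOn id {y | (StableGraph.corolla γ I h).vert y = v₀}
        {y | (StableGraph.corolla γ I h).inv y = y} := by
      have : {y | (StableGraph.corolla γ I h).vert y = v₀} =
        {y | (StableGraph.corolla γ I h).inv y = y} := by
        ext y
        exact ⟨fun _ => rfl, fun _ => rfl⟩
      rw [this]
      exact Set.bijOn_id _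
    have d : IsVal C X (StableGraph.corolla γ I h).toFlagGraph o (fun _ => q)
        (corollaDecoration A h x) Finset.univ
        {y | (StableGraph.corolla γ I h).inv y = y} γ _ :=
      IsVal.vertex v₀ (by
        ext w
        simp only [Finset.mem_univ, Finset.mem_singleton, true_iff]
        rfl) rfl hs rfl
    refine (d.composite_eq hCX fun _ => A.relabel_mem rfl _ hx).trans ?_
    simp only [StableGraph.label, StableSModule.push]
    refine (congrArg _ (A.relabel_relabel _ _ _ _ _)).trans ((A.relabel_relabel _ _ _ _ _).trans ?_)
    refine Eq.trans ?_ (A.relabel_refl x)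
    congr 2
    ext y
    rfl
  · intro x y hx hy
    -- Written as an update at the only vertex, the decoration is accessible to multilinearity.
    have key : ∀ z : A.onSet γ I, corollaDecoration A h z =
        Function.update (fun _ => 0) v₀ (corollaDecoration A h z v₀) := by
      intro z
      funext v
      obtain rfl : v = v₀ := rfl
      rw [Function.update_self]
    have e : corollaDecoration A h (x + y) v₀ =
      corollaDecoration A h x v₀ + corollaDecoration A h y v₀ := map_add _ _ _
    rw [key] at hx hy ⊢
    rw [e, MultilinearMap.map_update_add, hx, hy]

theorem FlagGraph.PreHom.flag_preimageLegs {G₀ G₁ : FlagGraph} (f : G₀.PreHom G₁) (w : G₁.Vert)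
    (x : (f.preimage w).Legs) : f.flag (f.preimageLegs w x).1 = x.1.1 := by
  obtain ⟨y, rfl⟩ := (f.preimageLegs w).symm.surjective x
  rw [Equiv.apply_symm_apply]
  rfl

/-- As `f` is monotone, any two vertices over `w ≠ w'` are ordered like `w` and `w'`, so the sign
for the sums of degrees is the product of the signs of all pairs in the two fibres. The
compatibility of orders in the associativity axiom enters here. -/
theorem crossSign_comap {V W : Type} (o : LinearOrder V) (o' : LinearOrder W) (p : V → ℤ)
    [Fintype V] [DecidableEq W] (f : V → W) (hf : ∀ u v, o.le u v → o'.le (f u) (f v))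
    (c₁ c₂ : Finset W) (hd : Disjoint c₁ c₂) :
    crossSign o' (fun w => ∑ u ∈ Finset.univ.filter (f · = w), p u) c₁ c₂ =
      crossSign o p (Finset.univ.filter (f · ∈ c₁)) (Finset.univ.filter (f · ∈ c₂)) := by
  unfold crossSign
  have fib : ∀ (c : Finset W) (F : V → ℤˣ), ∏ u ∈ Finset.univ.filter (f · ∈ c), F u =
      ∏ w ∈ c, ∏ u ∈ Finset.univ.filter (f · = w), F u := by
    intro c F
    rw [← Finset.prod_fiberwise_of_maps_to (t := c) (g := f) (by simp)]
    refine Finset.prod_congr rfl fun w hw => ?_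
    refine Finset.prod_congr ?_ fun _ _ => rfl
    ext u
    simp only [Finset.mem_filter, Finset.mem_univ, true_and, and_iff_right_iff_imp]
    rintro rfl
    exact hw
  rw [fib]
  refine Finset.prod_congr rfl fun w hw => ?_
  simp only [fib c₂]
  rw [Finset.prod_comm]
  refine Finset.prod_congr rfl fun w' hw' => ?_
  have hne : w ≠ w' := fun e => Finset.disjoint_left.1 hd hw (e ▸ hw')
  rcases lt_or_gt_of_ne hne with h | h
  · rw [if_neg (not_lt_of_gt h)]
    refine (Finset.prod_eq_one fun u hu => Finset.prod_eq_one fun v hv => if_neg fun h' => ?_).symm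
    simp only [Finset.mem_filter, Finset.mem_univ, true_and] at hu hv
    have := hf _ _ (le_of_lt h')
    rw [hu, hv] at this
    exact not_lt_of_ge this h
  · rw [if_pos h, Finset.sum_mul_sum, negOnePow_sum]
    refine Finset.prod_congr rfl fun u hu => ?_
    rw [negOnePow_sum]
    refine Finset.prod_congr rfl fun v hv => (if_pos ?_).symm
    simp only [Finset.mem_filter, Finset.mem_univ, true_and] at hu hv
    refine lt_of_not_ge fun h' => ?_
    have := hf _ _ h'
    rw [hu, hv] at this
    exact not_lt_of_ge this h

/-- A value for the preimage of a vertex under a morphism is a value for the source. -/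
theorem IsVal.of_fiber {γ : ℕ} {I : Type} {G₀ G₁ : StableGraph γ I} (f : G₀.Hom G₁)
    {o₀ : LinearOrder G₀.Vert} {p : G₀.Vert → ℤ}
    {a : ∀ v : G₀.Vert, A.onSet (G₀.genus v) (G₀.toFlagGraph.Leg v)}
    (ha : ∀ v, a v ∈ A.onSetDeg (G₀.genus v) (G₀.toFlagGraph.Leg v) (p v)) (w : G₁.Vert)
    {c : Finset (f.fiber w).Vert} {s : Set (f.fiber w).Flag} {g : ℕ} {r}
    (d : IsVal C X (f.fiber w).toFlagGraph
      (LinearOrder.lift' (fun u : {u : G₀.Vert // f.vert u = w} => u.1) Subtype.val_injective)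
      (fun u => p u.1) (fun u => A.relabel rfl (f.toPreHom.preimageLegEquiv w u) (a u.1)) c s g r)
    (t : Set G₀.Flag) (h : Set.BijOn (fun x : (f.fiber w).Flag => x.1) s t) :
    IsVal C X G₀.toFlagGraph o₀ p a (c.map ⟨fun u : (f.fiber w).Vert => u.1, Subtype.val_injective⟩) t g
      (A.push rfl _ h r) := by
  classical
  have d' := d.map (G' := G₀.toFlagGraph) (o' := o₀) (p' := p) (a' := a)
    (fun u : (f.fiber w).Vert => A.relabel_mem rfl _ (ha u.1)) (fun x : (f.fiber w).Flag => x.1) Subtype.val_injective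
    (fun c => c.map ⟨fun u : (f.fiber w).Vert => u.1, Subtype.val_injective⟩) (fun _ => 1)
    (fun c₁ c₂ hd => ⟨(Finset.disjoint_map _).2 hd, by rw [Finset.map_disjUnion]⟩)
    (fun c₁ c₂ hd => by
      rw [one_mul, one_mul, one_mul]
      simp only [crossSign, Finset.prod_map]
      refine Finset.prod_congr rfl fun u hu => Finset.prod_congr rfl fun v hv => ?_
      exact if_congr Iff.rfl rfl rfl)
    (fun x hx => by
      change (f.toPreHom.preimage w).inv x ≠ x at hx
      change G₀.inv x.1 = ((f.toPreHom.preimage w).inv x).1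
      by_cases h' : x.1 ∈ Set.range f.flag
      · refine absurd ?_ hx
        exact dif_pos h'
      · simp [FlagGraph.PreHom.preimage, h'])
    (fun u s g hg t hs h => by
      have hs' : {x | (f.fiber w).vert x = u} = s := by simpa using hs.image_eq
      have ht : Set.BijOn id {x | G₀.vert x = u.1} t := by
        have : {x | G₀.vert x = u.1} = t := by
          rw [← h.image_eq, ← hs']
          ext y
          constructor
          · intro hy
            exact ⟨⟨y, (congrArg f.vert hy).trans u.2⟩, Subtype.ext hy, rfl⟩
          · rintro ⟨x, hx, rfl⟩
            exact congrArg Subtype.val hx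
        rw [← this]
        exact Set.bijOn_id _
      refine ⟨_, IsVal.vertex u.1 (by rw [Finset.map_singleton]; rfl) hg ht rfl, ?_⟩
      rw [one_smul]
      simp only [StableSModule.push]
      refine Eq.trans ?_ (congrArg _ (A.relabel_relabel _ _ _ _ _)).symm
      refine Eq.trans ?_ (A.relabel_relabel _ _ _ _ _).symm
      congr 2
      ext x
      rfl)
    t h
  rwa [one_smul] at d'

/-- Substitution: in a stepwise composition along `G₁`, each vertex is replaced by a stepwise
composition along its fibre. This is `IsVal.map` with a vertex `w` corresponding to the set of
vertices over `w`, and with no additional sign. -/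
theorem IsVal.of_hom {γ : ℕ} {I : Type} {G₀ G₁ : StableGraph γ I} (f : G₀.Hom G₁)
    {o₀ : LinearOrder G₀.Vert} {o₁ : LinearOrder G₁.Vert}
    (ho : ∀ u u', o₀.le u u' → o₁.le (f.vert u) (f.vert u')) {p : G₀.Vert → ℤ}
    {a : ∀ v : G₀.Vert, A.onSet (G₀.genus v) (G₀.toFlagGraph.Leg v)}
    (ha : ∀ v, a v ∈ A.onSetDeg (G₀.genus v) (G₀.toFlagGraph.Leg v) (p v))
    {q : G₁.Vert → ℤ} (hq : ∀ w, q w = ∑ u : (f.fiber w).Vert, p u.1)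
    {r : ∀ w, A.onSet (G₁.genus w) ({x | (f.fiber w).inv x = x} : Set (f.fiber w).Flag)}
    (d : ∀ w, IsVal C X (f.fiber w).toFlagGraph
      (LinearOrder.lift' (fun u : {u : G₀.Vert // f.vert u = w} => u.1) Subtype.val_injective)
      (fun u => p u.1) (fun u => A.relabel rfl (f.toPreHom.preimageLegEquiv w u) (a u.1))
      Finset.univ {x | (f.fiber w).inv x = x} (G₁.genus w) (r w))
    (hr : ∀ w, (f.fiber w).label A (r w) ∈
      A.onSetDeg (G₁.genus w) (G₁.toFlagGraph.Leg w) (q w))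
    {R} (D : IsVal C X G₁.toFlagGraph o₁ q (fun w => (f.fiber w).label A (r w)) Finset.univ
      {x | G₁.inv x = x} γ R) (h : Set.BijOn f.flag {x | G₁.inv x = x} {x | G₀.inv x = x}) :
    IsVal C X G₀.toFlagGraph o₀ p a Finset.univ {x | G₀.inv x = x} γ (A.push rfl f.flag h R) := by
  classical
  have hfib : ∀ w, (Finset.univ : Finset (f.fiber w).Vert).map
      ⟨fun u : (f.fiber w).Vert => u.1, Subtype.val_injective⟩ = Finset.univ.filter (f.vert · = w) := by
    intro w
    ext u
    simp only [Finset.mem_map, Finset.mem_univ, true_and, Finset.mem_filter]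
    exact ⟨fun ⟨v, hv⟩ => hv ▸ v.2, fun hu => ⟨⟨u, hu⟩, rfl⟩⟩
  have hq' : q = fun w => ∑ u ∈ Finset.univ.filter (f.vert · = w), p u := by
    funext w
    rw [hq, ← hfib, Finset.sum_map]
    rfl
  have D' := D.map (G' := G₀.toFlagGraph) (o' := o₀) (p' := p) (a' := a) hr f.flag
    f.flag_injective (fun c => Finset.univ.filter (f.vert · ∈ c)) (fun _ => 1)
    (fun c₁ c₂ hd => ⟨by
      rw [Finset.disjoint_filter]
      exact fun u _ h h' => Finset.disjoint_left.1 hd h h', by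
      ext u
      simp⟩)
    (fun c₁ c₂ hd => by
      rw [one_mul, one_mul, one_mul, hq']
      exact crossSign_comap o₀ o₁ p f.vert ho c₁ c₂ hd)
    (fun x _ => f.inv_flag x)
    (fun w s g hg t hs h => by
      subst hg
      have hs' : {x | G₁.vert x = w} = s := by simpa using hs.image_eq
      have ht : Set.BijOn (fun x : (f.fiber w).Flag => x.1) {x | (f.fiber w).inv x = x} t := by
        rw [← h.image_eq, ← hs']
        refine ⟨fun x hx => ?_, Subtype.val_injective.injOn, ?_⟩
        · exact ⟨_, (f.toPreHom.preimageLegs w ⟨x, hx⟩).2, f.flag_preimageLegs w ⟨x, hx⟩⟩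
        · rintro _ ⟨y, hy, rfl⟩
          refine ⟨_, ((f.toPreHom.preimageLegs w).symm ⟨y, hy⟩).2, ?_⟩
          have := f.flag_preimageLegs w ((f.toPreHom.preimageLegs w).symm ⟨y, hy⟩)
          rw [Equiv.apply_symm_apply] at this
          exact this.symm
      have d₁ := IsVal.of_fiber f (o₀ := o₀) ha w (d w) t ht
      rw [hfib] at d₁
      refine ⟨_, by simpa using d₁, ?_⟩
      rw [one_smul]
      simp only [StableSModule.push, StableGraph.label]
      refine Eq.trans ?_ (congrArg _ (A.relabel_relabel _ _ _ _ _)).symm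
      refine Eq.trans ?_ (A.relabel_relabel _ _ _ _ _).symm
      congr 2
      ext x
      exact (f.flag_preimageLegs w x).symm)
    _ h
  rw [one_smul] at D'
  simpa using D'

theorem StableGraph.Hom.bijOn_flag {γ : ℕ} {I : Type} {G₀ G₁ : StableGraph γ I} (f : G₀.Hom G₁) :
    Set.BijOn f.flag {x | G₁.inv x = x} {x | G₀.inv x = x} := by
  refine ⟨fun x hx => ?_, f.flag_injective.injOn, fun x hx => ?_⟩
  · exact (f.inv_flag x).trans (congrArg _ hx)
  · by_cases h : x ∈ Set.range f.flag
    · obtain ⟨y, rfl⟩ := h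
      exact ⟨y, f.flag_injective ((f.inv_flag y).symm.trans hx), rfl⟩
    · exact absurd hx (f.inv_ne x h)

/-- On homogeneous decorations `IsVal.of_hom` exhibits the iterated composite as a value of `G₀`,
and values are unique. Additivity reduces the general case to this one. -/
theorem composite_assoc (hCX : Coherent C X) {γ : ℕ} {I : Type} {G₀ G₁ : StableGraph γ I}
    (f : G₀.Hom G₁) (o₀ : LinearOrder G₀.Vert) (o₁ : LinearOrder G₁.Vert)
    (ho : ∀ u u', o₀.le u u' → o₁.le (f.vert u) (f.vert u'))
    (a : ∀ v : G₀.Vert, A.onSet (G₀.genus v) (G₀.toFlagGraph.Leg v)) :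
    composite hCX G₁ o₁ (fun w =>
      composite hCX (f.fiber w)
        (LinearOrder.lift' (fun u : {u : G₀.Vert // f.vert u = w} => u.1) Subtype.val_injective)
        (fun u : {u : G₀.Vert // f.vert u = w} =>
          A.relabel rfl (f.toPreHom.preimageLegEquiv w u) (a u.1))) =
      composite hCX G₀ o₀ a := by
  classical
  refine eq_of_eq_on_homogeneous (N := A.onSet γ I)
    (D := fun v => A.onSetDeg (G₀.genus v) (G₀.toFlagGraph.Leg v))
    (f := fun a => composite hCX G₁ o₁ (fun w =>
      composite hCX (f.fiber w)
        (LinearOrder.lift' (fun u : {u : G₀.Vert // f.vert u = w} => u.1) Subtype.val_injective)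
        (fun u : {u : G₀.Vert // f.vert u = w} =>
          A.relabel rfl (f.toPreHom.preimageLegEquiv w u) (a u.1))))
    (f' := fun a => composite hCX G₀ o₀ a)
    (fun v => A.isInternal_onSetDeg _ _) (fun a v x y => ?_)
    (fun a v x y => (composite hCX G₀ o₀).map_update_add a v x y) (fun p a ha => ?_) a
  -- Additivity of the iterated composite in the decoration at `v`: only the composite over the
  -- fibre that contains `v` depends on it.
  · set b : ∀ v : G₀.Vert, A.onSet (G₀.genus v) (G₀.toFlagGraph.Leg v) → ∀ w, A.onSet (G₁.genus w)
        (G₁.toFlagGraph.Leg w) := fun v x w => composite hCX (f.fiber w)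
        (LinearOrder.lift' (fun u : {u : G₀.Vert // f.vert u = w} => u.1) Subtype.val_injective)
        (fun u : {u : G₀.Vert // f.vert u = w} =>
          A.relabel rfl (f.toPreHom.preimageLegEquiv w u) (Function.update a v x u.1)) with hb
    have h1 : ∀ x, b v x = Function.update (b v 0) (f.vert v) (b v x (f.vert v)) := by
      intro x
      funext w
      by_cases hw : w = f.vert v
      · subst hw
        rw [Function.update_self]
      · rw [Function.update_of_ne hw]
        simp only [hb]
        congr 1
        funext u
        have : u.1 ≠ v := fun e => hw (u.2.symm.trans (congrArg f.vert e))
        rw [Function.update_of_ne this, Function.update_of_ne this]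
    have h2 : b v (x + y) (f.vert v) = b v x (f.vert v) + b v y (f.vert v) := by
      let B : ∀ u : (f.fiber (f.vert v)).Vert, A.onSet ((f.fiber (f.vert v)).genus u)
          ((f.fiber (f.vert v)).toFlagGraph.Leg u) :=
        fun u => A.relabel rfl (f.toPreHom.preimageLegEquiv _ u) (a u.1)
      let v' : (f.fiber (f.vert v)).Vert := ⟨v, rfl⟩
      let L := A.relabel (g := G₀.genus v) (g' := (f.fiber (f.vert v)).genus v') rfl
        (f.toPreHom.preimageLegEquiv _ v')
      have E : ∀ x, b v x (f.vert v) = composite hCX (f.fiber (f.vert v))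
          (LinearOrder.lift' (fun u : {u : G₀.Vert // f.vert u = f.vert v} => u.1)
            Subtype.val_injective) (Function.update B v' (L x)) := by
        intro x
        refine congrArg (composite hCX (f.fiber (f.vert v)) _) (funext fun u : (f.fiber (f.vert v)).Vert => ?_)
        by_cases hu : u = v'
        · subst hu
          exact (congrArg L (Function.update_self v x a)).trans (Function.update_self v' (L x) B).symm
        · exact (congrArg (A.relabel (g := G₀.genus u.1) (g' := (f.fiber (f.vert v)).genus u) rfl
            (f.toPreHom.preimageLegEquiv _ u)) (Function.update_of_ne (fun e => hu (Subtype.ext e)) x a)).trans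
            (Function.update_of_ne hu (L x) B).symm
      rw [E, E, E, map_add]
      exact (composite hCX (f.fiber (f.vert v)) _).map_update_add B v' (L x) (L y)
    change composite hCX G₁ o₁ (b v (x + y)) =
      composite hCX G₁ o₁ (b v x) + composite hCX G₁ o₁ (b v y)
    rw [h1 (x + y), h1 x, h1 y, h2]
    exact (composite hCX G₁ o₁).map_update_add _ _ _ _
  · choose r d using fun w => (f.fiber w).exists_isVal C X
      (LinearOrder.lift' (fun u : {u : G₀.Vert // f.vert u = w} => u.1) Subtype.val_injective)
      (fun u => p u.1) (fun u => A.relabel rfl (f.toPreHom.preimageLegEquiv w u) (a u.1))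
    have ha' : ∀ w, ∀ u : (f.fiber w).Vert, A.relabel rfl (f.toPreHom.preimageLegEquiv w u) (a u.1) ∈
        A.onSetDeg ((f.fiber w).genus u) ((f.fiber w).toFlagGraph.Leg u) (p u.1) :=
      fun w u => A.relabel_mem rfl _ (ha u.1)
    have e := fun w => (d w).composite_eq hCX (ha' w)
    have hr := fun w => A.relabel_mem rfl (f.fiber w).leg ((d w).mem_deg (ha' w))
    obtain ⟨R, D⟩ := G₁.exists_isVal C X o₁
      (fun w => ∑ u : (f.fiber w).Vert, p u.1) (fun w => (f.fiber w).label A (r w))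
    refine (congrArg (composite hCX G₁ o₁) (funext e)).trans ((D.composite_eq hCX hr).trans
      (Eq.trans ?_ ((D.of_hom f ho ha (fun _ => rfl) d hr f.bijOn_flag).composite_eq hCX ha).symm))
    simp only [StableGraph.label, StableSModule.push]
    refine Eq.trans ?_ (A.relabel_relabel _ _ _ _ _).symm
    congr 2
    ext x
    exact (f.leg_flag x).symm

end Construction

/-! ### Graphs with one edge -/

section OneEdge

variable {k : Type u} [Field k] {A : StableSModule.{u, v} k} (C : StableGradedCyclicOperad A)
  (X : Contractions A)

section Tree

variable {Y Z I : Type} [Finite Y] [Finite Z] {g h γ : ℕ} (hγ : g + h = γ) (y : Y) (z : Z)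
  (hY : 2 < 2 * g + Nat.card Y) (hZ : 2 < 2 * h + Nat.card Z)
  (e : {w : Y ⊕ Z // w ≠ Sum.inl y ∧ w ≠ Sum.inr z} ≃ I)

theorem tree_glueData :
    GlueData (F := Y ⊕ Z) {w | (StableGraph.tree g h γ hγ y z hY hZ e).vert w = false}
      {w | (StableGraph.tree g h γ hγ y z hY hZ e).vert w = true}
      {w | (StableGraph.tree g h γ hγ y z hY hZ e).inv w = w} (Sum.inl y) (Sum.inr z) := by
  classical
  refine ⟨rfl, rfl, Set.disjoint_left.2 fun w (h1 : _ = false) (h2 : _ = true) => ?_, ?_⟩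
  · rw [h1] at h2
    exact Bool.noConfusion h2
  · ext w
    refine (swap_apply_eq_self_iff' Sum.inl_ne_inr w).trans ?_
    rcases w with w | w
    · constructor
      · exact fun h' => Or.inl ⟨rfl, h'.1⟩
      · rintro (⟨-, h'⟩ | ⟨h', -⟩)
        · exact ⟨h', by simp⟩
        · exact Bool.noConfusion h'
    · constructor
      · exact fun h' => Or.inr ⟨rfl, h'.2⟩
      · rintro (⟨h', -⟩ | ⟨-, h'⟩)
        · exact Bool.noConfusion h'
        · exact ⟨by simp, h'⟩

/-- The composition along a tree with one edge, expressed by gluing. -/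
def treeValue (a : A.onSet g Y) (b : A.onSet h Z) : A.onSet γ I :=
  (StableGraph.tree g h γ hγ y z hY hZ e).label A
    (C.glue (s₁ := {w | (StableGraph.tree g h γ hγ y z hY hZ e).vert w = false})
      (s₂ := {w | (StableGraph.tree g h γ hγ y z hY hZ e).vert w = true}) hγ
      (tree_glueData hγ y z hY hZ e)
      (A.relabel (J := (StableGraph.tree g h γ hγ y z hY hZ e).toFlagGraph.Leg false) rfl
        (treeFlagsFst Y Z) a)
      (A.relabel (J := (StableGraph.tree g h γ hγ y z hY hZ e).toFlagGraph.Leg true) rfl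
        (treeFlagsSnd Y Z) b))

end Tree

section Numbered

variable {g h γ m n s : ℕ} (hγ : g + h = γ)

theorem bijOn_inl {Y Z : Type} : Set.BijOn (Sum.inl : Y → Y ⊕ Z) Set.univ
    {w | Sum.elim (fun _ : Y => false) (fun _ : Z => true) w = false} := by
  refine ⟨fun _ _ => rfl, Sum.inl_injective.injOn, ?_⟩
  rintro (w | w) hw
  · exact ⟨w, trivial, rfl⟩
  · exact Bool.noConfusion hw

theorem bijOn_inr {Y Z : Type} : Set.BijOn (Sum.inr : Z → Y ⊕ Z) Set.univ
    {w | Sum.elim (fun _ : Y => false) (fun _ : Z => true) w = true} := by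
  refine ⟨fun _ _ => rfl, Sum.inr_injective.injOn, ?_⟩
  rintro (w | w) hw
  · exact Bool.noConfusion hw
  · exact ⟨w, trivial, rfl⟩

theorem relabel_treeFlagsFst {Z : Type} (a : A.obj g m) :
    A.relabel rfl (treeFlagsFst (Fin m) Z) (A.cls (Equiv.refl _) a) =
      A.ofEnum Sum.inl bijOn_inl a := by
  rw [A.relabel_cls]
  unfold StableSModule.ofEnum
  congr 2
  ext w
  rfl

theorem relabel_treeFlagsSnd {Y : Type} (a : A.obj g m) :
    A.relabel rfl (treeFlagsSnd Y (Fin m)) (A.cls (Equiv.refl _) a) =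
      A.ofEnum Sum.inr bijOn_inr a := by
  rw [A.relabel_cls]
  unfold StableSModule.ofEnum
  congr 2
  ext w
  rfl

/-- The two inclusions into the disjoint union enumerate the flags at the two vertices, so
`IsGlue.fst` applies, and `cat` of them is the inverse of `circNumbering`. -/
theorem treeValue_circ (hs : m + n = s) (i : ℕ) (hi : 1 ≤ i ∧ i ≤ m)
    (hm : 2 < 2 * g + Nat.card (Fin (m + 1))) (hn : 2 < 2 * h + Nat.card (Fin (n + 1)))
    (a : A.obj g (m + 1)) (b : A.obj h (n + 1)) :
    treeValue C hγ (⟨i, by omega⟩ : Fin (m + 1)) (0 : Fin (n + 1)) hm hn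
      (circNumbering hs ⟨i, by omega⟩) (A.cls (Equiv.refl _) a) (A.cls (Equiv.refl _) b) =
        A.cls (Equiv.refl (Fin s)) (C.circ hγ hs i hi a b) := by
  unfold treeValue
  refine (congrArg _ (((congrArg₂ (fun p q => C.glue hγ (tree_glueData hγ (⟨i, by omega⟩ : Fin (m + 1)) (0 : Fin (n + 1)) hm hn
      (circNumbering hs ⟨i, by omega⟩)) p q) (relabel_treeFlagsFst a) (relabel_treeFlagsSnd b))).trans
    ((C.isGlue_glue hγ (tree_glueData hγ (⟨i, by omega⟩ : Fin (m + 1)) (0 : Fin (n + 1)) hm hn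
      (circNumbering hs ⟨i, by omega⟩))).fst hs i hi Sum.inl Sum.inr bijOn_inl bijOn_inr rfl rfl a b))).trans ?_
  refine (A.relabel_cls _ _ _).trans ?_
  congr 2
  ext x
  refine congrArg Fin.val ?_
  have h1 := cat_eq_elim hs i hi.2 (Sum.inl : Fin (m + 1) → Fin (m + 1) ⊕ Fin (n + 1)) Sum.inr x
  rw [Sum.elim_inl_inr, id] at h1
  refine Eq.trans ?_ ((circNumbering hs (⟨i, by omega⟩ : Fin (m + 1))).apply_symm_apply x)
  exact congrArg (circNumbering hs (⟨i, by omega⟩ : Fin (m + 1))) (Subtype.ext h1)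

theorem treeValue_pair (hm : 2 < 2 * g + Nat.card (Fin 1)) (hn : 2 < 2 * h + Nat.card (Fin 1))
    (a : A.obj g 1) (b : A.obj h 1) :
    treeValue C hγ (0 : Fin 1) (0 : Fin 1) hm hn (circNumbering (m := 0) (n := 0) rfl 0)
      (A.cls (Equiv.refl _) a) (A.cls (Equiv.refl _) b) =
        A.cls (Equiv.refl (Fin 0)) (C.pair hγ a b) := by
  have hθ : Set.BijOn (Fin.elim0 : Fin 0 → Fin 1 ⊕ Fin 1) Set.univ
      {w | (StableGraph.tree g h γ hγ (0 : Fin 1) (0 : Fin 1) hm hn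
        (circNumbering (m := 0) (n := 0) rfl 0)).inv w = w} := by
    refine ⟨fun x => x.elim0, fun x => x.elim0, fun w hw => ?_⟩
    exact ((StableGraph.tree g h γ hγ (0 : Fin 1) (0 : Fin 1) hm hn
        (circNumbering (m := 0) (n := 0) rfl 0)).leg ⟨w, hw⟩).elim0
  unfold treeValue
  refine (congrArg _ (((congrArg₂ (fun p q => C.glue hγ (tree_glueData hγ (0 : Fin 1) (0 : Fin 1) hm
      hn (circNumbering (m := 0) (n := 0) rfl 0)) p q) (relabel_treeFlagsFst a)
      (relabel_treeFlagsSnd b))).trans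
    ((C.isGlue_glue hγ (tree_glueData hγ (0 : Fin 1) (0 : Fin 1) hm hn
      (circNumbering (m := 0) (n := 0) rfl 0))).pair Sum.inl Sum.inr Fin.elim0 bijOn_inl bijOn_inr
      hθ a b))).trans ?_
  refine (A.relabel_cls _ _ _).trans ?_
  congr 2
  ext x
  exact x.elim0

end Numbered

section Loop

variable {I : Type} [Finite I] {g : ℕ} (i j : I) (hij : i ≠ j) (h : 2 < 2 * g + Nat.card I)

theorem loop_loopData : LoopData (F := I) {w | (StableGraph.loop g i j hij h).vert w = ()}
    {w | (StableGraph.loop g i j hij h).inv w = w} i j := by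
  classical
  refine ⟨rfl, rfl, hij, fun w => ?_⟩
  exact (swap_apply_eq_self_iff' hij w).trans ⟨fun h' => ⟨rfl, h'⟩, fun h' => h'.2⟩

/-- The decoration of the vertex of a graph with one loop. -/
def loopDecoration (a : A.onSet g I) (v : (StableGraph.loop g i j hij h).Vert) :
    A.onSet ((StableGraph.loop g i j hij h).genus v)
      ((StableGraph.loop g i j hij h).toFlagGraph.Leg v) :=
  A.relabel (J := (StableGraph.loop g i j hij h).toFlagGraph.Leg v) rfl
    (Equiv.subtypeUnivEquiv (fun _ => rfl)).symm a

theorem label_loop (a : A.onSet g I) :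
    (StableGraph.loop g i j hij h).label A
      (X.loop (s := {w | (StableGraph.loop g i j hij h).vert w = ()}) rfl
        (loop_loopData i j hij h) (loopDecoration i j hij h a ())) = X.xi i j hij a := by
  have := X.loop_relabel rfl (loop_loopData i j hij h)
    (Equiv.subtypeUnivEquiv (p := fun w => (StableGraph.loop g i j hij h).vert w = ())
      (fun _ => rfl)).symm i j hij rfl rfl (StableGraph.loop g i j hij h).leg.symm (fun _ => rfl) a
  refine (congrArg _ this).trans ((A.relabel_relabel _ _ _ _ _).trans ?_)
  refine Eq.trans ?_ (A.relabel_refl _)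
  congr 2

end Loop

end OneEdge

/-! ### The constructed modular operad induces the given operations -/

section Construction

variable {k : Type u} [Field k] {A : StableSModule.{u, v} k} {C : StableGradedCyclicOperad A}
  {X : Contractions A}

theorem composite_loop (hCX : Coherent C X) {I : Type} [Finite I] {g : ℕ} (i j : I) (hij : i ≠ j)
    (h : 2 < 2 * g + Nat.card I) (o : LinearOrder (StableGraph.loop g i j hij h).Vert)
    (a : A.onSet g I) :
    composite hCX (StableGraph.loop g i j hij h) o (loopDecoration i j hij h a) =
      X.xi i j hij a := by
  classical
  let v₀ : (StableGraph.loop g i j hij h).Vert := ()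
  refine (A.isInternal_onSetDeg g I).induction_on (P := fun a =>
    composite hCX (StableGraph.loop g i j hij h) o (loopDecoration i j hij h a) =
      X.xi i j hij a) ?_ ?_ a
  · intro q x hx
    have d : IsVal C X (StableGraph.loop g i j hij h).toFlagGraph o (fun _ => q)
        (loopDecoration i j hij h x) Finset.univ
        {y | (StableGraph.loop g i j hij h).inv y = y} (g + 1) _ :=
      IsVal.loop i j (by classical exact Equiv.swap_apply_left i j)
        (IsVal.vertex (r := loopDecoration i j hij h x v₀) v₀ (by
        ext w
        simp only [Finset.mem_univ, Finset.mem_singleton, true_iff]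
        rfl) rfl (Set.bijOn_id _) (A.push_id _ (fun _ _ => rfl) _).symm) rfl
        (loop_loopData i j hij h) rfl
    refine (d.composite_eq hCX fun _ => A.relabel_mem rfl _ hx).trans ?_
    exact label_loop X i j hij h x
  · intro x y hx hy
    have key : ∀ z : A.onSet g I, loopDecoration i j hij h z =
        Function.update (fun _ => 0) v₀ (loopDecoration i j hij h z v₀) := by
      intro z
      funext v
      obtain rfl : v = v₀ := rfl
      rw [Function.update_self]
    have e : loopDecoration i j hij h (x + y) v₀ =
      loopDecoration i j hij h x v₀ + loopDecoration i j hij h y v₀ := map_add _ _ _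
    rw [key] at hx hy ⊢
    rw [e, MultilinearMap.map_update_add, hx, hy, map_add]

section Tree

variable {Y Z I : Type} [Finite Y] [Finite Z] {g h γ : ℕ} {hγ : g + h = γ} {y : Y} {z : Z}
  {hY : 2 < 2 * g + Nat.card Y} {hZ : 2 < 2 * h + Nat.card Z}
  {e : {w : Y ⊕ Z // w ≠ Sum.inl y ∧ w ≠ Sum.inr z} ≃ I}

theorem treeDecoration_mem {a : A.onSet g Y} {b : A.onSet h Z} {p q : ℤ}
    (ha : a ∈ A.onSetDeg g Y p) (hb : b ∈ A.onSetDeg h Z q)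
    (v : (StableGraph.tree g h γ hγ y z hY hZ e).Vert) :
    treeDecoration A a b v ∈ A.onSetDeg ((StableGraph.tree g h γ hγ y z hY hZ e).genus v)
      ((StableGraph.tree g h γ hγ y z hY hZ e).toFlagGraph.Leg v) (Bool.rec p q v) := by
  match v with
  | false =>
    exact A.relabel_mem (J := (StableGraph.tree g h γ hγ y z hY hZ e).toFlagGraph.Leg false) rfl _ ha
  | true =>
    exact A.relabel_mem (J := (StableGraph.tree g h γ hγ y z hY hZ e).toFlagGraph.Leg true) rfl _ hb

/-- The decoration is an update at the first vertex of the one with `0` there, which makes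
multilinearity applicable. -/
theorem comp_treeDecoration_add_left {N : Type*} [AddCommGroup N] [Module k N]
    (F : MultilinearMap k (fun v : (StableGraph.tree g h γ hγ y z hY hZ e).Vert =>
      A.onSet ((StableGraph.tree g h γ hγ y z hY hZ e).genus v)
        ((StableGraph.tree g h γ hγ y z hY hZ e).toFlagGraph.Leg v)) N)
    (a a' : A.onSet g Y) (b : A.onSet h Z) :
    F (treeDecoration A (a + a') b) = F (treeDecoration A a b) + F (treeDecoration A a' b) := by
  classical
  let v₀ : (StableGraph.tree g h γ hγ y z hY hZ e).Vert := false
  let v₁ : (StableGraph.tree g h γ hγ y z hY hZ e).Vert := true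
  have key : ∀ a, treeDecoration A (hX := hY) (hY := hZ) (hγ := hγ) (e := e) a b =
      Function.update (treeDecoration A 0 b) v₀ (treeDecoration A a b v₀) := by
    intro a
    funext v
    match v with
    | false => exact (Function.update_self v₀ (treeDecoration A a b v₀) (treeDecoration A 0 b)).symm
    | true =>
      exact (Function.update_of_ne (show v₁ ≠ v₀ from Bool.noConfusion) (treeDecoration A a b v₀)
        (treeDecoration A 0 b)).symm
  have e : treeDecoration A (hX := hY) (hY := hZ) (hγ := hγ) (e := e) (a + a') b v₀ =
      treeDecoration A a b v₀ + treeDecoration A a' b v₀ := map_add _ _ _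
  rw [key a, key a', key (a + a'), e, MultilinearMap.map_update_add]

theorem comp_treeDecoration_add_right {N : Type*} [AddCommGroup N] [Module k N]
    (F : MultilinearMap k (fun v : (StableGraph.tree g h γ hγ y z hY hZ e).Vert =>
      A.onSet ((StableGraph.tree g h γ hγ y z hY hZ e).genus v)
        ((StableGraph.tree g h γ hγ y z hY hZ e).toFlagGraph.Leg v)) N)
    (a : A.onSet g Y) (b b' : A.onSet h Z) :
    F (treeDecoration A a (b + b')) = F (treeDecoration A a b) + F (treeDecoration A a b') := by
  classical
  let v₀ : (StableGraph.tree g h γ hγ y z hY hZ e).Vert := true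
  let v₁ : (StableGraph.tree g h γ hγ y z hY hZ e).Vert := false
  have key : ∀ b, treeDecoration A (hX := hY) (hY := hZ) (hγ := hγ) (e := e) a b =
      Function.update (treeDecoration A a 0) v₀ (treeDecoration A a b v₀) := by
    intro b
    funext v
    match v with
    | true => exact (Function.update_self v₀ (treeDecoration A a b v₀) (treeDecoration A a 0)).symm
    | false =>
      exact (Function.update_of_ne (show v₁ ≠ v₀ from Bool.noConfusion) (treeDecoration A a b v₀)
        (treeDecoration A a 0)).symm
  have e : treeDecoration A (hX := hY) (hY := hZ) (hγ := hγ) (e := e) a (b + b') v₀ =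
      treeDecoration A a b v₀ + treeDecoration A a b' v₀ := map_add _ _ _
  rw [key b, key b', key (b + b'), e, MultilinearMap.map_update_add]

/-- A composition along trees with one edge is determined by its values on homogeneous elements. -/
theorem comp_tree_eq_treeValue
    (F : MultilinearMap k (fun v : (StableGraph.tree g h γ hγ y z hY hZ e).Vert =>
      A.onSet ((StableGraph.tree g h γ hγ y z hY hZ e).genus v)
        ((StableGraph.tree g h γ hγ y z hY hZ e).toFlagGraph.Leg v)) (A.onSet γ I))
    (hF : ∀ p q, ∀ a ∈ A.onSetDeg g Y p, ∀ b ∈ A.onSetDeg h Z q,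
      F (treeDecoration A a b) = treeValue C hγ y z hY hZ e a b)
    (a : A.onSet g Y) (b : A.onSet h Z) :
    F (treeDecoration A a b) = treeValue C hγ y z hY hZ e a b := by
  refine (A.isInternal_onSetDeg g Y).induction_on
    (P := fun a => F (treeDecoration A a b) = treeValue C hγ y z hY hZ e a b) ?_ ?_ a
  · intro p a ha
    refine (A.isInternal_onSetDeg h Z).induction_on
      (P := fun b => F (treeDecoration A a b) = treeValue C hγ y z hY hZ e a b) ?_ ?_ b
    · exact fun q b hb => hF p q a ha b hb
    · intro b b' h1 h2
      rw [comp_treeDecoration_add_right, h1, h2]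
      simp only [treeValue, map_add]
  · intro a a' h1 h2
    rw [comp_treeDecoration_add_left, h1, h2]
    simp only [treeValue, map_add, LinearMap.add_apply]

open Classical in
theorem tree_inv (hγ : g + h = γ) (y : Y) (z : Z) (hY : 2 < 2 * g + Nat.card Y)
    (hZ : 2 < 2 * h + Nat.card Z) (e : {w : Y ⊕ Z // w ≠ Sum.inl y ∧ w ≠ Sum.inr z} ≃ I) :
    (StableGraph.tree g h γ hγ y z hY hZ e).inv (Sum.inl y) = Sum.inr z :=
  Equiv.swap_apply_left (Sum.inl y) (Sum.inr z)

theorem composite_tree (hCX : Coherent C X) (a : A.onSet g Y) (b : A.onSet h Z) :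
    composite hCX (StableGraph.tree g h γ hγ y z hY hZ e) (inferInstanceAs (LinearOrder Bool))
      (treeDecoration A a b) = treeValue C hγ y z hY hZ e a b := by
  classical
  refine comp_tree_eq_treeValue _ (fun p q a ha b hb => ?_) a b
  let v₀ : (StableGraph.tree g h γ hγ y z hY hZ e).Vert := false
  let v₁ : (StableGraph.tree g h γ hγ y z hY hZ e).Vert := true
  have hne : v₀ ≠ v₁ := Bool.noConfusion
  have d : IsVal C X (StableGraph.tree g h γ hγ y z hY hZ e).toFlagGraph
      (inferInstanceAs (LinearOrder Bool)) (fun v => Bool.rec p q v) (treeDecoration A a b)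
      Finset.univ {w | (StableGraph.tree g h γ hγ y z hY hZ e).inv w = w} γ _ :=
    IsVal.glue (c₁ := {v₀}) (c₂ := {v₁}) (Sum.inl y) (Sum.inr z) (tree_inv hγ y z hY hZ e)
      (IsVal.vertex (r := treeDecoration A a b v₀) v₀ rfl rfl
        (Set.bijOn_id _) (A.push_id _ (fun _ _ => rfl) _).symm)
      (IsVal.vertex (r := treeDecoration A a b v₁) v₁ rfl rfl
        (Set.bijOn_id _) (A.push_id _ (fun _ _ => rfl) _).symm)
      (Finset.disjoint_singleton.2 hne) (by
        ext w
        rw [Finset.mem_disjUnion, Finset.mem_singleton, Finset.mem_singleton]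
        refine iff_of_true (Finset.mem_univ w) ?_
        match w with
        | false => exact Or.inl rfl
        | true => exact Or.inr rfl) hγ (tree_glueData hγ y z hY hZ e) rfl
  refine (d.composite_eq hCX (treeDecoration_mem ha hb)).trans ?_
  refine congrArg _ ((congrArg (· • _) ?_).trans (one_smul _ _))
  -- The first vertex precedes the second one, so no sign occurs.
  simp only [crossSign, Finset.prod_singleton]
  exact if_neg (by decide : ¬ (true < false))

end Tree

/-- A cyclic operad with coherent contractions is a modular operad. -/
def modularOperad (hCX : Coherent C X) : ModularOperad A where
  comp G o := composite hCX G o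
  comp_mem G o p a ha := composite_mem hCX G o p a ha
  comp_d G o p a ha := composite_d hCX G o p a ha
  comp_iso φ o o' p a a' ha ha' := composite_iso hCX φ o o' p a a' ha ha'
  comp_unit γ I _ h o a := composite_corolla hCX γ I h o a
  comp_assoc f o₀ o₁ ho a := composite_assoc hCX f o₀ o₁ ho a

theorem modularOperad_induces (hCX : Coherent C X) : (modularOperad hCX).Induces C X where
  circ hγ hs i hi hm hn a b := (composite_tree hCX _ _).trans (treeValue_circ C hγ hs i hi hm hn a b)
  pair hγ hm hn a b := (composite_tree hCX _ _).trans (treeValue_pair C hγ hm hn a b)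
  xi i j hij h a := composite_loop hCX i j hij h _ a

end Construction

/-! ### Compositions along graphs with one edge in a modular operad -/

theorem swap_apply_equiv {X X' : Type} {_ : DecidableEq X} {_ : DecidableEq X'} (f : X ≃ X')
    {a b : X} {a' b' : X'} (ha : f a = a') (hb : f b = b') (x : X) :
    Equiv.swap a' b' (f x) = f (Equiv.swap a b x) := by
  subst ha hb
  by_cases h1 : x = a
  · subst h1
    rw [Equiv.swap_apply_left, Equiv.swap_apply_left]
  by_cases h2 : x = b
  · subst h2
    rw [Equiv.swap_apply_right, Equiv.swap_apply_right]
  · rw [Equiv.swap_apply_of_ne_of_ne h1 h2,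
      Equiv.swap_apply_of_ne_of_ne (f.injective.ne h1) (f.injective.ne h2)]

theorem swap_apply_equiv_swap {X X' : Type} {_ : DecidableEq X} {_ : DecidableEq X'} (f : X ≃ X')
    {a b : X} {a' b' : X'} (ha : f a = b') (hb : f b = a') (x : X) :
    Equiv.swap a' b' (f x) = f (Equiv.swap a b x) := by
  rw [Equiv.swap_comm]
  exact swap_apply_equiv f ha hb x

theorem koszulSign_refl {V : Type} {_ : Fintype V} (o : LinearOrder V) (p : V → ℤ) :
    koszulSign o o (Equiv.refl V) p = 1 := by
  classical
  unfold koszulSign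
  refine Finset.prod_eq_one fun u _ => Finset.prod_eq_one fun v _ => if_neg ?_
  exact fun h => lt_asymm h.1 h.2

/-- The exchange of the two vertices inverts the only pair there is. -/
theorem koszulSign_boolNot (i : Fintype Bool) (p : Bool → ℤ) :
    koszulSign (inferInstance : LinearOrder Bool) (inferInstance : LinearOrder Bool)
      Equiv.boolNot p = (p false * p true).negOnePow := by
  obtain rfl : i = Bool.fintype := Subsingleton.elim _ _
  have h1 : ∀ u v : Bool, (inferInstance : LinearOrder Bool).lt u v ∧
      (inferInstance : LinearOrder Bool).lt (Equiv.boolNot v) (Equiv.boolNot u) ↔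
        u = false ∧ v = true := by
    intro u v
    change u < v ∧ (!v) < (!u) ↔ _
    revert u v
    decide
  unfold koszulSign
  simp only [Fintype.prod_bool, h1]
  simp

section Iso

variable {Y Z Y' Z' I J : Type} [Finite Y] [Finite Z] [Finite Y'] [Finite Z'] {g h γ : ℕ}
  {hγ : g + h = γ} {hγ' : h + g = γ} {y : Y} {z : Z} {y' : Y'} {z' : Z'}
  {hY : 2 < 2 * g + Nat.card Y} {hZ : 2 < 2 * h + Nat.card Z}
  {hY' : 2 < 2 * g + Nat.card Y'} {hZ' : 2 < 2 * h + Nat.card Z'}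
  {e : {w : Y ⊕ Z // w ≠ Sum.inl y ∧ w ≠ Sum.inr z} ≃ I}
  {e' : {w : Y' ⊕ Z' // w ≠ Sum.inl y' ∧ w ≠ Sum.inr z'} ≃ J}
  {e'' : {w : Z' ⊕ Y' // w ≠ Sum.inl z' ∧ w ≠ Sum.inr y'} ≃ J}

/-- The isomorphism of trees with one edge induced by bijections of the sets of flags. -/
def StableGraph.treeIso (α : Y ≃ Y') (β : Z ≃ Z') (hy : α y = y') (hz : β z = z') (τ : I ≃ J)
    (he : ∀ w w', w'.1 = Sum.map α β w.1 → e' w' = τ (e w)) :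
    (StableGraph.tree g h γ hγ y z hY hZ e).Iso (StableGraph.tree g h γ hγ y' z' hY' hZ' e') τ where
  flag := Equiv.sumCongr α β
  vert := Equiv.refl Bool
  vert_flag := by rintro (w | w) <;> rfl
  inv_flag w := swap_apply_equiv (Equiv.sumCongr α β) (congrArg Sum.inl hy) (congrArg Sum.inr hz) w
  genus_vert _ := rfl
  leg_flag w := he _ _ rfl

/-- The isomorphism of trees with one edge that exchanges the vertices. -/
def StableGraph.treeSwapIso (α : Y ≃ Y') (β : Z ≃ Z') (hy : α y = y') (hz : β z = z') (τ : I ≃ J)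
    (he : ∀ w w', w'.1 = Sum.swap (Sum.map α β w.1) → e'' w' = τ (e w)) :
    (StableGraph.tree g h γ hγ y z hY hZ e).Iso
      (StableGraph.tree h g γ hγ' z' y' hZ' hY' e'') τ where
  flag := (Equiv.sumCongr α β).trans (Equiv.sumComm Y' Z')
  vert := Equiv.boolNot
  vert_flag := by rintro (w | w) <;> rfl
  inv_flag w := swap_apply_equiv_swap ((Equiv.sumCongr α β).trans (Equiv.sumComm Y' Z'))
    (congrArg Sum.inr hy) (congrArg Sum.inl hz) w
  genus_vert v := by cases v <;> rfl
  leg_flag w := he _ _ rfl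

variable {k : Type u} [Field k] {A : StableSModule.{u, v} k} (M : ModularOperad A)

theorem ModularOperad.comp_tree_map (α : Y ≃ Y') (β : Z ≃ Z') (hy : α y = y') (hz : β z = z')
    (τ : I ≃ J) (he : ∀ w w', w'.1 = Sum.map α β w.1 → e' w' = τ (e w)) {p q : ℤ}
    {a : A.onSet g Y} {b : A.onSet h Z} (ha : a ∈ A.onSetDeg g Y p) (hb : b ∈ A.onSetDeg h Z q) :
    M.comp (StableGraph.tree g h γ hγ y' z' hY' hZ' e') (inferInstance : LinearOrder Bool)
        (treeDecoration A (A.relabel rfl α a) (A.relabel rfl β b)) =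
      A.relabel rfl τ (M.comp (StableGraph.tree g h γ hγ y z hY hZ e)
        (inferInstance : LinearOrder Bool) (treeDecoration A a b)) := by
  have hd := treeDecoration_mem (hγ := hγ) (y := y) (z := z) (hY := hY) (hZ := hZ) (e := e) ha hb
  have key := M.comp_iso (StableGraph.treeIso (hY := hY) (hZ := hZ) (hY' := hY') (hZ' := hZ')
      (hγ := hγ) α β hy hz τ he)
    (inferInstance : LinearOrder Bool) (inferInstance : LinearOrder Bool)
    (fun v => Bool.rec p q v) (treeDecoration A a b)
    (treeDecoration A (A.relabel rfl α a) (A.relabel rfl β b)) hd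
  refine (key fun v => ?_).trans ?_
  · match v with
    | false =>
      refine (A.relabel_relabel _ _ _ _ _).trans (Eq.trans ?_ (A.relabel_relabel _ _ _ _ _).symm)
      congr 2
      exact Equiv.ext fun x => rfl
    | true =>
      refine (A.relabel_relabel _ _ _ _ _).trans (Eq.trans ?_ (A.relabel_relabel _ _ _ _ _).symm)
      congr 2
      exact Equiv.ext fun x => rfl
  · exact (congrArg (· • _) (koszulSign_refl _ _)).trans (one_smul _ _)

theorem ModularOperad.comp_tree_swap (α : Y ≃ Y') (β : Z ≃ Z') (hy : α y = y') (hz : β z = z')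
    (τ : I ≃ J) (he : ∀ w w', w'.1 = Sum.swap (Sum.map α β w.1) → e'' w' = τ (e w)) {p q : ℤ}
    {a : A.onSet g Y} {b : A.onSet h Z} (ha : a ∈ A.onSetDeg g Y p) (hb : b ∈ A.onSetDeg h Z q) :
    M.comp (StableGraph.tree h g γ hγ' z' y' hZ' hY' e'') (inferInstance : LinearOrder Bool)
        (treeDecoration A (A.relabel rfl β b) (A.relabel rfl α a)) =
      (p * q).negOnePow • A.relabel rfl τ (M.comp (StableGraph.tree g h γ hγ y z hY hZ e)
        (inferInstance : LinearOrder Bool) (treeDecoration A a b)) := by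
  have hd := treeDecoration_mem (hγ := hγ) (y := y) (z := z) (hY := hY) (hZ := hZ) (e := e) ha hb
  have key := M.comp_iso (StableGraph.treeSwapIso (hY := hY) (hZ := hZ) (hY' := hY') (hZ' := hZ')
      (hγ := hγ) (hγ' := hγ') α β hy hz τ he)
    (inferInstance : LinearOrder Bool) (inferInstance : LinearOrder Bool)
    (fun v => Bool.rec p q v) (treeDecoration A a b)
    (treeDecoration A (A.relabel rfl β b) (A.relabel rfl α a)) hd
  refine (key fun v => ?_).trans ?_
  · match v with
    | false =>
      refine (A.relabel_relabel _ _ _ _ _).trans (Eq.trans ?_ (A.relabel_relabel _ _ _ _ _).symm)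
      congr 2
      exact Equiv.ext fun x => rfl
    | true =>
      refine (A.relabel_relabel _ _ _ _ _).trans (Eq.trans ?_ (A.relabel_relabel _ _ _ _ _).symm)
      congr 2
      exact Equiv.ext fun x => rfl
  · exact congrArg (· • _) (koszulSign_boolNot _ _)

end Iso

/-- The bijection from a numbering of a subset. -/
abbrev Set.BijOn.numbering {F : Type} {n : ℕ} {φ : Fin n → F} {s : Set F}
    (hφ : Set.BijOn φ Set.univ s) :
    Fin n ≃ s :=
  (Equiv.Set.univ (Fin n)).symm.trans (hφ.equiv φ)

theorem StableSModule.relabel_numbering {k : Type u} [Field k] (A : StableSModule.{u, v} k)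
    {F : Type} {g n : ℕ} {φ : Fin n → F} {s : Set F} (hφ : Set.BijOn φ Set.univ s) (a : A.obj g n) :
    A.relabel rfl hφ.numbering (A.cls (Equiv.refl _) a) = A.ofEnum φ hφ a :=
  A.relabel_cls _ _ _

/-! ### Trees with one edge and arbitrary labels in a modular operad -/

section Induces

variable {k : Type u} [Field k] {A : StableSModule.{u, v} k} {C : StableGradedCyclicOperad A}
  {X : Contractions A} {M : ModularOperad A} {F : Type} [Finite F] {s₁ s₂ s : Set F} {x y : F}
  {g h γ : ℕ}

/-- `Induces` speaks of trees with numbered flags only, and naturality extends it to arbitrary sets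
of flags. The three cases mirror those of `IsGlue`; when only the second vertex has spare labels,
the isomorphism exchanges the vertices and supplies the Koszul sign. -/
theorem ModularOperad.Induces.comp_tree (hM : M.Induces C X) (hγ : g + h = γ)
    (H : GlueData s₁ s₂ s x y) (h₁ : 2 < 2 * g + Nat.card s₁) (h₂ : 2 < 2 * h + Nat.card s₂)
    {I : Type} (τ : s ≃ I)
    (e : {z : s₁ ⊕ s₂ // z ≠ Sum.inl ⟨x, H.left⟩ ∧ z ≠ Sum.inr ⟨y, H.right⟩} ≃ I)
    (he : ∀ z (w : s), (w : F) = Sum.elim Subtype.val Subtype.val z.1 → e z = τ w) {p q : ℤ}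
    {a : A.onSet g s₁} {b : A.onSet h s₂} (ha : a ∈ A.onSetDeg g s₁ p)
    (hb : b ∈ A.onSetDeg h s₂ q) :
    M.comp (StableGraph.tree g h γ hγ (⟨x, H.left⟩ : s₁) (⟨y, H.right⟩ : s₂) h₁ h₂ e)
      (inferInstance : LinearOrder Bool) (treeDecoration A a b) =
        A.relabel rfl τ (C.glue hγ H a b) := by
  have n1 : s₁.ncard ≠ 0 := Set.ncard_ne_zero_of_mem H.left
  have n2 : s₂.ncard ≠ 0 := Set.ncard_ne_zero_of_mem H.right
  obtain ⟨m, hm⟩ : ∃ m, s₁.ncard = m + 1 := ⟨s₁.ncard - 1, by omega⟩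
  obtain ⟨n, hn⟩ : ∃ n, s₂.ncard = n + 1 := ⟨s₂.ncard - 1, by omega⟩
  have c₁ : Nat.card s₁ = Nat.card (Fin (m + 1)) := by rw [Nat.card_coe_set_eq, hm, Nat.card_fin]
  have c₂ : Nat.card s₂ = Nat.card (Fin (n + 1)) := by rw [Nat.card_coe_set_eq, hn, Nat.card_fin]
  by_cases hm1 : 1 ≤ m
  · obtain ⟨φ, hφ, hx⟩ := exists_enum₁ hm ⟨1, by omega⟩ H.left
    obtain ⟨ψ, hψ, hy⟩ := exists_enum₁ hn 0 H.right
    obtain ⟨a, rfl⟩ := A.exists_ofEnum_eq hφ a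
    obtain ⟨b, rfl⟩ := A.exists_ofEnum_eq hψ b
    have hθ := bijOn_cat rfl 1 hm1 H hφ hψ hx hy
    have ha' := (A.cls_mem_iff (Equiv.refl _)).2 ((A.ofEnum_mem_iff hφ).1 ha)
    have hb' := (A.cls_mem_iff (Equiv.refl _)).2 ((A.ofEnum_mem_iff hψ).1 hb)
    have key := M.comp_tree_map (hγ := hγ) (hY' := h₁) (hZ' := h₂) (e' := e) (hY := c₁ ▸ h₁)
      (hZ := c₂ ▸ h₂) (e := circNumbering rfl ⟨1, by omega⟩)
      hφ.numbering hψ.numbering (Subtype.ext hx) (Subtype.ext hy) (hθ.numbering.trans τ)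
      (fun w w' hw' => he _ _ (by
        rw [hw']
        refine (cat_circNumbering rfl 1 hm1 φ ψ w).trans ?_
        rcases w with ⟨w | w, hw⟩ <;> rfl)) ha' hb'
    rw [A.relabel_numbering, A.relabel_numbering] at key
    rw [key, hM.circ hγ rfl 1 ⟨le_rfl, hm1⟩ (c₁ ▸ h₁) (c₂ ▸ h₂) a b,
      (C.isGlue_glue hγ H).fst rfl 1 ⟨le_rfl, hm1⟩ φ ψ hφ hψ hx hy, A.relabel_cls]
    exact (A.relabel_cls τ hθ.numbering _).symm
  by_cases hn1 : 1 ≤ n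
  · obtain ⟨φ, hφ, hx⟩ := exists_enum₁ hm 0 H.left
    obtain ⟨ψ, hψ, hy⟩ := exists_enum₁ hn ⟨1, by omega⟩ H.right
    obtain ⟨a, rfl⟩ := A.exists_ofEnum_eq hφ a
    obtain ⟨b, rfl⟩ := A.exists_ofEnum_eq hψ b
    have hθ := bijOn_cat rfl 1 hn1 H.symm hψ hφ hy hx
    have ha₁ := (A.ofEnum_mem_iff hφ).1 ha
    have hb₁ := (A.ofEnum_mem_iff hψ).1 hb
    have ha' := (A.cls_mem_iff (Equiv.refl _)).2 ha₁
    have hb' := (A.cls_mem_iff (Equiv.refl _)).2 hb₁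
    have key := M.comp_tree_swap (hγ := (by omega : h + g = γ)) (hγ' := hγ) (hZ' := h₁) (hY' := h₂)
      (e'' := e) (hZ := c₁ ▸ h₁)
      (hY := c₂ ▸ h₂) (e := circNumbering rfl ⟨1, by omega⟩)
      hψ.numbering hφ.numbering (Subtype.ext hy) (Subtype.ext hx) (hθ.numbering.trans τ)
      (fun w w' hw' => he _ _ (by
        rw [hw']
        refine (cat_circNumbering rfl 1 hn1 ψ φ w).trans ?_
        rcases w with ⟨w | w, hw⟩ <;> rfl)) hb' ha'
    rw [A.relabel_numbering, A.relabel_numbering] at key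
    rw [key, hM.circ (by omega) rfl 1 ⟨le_rfl, hn1⟩ (c₂ ▸ h₂) (c₁ ▸ h₁) b a,
      (C.isGlue_glue hγ H).snd (by omega) rfl 1 ⟨le_rfl, hn1⟩ ψ φ hψ hφ hy hx p q b a ha₁ hb₁,
      A.relabel_cls, LinearMap.map_intUnits_smul, mul_comm]
    exact congrArg _ (A.relabel_cls τ hθ.numbering _).symm
  · obtain rfl : m = 0 := by omega
    obtain rfl : n = 0 := by omega
    obtain ⟨φ, hφ, hx⟩ := exists_enum₁ hm 0 H.left
    obtain ⟨ψ, hψ, hy⟩ := exists_enum₁ hn 0 H.right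
    obtain ⟨a, rfl⟩ := A.exists_ofEnum_eq hφ a
    obtain ⟨b, rfl⟩ := A.exists_ofEnum_eq hψ b
    have hθ := bijOn_cat (m := 0) (n := 0) rfl 0 le_rfl H hφ hψ hx hy
    have ha' := (A.cls_mem_iff (Equiv.refl _)).2 ((A.ofEnum_mem_iff hφ).1 ha)
    have hb' := (A.cls_mem_iff (Equiv.refl _)).2 ((A.ofEnum_mem_iff hψ).1 hb)
    have key := M.comp_tree_map (hγ := hγ) (hY' := h₁) (hZ' := h₂) (e' := e) (hY := c₁ ▸ h₁)
      (hZ := c₂ ▸ h₂) (e := circNumbering (m := 0) (n := 0) rfl 0)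
      hφ.numbering hψ.numbering (Subtype.ext hx) (Subtype.ext hy) (hθ.numbering.trans τ)
      (fun w w' hw' => he _ _ (by
        rw [hw']
        refine (cat_circNumbering (m := 0) (n := 0) rfl 0 le_rfl φ ψ w).trans ?_
        rcases w with ⟨w | w, hw⟩ <;> rfl)) ha' hb'
    rw [A.relabel_numbering, A.relabel_numbering] at key
    rw [key, hM.pair hγ (c₁ ▸ h₁) (c₂ ▸ h₂) a b, (C.isGlue_glue hγ H).pair φ ψ _ hφ hψ hθ,
      A.relabel_cls]
    exact (A.relabel_cls τ hθ.numbering _).symm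

/-- The bijection from the sum of two sets of labels, without those that are glued, to the set of
remaining labels. -/
def GlueData.equiv (H : GlueData s₁ s₂ s x y) :
    {z : s₁ ⊕ s₂ // z ≠ Sum.inl ⟨x, H.left⟩ ∧ z ≠ Sum.inr ⟨y, H.right⟩} ≃ s :=
  Equiv.ofBijective (fun z => ⟨Sum.elim Subtype.val Subtype.val z.1, by
      rcases z with ⟨z | z, h1, h2⟩
      · exact (H.mem_iff _).2 (Or.inl ⟨z.2, fun e => h1 (congrArg Sum.inl (Subtype.ext e))⟩)
      · exact (H.mem_iff _).2 (Or.inr ⟨z.2, fun e => h2 (congrArg Sum.inr (Subtype.ext e))⟩)⟩) (by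
    constructor
    · rintro ⟨z | z, hz⟩ ⟨w | w, hw⟩ e
      all_goals replace e := congrArg Subtype.val e
      · exact Subtype.ext (congrArg Sum.inl (Subtype.ext e))
      · exact absurd e (H.ne_of_mem z.2 w.2)
      · exact absurd e.symm (H.ne_of_mem w.2 z.2)
      · exact Subtype.ext (congrArg Sum.inr (Subtype.ext e))
    · rintro ⟨z, hz⟩
      rcases (H.mem_iff z).1 hz with ⟨h, hne⟩ | ⟨h, hne⟩
      · exact ⟨⟨Sum.inl ⟨z, h⟩, fun e => hne (congrArg Subtype.val (Sum.inl.inj e)),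
          Sum.inl_ne_inr⟩, rfl⟩
      · exact ⟨⟨Sum.inr ⟨z, h⟩, Sum.inr_ne_inl,
          fun e => hne (congrArg Subtype.val (Sum.inr.inj e))⟩, rfl⟩)

end Induces

/-! ### Graphs that are isomorphic to a part of a graph -/

/-- An isomorphism from `G'` to the part of `G` with vertices `c`, whose edges are those edges of `G`
at `c` that have no end in `s`, and whose legs are the flags in `s`. -/
structure FlagGraph.PartIso (G' G : FlagGraph) (c : Finset G.Vert) (s : Set G.Flag) where
  flag : G'.Flag → G.Flag
  vert : G'.Vert → G.Vert
  flag_injective : Function.Injective flag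
  vert_injective : Function.Injective vert
  vert_flag : ∀ x, G.vert (flag x) = vert (G'.vert x)
  vert_mem : ∀ v, vert v ∈ c
  exists_vert : ∀ v ∈ c, ∃ u, vert u = v
  exists_flag : ∀ x, G.vert x ∈ c → ∃ y, flag y = x
  inv_flag : ∀ x, flag x ∉ s → flag (G'.inv x) = G.inv (flag x)
  inv_eq_iff : ∀ x, G'.inv x = x ↔ flag x ∈ s
  genus_vert : ∀ u, G'.genus u = G.genus (vert u)
  subset : ∀ x ∈ s, G.vert x ∈ c

theorem FlagGraph.PreHom.preimage_inv_of_mem {G₀ G₁ : FlagGraph} (f : G₀.PreHom G₁) (w : G₁.Vert)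
    (x : (f.preimage w).Flag) (h : x.1 ∈ Set.range f.flag) : (f.preimage w).inv x = x :=
  dif_pos h

theorem FlagGraph.PreHom.preimage_inv_of_notMem {G₀ G₁ : FlagGraph} (f : G₀.PreHom G₁)
    (w : G₁.Vert) (x : (f.preimage w).Flag) (h : x.1 ∉ Set.range f.flag) :
    (f.preimage w).inv x = ⟨G₀.inv x.1, (f.vert_inv x.1 h).trans x.2⟩ :=
  dif_neg h

namespace FlagGraph.PartIso

variable {G' G : FlagGraph} {c : Finset G.Vert} {s : Set G.Flag} (S : G'.PartIso G c s)

theorem bijOn_legs : Set.BijOn S.flag {x | G'.inv x = x} s :=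
  ⟨fun x hx => (S.inv_eq_iff x).1 hx, S.flag_injective.injOn, fun x hx => by
    obtain ⟨y, rfl⟩ := S.exists_flag x (S.subset x hx)
    exact ⟨y, (S.inv_eq_iff y).2 hx, rfl⟩⟩

/-- The legs correspond to the elements of `s`. -/
def legsEquiv : G'.Legs ≃ s := S.bijOn_legs.equiv S.flag

theorem coe_legsEquiv (x : G'.Legs) : (S.legsEquiv x : G.Flag) = S.flag x.1 := rfl

theorem flag_legsEquiv_symm (x : s) : S.flag (S.legsEquiv.symm x).1 = x := by
  rw [← S.coe_legsEquiv, Equiv.apply_symm_apply]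

/-- The flags at a vertex correspond to the flags at its image. -/
def legEquiv (u : G'.Vert) : G'.Leg u ≃ G.Leg (S.vert u) :=
  Equiv.ofBijective (fun x => ⟨S.flag x.1, by rw [S.vert_flag, x.2]⟩)
    ⟨fun x y e => Subtype.ext (S.flag_injective (congrArg Subtype.val e)), by
      rintro ⟨x, hx⟩
      obtain ⟨y, rfl⟩ := S.exists_flag x (hx ▸ S.vert_mem u)
      exact ⟨⟨y, S.vert_injective ((S.vert_flag y).symm.trans hx)⟩, rfl⟩⟩

theorem coe_legEquiv (u : G'.Vert) (x : G'.Leg u) : (S.legEquiv u x : G.Flag) = S.flag x.1 := rfl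

theorem flag_legEquiv_symm (u : G'.Vert) (x : G.Leg (S.vert u)) :
    S.flag ((S.legEquiv u).symm x).1 = x := by
  rw [← S.coe_legEquiv, Equiv.apply_symm_apply]

/-- The preimage of a flag at `c`. -/
def preflag (x : G.Flag) (hx : G.vert x ∈ c) : G'.Flag := (S.exists_flag x hx).choose

theorem flag_preflag (x : G.Flag) (hx : G.vert x ∈ c) : S.flag (S.preflag x hx) = x :=
  (S.exists_flag x hx).choose_spec

/-- The preimage of a vertex under a morphism of graphs, as a part of `G`. -/
def preimage {G₁ : FlagGraph} (f : G'.PreHom G₁) (w : G₁.Vert) {c₁ : Finset G.Vert}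
    {s₁ : Set G.Flag} (hc : c₁ ⊆ c) (hw : ∀ v, f.vert v = w ↔ S.vert v ∈ c₁)
    (hf : ∀ x, f.vert (G'.vert x) = w → (x ∈ Set.range f.flag ↔ S.flag x ∈ s₁))
    (hs : ∀ x ∈ s₁, G.vert x ∈ c₁) : (f.preimage w).PartIso G c₁ s₁ where
  flag x := S.flag x.1
  vert u := S.vert u.1
  flag_injective x y e := Subtype.ext (S.flag_injective e)
  vert_injective x y e := Subtype.ext (S.vert_injective e)
  vert_flag x := S.vert_flag x.1
  vert_mem v := (hw v.1).1 v.2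
  exists_vert v hv := by
    obtain ⟨u, rfl⟩ := S.exists_vert v (hc hv)
    exact ⟨⟨u, (hw u).2 hv⟩, rfl⟩
  exists_flag x hx := by
    obtain ⟨y, rfl⟩ := S.exists_flag x (hc hx)
    exact ⟨⟨y, (hw _).2 ((S.vert_flag y) ▸ hx)⟩, rfl⟩
  inv_flag x hx := by
    have h1 : x.1 ∉ Set.range f.flag := fun h => hx ((hf x.1 x.2).1 h)
    have h2 : S.flag x.1 ∉ s := fun h => f.inv_ne x.1 h1 ((S.inv_eq_iff x.1).2 h)
    rw [f.preimage_inv_of_notMem w x h1]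
    exact S.inv_flag x.1 h2
  inv_eq_iff x := by
    rw [← hf x.1 x.2]
    by_cases h : x.1 ∈ Set.range f.flag
    · exact iff_of_true (f.preimage_inv_of_mem w x h) h
    · rw [f.preimage_inv_of_notMem w x h]
      exact iff_of_false (fun e => f.inv_ne x.1 h (congrArg Subtype.val e)) h
  genus_vert u := S.genus_vert u.1
  subset := hs

section Decoration

variable {k : Type u} [Field k] {A : StableSModule.{u, v} k}

/-- The restriction of a decoration. -/
def decoration (a : ∀ v, A.onSet (G.genus v) (G.Leg v)) (u : G'.Vert) :
    A.onSet (G'.genus u) (G'.Leg u) :=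
  A.relabel (S.genus_vert u).symm (S.legEquiv u).symm (a (S.vert u))

theorem decoration_mem {a : ∀ v, A.onSet (G.genus v) (G.Leg v)} {p : G.Vert → ℤ}
    (ha : ∀ v, a v ∈ A.onSetDeg (G.genus v) (G.Leg v) (p v)) (u : G'.Vert) :
    S.decoration a u ∈ A.onSetDeg (G'.genus u) (G'.Leg u) (p (S.vert u)) :=
  A.relabel_mem _ _ (ha _)

theorem decoration_preimage {G₁ : FlagGraph} (f : G'.PreHom G₁) (w : G₁.Vert) {c₁ : Finset G.Vert}
    {s₁ : Set G.Flag} (hc : c₁ ⊆ c) (hw : ∀ v, f.vert v = w ↔ S.vert v ∈ c₁)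
    (hf : ∀ x, f.vert (G'.vert x) = w → (x ∈ Set.range f.flag ↔ S.flag x ∈ s₁))
    (hs : ∀ x ∈ s₁, G.vert x ∈ c₁) (a : ∀ v, A.onSet (G.genus v) (G.Leg v))
    (u : (f.preimage w).Vert) :
    (S.preimage f w hc hw hf hs).decoration a u =
      A.relabel rfl (f.preimageLegEquiv w u) (S.decoration a u.1) := by
  refine Eq.trans ?_ (A.relabel_relabel _ _ _ _ _).symm
  unfold decoration
  congr 2
  ext x
  refine Subtype.ext (S.flag_injective ?_)
  refine ((S.preimage f w hc hw hf hs).flag_legEquiv_symm u x).trans ?_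
  exact (S.flag_legEquiv_symm u.1 x).symm

variable {C : StableGradedCyclicOperad A} {X : Contractions A} {o : LinearOrder G.Vert}
  {p : G.Vert → ℤ} {a : ∀ v, A.onSet (G.genus v) (G.Leg v)} {g : ℕ} {r : A.onSet g s}

include S in
-- `IsVal.exists_crossing` is applied to the vertices reachable from `u`: a contracted edge leading
-- out of them would make its other end reachable too.
theorem connected (d : IsVal C X G o p a c s g r) : G'.Connected := by
  obtain ⟨v, hv⟩ := d.nonempty
  obtain ⟨u, -⟩ := S.exists_vert v hv
  refine ⟨⟨u⟩, fun u v => ?_⟩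
  by_contra hv
  obtain ⟨z, hz, hzs, ⟨w, hw, hwu⟩, hz'⟩ := d.exists_crossing (fun v => ∃ w, S.vert w = v ∧
    Relation.ReflTransGen (fun u v => ∃ x, G'.vert x = u ∧ G'.vert (G'.inv x) = v) u w)
    (S.vert u) (S.vert_mem u) ⟨u, rfl, .refl⟩ (S.vert v) (S.vert_mem v) (by
      rintro ⟨w, hw, h⟩
      exact hv (S.vert_injective hw ▸ h))
  obtain ⟨x, rfl⟩ := S.exists_flag z hz
  refine hz' ⟨G'.vert (G'.inv x), ?_, hwu.tail ⟨x, ?_, rfl⟩⟩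
  · rw [← S.vert_flag, S.inv_flag x hzs]
  · exact S.vert_injective ((S.vert_flag x).symm.trans hw.symm)

include S in
-- `IsVal.genus_eq` becomes the genus formula when vertices, flags and legs are counted along the
-- isomorphism.
theorem hasGenus (d : IsVal C X G o p a c s g r) : G'.HasGenus g := by
  classical
  have h1 := d.genus_eq
  have h2 := G'.two_mul_card_edge
  have h3 : {x | G'.inv x = x}.ncard = s.ncard := by
    rw [← S.bijOn_legs.image_eq, S.bijOn_legs.injOn.ncard_image]
  have h4 : Nat.card G'.Flag = {x | G.vert x ∈ c}.ncard := by
    rw [← Set.ncard_univ, ← S.flag_injective.injOn.ncard_image]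
    congr 1
    ext x
    constructor
    · rintro ⟨y, -, rfl⟩
      change G.vert (S.flag y) ∈ c
      rw [S.vert_flag]
      exact S.vert_mem _
    · intro hx
      obtain ⟨y, rfl⟩ := S.exists_flag x hx
      exact ⟨y, trivial, rfl⟩
  have hc : Finset.univ.map ⟨S.vert, S.vert_injective⟩ = c := by
    ext v
    simp only [Finset.mem_map, Finset.mem_univ, true_and, Function.Embedding.coeFn_mk]
    exact ⟨by rintro ⟨u, rfl⟩; exact S.vert_mem u, S.exists_vert v⟩
  have h5 : ∑ v ∈ c, G.genus v = ∑ u, G'.genus u := by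
    rw [← hc, Finset.sum_map]
    exact Finset.sum_congr rfl fun u _ => (S.genus_vert u).symm
  have h6 : c.card = Nat.card G'.Vert := by
    rw [← hc, Finset.card_map, Finset.card_univ, Nat.card_eq_fintype_card]
  unfold FlagGraph.HasGenus
  omega

end Decoration

end FlagGraph.PartIso

/-! ### Changing the labels and the order -/

/-- A stable graph with its legs relabelled. -/
def StableGraph.relabelLegs {γ : ℕ} {I J : Type} (G : StableGraph γ I) (τ : I ≃ J) :
    StableGraph γ J :=
  { G with leg := G.leg.trans τ }

/-- The identity, as an isomorphism from a stable graph to the same graph with its legs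
relabelled. -/
def StableGraph.relabelLegsIso {γ : ℕ} {I J : Type} (G : StableGraph γ I) (τ : I ≃ J) :
    G.Iso (G.relabelLegs τ) τ where
  flag := Equiv.refl _
  vert := Equiv.refl _
  vert_flag _ := rfl
  inv_flag _ := rfl
  genus_vert _ := rfl
  leg_flag _ := rfl

section Order

variable {k : Type u} [Field k] {A : StableSModule.{u, v} k} (M : ModularOperad A)

theorem ModularOperad.comp_relabelLegs {γ : ℕ} {I J : Type} (G : StableGraph γ I) (τ : I ≃ J)
    (o o' : LinearOrder G.Vert) {p : G.Vert → ℤ}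
    {a : ∀ v : G.Vert, A.onSet (G.genus v) (G.toFlagGraph.Leg v)}
    (ha : ∀ v, a v ∈ A.onSetDeg (G.genus v) (G.toFlagGraph.Leg v) (p v)) :
    M.comp (G.relabelLegs τ) o' a =
      koszulSign o o' (Equiv.refl G.Vert) p • A.relabel rfl τ (M.comp G o a) :=
  M.comp_iso (G.relabelLegsIso τ) o o' p a a ha fun v => (A.relabel_refl (a v)).symm

theorem ModularOperad.comp_order {γ : ℕ} {I : Type} (G : StableGraph γ I)
    (o o' : LinearOrder G.Vert) {p : G.Vert → ℤ}
    {a : ∀ v : G.Vert, A.onSet (G.genus v) (G.toFlagGraph.Leg v)}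
    (ha : ∀ v, a v ∈ A.onSetDeg (G.genus v) (G.toFlagGraph.Leg v) (p v)) :
    M.comp G o' a = koszulSign o o' (Equiv.refl G.Vert) p • M.comp G o a :=
  (M.comp_relabelLegs G (Equiv.refl I) o o' ha).trans (congrArg _ (A.relabel_refl _))

/-- The lexicographic order for a map to a linearly ordered type and a linear order. -/

abbrev lexOrder {V W : Type} [LinearOrder W] (o : LinearOrder V) (f : V → W) : LinearOrder V :=
  LinearOrder.lift' (fun v => (toLex (f v, v) : W ×ₗ V)) fun _ _ h => (Prod.ext_iff.1 h).2

theorem lexOrder_lt_iff {V W : Type} [LinearOrder W] (o : LinearOrder V) (f : V → W) (u v : V) :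
    (lexOrder o f).lt u v ↔ f u < f v ∨ f u = f v ∧ o.lt u v :=
  Prod.Lex.toLex_lt_toLex

theorem lexOrder_le {V W : Type} [LinearOrder W] (o : LinearOrder V) (f : V → W) (u v : V)
    (h : (lexOrder o f).le u v) : f u ≤ f v := by
  rcases Prod.Lex.toLex_le_toLex.1 (show toLex (f u, u) ≤ toLex (f v, v) from h) with h | h
  · exact h.le
  · exact h.1.le

/-- Sorting first by side inverts exactly the pairs in which a vertex of `c₂` comes before one of
`c₁`, and these are the pairs counted by `crossSign`. The lexicographic order makes the map to the
two vertices of a tree monotone. -/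
theorem koszulSign_lexOrder {V V' : Type} [Fintype V] (o' : LinearOrder V) (o : LinearOrder V')
    (f : V → Bool) (i : V → V') (hi : Function.Injective i)
    (ho : ∀ u v, o'.lt u v → o.lt (i u) (i v)) (p : V' → ℤ) (c₁ c₂ : Finset V')
    (h₁ : ∀ v, v ∈ c₁ ↔ ∃ u, f u = false ∧ i u = v) (h₂ : ∀ v, v ∈ c₂ ↔ ∃ u, f u = true ∧ i u = v) :
    koszulSign (lexOrder o' f) o' (Equiv.refl V) (fun u => p (i u)) = crossSign o p c₁ c₂ := by
  classical
  have e₁ : c₁ = (Finset.univ.filter (f · = false)).map ⟨i, hi⟩ := by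
    ext v; simp [h₁]
  have e₂ : c₂ = (Finset.univ.filter (f · = true)).map ⟨i, hi⟩ := by
    ext v; simp [h₂]
  have ho' : ∀ u v, o.lt (i u) (i v) ↔ o'.lt u v := by
    refine fun u v => ⟨fun h => ?_, ho u v⟩
    rcases lt_trichotomy u v with h' | h' | h'
    · exact h'
    · subst h'; exact absurd h (lt_irrefl _)
    · exact absurd h (lt_asymm (ho v u h'))
  unfold koszulSign crossSign
  rw [e₁, e₂, Finset.prod_map, Finset.prod_filter]
  refine Finset.prod_congr rfl fun u _ => ?_
  rw [Finset.prod_map, Finset.prod_filter]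
  by_cases hu : f u = false
  · rw [if_pos hu]
    refine Finset.prod_congr rfl fun v _ => ?_
    simp only [lexOrder_lt_iff, hu, Equiv.refl_apply, Function.Embedding.coeFn_mk, ho']
    by_cases hv : f v = true
    · simp [hv]
    · have hv' : f v = false := by simpa using hv
      simp only [hv', lt_irrefl, false_or, true_and, Bool.false_eq_true, if_false]
      exact if_neg fun h => lt_asymm h.1 h.2
  · have hu' : f u = true := by simpa using hu
    rw [if_neg hu]
    refine Finset.prod_eq_one fun v _ => if_neg ?_
    rw [lexOrder_lt_iff, hu']
    rintro ⟨h | h, h'⟩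
    · exact absurd h (by simp)
    · exact lt_asymm h.2 h'

end Order

/-! ### Compositions in a modular operad -/

section Inv

variable {Y Z I : Type} [Finite Y] [Finite Z] {g h γ : ℕ}

open Classical in
theorem tree_inv_right (hγ : g + h = γ) (y : Y) (z : Z)
    (hY : 2 < 2 * g + Nat.card Y) (hZ : 2 < 2 * h + Nat.card Z)
    (e : {w : Y ⊕ Z // w ≠ Sum.inl y ∧ w ≠ Sum.inr z} ≃ I) :
    (StableGraph.tree g h γ hγ y z hY hZ e).inv (Sum.inr z) = Sum.inl y :=
  Equiv.swap_apply_right (Sum.inl y) (Sum.inr z)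

open Classical in
theorem tree_inv_of_ne (hγ : g + h = γ) (y : Y) (z : Z)
    (hY : 2 < 2 * g + Nat.card Y) (hZ : 2 < 2 * h + Nat.card Z)
    (e : {w : Y ⊕ Z // w ≠ Sum.inl y ∧ w ≠ Sum.inr z} ≃ I) (w : Y ⊕ Z)
    (hw : w ≠ Sum.inl y ∧ w ≠ Sum.inr z) : (StableGraph.tree g h γ hγ y z hY hZ e).inv w = w :=
  Equiv.swap_apply_of_ne_of_ne (α := Y ⊕ Z) hw.1 hw.2

open Classical in
theorem loop_inv_left (y z : Y) (hyz : y ≠ z) (hY : 2 < 2 * g + Nat.card Y) :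
    (StableGraph.loop g y z hyz hY).inv y = z :=
  Equiv.swap_apply_left y z

open Classical in
theorem loop_inv_right (y z : Y) (hyz : y ≠ z) (hY : 2 < 2 * g + Nat.card Y) :
    (StableGraph.loop g y z hyz hY).inv z = y :=
  Equiv.swap_apply_right y z

end Inv

/-! ### Morphisms that contract all edges but one -/

namespace FlagGraph.PartIso

variable {k : Type u} [Field k] {A : StableSModule.{u, v} k} {C : StableGradedCyclicOperad A}
  {X : Contractions A} {G : FlagGraph} {o : LinearOrder G.Vert} {p : G.Vert → ℤ}
  {a : ∀ v, A.onSet (G.genus v) (G.Leg v)} {c c₁ c₂ : Finset G.Vert} {s s₁ s₂ : Set G.Flag}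
  {x y : G.Flag} {g g₁ g₂ : ℕ}

section Tree

variable {I : Type} {G' : StableGraph g I} (S : G'.toFlagGraph.PartIso G c s)
  {r₁ : A.onSet g₁ s₁} {r₂ : A.onSet g₂ s₂} (hxy : G.inv x = y)
  (d₁ : IsVal C X G o p a c₁ s₁ g₁ r₁) (d₂ : IsVal C X G o p a c₂ s₂ g₂ r₂) (hd : Disjoint c₁ c₂)
  (hc : c = c₁.disjUnion c₂ hd) (hg : g₁ + g₂ = g) (H : GlueData s₁ s₂ s x y)
  (h₁ : 2 < 2 * g₁ + Nat.card s₁) (h₂ : 2 < 2 * g₂ + Nat.card s₂)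

theorem mem_iff_of_disjUnion {c c₁ c₂ : Finset G.Vert} {hd : Disjoint c₁ c₂}
    (hc : c = c₁.disjUnion c₂ hd) (v : G.Vert) : v ∈ c ↔ v ∈ c₁ ∨ v ∈ c₂ := by
  rw [hc, Finset.mem_disjUnion]

include d₁ d₂ hc in
theorem mem_of_sum (z : s₁ ⊕ s₂) :
    G.vert (Sum.elim Subtype.val Subtype.val z : G.Flag) ∈ c := by
  rw [hc, Finset.mem_disjUnion]
  rcases z with z | z
  · exact Or.inl (d₁.vert_mem z z.2)
  · exact Or.inr (d₂.vert_mem z z.2)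

open Classical in
/-- The contraction of all edges but one, if the latter separates the graph. -/
def treePreHom : G'.toFlagGraph.PreHom (StableGraph.tree g₁ g₂ g hg (⟨x, H.left⟩ : s₁)
    (⟨y, H.right⟩ : s₂) h₁ h₂ (H.equiv.trans (S.legsEquiv.symm.trans G'.leg))).toFlagGraph where
  flag z := S.preflag _ (mem_of_sum d₁ d₂ hd hc z)
  flag_injective z w e := by
    replace e := congrArg S.flag e
    rw [S.flag_preflag, S.flag_preflag] at e
    rcases z with z | z <;> rcases w with w | w
    · exact congrArg Sum.inl (Subtype.ext e)
    · exact absurd e (H.ne_of_mem z.2 w.2)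
    · exact absurd e.symm (H.ne_of_mem w.2 z.2)
    · exact congrArg Sum.inr (Subtype.ext e)
  -- The two values are the vertices of the tree: `false` for the part `c₁` and `true` for `c₂`.
  vert v := decide (S.vert v ∈ c₂)
  inv_flag z := by
    by_cases hz : z = Sum.inl ⟨x, H.left⟩ ∨ z = Sum.inr ⟨y, H.right⟩
    · have hz' : S.flag (S.preflag _ (mem_of_sum d₁ d₂ hd hc z)) ∉ s := by
        rw [S.flag_preflag, H.mem_iff]
        rcases hz with rfl | rfl
        · rintro (h | h)
          · exact h.2 rfl
          · exact H.ne_of_mem H.left h.1 rfl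
        · rintro (h | h)
          · exact H.ne_of_mem h.1 H.right rfl
          · exact h.2 rfl
      refine S.flag_injective ((S.inv_flag _ hz').trans ?_)
      rw [S.flag_preflag, S.flag_preflag]
      rcases hz with rfl | rfl
      · refine hxy.trans ?_
        exact (congrArg (Sum.elim (Subtype.val : s₁ → G.Flag) (Subtype.val : s₂ → G.Flag))
          (tree_inv hg (⟨x, H.left⟩ : s₁) (⟨y, H.right⟩ : s₂) h₁ h₂
            (H.equiv.trans (S.legsEquiv.symm.trans G'.leg)))).symm
      · refine ((congrArg G.inv hxy).symm.trans (G.inv_inv x)).trans ?_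
        exact (congrArg (Sum.elim (Subtype.val : s₁ → G.Flag) (Subtype.val : s₂ → G.Flag))
          (tree_inv_right hg (⟨x, H.left⟩ : s₁) (⟨y, H.right⟩ : s₂) h₁ h₂
            (H.equiv.trans (S.legsEquiv.symm.trans G'.leg)))).symm
    · rw [not_or] at hz
      have e : (StableGraph.tree g₁ g₂ g hg (⟨x, H.left⟩ : s₁) (⟨y, H.right⟩ : s₂) h₁ h₂
          (H.equiv.trans (S.legsEquiv.symm.trans G'.leg))).inv z = z :=
        tree_inv_of_ne _ _ _ _ _ _ z hz
      rw [e]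
      refine (S.inv_eq_iff _).2 ?_
      rw [S.flag_preflag]
      exact (H.equiv ⟨z, hz⟩).2
  vert_flag z := by
    have e : S.vert (G'.vert (S.preflag _ (mem_of_sum d₁ d₂ hd hc z))) =
        G.vert (Sum.elim Subtype.val Subtype.val z : G.Flag) := by
      rw [← S.vert_flag, S.flag_preflag]
    rw [e]
    rcases z with z | z
    · exact decide_eq_false (Finset.disjoint_left.1 hd (d₁.vert_mem z z.2))
    · exact decide_eq_true (d₂.vert_mem z z.2)
  inv_ne z hz h := by
    have h' := (S.inv_eq_iff z).1 h
    obtain ⟨w, hw⟩ := H.equiv.surjective ⟨_, h'⟩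
    refine hz ⟨w.1, S.flag_injective ?_⟩
    rw [S.flag_preflag]
    exact congrArg Subtype.val hw
  vert_inv z hz := by
    have hz₁ : S.flag z ∉ s₁ := fun h => hz ⟨Sum.inl ⟨_, h⟩, S.flag_injective (S.flag_preflag _ _)⟩
    have hz₂ : S.flag z ∉ s₂ := fun h => hz ⟨Sum.inr ⟨_, h⟩, S.flag_injective (S.flag_preflag _ _)⟩
    have hs : S.flag z ∉ s := by
      rw [H.mem_iff]
      tauto
    rw [← S.vert_flag, ← S.vert_flag, S.inv_flag z hs]
    have h := S.vert_mem (G'.vert z)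
    rw [← S.vert_flag] at h
    rcases (mem_iff_of_disjUnion hc _).1 h with h | h
    · have h' := (d₁.inv_mem _ h hz₁).1
      rw [decide_eq_false (Finset.disjoint_left.1 hd h),
        decide_eq_false (Finset.disjoint_left.1 hd h')]
    · rw [decide_eq_true h, decide_eq_true (d₂.inv_mem _ h hz₂).1]

/-- The preimage of the first vertex of the tree. -/
def treePreHomFst : ((S.treePreHom hxy d₁ d₂ hd hc hg H h₁ h₂).preimage false).PartIso G c₁ s₁ :=
  S.preimage (S.treePreHom hxy d₁ d₂ hd hc hg H h₁ h₂) false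
    (by rw [hc]; exact fun v hv => Finset.mem_disjUnion.2 (Or.inl hv))
    (fun v => by
      refine decide_eq_false_iff_not.trans ?_
      have h := (mem_iff_of_disjUnion hc _).1 (S.vert_mem v)
      exact ⟨h.resolve_right, fun h' => Finset.disjoint_left.1 hd h'⟩)
    (fun z hz => by
      have hz' : S.vert (G'.vert z) ∉ c₂ := of_decide_eq_false hz
      constructor
      · rintro ⟨w | w, rfl⟩
        · exact (S.flag_preflag _ (mem_of_sum d₁ d₂ hd hc (Sum.inl w))).symm ▸ w.2
        · refine absurd ?_ hz'
          rw [← S.vert_flag]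
          exact (S.flag_preflag _ (mem_of_sum d₁ d₂ hd hc (Sum.inr w))).symm ▸ d₂.vert_mem w w.2
      · intro h
        exact ⟨Sum.inl ⟨_, h⟩, S.flag_injective
          (S.flag_preflag _ (mem_of_sum d₁ d₂ hd hc (Sum.inl ⟨_, h⟩)))⟩)
    d₁.vert_mem

/-- The preimage of the second vertex of the tree. -/
def treePreHomSnd : ((S.treePreHom hxy d₁ d₂ hd hc hg H h₁ h₂).preimage true).PartIso G c₂ s₂ :=
  S.preimage (S.treePreHom hxy d₁ d₂ hd hc hg H h₁ h₂) true
    (by rw [hc]; exact fun v hv => Finset.mem_disjUnion.2 (Or.inr hv))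
    (fun v => decide_eq_true_iff)
    (fun z hz => by
      have hz' : S.vert (G'.vert z) ∈ c₂ := of_decide_eq_true hz
      constructor
      · rintro ⟨w | w, rfl⟩
        · refine absurd hz' (Finset.disjoint_left.1 hd ?_)
          rw [← S.vert_flag]
          exact (S.flag_preflag _ (mem_of_sum d₁ d₂ hd hc (Sum.inl w))).symm ▸ d₁.vert_mem w w.2
        · exact (S.flag_preflag _ (mem_of_sum d₁ d₂ hd hc (Sum.inr w))).symm ▸ w.2
      · intro h
        exact ⟨Sum.inr ⟨_, h⟩, S.flag_injective
          (S.flag_preflag _ (mem_of_sum d₁ d₂ hd hc (Sum.inr ⟨_, h⟩)))⟩)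
    d₂.vert_mem

/-- The contraction of all edges but one, if the latter separates the graph. -/
def treeHom : G'.Hom (StableGraph.tree g₁ g₂ g hg (⟨x, H.left⟩ : s₁) (⟨y, H.right⟩ : s₂) h₁ h₂
    (H.equiv.trans (S.legsEquiv.symm.trans G'.leg))) where
  toPreHom := S.treePreHom hxy d₁ d₂ hd hc hg H h₁ h₂
  connected w :=
    match w with
    | false => (S.treePreHomFst hxy d₁ d₂ hd hc hg H h₁ h₂).connected d₁
    | true => (S.treePreHomSnd hxy d₁ d₂ hd hc hg H h₁ h₂).connected d₂
  hasGenus w :=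
    match w with
    | false => (S.treePreHomFst hxy d₁ d₂ hd hc hg H h₁ h₂).hasGenus d₁
    | true => (S.treePreHomSnd hxy d₁ d₂ hd hc hg H h₁ h₂).hasGenus d₂
  leg_flag z := by
    refine congrArg G'.leg (Subtype.ext (S.flag_injective ?_))
    refine (S.flag_preflag _ (mem_of_sum d₁ d₂ hd hc z.1)).trans
      (Eq.trans ?_ (S.flag_legsEquiv_symm _).symm)
    rfl

end Tree

section Loop

variable {I : Type} {G' : StableGraph g I} (S : G'.toFlagGraph.PartIso G c s)
  {r₁ : A.onSet g₁ s₁} (hxy : G.inv x = y) (d₁ : IsVal C X G o p a c s₁ g₁ r₁)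
  (hg : g₁ + 1 = g) (H : LoopData s₁ s x y) (h₁ : 2 < 2 * g₁ + Nat.card s₁)

open Classical in
/-- The contraction of all edges but one, if the latter does not separate the graph. -/
def loopPreHom : G'.toFlagGraph.PreHom (StableGraph.loop g₁ (⟨x, H.left⟩ : s₁) ⟨y, H.right⟩
    (fun e => H.ne (congrArg Subtype.val e)) h₁).toFlagGraph where
  flag z := S.preflag z.1 (d₁.vert_mem z.1 z.2)
  flag_injective z w e := by
    replace e := congrArg S.flag e
    rw [S.flag_preflag, S.flag_preflag] at e
    exact Subtype.ext e
  vert _ := ()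
  inv_flag z := by
    by_cases hz : z = ⟨x, H.left⟩ ∨ z = ⟨y, H.right⟩
    · have hz' : S.flag (S.preflag z.1 (d₁.vert_mem z.1 z.2)) ∉ s := by
        rw [S.flag_preflag, H.mem_iff]
        rcases hz with rfl | rfl
        · exact fun h => h.2.1 rfl
        · exact fun h => h.2.2 rfl
      refine S.flag_injective ((S.inv_flag _ hz').trans ?_)
      rw [S.flag_preflag, S.flag_preflag]
      rcases hz with rfl | rfl
      · refine hxy.trans ?_
        exact (congrArg (Subtype.val : s₁ → G.Flag) (loop_inv_left (⟨x, H.left⟩ : s₁)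
          ⟨y, H.right⟩ (fun e => H.ne (congrArg Subtype.val e)) h₁)).symm
      · refine ((congrArg G.inv hxy).symm.trans (G.inv_inv x)).trans ?_
        exact (congrArg (Subtype.val : s₁ → G.Flag) (loop_inv_right (⟨x, H.left⟩ : s₁)
          ⟨y, H.right⟩ (fun e => H.ne (congrArg Subtype.val e)) h₁)).symm
    · rw [not_or] at hz
      have e : (StableGraph.loop g₁ (⟨x, H.left⟩ : s₁) ⟨y, H.right⟩
          (fun e => H.ne (congrArg Subtype.val e)) h₁).inv z = z :=
        Equiv.swap_apply_of_ne_of_ne hz.1 hz.2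
      rw [e]
      refine (S.inv_eq_iff _).2 ?_
      rw [S.flag_preflag]
      exact (H.mem_iff _).2 ⟨z.2, fun e => hz.1 (Subtype.ext e), fun e => hz.2 (Subtype.ext e)⟩
  vert_flag z := rfl
  inv_ne z hz h := by
    have h' := ((H.mem_iff _).1 ((S.inv_eq_iff z).1 h)).1
    exact hz ⟨⟨_, h'⟩, S.flag_injective (S.flag_preflag _ _)⟩
  vert_inv z hz := rfl

/-- The preimage of the vertex. -/
def loopPreHomPart (w) : ((S.loopPreHom hxy d₁ H h₁).preimage w).PartIso G c s₁ :=
  S.preimage (S.loopPreHom hxy d₁ H h₁) w (Finset.Subset.refl c)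
    (fun v => iff_of_true rfl (S.vert_mem v))
    (fun z hz => by
      constructor
      · rintro ⟨w, rfl⟩
        exact (S.flag_preflag _ (d₁.vert_mem w.1 w.2)).symm ▸ w.2
      · intro h
        exact ⟨⟨_, h⟩, S.flag_injective (S.flag_preflag _ (d₁.vert_mem _ h))⟩)
    d₁.vert_mem

end Loop

/-- The contraction of all edges but one, if the latter does not separate the graph. -/
def loopHom {I : Type} {G' : StableGraph (g₁ + 1) I} (S : G'.toFlagGraph.PartIso G c s)
    {r₁ : A.onSet g₁ s₁} (hxy : G.inv x = y) (d₁ : IsVal C X G o p a c s₁ g₁ r₁)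
    (H : LoopData s₁ s x y) (h₁ : 2 < 2 * g₁ + Nat.card s₁) :
    (G'.relabelLegs (G'.leg.symm.trans (S.legsEquiv.trans H.equiv.symm))).Hom
      (StableGraph.loop g₁ (⟨x, H.left⟩ : s₁) ⟨y, H.right⟩
        (fun e => H.ne (congrArg Subtype.val e)) h₁) where
  toPreHom := S.loopPreHom hxy d₁ H h₁
  connected w := (S.loopPreHomPart hxy d₁ H h₁ w).connected d₁
  hasGenus w := (S.loopPreHomPart hxy d₁ H h₁ w).hasGenus d₁
  leg_flag z := by
    refine Subtype.ext (Subtype.ext ?_)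
    refine Eq.trans ?_ (S.flag_preflag z.1.1 (d₁.vert_mem z.1.1 z.1.2))
    have e : ∀ t : G'.toFlagGraph.Legs, G'.leg.symm (G'.leg t) = t := G'.leg.symm_apply_apply
    refine congrArg (fun t => ((H.equiv.symm (S.legsEquiv t)).1 : G.Flag)) (e _)

end FlagGraph.PartIso

theorem koszulSign_of_subsingleton {V V' : Type} {_ : Fintype V} [Subsingleton V]
    (o : LinearOrder V) (o' : LinearOrder V') (φ : V ≃ V') (p : V → ℤ) :
    koszulSign o o' φ p = 1 := by
  classical
  unfold koszulSign
  refine Finset.prod_eq_one fun u _ => Finset.prod_eq_one fun v _ => if_neg ?_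
  rintro ⟨h, -⟩
  exact lt_irrefl u (Subsingleton.elim v u ▸ h)

/-- A stable graph with one vertex and no edges is isomorphic to a corolla. -/
def StableGraph.corollaIso {g : ℕ} {I : Type} [Finite I] (G : StableGraph g I)
    (h : 2 < 2 * g + Nat.card I) (w : G.Vert) (hw : ∀ v, v = w) (hinv : ∀ x, G.inv x = x)
    (hg : g = G.genus w) : (StableGraph.corolla g I h).Iso G (Equiv.refl I) where
  flag := G.leg.symm.trans (Equiv.subtypeUnivEquiv hinv)
  vert := ⟨fun _ => w, fun _ => (), fun _ => rfl, fun v => (hw v).symm⟩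
  vert_flag _ := hw _
  inv_flag _ := hinv _
  genus_vert _ := hg
  leg_flag x := G.leg.apply_symm_apply x.1

/-! ### Soundness of values in a modular operad -/

section Soundness

variable {k : Type u} [Field k] {A : StableSModule.{u, v} k} {C : StableGradedCyclicOperad A}
  {X : Contractions A} {M : ModularOperad A} {G : FlagGraph} {o : LinearOrder G.Vert}
  {p : G.Vert → ℤ} {a : ∀ v, A.onSet (G.genus v) (G.Leg v)}

/-- The values obtained by composing along one edge after the other are the values of the
compositions of every modular operad that induces the given operations. -/
theorem IsVal.comp_eq (hM : M.Induces C X) (hG : ∀ v, 2 < 2 * G.genus v + Nat.card (G.Leg v))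
    (ha : ∀ v, a v ∈ A.onSetDeg (G.genus v) (G.Leg v) (p v)) {c s g r}
    (d : IsVal C X G o p a c s g r) :
    ∀ {I : Type} (G' : StableGraph g I) (S : G'.toFlagGraph.PartIso G c s)
      (o' : LinearOrder G'.Vert), (∀ u v, o'.lt u v → o.lt (S.vert u) (S.vert v)) →
      M.comp G' o' (S.decoration a) = A.relabel rfl (S.legsEquiv.symm.trans G'.leg) r := by
  induction d with
  | @vertex c s g r v hc hg hs hr =>
    intro I G' S o' ho
    have hcm : ∀ u, u ∈ c ↔ u = v := fun u => by rw [hc, Finset.mem_singleton]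
    clear hc
    obtain ⟨w, rfl⟩ := S.exists_vert v ((hcm v).2 rfl)
    subst hr
    have hw : ∀ v, v = w := fun v => S.vert_injective ((hcm _).1 (S.vert_mem v))
    have hinv : ∀ x, G'.inv x = x := fun x => (S.inv_eq_iff x).2
      (hs.mapsTo ((S.vert_flag x).trans (congrArg S.vert (hw _))))
    have : Finite I := Finite.of_equiv _ G'.leg
    have hI : 2 < 2 * g + Nat.card I := by
      have h := G'.stable w
      rw [S.genus_vert, hg] at h
      rwa [← Nat.card_congr ((Equiv.subtypeUnivEquiv hinv).symm.trans G'.leg),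
        ← Nat.card_congr (Equiv.subtypeUnivEquiv (p := fun x => G'.vert x = w) fun x => hw _)]
    have hg' : g = G'.genus w := by rw [S.genus_vert, hg]
    let r' : A.onSet g I :=
      A.relabel rfl (S.legsEquiv.symm.trans G'.leg) (A.push hg id hs (a (S.vert w)))
    have hr' : r' ∈ A.onSetDeg g I (p (S.vert w)) := A.relabel_mem _ _ (A.push_mem _ _ (ha _))
    let oU : LinearOrder (StableGraph.corolla g I hI).Vert := inferInstanceAs (LinearOrder Unit)
    -- A part with one vertex and no contracted edge is a corolla up to isomorphism, so naturality
    -- reduces the claim to the unit axiom.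
    have key := M.comp_iso (G'.corollaIso hI w hw hinv hg') oU o' (fun _ => p (S.vert w))
      (corollaDecoration A hI r') (S.decoration a)
      (fun u => A.relabel_mem (J := (StableGraph.corolla g I hI).toFlagGraph.Leg u) rfl _ hr')
      (fun u => by
        refine Eq.trans ?_ (A.relabel_relabel _ _ _ _ _).symm
        refine Eq.trans ?_ (A.relabel_relabel _ _ _ _ _).symm
        refine Eq.trans ?_ (A.relabel_relabel _ _ _ _ _).symm
        change A.relabel _ _ (a (S.vert w)) = _
        congr 2
        ext x
        refine S.flag_injective ?_
        refine (S.flag_legEquiv_symm w x).trans ?_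
        have e : ∀ t : G'.toFlagGraph.Legs, G'.leg.symm (G'.leg t) = t := G'.leg.symm_apply_apply
        refine Eq.trans ?_ (congrArg (fun t => S.flag (Subtype.val t)) (e _)).symm
        exact (S.flag_legsEquiv_symm ⟨x.1, _⟩).symm)
    refine key.trans ?_
    refine (congrArg (· • _) (koszulSign_of_subsingleton (V := Unit) _ _ _ _)).trans ?_
    refine (one_smul _ _).trans ((A.relabel_refl _).trans ?_)
    exact M.comp_unit g I hI oU r'
  | @glue c c₁ c₂ s s₁ s₂ g g₁ g₂ r r₁ r₂ x y hxy d₁ d₂ hd hc hg H hr ih₁ ih₂ =>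
    intro I G' S o' ho
    have h₁ := d₁.two_lt hG
    have h₂ := d₂.two_lt hG
    rw [← Nat.card_coe_set_eq] at h₁ h₂
    let f := S.treeHom hxy d₁ d₂ hd hc hg H h₁ h₂
    let fv : G'.Vert → Bool := f.vert
    let oB : LinearOrder (StableGraph.tree g₁ g₂ g hg (⟨x, H.left⟩ : s₁) (⟨y, H.right⟩ : s₂) h₁ h₂
      (H.equiv.trans (S.legsEquiv.symm.trans G'.leg))).Vert := inferInstanceAs (LinearOrder Bool)
    -- The associativity axiom needs an order in which the first part precedes the second. Passing
    -- to it from `o'` costs a Koszul sign, which is the sign contained in the gluing step.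
    have hsign : koszulSign (lexOrder o' fv) o' (Equiv.refl G'.Vert) (fun u => p (S.vert u)) =
        crossSign o p c₁ c₂ := by
      refine koszulSign_lexOrder o' o fv S.vert S.vert_injective ho p c₁ c₂ (fun v => ?_)
        (fun v => ?_)
      · constructor
        · intro hv
          obtain ⟨u, rfl⟩ := S.exists_vert v ((FlagGraph.PartIso.mem_iff_of_disjUnion hc v).2
            (Or.inl hv))
          exact ⟨u, decide_eq_false (Finset.disjoint_left.1 hd hv), rfl⟩
        · rintro ⟨u, hu, rfl⟩
          exact ((FlagGraph.PartIso.mem_iff_of_disjUnion hc _).1 (S.vert_mem u)).resolve_right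
            (of_decide_eq_false hu)
      · constructor
        · intro hv
          obtain ⟨u, rfl⟩ := S.exists_vert v ((FlagGraph.PartIso.mem_iff_of_disjUnion hc v).2
            (Or.inr hv))
          exact ⟨u, decide_eq_true hv, rfl⟩
        · rintro ⟨u, hu, rfl⟩
          exact of_decide_eq_true hu
    have hlt : ∀ u v, fv u = fv v → (lexOrder o' fv).lt u v → o.lt (S.vert u) (S.vert v) := by
      intro u v huv h
      rcases (lexOrder_lt_iff o' fv u v).1 h with h | h
      · exact absurd h (huv ▸ lt_irrefl _)
      · exact ho u v h.2
    rw [M.comp_order G' (lexOrder o' fv) o' (S.decoration_mem ha), hsign, hr,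
      LinearMap.map_intUnits_smul]
    refine congrArg _ ?_
    refine (M.comp_assoc f (lexOrder o' fv) oB (lexOrder_le o' fv) (S.decoration a)).symm.trans ?_
    refine Eq.trans (congrArg _ ?_) (hM.comp_tree hg H h₁ h₂ (S.legsEquiv.symm.trans G'.leg)
      (H.equiv.trans (S.legsEquiv.symm.trans G'.leg))
      (fun z w hw => congrArg (S.legsEquiv.symm.trans G'.leg) (Subtype.ext hw.symm))
      (d₁.mem_deg ha) (d₂.mem_deg ha))
    funext w
    match w with
    | false =>
      have key := ih₁ (f.fiber false) (S.treePreHomFst hxy d₁ d₂ hd hc hg H h₁ h₂)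
        (@LinearOrder.lift' (f.fiber false).Vert G'.Vert (lexOrder o' fv) (fun u => u.1)
          Subtype.val_injective)
        (fun u v h => hlt u.1 v.1 (u.2.trans v.2.symm) h)
      refine Eq.trans (congrArg _ ?_) (key.trans ?_)
      · funext u
        exact (S.decoration_preimage _ _ _ _ _ _ a u).symm
      · refine congrArg (fun e => A.relabel rfl e r₁) (Equiv.ext fun z => Subtype.ext ?_)
        refine f.flag_injective ((f.toPreHom.flag_preimageLegs false _).trans ?_)
        refine S.flag_injective ?_
        refine ((S.treePreHomFst hxy d₁ d₂ hd hc hg H h₁ h₂).flag_legsEquiv_symm z).trans ?_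
        exact (S.flag_preflag _
          (FlagGraph.PartIso.mem_of_sum d₁ d₂ hd hc (Sum.inl z))).symm
    | true =>
      have key := ih₂ (f.fiber true) (S.treePreHomSnd hxy d₁ d₂ hd hc hg H h₁ h₂)
        (@LinearOrder.lift' (f.fiber true).Vert G'.Vert (lexOrder o' fv) (fun u => u.1)
          Subtype.val_injective)
        (fun u v h => hlt u.1 v.1 (u.2.trans v.2.symm) h)
      refine Eq.trans (congrArg _ ?_) (key.trans ?_)
      · funext u
        exact (S.decoration_preimage _ _ _ _ _ _ a u).symm
      · refine congrArg (fun e => A.relabel rfl e r₂) (Equiv.ext fun z => Subtype.ext ?_)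
        refine f.flag_injective ((f.toPreHom.flag_preimageLegs true _).trans ?_)
        refine S.flag_injective ?_
        refine ((S.treePreHomSnd hxy d₁ d₂ hd hc hg H h₁ h₂).flag_legsEquiv_symm z).trans ?_
        exact (S.flag_preflag _
          (FlagGraph.PartIso.mem_of_sum d₁ d₂ hd hc (Sum.inr z))).symm
  | @loop c s s₁ g g₁ r r₁ x y hxy d₁ hg H hr ih =>
    intro I G' S o' ho
    subst hg
    have h₁ := d₁.two_lt hG
    rw [← Nat.card_coe_set_eq] at h₁
    let f := S.loopHom hxy d₁ H h₁
    let τ := G'.leg.symm.trans (S.legsEquiv.trans H.equiv.symm)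
    let oU : LinearOrder (StableGraph.loop g₁ (⟨x, H.left⟩ : s₁) ⟨y, H.right⟩
        (fun e => H.ne (congrArg Subtype.val e)) h₁).Vert := inferInstanceAs (LinearOrder Unit)
    -- The legs of the graph with one loop are indexed by a subtype of `s₁`; both sides are compared
    -- after relabelling the legs of `G'` accordingly. No sign arises, since any order is monotone
    -- over a single vertex.
    refine A.relabel_injective rfl τ ?_
    have e := M.comp_relabelLegs G' τ o' o' (S.decoration_mem ha)
    rw [koszulSign_refl, one_smul] at e
    rw [← e, hr]
    refine (M.comp_assoc f o' oU (fun _ _ _ => le_rfl) (S.decoration a)).symm.trans ?_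
    refine Eq.trans (congrArg _ (funext fun w => ?_)) ((hM.xi (⟨x, H.left⟩ : s₁) ⟨y, H.right⟩
        (fun e => H.ne (congrArg Subtype.val e)) h₁ r₁).trans ?_)
    · have key := ih (f.fiber w) (S.loopPreHomPart hxy d₁ H h₁ w)
        (LinearOrder.lift' (fun u : {u : G'.Vert // f.vert u = w} => u.1) Subtype.val_injective)
        (fun u v h => ho u.1 v.1 h)
      refine Eq.trans (congrArg _ ?_) (key.trans ?_)
      · funext u
        exact (S.decoration_preimage _ _ _ _ _ _ a u).symm
      · refine congrArg (fun e => A.relabel rfl e r₁) (Equiv.ext fun z => Subtype.ext ?_)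
        refine f.flag_injective ((f.toPreHom.flag_preimageLegs w _).trans ?_)
        refine S.flag_injective ?_
        refine ((S.loopPreHomPart hxy d₁ H h₁ w).flag_legsEquiv_symm z).trans ?_
        exact (S.flag_preflag _ (d₁.vert_mem z.1 z.2)).symm
    · refine Eq.trans ?_ (A.relabel_relabel _ _ _ _ _).symm
      refine Eq.trans ?_ (A.relabel_relabel rfl rfl H.equiv _ _).symm
      refine (A.relabel_refl _).symm.trans ?_
      congr 2
      refine Equiv.ext fun z => ?_
      exact ((congrArg H.equiv.symm ((congrArg S.legsEquiv (G'.leg.symm_apply_apply _)).trans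
        (S.legsEquiv.apply_symm_apply _))).trans (H.equiv.symm_apply_apply z)).symm

end Soundness

/-! ### Uniqueness of the modular operad -/

/-- A graph as a part of itself. -/
def FlagGraph.partIsoRefl (G : FlagGraph) :
    G.PartIso G Finset.univ {x | G.inv x = x} where
  flag := id
  vert := id
  flag_injective := Function.injective_id
  vert_injective := Function.injective_id
  vert_flag _ := rfl
  vert_mem _ := Finset.mem_univ _
  exists_vert v _ := ⟨v, rfl⟩
  exists_flag x _ := ⟨x, rfl⟩
  inv_flag _ _ := rfl
  inv_eq_iff _ := Iff.rfl
  genus_vert _ := rfl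
  subset _ _ := Finset.mem_univ _

section Determined

variable {k : Type u} [Field k] {A : StableSModule.{u, v} k} {C : StableGradedCyclicOperad A}
  {X : Contractions A} {M M' : ModularOperad A}

theorem FlagGraph.decoration_partIsoRefl (G : FlagGraph) (a : ∀ v, A.onSet (G.genus v) (G.Leg v)) :
    G.partIsoRefl.decoration a = a := by
  funext v
  refine Eq.trans ?_ (A.relabel_refl _)
  unfold FlagGraph.PartIso.decoration
  congr 2
  ext x
  exact G.partIsoRefl.flag_legEquiv_symm v x

/-- If `C` and `X` are induced by a modular operad, then the composites along a graph do not depend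
on the order in which the edges are contracted. -/
theorem IsVal.unique_of_induces (hM : M.Induces C X) {G : FlagGraph} {o : LinearOrder G.Vert}
    {p : G.Vert → ℤ} {a : ∀ v, A.onSet (G.genus v) (G.Leg v)}
    (hG : ∀ v, 2 < 2 * G.genus v + Nat.card (G.Leg v))
    (ha : ∀ v, a v ∈ A.onSetDeg (G.genus v) (G.Leg v) (p v)) {s : Set G.Flag}
    (hs : ∀ x, x ∈ s ↔ G.inv x = x) {g : ℕ} {r r' : A.onSet g s}
    (d : IsVal C X G o p a Finset.univ s g r) (d' : IsVal C X G o p a Finset.univ s g r') :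
    r = r' := by
  obtain rfl : s = {x | G.inv x = x} := Set.ext hs
  let S := G.partIsoRefl
  let G' : StableGraph g G.Legs :=
    { G with
      leg := Equiv.refl _
      connected := S.connected d
      hasGenus := S.hasGenus d
      stable := hG }
  have h := d.comp_eq hM hG ha G' S o fun _ _ h => h
  exact A.relabel_injective _ _ (h.symm.trans (d'.comp_eq hM hG ha G' S o fun _ _ h => h))

/-- The graph is a part of itself and has some stepwise value; both modular operads must return it.
-/
theorem ModularOperad.Induces.comp_eq (hM : M.Induces C X) (hM' : M'.Induces C X) {γ : ℕ} {I : Type}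
    (G : StableGraph γ I) (o : LinearOrder G.Vert) : M.comp G o = M'.comp G o := by
  classical
  ext a
  refine eq_of_eq_on_homogeneous (f := fun a => M.comp G o a) (f' := fun a => M'.comp G o a)
    (fun v : G.Vert => A.isInternal_onSetDeg (G.genus v) (G.toFlagGraph.Leg v))
    (fun a v x y => (M.comp G o).map_update_add a v x y)
    (fun a v x y => (M'.comp G o).map_update_add a v x y) (fun p a ha => ?_) a
  obtain ⟨r, d⟩ := G.exists_isVal C X o p a
  have h := d.comp_eq hM G.stable ha G G.partIsoRefl o fun _ _ h => h
  have h' := d.comp_eq hM' G.stable ha G G.partIsoRefl o fun _ _ h => h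
  rw [G.decoration_partIsoRefl] at h h'
  exact h.trans h'.symm

/-- A modular operad is determined by its compositions along graphs with one edge. -/
theorem ModularOperad.Induces.unique (hM : M.Induces C X) (hM' : M'.Induces C X) : M = M' := by
  have h : @M.comp = @M'.comp := by
    funext γ I G o
    exact hM.comp_eq hM' G o
  cases M
  cases M'
  cases h
  rfl

end Determined

/-! ### Necessity of the relations -/

open Classical in
/-- A graph with two edges, one joining `x` to `y` and the other one joining `z` to `w`. -/
def FlagGraph.twoEdges {F V : Type} [Finite F] [Finite V] (vert : F → V) (genus : V → ℕ)
    {x y z w : F} (hxz : x ≠ z) (hxw : x ≠ w) (hyz : y ≠ z) (hyw : y ≠ w) : FlagGraph where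
  Flag := F
  Vert := V
  vert := vert
  inv f := Equiv.swap x y (Equiv.swap z w f)
  inv_inv f := by
    simp only [Equiv.swap_apply_def]
    split_ifs <;> simp_all
  genus := genus

section TwoEdges

variable {F V : Type} [Finite F] [Finite V] {vert : F → V} {genus : V → ℕ}
  {x y z w : F} (hxz : x ≠ z) (hxw : x ≠ w) (hyz : y ≠ z) (hyw : y ≠ w)

theorem FlagGraph.twoEdges_inv_fst :
    (FlagGraph.twoEdges vert genus hxz hxw hyz hyw).inv x = y := by
  classical
  change Equiv.swap x y (Equiv.swap z w x) = y
  rw [Equiv.swap_apply_of_ne_of_ne hxz hxw, Equiv.swap_apply_left]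

theorem FlagGraph.twoEdges_inv_snd :
    (FlagGraph.twoEdges vert genus hxz hxw hyz hyw).inv z = w := by
  classical
  change Equiv.swap x y (Equiv.swap z w z) = w
  rw [Equiv.swap_apply_left, Equiv.swap_apply_of_ne_of_ne hxw.symm hyw.symm]

theorem FlagGraph.twoEdges_inv_eq_iff (hxy : x ≠ y) (hzw : z ≠ w) (f : F) :
    (FlagGraph.twoEdges vert genus hxz hxw hyz hyw).inv f = f ↔
      (f ≠ x ∧ f ≠ y) ∧ f ≠ z ∧ f ≠ w := by
  classical
  change Equiv.swap x y (Equiv.swap z w f) = f ↔ _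
  simp only [Equiv.swap_apply_def]
  split_ifs <;> simp_all [eq_comm]

end TwoEdges

theorem crossSign_false_true (p : Bool → ℤ) :
    crossSign (inferInstance : LinearOrder Bool) p {false} {true} = 1 := by
  unfold crossSign
  rw [Finset.prod_singleton, Finset.prod_singleton, if_neg]
  exact not_lt_of_ge (Bool.false_le _)

section Necessity

variable {k : Type u} [Field k] {A : StableSModule.{u, v} k} {C : StableGradedCyclicOperad A}
  {X : Contractions A} {M : ModularOperad A}

/-- Bilinear maps are equal if they agree on homogeneous elements of components that can be
attached to the vertices of stable graphs. -/
theorem StableSModule.bilinear_ext {g h γ : ℕ} {I J K : Type} [Finite I] [Finite J]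
    {f f' : A.onSet g I →ₗ[k] A.onSet h J →ₗ[k] A.onSet γ K}
    (H : 2 < 2 * g + Nat.card I → 2 < 2 * h + Nat.card J → ∀ p q, ∀ a ∈ A.onSetDeg g I p,
      ∀ b ∈ A.onSetDeg h J q, f a b = f' a b) (a : A.onSet g I) (b : A.onSet h J) :
    f a b = f' a b := by
  by_cases hI : 2 < 2 * g + Nat.card I
  · by_cases hJ : 2 < 2 * h + Nat.card J
    · refine (A.isInternal_onSetDeg g I).induction_on (P := fun a => f a b = f' a b)
        (fun p a ha => ?_) (fun a a' e e' => ?_) a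
      · refine (A.isInternal_onSetDeg h J).induction_on (P := fun b => f a b = f' a b)
          (fun q b hb => H hI hJ p q a ha b hb) (fun b b' e e' => ?_) b
        rw [map_add, map_add, e, e']
      · rw [map_add, map_add, LinearMap.add_apply, LinearMap.add_apply, e, e']
    · have := A.onSet_subsingleton h J (not_lt.1 hJ)
      rw [Subsingleton.elim b 0, map_zero, map_zero]
  · have := A.onSet_subsingleton g I (not_lt.1 hI)
    rw [Subsingleton.elim a 0, map_zero, map_zero]

section TwoVertices

variable {F : Type} {vert : F → Bool} {g h γ : ℕ} {s s' t : Set F} {x y z w : F}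

theorem GlueData.ne (H : GlueData {f | vert f = false} {f | vert f = true} s x y) : x ≠ y :=
  H.ne_of_mem H.left H.right

theorem GlueData.mem_iff_ne (H : GlueData {f | vert f = false} {f | vert f = true} s x y) (f : F) :
    f ∈ s ↔ f ≠ x ∧ f ≠ y := by
  have hx : vert x = false := H.left
  have hy : vert y = true := H.right
  rw [H.mem_iff]
  cases hf : vert f
  · have : f ≠ y := by rintro rfl; simp [hf] at hy
    simp [hf, this]
  · have : f ≠ x := by rintro rfl; simp [hf] at hx
    simp [hf, this]

/-- The decoration of a graph with two vertices. -/
def boolDecoration (a : A.onSet g {f | vert f = false}) (b : A.onSet h {f | vert f = true})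
    (v : Bool) : A.onSet (Bool.rec g h v) {f | vert f = v} :=
  match v with
  | false => a
  | true => b

variable [Finite F]

variable (g h) in
/-- The graph with two vertices and two edges, one of them joining the two vertices. -/
def boolGraph (H : GlueData {f | vert f = false} {f | vert f = true} s x y)
    (H' : LoopData s t z w) : FlagGraph :=
  FlagGraph.twoEdges vert (fun v => Bool.rec g h v)
    (Ne.symm ((H.mem_iff_ne z).1 H'.left).1) (Ne.symm ((H.mem_iff_ne w).1 H'.right).1)
    (Ne.symm ((H.mem_iff_ne z).1 H'.left).2) (Ne.symm ((H.mem_iff_ne w).1 H'.right).2)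

variable {H : GlueData {f | vert f = false} {f | vert f = true} s x y} {H' : LoopData s t z w}

variable (g h H H') in
/-- The order of the vertices. -/
abbrev boolGraphOrder : LinearOrder (boolGraph g h H H').Vert := inferInstanceAs (LinearOrder Bool)

variable {p : Bool → ℤ} {a : A.onSet g {f | vert f = false}} {b : A.onSet h {f | vert f = true}}

variable (C X p a b H H') in
theorem isVal_fst : IsVal C X (boolGraph g h H H') (boolGraphOrder g h H H') p (boolDecoration a b)
    {false} {f | vert f = false} g a :=
  .vertex (G := boolGraph g h H H') false rfl rfl
    (Set.bijOn_id _) (A.push_id _ (fun _ _ => rfl) _).symm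

variable (C X p a b H H') in
theorem isVal_snd : IsVal C X (boolGraph g h H H') (boolGraphOrder g h H H') p (boolDecoration a b)
    {true} {f | vert f = true} h b :=
  .vertex (G := boolGraph g h H H') true rfl rfl
    (Set.bijOn_id _) (A.push_id _ (fun _ _ => rfl) _).symm

theorem IsVal.bool_glue {g' h' γ : ℕ} (hγ : g' + h' = γ) {s₁ s₂ s' : Set F} {u v : F}
    (K : GlueData s₁ s₂ s' u v) (huv : (boolGraph g h H H').inv u = v) {r₁ r₂}
    (d₁ : IsVal C X (boolGraph g h H H') (boolGraphOrder g h H H') p (boolDecoration a b)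
      {false} s₁ g' r₁)
    (d₂ : IsVal C X (boolGraph g h H H') (boolGraphOrder g h H H') p (boolDecoration a b)
      {true} s₂ h' r₂) :
    IsVal C X (boolGraph g h H H') (boolGraphOrder g h H H') p (boolDecoration a b)
      Finset.univ s' γ (C.glue hγ K r₁ r₂) := by
  have hd : Disjoint ({false} : Finset Bool) {true} := by decide
  refine .glue u v huv d₁ d₂ hd (Finset.ext fun v => ?_) hγ K ?_
  · refine iff_of_true (Finset.mem_univ v) ((Finset.mem_disjUnion (h := hd)).2 ?_)
    cases (v : Bool)
    exacts [Or.inl (Finset.mem_singleton_self _), Or.inr (Finset.mem_singleton_self _)]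
  · have e : crossSign (boolGraphOrder g h H H') p {false} {true} = 1 :=
      crossSign_false_true p
    exact ((congrArg (· • _) e).trans (one_smul _ _)).symm

/-- Both sides are stepwise values of one graph with all its edges contracted, so they agree by
`IsVal.unique_of_induces`. Homogeneous elements of stable components suffice by bilinearity. -/
theorem ModularOperad.Induces.bilinear_eq (hM : M.Induces C X)
    {f f' : A.onSet g {f | vert f = false} →ₗ[k] A.onSet h {f | vert f = true} →ₗ[k] A.onSet γ t}
    (d : ∀ p a b, IsVal C X (boolGraph g h H H') (boolGraphOrder g h H H') p (boolDecoration a b)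
      Finset.univ t γ (f a b))
    (d' : ∀ p a b, IsVal C X (boolGraph g h H H') (boolGraphOrder g h H H') p (boolDecoration a b)
      Finset.univ t γ (f' a b))
    (a : A.onSet g {f | vert f = false}) (b : A.onSet h {f | vert f = true}) :
    f a b = f' a b := by
  refine A.bilinear_ext (fun hg hh p q a ha b hb => ?_) a b
  refine IsVal.unique_of_induces hM (G := boolGraph g h H H') ?_ ?_ ?_
    (d (fun v => Bool.rec p q v) a b) (d' (fun v => Bool.rec p q v) a b)
  · rintro (_ | _)
    exacts [hg, hh]
  · rintro (_ | _)
    exacts [ha, hb]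
  · intro f
    refine ((H'.mem_iff f).trans (and_congr_left' (H.mem_iff_ne f))).trans ?_
    exact (FlagGraph.twoEdges_inv_eq_iff _ _ _ _ H.ne H'.ne f).symm

theorem boolGraph_inv_fst : (boolGraph g h H H').inv x = y := FlagGraph.twoEdges_inv_fst _ _ _ _

theorem boolGraph_inv_snd : (boolGraph g h H H').inv z = w := FlagGraph.twoEdges_inv_snd _ _ _ _

variable (H H') in
-- The edge `xy` joins the two vertices and `zw` is a loop at the first one; the two sides contract
-- these edges in the two possible orders.
theorem ModularOperad.Induces.loop_glue_left (hM : M.Induces C X) (hγ : g + h = γ)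
    (hγ' : g + 1 + h = γ + 1) {s₁' : Set F} (H₁ : LoopData {f | vert f = false} s₁' z w)
    (H₁' : GlueData s₁' {f | vert f = true} t x y)
    (a : A.onSet g {f | vert f = false}) (b : A.onSet h {f | vert f = true}) :
    X.loop rfl H' (C.glue hγ H a b) = C.glue hγ' H₁' (X.loop rfl H₁ a) b :=
  hM.bilinear_eq (H := H) (H' := H') (f := (C.glue hγ H).compr₂ (X.loop rfl H'))
    (f' := C.glue hγ' H₁' ∘ₗ X.loop rfl H₁)
    (fun p a b => .loop z w boolGraph_inv_snd (.bool_glue hγ H boolGraph_inv_fst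
      (isVal_fst C X H H' p a b) (isVal_snd C X H H' p a b)) rfl H' rfl)
    (fun p a b => .bool_glue hγ' H₁' boolGraph_inv_fst
      (.loop z w boolGraph_inv_snd (isVal_fst C X H H' p a b) rfl H₁ rfl)
      (isVal_snd C X H H' p a b)) a b

variable (H H') in
theorem ModularOperad.Induces.loop_glue_right (hM : M.Induces C X) (hγ : g + h = γ)
    (hγ' : g + (h + 1) = γ + 1) {s₂' : Set F} (H₂ : LoopData {f | vert f = true} s₂' z w)
    (H₂' : GlueData {f | vert f = false} s₂' t x y)
    (a : A.onSet g {f | vert f = false}) (b : A.onSet h {f | vert f = true}) :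
    X.loop rfl H' (C.glue hγ H a b) = C.glue hγ' H₂' a (X.loop rfl H₂ b) :=
  hM.bilinear_eq (H := H) (H' := H') (f := (C.glue hγ H).compr₂ (X.loop rfl H'))
    (f' := (C.glue hγ' H₂').compl₂ (X.loop rfl H₂))
    (fun p a b => .loop z w boolGraph_inv_snd (.bool_glue hγ H boolGraph_inv_fst
      (isVal_fst C X H H' p a b) (isVal_snd C X H H' p a b)) rfl H' rfl)
    (fun p a b => .bool_glue hγ' H₂' boolGraph_inv_fst (isVal_fst C X H H' p a b)
      (.loop z w boolGraph_inv_snd (isVal_snd C X H H' p a b) rfl H₂ rfl)) a b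

variable (H H') in
-- Here both edges join the two vertices: whichever is contracted first is a gluing, and the other
-- one has become a loop.
theorem ModularOperad.Induces.loop_glue_cross (hM : M.Induces C X) (hγ : g + h = γ)
    (K : GlueData {f | vert f = false} {f | vert f = true} s' z w) (K' : LoopData s' t x y)
    (a : A.onSet g {f | vert f = false}) (b : A.onSet h {f | vert f = true}) :
    X.loop rfl H' (C.glue hγ H a b) = X.loop rfl K' (C.glue hγ K a b) :=
  hM.bilinear_eq (H := H) (H' := H') (f := (C.glue hγ H).compr₂ (X.loop rfl H'))
    (f' := (C.glue hγ K).compr₂ (X.loop rfl K'))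
    (fun p a b => .loop z w boolGraph_inv_snd (.bool_glue hγ H boolGraph_inv_fst
      (isVal_fst C X H H' p a b) (isVal_snd C X H H' p a b)) rfl H' rfl)
    (fun p a b => .loop x y boolGraph_inv_fst (.bool_glue hγ K boolGraph_inv_snd
      (isVal_fst C X H H' p a b) (isVal_snd C X H H' p a b)) rfl K' rfl) a b

end TwoVertices

/-! ### Graphs with two edges and numbered flags -/

section Numbered

theorem GlueData.ne_of_loop {F : Type} {s₁ s₂ s s₁' t : Set F} {x y z w : F}
    (H : GlueData s₁ s₂ s x y) (H' : LoopData s t z w) (H₁ : LoopData s₁ s₁' z w) :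
    GlueData s₁' s₂ t x y := by
  have hz := (H.mem_iff z).1 H'.left
  have hw := (H.mem_iff w).1 H'.right
  have hz₂ := fun h => H.ne_of_mem H₁.left (w := z) h rfl
  have hw₂ := fun h => H.ne_of_mem H₁.right (w := w) h rfl
  refine ⟨(H₁.mem_iff x).2 ⟨H.left, ?_, ?_⟩, H.right,
    H.disj.mono_left fun f hf => ((H₁.mem_iff f).1 hf).1, Set.ext fun f => ?_⟩
  · rintro rfl
    exact hz.elim (fun h => h.2 rfl) fun h => hz₂ h.1
  · rintro rfl
    exact hw.elim (fun h => h.2 rfl) fun h => hw₂ h.1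
  · have h₁ : f ∈ s₂ → f ≠ z ∧ f ≠ w :=
      fun h => ⟨(H.ne_of_mem H₁.left h).symm, (H.ne_of_mem H₁.right h).symm⟩
    rw [H'.mem_iff, H.mem_iff, Set.mem_union, Set.mem_sdiff, Set.mem_sdiff, H₁.mem_iff,
      Set.mem_singleton_iff, Set.mem_singleton_iff]
    tauto

theorem LoopData.of_mem {F : Type} {s : Set F} {z w : F} (hz : z ∈ s) (hw : w ∈ s) (hzw : z ≠ w) :
    LoopData s {f | f ∈ s ∧ f ≠ z ∧ f ≠ w} z w :=
  ⟨hz, hw, hzw, fun _ => Iff.rfl⟩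

variable {I J : Type}

theorem glueData_sum (x : I) (y : J) :
    GlueData {f : I ⊕ J | Sum.elim (fun _ => false) (fun _ => true) f = false}
      {f | Sum.elim (fun _ => false) (fun _ => true) f = true}
      {f | f ≠ Sum.inl x ∧ f ≠ Sum.inr y} (Sum.inl x) (Sum.inr y) where
  left := rfl
  right := rfl
  disj := Set.disjoint_left.2 fun f h h' => by simp_all
  eq := by ext (f | f) <;> simp

theorem loopData_sum_left (x : I) (y : J) {z w : I} (hz : z ≠ x) (hw : w ≠ x) (hzw : z ≠ w) :
    LoopData {f : I ⊕ J | f ≠ Sum.inl x ∧ f ≠ Sum.inr y}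
      {f | (f ≠ Sum.inl x ∧ f ≠ Sum.inr y) ∧ f ≠ Sum.inl z ∧ f ≠ Sum.inl w}
      (Sum.inl z) (Sum.inl w) :=
  .of_mem ⟨Sum.inl_injective.ne hz, Sum.inl_ne_inr⟩ ⟨Sum.inl_injective.ne hw, Sum.inl_ne_inr⟩
    (Sum.inl_injective.ne hzw)

theorem loopData_sum_right (x : I) (y : J) {z w : J} (hz : z ≠ y) (hw : w ≠ y) (hzw : z ≠ w) :
    LoopData {f : I ⊕ J | f ≠ Sum.inl x ∧ f ≠ Sum.inr y}
      {f | (f ≠ Sum.inl x ∧ f ≠ Sum.inr y) ∧ f ≠ Sum.inr z ∧ f ≠ Sum.inr w}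
      (Sum.inr z) (Sum.inr w) :=
  .of_mem ⟨Sum.inr_ne_inl, Sum.inr_injective.ne hz⟩ ⟨Sum.inr_ne_inl, Sum.inr_injective.ne hw⟩
    (Sum.inr_injective.ne hzw)

theorem loopData_sum (x z : I) (y w : J) (hz : z ≠ x) (hw : w ≠ y) :
    LoopData {f : I ⊕ J | f ≠ Sum.inl x ∧ f ≠ Sum.inr y}
      {f | (f ≠ Sum.inl x ∧ f ≠ Sum.inr y) ∧ f ≠ Sum.inl z ∧ f ≠ Sum.inr w}
      (Sum.inl z) (Sum.inr w) :=
  .of_mem ⟨Sum.inl_injective.ne hz, Sum.inl_ne_inr⟩ ⟨Sum.inr_ne_inl, Sum.inr_injective.ne hw⟩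
    Sum.inl_ne_inr

theorem loopData_sum' (x z : I) (y w : J) (hz : z ≠ x) (hw : w ≠ y) :
    LoopData {f : I ⊕ J | f ≠ Sum.inl z ∧ f ≠ Sum.inr w}
      {f | (f ≠ Sum.inl x ∧ f ≠ Sum.inr y) ∧ f ≠ Sum.inl z ∧ f ≠ Sum.inr w}
      (Sum.inl x) (Sum.inr y) :=
  ⟨⟨Sum.inl_injective.ne hz.symm, Sum.inl_ne_inr⟩, ⟨Sum.inr_ne_inl, Sum.inr_injective.ne hw.symm⟩,
    Sum.inl_ne_inr, fun _ => and_comm⟩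

end Numbered

/-- The flags are the disjoint union of the two sets of numbers, and the edges are placed at the
labels occurring in the numbered relation, which is then the instance of `loop_glue_left_iff` or
`loop_glue_pair_iff` for these enumerations. -/
theorem ModularOperad.Induces.contractLeft (hM : M.Induces C X) : ContractLeft C X := by
  constructor
  · intro g h γ m n r hγ hγ' hr hr' hm a b
    have H := glueData_sum (⟨m + 2, by omega⟩ : Fin (m + 2 + 1)) (0 : Fin (n + 1))
    have H' := loopData_sum_left (⟨m + 2, by omega⟩ : Fin (m + 2 + 1)) (0 : Fin (n + 1))
      (z := ⟨1, by omega⟩) (w := ⟨2, by omega⟩) (by simp) (by simp; omega) (by simp)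
    have H₁ := LoopData.of_mem
      (s := {f : Fin (m + 2 + 1) ⊕ Fin (n + 1) | Sum.elim (fun _ => false) (fun _ => true) f = false})
      (z := Sum.inl ⟨1, by omega⟩) (w := Sum.inl ⟨2, by omega⟩) rfl rfl (by simp)
    exact (loop_glue_left_iff C X hγ hγ' H H' H₁ (H.ne_of_loop H' H₁) hr hr' hm bijOn_inl
      bijOn_inr rfl rfl rfl rfl a b).1 (hM.loop_glue_left H H' hγ hγ' H₁ _ _ _)
  · intro g h γ hγ hγ' a b
    have H := glueData_sum (2 : Fin 3) (0 : Fin 1)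
    have H' := loopData_sum_left (2 : Fin 3) (0 : Fin 1) (z := 0) (w := 1) (by simp) (by simp)
      (by simp)
    have H₁ := LoopData.of_mem
      (s := {f : Fin 3 ⊕ Fin 1 | Sum.elim (fun _ => false) (fun _ => true) f = false})
      (z := Sum.inl 0) (w := Sum.inl 1) rfl rfl (by simp)
    exact (loop_glue_pair_iff C X hγ hγ' H H' H₁ (H.ne_of_loop H' H₁) bijOn_inl bijOn_inr
      rfl rfl rfl rfl a b).1 (hM.loop_glue_left H H' hγ hγ' H₁ _ _ _)

theorem ModularOperad.Induces.contractRight (hM : M.Induces C X) : ContractRight C X := by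
  intro g h γ m n r hγ hγ' hr hr' hm a b
  have H := glueData_sum (⟨m, by omega⟩ : Fin (m + 1)) (0 : Fin (n + 2 + 1))
  have H' := loopData_sum_right (⟨m, by omega⟩ : Fin (m + 1)) (0 : Fin (n + 2 + 1))
    (z := ⟨1, by omega⟩) (w := ⟨2, by omega⟩) (by simp) (by simp [Fin.ext_iff]) (by simp)
  have H₂ := LoopData.of_mem
    (s := {f : Fin (m + 1) ⊕ Fin (n + 2 + 1) | Sum.elim (fun _ => false) (fun _ => true) f = true})
    (z := Sum.inr ⟨1, by omega⟩) (w := Sum.inr ⟨2, by omega⟩) rfl rfl (by simp)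
  have H₂' := (H.symm.ne_of_loop H' H₂).symm
  exact (loop_glue_right_iff C X hγ hγ' H H' H₂ H₂' hr hr' hm bijOn_inl
    bijOn_inr rfl rfl rfl rfl a b).1 (hM.loop_glue_right H H' hγ hγ' H₂ _ _ _)

theorem ModularOperad.Induces.contractBoth (hM : M.Induces C X) : ContractBoth C X := by
  constructor
  · intro g h γ m n hγ hs a b
    have H := glueData_sum (⟨m + 2, by omega⟩ : Fin (m + 2 + 1)) (0 : Fin (n + 1 + 1))
    have K := glueData_sum (⟨m + 1, by omega⟩ : Fin (m + 2 + 1)) (⟨1, by omega⟩ : Fin (n + 1 + 1))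
    have H' := loopData_sum (⟨m + 2, by omega⟩ : Fin (m + 2 + 1)) ⟨m + 1, by omega⟩
      (0 : Fin (n + 1 + 1)) ⟨1, by omega⟩ (by simp) (by simp)
    have K' := loopData_sum' (⟨m + 2, by omega⟩ : Fin (m + 2 + 1)) ⟨m + 1, by omega⟩
      (0 : Fin (n + 1 + 1)) ⟨1, by omega⟩ (by simp) (by simp)
    exact (loop_glue_cross_iff C X hγ H H' K K' hs bijOn_inl bijOn_inr rfl rfl rfl rfl a b).1
      (hM.loop_glue_cross H H' hγ K K' _ _)
  · intro g h γ hγ a b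
    have H := glueData_sum (1 : Fin 2) (0 : Fin 2)
    have K := glueData_sum (0 : Fin 2) (1 : Fin 2)
    have H' := loopData_sum (1 : Fin 2) 0 (0 : Fin 2) 1 (by simp) (by simp)
    have K' := loopData_sum' (1 : Fin 2) 0 (0 : Fin 2) 1 (by simp) (by simp)
    exact (loop_glue_cross_two_iff C X hγ H H' K K' bijOn_inl bijOn_inr rfl rfl rfl rfl a b).1
      (hM.loop_glue_cross H H' hγ K K' _ _)

/-- A graph with one vertex and two loops has two stepwise compositions, and they have the same
value. For an unstable component there is nothing to prove. -/
theorem ModularOperad.Induces.commute (hM : M.Induces C X) : X.Commute := by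
  intro g I _ i j k l hij hkl hik hil hjk hjl a
  by_cases hI : 2 < 2 * g + Nat.card I
  swap
  · have := A.onSet_subsingleton g I (not_lt.1 hI)
    rw [Subsingleton.elim a 0]
    simp only [map_zero]
  refine (A.isInternal_onSetDeg g I).induction_on (P := fun a =>
      A.relabel rfl (removeSwap hik hil hjk hjl)
      (X.xi (⟨i, hik, hil⟩ : {x : I // x ≠ k ∧ x ≠ l}) ⟨j, hjk, hjl⟩
        (fun h => hij (congrArg Subtype.val h)) (X.xi k l hkl a)) =
      X.xi (⟨k, hik.symm, hjk.symm⟩ : {x : I // x ≠ i ∧ x ≠ j}) ⟨l, hil.symm, hjl.symm⟩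
        (fun h => hkl (congrArg Subtype.val h)) (X.xi i j hij a)) (fun p a ha => ?_)
        (fun a a' e e' => ?_) a
  swap
  · simp only [map_add, e, e']
  let G := FlagGraph.twoEdges (fun _ : I => ()) (fun _ => g) hik hil hjk hjl
  let oU : LinearOrder G.Vert := (inferInstance : LinearOrder Unit)
  let τ : I ≃ ({f | G.vert f = ()} : Set I) := (Equiv.subtypeUnivEquiv fun _ => rfl).symm
  have d₀ : IsVal C X G oU (fun _ => p) (fun _ => A.relabel rfl τ a) Finset.univ
      {f | G.vert f = ()} g (A.relabel rfl τ a) :=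
    .vertex () (Finset.ext fun _ => iff_of_true (Finset.mem_univ _) (Finset.mem_singleton.2 rfl)) rfl
      (Set.bijOn_id _) (A.push_id _ (fun _ _ => rfl) _).symm
  let s : Set I := {f | f ≠ i ∧ f ≠ j}
  let s' : Set I := {f | f ≠ k ∧ f ≠ l}
  let t : Set I := {f | (f ≠ i ∧ f ≠ j) ∧ f ≠ k ∧ f ≠ l}
  have H₁ : LoopData {f : I | G.vert f = ()} s i j :=
    ⟨rfl, rfl, hij, fun z => (and_iff_right rfl).symm⟩
  have H₂ : LoopData s t k l := ⟨⟨hik.symm, hjk.symm⟩, ⟨hil.symm, hjl.symm⟩, hkl, fun z => Iff.rfl⟩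
  have K₁ : LoopData {f : I | G.vert f = ()} s' k l :=
    ⟨rfl, rfl, hkl, fun z => (and_iff_right rfl).symm⟩
  have K₂ : LoopData s' t i j := ⟨⟨hik, hil⟩, ⟨hjk, hjl⟩, hij, fun z => and_comm⟩
  have hi : G.inv i = j := FlagGraph.twoEdges_inv_fst _ _ _ _
  have hk : G.inv k = l := FlagGraph.twoEdges_inv_snd _ _ _ _
  have h := IsVal.unique_of_induces hM (G := G) (fun v => ?_) (fun v => ?_) (s := t) (fun f => ?_)
    (.loop (G := G) k l hk (.loop (G := G) i j hi d₀ rfl H₁ rfl) rfl H₂ rfl)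
    (.loop (G := G) i j hi (.loop (G := G) k l hk d₀ rfl K₁ rfl) rfl K₂ rfl)
  rotate_left
  · exact lt_of_lt_of_eq hI (congrArg (2 * g + ·) (Nat.card_congr τ))
  · exact A.relabel_mem _ _ ha
  · exact (FlagGraph.twoEdges_inv_eq_iff _ _ _ _ hij hkl f).symm
  -- Brings the labels left after both contractions from the form of an iterated subtype to that of
  -- a subset of `I`; with `removeSwap` it also serves the other order.
  let e : {x : {x : I // x ≠ i ∧ x ≠ j} //
      x ≠ ⟨k, hik.symm, hjk.symm⟩ ∧ x ≠ ⟨l, hil.symm, hjl.symm⟩} ≃ t :=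
    { toFun x := ⟨x.1.1, x.1.2, fun e => x.2.1 (Subtype.ext e), fun e => x.2.2 (Subtype.ext e)⟩
      invFun x := ⟨⟨x.1, x.2.1⟩, fun e => x.2.2.1 (congrArg Subtype.val e),
        fun e => x.2.2.2 (congrArg Subtype.val e)⟩
      left_inv _ := rfl
      right_inv _ := rfl }
  have h₁ := (congrArg (X.loop rfl H₂) (X.loop_relabel rfl H₁ τ i j hij rfl rfl (Equiv.refl s)
    (fun _ => rfl) a)).trans (X.loop_relabel rfl H₂ (Equiv.refl s) ⟨k, hik.symm, hjk.symm⟩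
      ⟨l, hil.symm, hjl.symm⟩ (fun h => hkl (congrArg Subtype.val h)) rfl rfl e (fun _ => rfl) _)
  have h₂ := (congrArg (X.loop rfl K₂) (X.loop_relabel rfl K₁ τ k l hkl rfl rfl (Equiv.refl s')
    (fun _ => rfl) a)).trans (X.loop_relabel rfl K₂ (Equiv.refl s') ⟨i, hik, hil⟩
      ⟨j, hjk, hjl⟩ (fun h => hij (congrArg Subtype.val h)) rfl rfl
      ((removeSwap hik hil hjk hjl).trans e) (fun _ => rfl) _)
  exact A.relabel_injective rfl e
    ((A.relabel_relabel _ _ _ _ _).trans (h₂.symm.trans (h.symm.trans h₁)))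

end Necessity

end

/-! ### The theorem -/

theorem mainTheorem3 {k : Type u} [Field k] (A : StableSModule.{u, v} k)
    (C : StableGradedCyclicOperad A) (X : Contractions A) :
    ((∃ M : ModularOperad A, M.Induces C X) ↔
      X.Commute ∧ ContractLeft C X ∧ ContractRight C X ∧ ContractBoth C X) ∧
    (∀ M M' : ModularOperad A, M.Induces C X → M'.Induces C X → M = M') := by
  refine ⟨⟨?_, fun ⟨h₁, h₂, h₃, h₄⟩ => ?_⟩, fun M M' hM hM' => hM.unique hM'⟩
  · rintro ⟨M, hM⟩
    exact ⟨hM.commute, hM.contractLeft, hM.contractRight, hM.contractBoth⟩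
  · have hCX : Coherent C X := ⟨h₁, h₂, h₃, h₄⟩
    exact ⟨modularOperad hCX, modularOperad_induces hCX⟩
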